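/- Let $q\ge 2$ be an integer. Write $C_n$ for the cyclic group of order $n$, and put $H_k=C_{q-1}\times C_q^k$ ($k\ge 0$), $G_0=1$, $G_k=C_q^k$ ($k\ge 1$), with the standard inclusions $H_k\subset H_{k+1}$, $G_k\subset G_{k+1}$. For $N\ge 1$ let $\mathbf X_N=(X_N,\mathcal G_N)$ be the following graph of groups. Its vertices are $c_k$ ($k\ge 1$) and $a_k,b_k$ ($1\le k\le N$); put $a_0=b_0=c_1$. The vertex groups are $H_0$ at $c_1$, $G_{k}$ at $c_{k+1}$ ($k\ge1$), and $H_k$ at $a_k$ and $b_k$. Its geometric edges are: $a_k a_{k+1}$ and $b_kb_{k+1}$ with group $H_k$ ($0\le k<N$), $a_Nb_N$ with group $H_N$, and $c_{k+1}c_{k+2}$ with group $G_k$ ($k\ge 0$). All edge monomorphisms are inclusions. For a graph of finite groups $\mathbf X=(X,\mathcal G)$ consider two zeta functions. (a) The (Selberg) zeta function $Z_{\mathbf X}(u)=\prod_{[\gamma]}(1-u^{\ell(\gamma)})^{-1}$, over the conjugacy classes of primitive hyperbolic elements of $\pi_1(\mathbf X)$ (elements without fixed vertex on the universal covering tree that are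 not proper powers), where $\ell$ is the translation length on that tree. (For $\mathbf X_N$ the fundamental group is formed with the maximal subtree consisting of all edges except $a_Nb_N$.) (b) The Bass–Ihara zeta function of the associated weighted graph $\mathbf A=(X,w)$, $Z_{\mathbf A}(u)=\prod_{[c]}(1-w(c)u^{\ell(c)})^{-1}$, over the prime cycles of $X$ (closed paths up to rotation that are not proper powers, backtracking allowed), where $w(e)=|G_{s(e)}|/|G_e|$, $w(e,e')=w(e')$ if $e'\ne\bar e$, $w(e,\bar e)=w(\bar e)-1$, and $w(c)=\prod_{j\in\mathbb Z/n}w(e_j,e_{j+1})$ for $c=[(e_1,\dots,e_n)]$. If $R$ is the radius of convergence of (the power series at $0$ of) a zeta function $Z$, a disc $|u|<r$ with $r>R$ is called a pole-free region of $Z$ if $Z$ continues meromorphically to $|u|\le r$ and all poles with $R\le|u|\le r$ lie on $|u|=R$. Put $$P_N(u)=1+(q-1)\sum_{k=0}^{N-1}q^ku^{2k+1}+q^N(q-2)u^{2N+1},$$ $$\Lambda_N(u)=\bigl(1-q^Nu^{2N+1}\bigr)^2-\Bigl((q-1)\sum_{k=1}^{N}q^{k-1}u^{2k}\Bigr)^2,$$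 and let $p(m)$ be the number of elements of $C_{q-1}$ that are not $r$-th powers in $C_{q-1}$ for any divisor $r>1$ of $m$. Theorem. (1) For every $N\ge 1$, $\mathbf X_N$ is a $(q+1)$-regular graph of finite groups (the weights of the edges starting at each vertex add up to $q+1$). For $|u|<1/q$ both products converge (unconditionally), to $$Z_{\mathbf A_N}(u)=\frac{1-qu^2}{(1-u^2)(1-qu)\Bigl((1+u)\sum_{k=0}^{N-1}q^ku^{2k}+q^Nu^{2N}\Bigr)P_N(u)},$$ $$Z_{\mathbf X_N}(u)=Z_{\mathbf A_N}(u)\,\Lambda_N(u)^{-(q-2)}\prod_{m\ge 2}\Lambda_N(u^m)^{-p(m)},$$ where the last product converges too. (In particular $Z_{\mathbf X_N}=Z_{\mathbf A_N}$ if $q=2$.) (2) There are real numbers $x_N<-1/q$ ($N\ge 1$) with $P_N(x_N)=0$ and $x_N\to-1/q$ as $N\to\infty$, such that both $Z_{\mathbf A_N}$ and $Z_{\mathbf X_N}$ continue meromorphically to $|u|\le|x_N|$ and have a pole at $x_N$. (3) For every $N\ge1$, both $Z_{\mathbf A_N}$ and $Z_{\mathbf X_N}$ have radius of convergence $1/q$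 and possess pole-free regions. The pole-free regions shrink to $|u|\le 1/q$: for every $\varepsilon>0$ there is $N_0$ such that for all $N\ge N_0$ every pole-free region $|u|<r$ of $Z_{\mathbf A_N}$ or of $Z_{\mathbf X_N}$ has $r<1/q+\varepsilon$. -/

import Mathlib

open Filter Topology

noncomputable section

/-- A graph of groups.  The underlying graph has vertex set `V`; its set of oriented edges is
`B × Bool`, where `B` is the set of geometric edges and the inverse of the oriented edge `(b, x)` is
`(b, !x)`.  The target of `(b, x)` is `ends b x`.  The two orientations of an edge share the group
`Ge b`, and `φ b x` is the monomorphism from `Ge b` to the group of the target of `(b, x)`. -/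
structure GraphOfGroups where
  V : Type
  B : Type
  ends : B → Bool → V
  Gv : V → Type
  Ge : B → Type
  [groupV : ∀ v, Group (Gv v)]
  [groupE : ∀ b, Group (Ge b)]
  φ : ∀ (b : B) (x : Bool), Ge b →* Gv (ends b x)
  φ_injective : ∀ (b : B) (x : Bool), Function.Injective (φ b x)

namespace GraphOfGroups

attribute [instance] GraphOfGroups.groupV GraphOfGroups.groupE

variable (X : GraphOfGroups)

/-- Oriented edges. -/
abbrev Edge : Type := X.B × Bool

variable {X} in
/-- The inverse edge. -/
def rev (e : X.Edge) : X.Edge := (e.1, !e.2)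

variable {X} in
/-- The target of an oriented edge. -/
def tgt (e : X.Edge) : X.V := X.ends e.1 e.2

variable {X} in
/-- The source of an oriented edge. -/
def src (e : X.Edge) : X.V := X.ends e.1 (!e.2)

/-! ### The fundamental group -/

/-- Generators of the fundamental group: the elements of the vertex groups and one letter for every
oriented edge. -/
abbrev Gen : Type := (Σ v : X.V, X.Gv v) ⊕ X.Edge

/-- The defining relators of the fundamental group with respect to a set `T` of geometric edges
(the edges of a maximal subtree): the multiplication tables of the vertex groups,
`g_e φ_e(h) g_e⁻¹ = φ_ē(h)`, `g_ē = g_e⁻¹`, and `g_e = 1` for the edges of `T`. -/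
inductive Relator (T : Set X.B) : FreeGroup X.Gen → Prop
  | vertex (v : X.V) (g h : X.Gv v) : Relator T
      (FreeGroup.of (Sum.inl ⟨v, g⟩) * FreeGroup.of (Sum.inl ⟨v, h⟩) *
        (FreeGroup.of (Sum.inl ⟨v, g * h⟩))⁻¹)
  | edge (b : X.B) (x : Bool) (h : X.Ge b) : Relator T
      (FreeGroup.of (Sum.inr (b, x)) * FreeGroup.of (Sum.inl ⟨X.ends b x, X.φ b x h⟩) *
        (FreeGroup.of (Sum.inr (b, x)))⁻¹ *
        (FreeGroup.of (Sum.inl ⟨X.ends b (!x), X.φ b (!x) h⟩))⁻¹)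
  | inverse (e : X.Edge) : Relator T
      (FreeGroup.of (Sum.inr (rev e)) * FreeGroup.of (Sum.inr e))
  | tree (e : X.Edge) (he : e.1 ∈ T) : Relator T (FreeGroup.of (Sum.inr e))

/-- The fundamental group of `X` with respect to a maximal subtree `T`. -/
abbrev Pi1 (T : Set X.B) : Type := PresentedGroup {r | X.Relator T r}

/-- The canonical homomorphism from a vertex group to the fundamental group. -/
def vertexHom (T : Set X.B) (v : X.V) : X.Gv v →* X.Pi1 T :=
  MonoidHom.mk' (fun g => PresentedGroup.of (Sum.inl ⟨v, g⟩)) fun g h => by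
    have key := PresentedGroup.mk_eq_one_iff.2
      (Subgroup.subset_normalClosure (show _ ∈ {r | X.Relator T r} from Relator.vertex v g h))
    rw [map_mul, map_mul, map_inv, mul_inv_eq_one] at key
    exact key.symm

/-- The element `g_e` of the fundamental group. -/
def edgeElt (T : Set X.B) (e : X.Edge) : X.Pi1 T := PresentedGroup.of (Sum.inr e)

/-! ### The universal covering tree -/

/-- Vertices of the universal covering tree: cosets of the vertex groups. The fundamental group
acts on them by left translation. -/
abbrev CoverVertex (T : Set X.B) : Type := Σ v : X.V, X.Pi1 T ⧸ (X.vertexHom T v).range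

/-- The universal covering tree: for every `g` in the fundamental group and every oriented edge `e`
there is an edge from `g G_{s(e)}` to `g g_e G_{t(e)}`. -/
def cover (T : Set X.B) : SimpleGraph (X.CoverVertex T) :=
  SimpleGraph.fromRel fun p p' => ∃ (g : X.Pi1 T) (e : X.Edge),
    p = ⟨src e, QuotientGroup.mk g⟩ ∧ p' = ⟨tgt e, QuotientGroup.mk (g * X.edgeElt T e)⟩

variable {X}

/-- Hyperbolic elements: those without a fixed vertex on the universal covering tree. -/
def IsHyperbolic {T : Set X.B} (γ : X.Pi1 T) : Prop := ∀ p : X.CoverVertex T, γ • p ≠ p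

/-- The translation length on the universal covering tree. -/
def translationLength {T : Set X.B} (γ : X.Pi1 T) : ℕ :=
  ⨅ p : X.CoverVertex T, (X.cover T).dist p (γ • p)

theorem cover_adj_smul {T : Set X.B} (δ : X.Pi1 T) (p p' : X.CoverVertex T)
    (h : (X.cover T).Adj p p') : (X.cover T).Adj (δ • p) (δ • p') := by
  have aux : ∀ a a' : X.CoverVertex T,
      (∃ (g : X.Pi1 T) (e : X.Edge), a = ⟨src e, QuotientGroup.mk g⟩ ∧
        a' = ⟨tgt e, QuotientGroup.mk (g * X.edgeElt T e)⟩) →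
      (∃ (g : X.Pi1 T) (e : X.Edge), δ • a = ⟨src e, QuotientGroup.mk g⟩ ∧
        δ • a' = ⟨tgt e, QuotientGroup.mk (g * X.edgeElt T e)⟩) := by
    rintro a a' ⟨g, e, rfl, rfl⟩
    exact ⟨δ * g, e, rfl, by rw [mul_assoc]; rfl⟩
  rw [cover, SimpleGraph.fromRel_adj] at h ⊢
  exact ⟨fun hp => h.1 (MulAction.injective δ hp), h.2.imp (aux _ _) (aux _ _)⟩

theorem cover_dist_smul {T : Set X.B} (δ : X.Pi1 T) (p p' : X.CoverVertex T) :
    (X.cover T).dist (δ • p) (δ • p') = (X.cover T).dist p p' := by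
  have aux : ∀ (δ : X.Pi1 T) (p p' : X.CoverVertex T) (w : (X.cover T).Walk p p'),
      ∃ w' : (X.cover T).Walk (δ • p) (δ • p'), w'.length = w.length := fun δ p p' w =>
    ⟨w.map (⟨fun a => δ • a, fun {a b} h => cover_adj_smul δ a b h⟩ : X.cover T →g X.cover T),
      SimpleGraph.Walk.length_map _ w⟩
  rw [SimpleGraph.dist_eq_sInf, SimpleGraph.dist_eq_sInf]
  congr 1
  ext n
  constructor
  · rintro ⟨w, rfl⟩
    have h := aux δ⁻¹ _ _ w
    rwa [inv_smul_smul, inv_smul_smul] at h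
  · rintro ⟨w, rfl⟩
    obtain ⟨w', hw'⟩ := aux δ _ _ w
    exact ⟨w', hw'⟩

theorem translationLength_conj {T : Set X.B} (δ γ : X.Pi1 T) :
    translationLength (δ * γ * δ⁻¹) = translationLength γ := by
  unfold translationLength
  refine (Equiv.iInf_congr (MulAction.toPerm δ) fun p => ?_).symm
  simp only [MulAction.toPerm_apply, mul_smul, inv_smul_smul]
  exact cover_dist_smul δ p (γ • p)

/-- The translation length of a conjugacy class. -/
def classLength {T : Set X.B} (c : ConjClasses (X.Pi1 T)) : ℕ :=
  Quotient.liftOn c translationLength fun γ γ' h => by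
    obtain ⟨δ, rfl⟩ := isConj_iff.1 h
    exact (translationLength_conj δ γ).symm

/-- Primitive hyperbolic elements: hyperbolic elements that are not proper powers. -/
def IsPrimitiveHyperbolic {T : Set X.B} (γ : X.Pi1 T) : Prop :=
  IsHyperbolic γ ∧ ∀ (δ : X.Pi1 T) (r : ℕ), 1 < r → γ ≠ δ ^ r

variable (X) in
/-- Conjugacy classes of primitive hyperbolic elements. -/
abbrev PrimitiveClass (T : Set X.B) : Type :=
  {c : ConjClasses (X.Pi1 T) // ∃ γ : X.Pi1 T, IsPrimitiveHyperbolic γ ∧ ConjClasses.mk γ = c}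

/-- Euler factor `1 / (1 - u ^ ℓ(γ))` of the zeta function of a graph of groups. -/
def selbergFactor {T : Set X.B} (u : ℂ) (c : X.PrimitiveClass T) : ℂ :=
  (1 - u ^ classLength c.1)⁻¹

variable (X) in
/-- The (Selberg) zeta function of a graph of groups, as an infinite product. -/
def selbergZeta (T : Set X.B) (u : ℂ) : ℂ := ∏' c : X.PrimitiveClass T, selbergFactor u c

/-! ### The associated weighted graph -/

/-- The weight `w(e) = |G_{s(e)}| / |G_e|`. -/
def weight (e : X.Edge) : ℚ := (Nat.card (X.Gv (src e)) : ℚ) / Nat.card (X.Ge e.1)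

open Classical in
/-- The transition weight: `w(e, e') = w(e')` for `e' ≠ ē` and `w(e, ē) = w(ē) - 1`. -/
def weight₂ (e e' : X.Edge) : ℚ := if e' = rev e then weight e' - 1 else weight e'

/-- The weight of a closed path `(e₁, …, eₙ)`: the product of all `w(e_j, e_{j+1})`, `j` mod `n`. -/
def pathWeight (l : List X.Edge) : ℚ := (List.zipWith weight₂ l (l.rotate 1)).prod

theorem pathWeight_eq_of_isRotated {l l' : List X.Edge} (h : l.IsRotated l') :
    pathWeight l = pathWeight l' := by
  obtain ⟨n, rfl⟩ := h
  unfold pathWeight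
  rw [List.rotate_rotate, Nat.add_comm n 1, ← List.rotate_rotate,
    ← List.zipWith_rotate_distrib weight₂ l (l.rotate 1) n (by simp)]
  exact (List.rotate_perm _ n).symm.prod_eq

/-- The weight of a cycle (a closed path up to cyclic rotation). -/
def cycleWeight (c : Cycle X.Edge) : ℚ :=
  Quotient.liftOn c pathWeight fun _ _ h => pathWeight_eq_of_isRotated h

/-- Prime cycles: nonempty closed paths up to cyclic rotation that are not proper powers of closed
paths. Backtracking is allowed. -/
def IsPrimeCycle (c : Cycle X.Edge) : Prop :=
  c ≠ Cycle.nil ∧ c.Chain (fun e e' => tgt e = src e') ∧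
    ∀ (d : List X.Edge) (f : ℕ), 1 < f → c ≠ ((List.replicate f d).flatten : List X.Edge)

variable (X) in
abbrev PrimeCycle : Type := {c : Cycle X.Edge // IsPrimeCycle c}

/-- Euler factor `1 / (1 - w(c) u ^ ℓ(c))` of the Bass–Ihara zeta function. -/
def bassIharaFactor (u : ℂ) (c : X.PrimeCycle) : ℂ :=
  (1 - (cycleWeight c.1 : ℂ) * u ^ c.1.length)⁻¹

variable (X) in
/-- The Bass–Ihara zeta function of the weighted graph associated to `X`. -/
def bassIharaZeta (u : ℂ) : ℂ := ∏' c : X.PrimeCycle, bassIharaFactor u c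

variable (X) in
/-- `X` is a `d`-regular graph of finite groups: at every vertex finitely many edges start and their
weights add up to `d`, that is, its universal covering tree is `d`-regular. -/
def IsRegular (d : ℕ) : Prop :=
  (∀ v, Finite (X.Gv v)) ∧
    ∀ v, {e : X.Edge | src e = v}.Finite ∧ ∑ᶠ e ∈ {e : X.Edge | src e = v}, weight e = d

end GraphOfGroups

/-! ### Poles and pole-free regions -/

/-- The power series expansion of `f` at the origin has radius of convergence `R`. -/
def HasConvergenceRadius (f : ℂ → ℂ) (R : ℝ) : Prop :=
  ∃ p : FormalMultilinearSeries ℂ ℂ ℂ, HasFPowerSeriesAt f p 0 ∧ p.radius = ENNReal.ofReal R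

/-- `g` is a meromorphic continuation to the closed disc `|u| ≤ r` of the germ of `f` at `0`. -/
def IsMeromorphicContinuation (f g : ℂ → ℂ) (r : ℝ) : Prop :=
  MeromorphicOn g (Metric.closedBall 0 r) ∧ g =ᶠ[𝓝 0] f

/-- `f` continues meromorphically to the disc `|u| ≤ |x|`, and the continuation has a pole at `x`. -/
def IsPoleOfContinuation (f : ℂ → ℂ) (x : ℂ) : Prop :=
  ∃ g, IsMeromorphicContinuation f g ‖x‖ ∧ meromorphicOrderAt g x < 0

/-- The disc `|u| < r` is a pole-free region of `f`: it is larger than the disc of convergence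
`|u| < R` of `f`, and every pole of `f` with `R ≤ |u| ≤ r` lies on the circle `|u| = R`. -/
def IsPoleFreeRadius (f : ℂ → ℂ) (r : ℝ) : Prop :=
  ∃ R, HasConvergenceRadius f R ∧ R < r ∧ ∃ g, IsMeromorphicContinuation f g r ∧
    ∀ u : ℂ, R ≤ ‖u‖ → ‖u‖ ≤ r → meromorphicOrderAt g u < 0 → ‖u‖ = R

/-! ### The sequence of graphs of groups -/

/-- The vertices of the graph: `c k`, `a k`, `b k` stand for `c_{k+1}`, `a_{k+1}`, `b_{k+1}`. -/
inductive XVertex (N : ℕ)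
  | c (k : ℕ)
  | a (k : Fin N)
  | b (k : Fin N)

/-- The geometric edges. With `a_0 = b_0 = c_1`: `aEdge k` joins `a_k` to `a_{k+1}`, `bEdge k` joins
`b_k` to `b_{k+1}`, `cross` joins `a_N` to `b_N`, and `cEdge k` joins `c_{k+1}` to `c_{k+2}`. -/
inductive XEdge (N : ℕ)
  | aEdge (k : Fin N)
  | bEdge (k : Fin N)
  | cross
  | cEdge (k : ℕ)

/-- `a_k` for `0 ≤ k ≤ N`, with `a_0 = c_1`. -/
def XVertex.aPos {N : ℕ} (k : Fin (N + 1)) : XVertex N :=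
  Fin.cases (motive := fun _ => XVertex N) (XVertex.c 0) XVertex.a k

/-- `b_k` for `0 ≤ k ≤ N`, with `b_0 = c_1`. -/
def XVertex.bPos {N : ℕ} (k : Fin (N + 1)) : XVertex N :=
  Fin.cases (motive := fun _ => XVertex N) (XVertex.c 0) XVertex.b k

/-- The end points of the edges. -/
def XEdge.ends {N : ℕ} : XEdge N → Bool → XVertex N
  | .aEdge k, false => XVertex.aPos k.castSucc
  | .aEdge k, true => XVertex.aPos k.succ
  | .bEdge k, false => XVertex.bPos k.castSucc
  | .bEdge k, true => XVertex.bPos k.succ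
  | .cross, false => XVertex.aPos (Fin.last N)
  | .cross, true => XVertex.bPos (Fin.last N)
  | .cEdge k, false => XVertex.c k
  | .cEdge k, true => XVertex.c (k + 1)

/-- The abelian group `C_{q-1} × ∏_ℕ C_q`, which contains all the groups `H_k` and `G_k`. -/
abbrev XAmbient (q : ℕ) : Type :=
  Multiplicative (ZMod (q - 1)) × (ℕ → Multiplicative (ZMod q))

/-- `H_k ≃ C_{q-1} × C_q ^ k`. -/
def XH (q k : ℕ) : Subgroup (XAmbient q) where
  carrier := {x | ∀ i, k ≤ i → x.2 i = 1}
  mul_mem' := fun hx hy i hi => by simp [hx i hi, hy i hi]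
  one_mem' := fun _ _ => rfl
  inv_mem' := fun hx i hi => by simp [hx i hi]

/-- `G_k ≃ C_q ^ k`. -/
def XG (q k : ℕ) : Subgroup (XAmbient q) where
  carrier := {x | x.1 = 1 ∧ ∀ i, k ≤ i → x.2 i = 1}
  mul_mem' := fun hx hy =>
    ⟨by simp [hx.1, hy.1], fun i hi => by simp [hx.2 i hi, hy.2 i hi]⟩
  one_mem' := ⟨rfl, fun _ _ => rfl⟩
  inv_mem' := fun hx => ⟨by simp [hx.1], fun i hi => by simp [hx.2 i hi]⟩

/-- The vertex groups: `H_0` at `c_1`, `G_k` at `c_{k+1}` for `k ≥ 1`, `H_k` at `a_k` and `b_k`. -/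
def XVertex.group (q : ℕ) {N : ℕ} : XVertex N → Subgroup (XAmbient q)
  | .c 0 => XH q 0
  | .c (k + 1) => XG q (k + 1)
  | .a k => XH q (k + 1)
  | .b k => XH q (k + 1)

/-- The edge groups: `H_k` on the edges from `a_k` to `a_{k+1}` and from `b_k` to `b_{k+1}`, `H_N` on
the edge from `a_N` to `b_N`, the trivial group `G_0` on the edge from `c_1` to `c_2`, and `G_k` on
the edge from `c_{k+1}` to `c_{k+2}` for `k ≥ 1`. -/
def XEdge.group (q : ℕ) {N : ℕ} : XEdge N → Subgroup (XAmbient q)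
  | .aEdge k => XH q k
  | .bEdge k => XH q k
  | .cross => XH q N
  | .cEdge k => XG q k

theorem XVertex.group_aPos (q : ℕ) {N : ℕ} (k : Fin (N + 1)) :
    (XVertex.aPos k).group q = XH q k := by
  refine Fin.cases ?_ (fun i => ?_) k <;> rfl

theorem XVertex.group_bPos (q : ℕ) {N : ℕ} (k : Fin (N + 1)) :
    (XVertex.bPos k).group q = XH q k := by
  refine Fin.cases ?_ (fun i => ?_) k <;> rfl

theorem XH_mono (q : ℕ) {k l : ℕ} (h : k ≤ l) : XH q k ≤ XH q l :=
  fun _ hx i hi => hx i (h.trans hi)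

theorem XG_mono (q : ℕ) {k l : ℕ} (h : k ≤ l) : XG q k ≤ XG q l :=
  fun _ hx => ⟨hx.1, fun i hi => hx.2 i (h.trans hi)⟩

theorem XEdge.group_le (q : ℕ) {N : ℕ} (e : XEdge N) (x : Bool) :
    e.group q ≤ (e.ends x).group q := by
  cases e with
  | aEdge k =>
    cases x
    · exact (XVertex.group_aPos q k.castSucc).ge
    · exact (XH_mono q (Nat.le_succ _)).trans (XVertex.group_aPos q k.succ).ge
  | bEdge k =>
    cases x
    · exact (XVertex.group_bPos q k.castSucc).ge
    · exact (XH_mono q (Nat.le_succ _)).trans (XVertex.group_bPos q k.succ).ge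
  | cross =>
    cases x
    · exact (XVertex.group_aPos q (Fin.last N)).ge
    · exact (XVertex.group_bPos q (Fin.last N)).ge
  | cEdge k =>
    cases x
    · cases k with
      | zero => exact fun _ hx => hx.2
      | succ k => exact le_rfl
    · exact XG_mono q (Nat.le_succ _)

/-- The graph of groups `X_N`; all the monomorphisms are inclusions. -/
def XGraph (q N : ℕ) : GraphOfGroups where
  V := XVertex N
  B := XEdge N
  ends := XEdge.ends
  Gv := fun v => v.group q
  Ge := fun e => e.group q
  φ := fun e x => Subgroup.inclusion (XEdge.group_le q e x)
  φ_injective := fun e x => Subgroup.inclusion_injective (XEdge.group_le q e x)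

/-- The maximal subtree of `X_N` consisting of all edges except the one joining `a_N` to `b_N`. -/
def XTree (q N : ℕ) : Set (XGraph q N).B := {e | e ≠ XEdge.cross}

/-! ### The explicit zeta functions -/

/-- The factor `1 + (q-1) ∑_{k=0}^{N-1} q^k u^{2k+1} + q^N (q-2) u^{2N+1}`. -/
def poleFactor (q N : ℕ) (u : ℂ) : ℂ :=
  1 + ((q : ℂ) - 1) * ∑ k ∈ Finset.range N, (q : ℂ) ^ k * u ^ (2 * k + 1) +
    (q : ℂ) ^ N * ((q : ℂ) - 2) * u ^ (2 * N + 1)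

/-- The rational function `Z_{(X_N, w)}(u)`. -/
def explicitBassIhara (q N : ℕ) (u : ℂ) : ℂ :=
  (1 - (q : ℂ) * u ^ 2) /
    ((1 - u ^ 2) * (1 - (q : ℂ) * u) *
      ((1 + u) * ∑ k ∈ Finset.range N, (q : ℂ) ^ k * u ^ (2 * k) + (q : ℂ) ^ N * u ^ (2 * N)) *
      poleFactor q N u)

/-- The polynomial `(1 - q^N u^{2N+1})² - ((q-1) ∑_{k=1}^{N} q^{k-1} u^{2k})²`. -/
def loopFactor (q N : ℕ) (u : ℂ) : ℂ :=
  (1 - (q : ℂ) ^ N * u ^ (2 * N + 1)) ^ 2 -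
    (((q : ℂ) - 1) * ∑ k ∈ Finset.range N, (q : ℂ) ^ k * u ^ (2 * (k + 1))) ^ 2

/-- The number of elements of the cyclic group `C_n` that are not `r`-th powers of elements of `C_n`
for any divisor `r > 1` of `m`. -/
def primitiveCount (n m : ℕ) : ℕ :=
  Nat.card {h : ZMod n // ∀ r : ℕ, 1 < r → r ∣ m → ∀ y : ZMod n, h ≠ r • y}

/-- The function `Z_{X_N}(u)`: the rational function above times
`Λ(u)^{-(q-2)} ∏_{m ≥ 2} Λ(u^m)^{-p(m)}`, where `Λ` is `loopFactor q N` and `p(m)` is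
`primitiveCount (q - 1) m`. -/
def explicitSelberg (q N : ℕ) (u : ℂ) : ℂ :=
  explicitBassIhara q N u * ((loopFactor q N u)⁻¹) ^ (q - 2) *
    ∏' m : ℕ, ((loopFactor q N (u ^ (m + 2)))⁻¹) ^ primitiveCount (q - 1) (m + 2)

end

/-!
Both zeta functions are Euler products over prime cyclic words, and for `|u| < 1/q` both of them are
expressed by the generating functions of the excursions from the vertex `c_1` of `X_N`: `C` (`excC`)
for the excursions into the ray, and `S = A + L` (`excS`, `excA`, `excL`) for the excursions to one
of the sides, which return on the same side or pass the loop. With `κ = q - 2 + 2 (q - 1) S / (1 -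
S)` (`kap`) and `Λ = (1 - S) (1 + A - L)` (`loopFactor_eq`), `Z_A = (1 - C κ)⁻¹ Λ(u)⁻¹` and `Z_X =
(1 - C κ)⁻¹ Λ(u)^{-(q-1)} ∏_{m ≥ 2} Λ(u^m)^{-p(m)}`.

Three facts evaluate such Euler products. The trace formula `CyclicWeight.hasSum_log` turns the
logarithm of an Euler product into a sum over words. If the weight of a transition to a marked
letter depends on the source only, the words with a marked letter are words in a free alphabet of
blocks, and they contribute the factor `(1 - s)⁻¹`, where `s` is the total weight of the blocks
(`hasSum_transWeight_split`). Finally, words with two states, in which every letter keeps or changes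
the state, form a double cover of a free alphabet; their Euler product is the product over the two
characters, with the letters counted with and without signs (`hasSum_doubleCover`). This is the
origin of the two factors of `Λ`.

*The Selberg zeta function.* The fundamental group of `X_N` is `(C_{q-1} × (C_q^N * ℤ)) * ⋃ C_q^k`
(`piEquiv`). Elements of a free product have normal forms (`NormalForm`, `coprodNF`). The group
`C_q^N * ℤ` has a normal form that suits the two sides of the loop: its words are the paths of a
double cover (`loopNF`). The sum of the lengths of the letters of the normal form is the
displacement of `c_1` in the covering tree (`dist_basePt`), and the translation length is the growth
rate of the displacement under powers (`translationLength_eq`). Conjugate cyclically reduced words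
are rotations of each other (`NormalForm.isRotated_of_isConj`), whence the classes of primitive
hyperbolic elements are parametrized by prime cyclic words (`classOf_bijective`). Alternating words
in the two factors yield `(1 - C κ)⁻¹`, because `C` and `κ` are the growth series of the factors
without the trivial element (`hasSum_gam_primeWord`). The other classes lie in the first factor: an
element `(h, f ^ m)` with `f` primitive is not a proper power if and only if `h` is not an `r`-th
power for any divisor `r > 1` of `m` (`notPower_prod_iff`), so these classes yield `∏_{m ≥ 1}
Λ(u^m)^{-p(m)}`, where `p(1) = q - 1` (`hasSum_elliptic_classes`).

*The Bass–Ihara zeta function.* A path that leaves `c_1` can only turn back towards `c_1` once, as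
reversing an edge that leads towards `c_1` has the weight `0`. Hence a closed path of nonzero weight
is a cyclic word of excursions from `c_1` (`exists_exc_of_pathTo_ne_zero`, `cyc_not_atBase`). The
weights of the turns at `c_1` make the excursions into the ray marked letters, and the excursions to
the sides the letters of a double cover (`hasSum_excursions`).

*Poles.* The explicit formula for `Z_A` is the algebraic identity `explicitBassIhara_eq_inv`, which
rests on `kap_identity` and `one_add_excA_sub_excL`. On a disc of radius less than `1` the product
of the `Λ(u^m)` has only finitely many factors with zeros
(`exists_tail`), and for `q = 2` it is empty, so both zeta functions
are quotients of holomorphic functions whose denominators vanish at the zeros of `(1 - q u) P_N(u)`,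
while the numerators vanish at most at the zeros of `1 - q u^2` (`HasQuotients`). Since `P_N(-1/q) =
2 / q ^ (N + 1)` is small and positive, and the slope of `P_N` on the negative axis is bounded below
by `q - 1`, there is a zero `x_N` with `-1/q - 2 / q ^ (N + 1) ≤ x_N < -1/q` (`exists_root`). It is
a zero of the numerator only if `q x_N^2 = 1`; then `P_N(x_N) = 0` says that `q` is the square of
the integer `(q - 1) N + q - 2`, which is impossible (`mul_sq_ne_one_of_root`). So `x_N` is a pole,
and it bounds every pole-free region by the identity theorem (`IsQuotient.lt_of_isPoleFreeRadius`).
-/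

noncomputable section

namespace Necklace

/-! ### Words and prime cyclic words -/

section CyclicWords

variable {α : Type*}

/-- The `m`-fold concatenation of a list with itself. -/
def lpow (l : List α) (m : ℕ) : List α := (List.replicate m l).flatten

@[simp] theorem lpow_zero (l : List α) : lpow l 0 = [] := rfl

theorem lpow_succ (l : List α) (m : ℕ) : lpow l (m + 1) = l ++ lpow l m := by
  simp [lpow, List.replicate_succ]

@[simp] theorem lpow_one (l : List α) : lpow l 1 = l := by simp [lpow_succ]

theorem lpow_add (l : List α) (m n : ℕ) : lpow l (m + n) = lpow l m ++ lpow l n := by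
  simp only [lpow, List.replicate_add, List.flatten_append]

theorem lpow_succ' (l : List α) (m : ℕ) : lpow l (m + 1) = lpow l m ++ l := by
  rw [lpow_add, lpow_one]

theorem lpow_mul (l : List α) (m n : ℕ) : lpow l (m * n) = lpow (lpow l m) n := by
  induction n with
  | zero => simp
  | succ n ih => rw [Nat.mul_succ, lpow_add, ih, lpow_succ']

@[simp] theorem length_lpow (l : List α) (m : ℕ) : (lpow l m).length = m * l.length := by
  simp [lpow]

theorem map_lpow {β : Type*} (f : α → β) (l : List α) (m : ℕ) :
    (lpow l m).map f = lpow (l.map f) m := by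
  simp [lpow]

theorem rotate_one_lpow (l : List α) (m : ℕ) : (lpow l m).rotate 1 = lpow (l.rotate 1) m := by
  cases l with
  | nil => cases m <;> simp [lpow]
  | cons a l =>
    have key : ∀ m : ℕ, lpow (a :: l) m ++ [a] = a :: lpow (l ++ [a]) m := by
      intro m
      induction m with
      | zero => rfl
      | succ m ih => rw [lpow_succ, List.append_assoc, ih, lpow_succ]; simp
    cases m with
    | zero => rfl
    | succ m =>
      rw [lpow_succ]
      simp only [List.cons_append, List.rotate_cons_succ, List.rotate_zero, List.append_assoc]
      rw [key, lpow_succ]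
      simp

theorem rotate_lpow (l : List α) (m k : ℕ) : (lpow l m).rotate k = lpow (l.rotate k) m := by
  induction k with
  | zero => simp
  | succ k ih => rw [← List.rotate_rotate, ih, rotate_one_lpow, List.rotate_rotate]

theorem rotate_iterate (l : List α) (d : ℕ) :
    (fun l : List α => l.rotate 1)^[d] l = l.rotate d := by
  induction d with
  | zero => simp
  | succ d ih => rw [Function.iterate_succ_apply', ih, List.rotate_rotate]

theorem eq_lpow_of_commute {x : List α} : ∀ {k : ℕ} {y : List α},
    x ++ y = y ++ x → y.length = x.length * k → y = lpow x k
  | 0, y, _, h => by simpa using h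
  | k + 1, y, hc, h => by
    have hle : x.length ≤ y.length := by rw [h]; exact Nat.le_mul_of_pos_right _ (Nat.succ_pos k)
    obtain ⟨z, rfl⟩ : x <+: y :=
      List.prefix_of_prefix_length_le (List.prefix_append x y) (hc ▸ List.prefix_append y x) hle
    rw [List.append_assoc, List.append_cancel_left_eq] at hc
    rw [lpow_succ, ← eq_lpow_of_commute (k := k) hc]
    simp only [List.length_append, Nat.mul_succ] at h
    omega

/-- A list which is invariant under a rotation whose amount divides its length is a power. -/
theorem eq_lpow_of_rotate {w : List α} {d : ℕ} (hd : d ∣ w.length) (h : w.rotate d = w) :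
    w = lpow (w.take d) (w.length / d) := by
  rcases Nat.eq_zero_or_pos w.length with h0 | h0
  · rw [List.length_eq_zero_iff] at h0; subst h0; simp
  have hle : d ≤ w.length := Nat.le_of_dvd h0 hd
  obtain ⟨m, hm⟩ := hd
  have hdpos : 0 < d := Nat.pos_of_ne_zero (by rintro rfl; rw [zero_mul] at hm; omega)
  have hmpos : 0 < m := Nat.pos_of_ne_zero (by rintro rfl; rw [mul_zero] at hm; omega)
  obtain ⟨k, rfl⟩ : ∃ k, m = k + 1 := ⟨m - 1, by omega⟩
  have hdiv : w.length / d = k + 1 := by rw [hm]; exact Nat.mul_div_cancel_left _ hdpos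
  rw [List.rotate_eq_drop_append_take hle] at h
  have hl : (w.take d).length = d := by simp [hle]
  have := eq_lpow_of_commute (x := w.take d) (y := w.drop d) (k := k)
    (by rw [h, List.take_append_drop]) (by rw [hl, List.length_drop, hm, Nat.mul_succ]; omega)
  rw [hdiv, lpow_succ, ← this, List.take_append_drop]

/-- A list is primitive if it is nonempty and not a proper power. -/
def IsPrimitive (l : List α) : Prop := l ≠ [] ∧ ∀ (d : List α) (f : ℕ), 1 < f → l ≠ lpow d f

theorem IsPrimitive.rotate {l : List α} (h : IsPrimitive l) (k : ℕ) : IsPrimitive (l.rotate k) := by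
  refine ⟨by simpa using h.1, fun d f hf he => ?_⟩
  rw [List.rotate_eq_iff, rotate_lpow] at he
  exact h.2 _ f hf he

theorem exists_primitive_root (w : List α) (hw : w ≠ []) :
    ∃ (l : List α) (m : ℕ), IsPrimitive l ∧ w = lpow l (m + 1) := by
  induction hn : w.length using Nat.strong_induction_on generalizing w with
  | _ n ih =>
    by_cases hp : IsPrimitive w
    · exact ⟨w, 0, hp, by simp⟩
    · simp only [IsPrimitive, hw, ne_eq, not_false_eq_true, true_and, not_forall, not_not] at hp
      obtain ⟨d, f, hf, rfl⟩ := hp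
      have hd : d ≠ [] := by rintro rfl; simp [lpow] at hw
      have hpos := List.length_pos_iff.2 hd
      obtain ⟨l, m, hl, rfl⟩ := ih d.length (by rw [← hn, length_lpow]; nlinarith) d hd rfl
      refine ⟨l, (m + 1) * f - 1, hl, ?_⟩
      rw [← lpow_mul]
      congr 1
      have : 0 < (m + 1) * f := by positivity
      omega

/-- If a power of the primitive word `l` is invariant under rotation by a divisor `g` of the length
of `l`, it is also a power of its first `g` letters, whence `g` is the length of `l`. -/
theorem IsPrimitive.eq_take_of_rotate {w l : List α} {m g : ℕ} (hl : IsPrimitive l)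
    (hw : w = lpow l m) (hm : 0 < m) (hg : g ∣ l.length) (h : w.rotate g = w) : l = w.take g := by
  have hpos := List.length_pos_iff.2 hl.1
  obtain ⟨e, he⟩ := hg
  have hgpos : 0 < g := Nat.pos_of_ne_zero (by rintro rfl; rw [zero_mul] at he; omega)
  have hdvd : g ∣ w.length := by rw [hw, length_lpow, he]; exact ⟨m * e, by ring⟩
  have hw2 := eq_lpow_of_rotate hdvd h
  obtain ⟨m, rfl⟩ : ∃ k, m = k + 1 := ⟨m - 1, by omega⟩
  have hlen : (w.take g).length = g := by
    rw [List.length_take, min_eq_left]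
    rw [hw, length_lpow, he]
    nlinarith [Nat.pos_of_ne_zero (show e ≠ 0 by rintro rfl; rw [mul_zero] at he; omega)]
  have hl1 : l = w.take l.length := by rw [hw, lpow_succ]; simp
  have hcount : w.length / g = e + m * e := by
    rw [hw, length_lpow, he, show (m + 1) * (g * e) = g * (e + m * e) by ring]
    exact Nat.mul_div_cancel_left _ hgpos
  have hl2 : l = lpow (w.take g) e := by
    rw [hcount, lpow_add] at hw2
    have h3 : w.take l.length = lpow (w.take g) e := by
      conv_lhs => rw [hw2]
      rw [List.take_append_of_le_length (by rw [length_lpow, hlen, he, mul_comm]),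
        List.take_of_length_le (by rw [length_lpow, hlen, he, mul_comm])]
    rw [← h3]; exact hl1
  have he1 : e = 1 := by
    by_contra hne
    have : 1 < e := by
      rcases Nat.eq_zero_or_pos e with h0 | h0
      · subst h0; rw [mul_zero] at he; omega
      · omega
    exact hl.2 _ e this hl2
  subst he1
  simpa using hl2

/-- Primitive roots of lists are unique. -/
theorem lpow_injective_of_primitive {l l' : List α} {m m' : ℕ} (hl : IsPrimitive l)
    (hl' : IsPrimitive l') (h : lpow l (m + 1) = lpow l' (m' + 1)) : l = l' ∧ m = m' := by
  have key : ∀ (l : List α) (m : ℕ), (lpow l m).rotate l.length = lpow l m := fun l m => by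
    rw [rotate_lpow, List.rotate_length]
  have hp : Function.IsPeriodicPt (fun l : List α => l.rotate 1) l.length (lpow l (m + 1)) := by
    rw [Function.IsPeriodicPt, Function.IsFixedPt, rotate_iterate, key]
  have hp' : Function.IsPeriodicPt (fun l : List α => l.rotate 1) l'.length (lpow l (m + 1)) := by
    rw [Function.IsPeriodicPt, Function.IsFixedPt, rotate_iterate, h, key]
  have hg := hp.gcd hp'
  rw [Function.IsPeriodicPt, Function.IsFixedPt, rotate_iterate] at hg
  have e1 := hl.eq_take_of_rotate rfl (Nat.succ_pos m) (Nat.gcd_dvd_left _ _) hg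
  have e2 := hl'.eq_take_of_rotate h (Nat.succ_pos m') (Nat.gcd_dvd_right _ _) hg
  have e : l = l' := e1.trans e2.symm
  refine ⟨e, ?_⟩
  have := congrArg List.length h
  rw [length_lpow, length_lpow, ← e] at this
  have := Nat.eq_of_mul_eq_mul_right (List.length_pos_iff.2 hl.1) this
  omega

theorem IsPrimitive.rotate_injOn {l : List α} (hl : IsPrimitive l) {i j : ℕ} (hi : i < l.length)
    (hj : j < l.length) (h : l.rotate i = l.rotate j) : i = j := by
  wlog hij : i < j generalizing i j
  · rcases Nat.lt_trichotomy i j with h1 | h1 | h1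
    · exact absurd h1 hij
    · exact h1
    · exact (this hj hi h.symm h1).symm
  have hr : l.rotate (j - i) = l := by
    apply List.rotate_injective i
    show (l.rotate (j - i)).rotate i = l.rotate i
    rw [List.rotate_rotate, Nat.sub_add_cancel hij.le, h]
  have hp : Function.IsPeriodicPt (fun l : List α => l.rotate 1) (j - i) l := by
    rw [Function.IsPeriodicPt, Function.IsFixedPt, rotate_iterate, hr]
  have hp' : Function.IsPeriodicPt (fun l : List α => l.rotate 1) l.length l := by
    rw [Function.IsPeriodicPt, Function.IsFixedPt, rotate_iterate, List.rotate_length]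
  have hg := hp.gcd hp'
  rw [Function.IsPeriodicPt, Function.IsFixedPt, rotate_iterate] at hg
  have e1 := hl.eq_take_of_rotate (m := 1) (by simp) one_pos (Nat.gcd_dvd_right (j - i) _) hg
  have := congrArg List.length e1
  rw [List.length_take] at this
  have h2 : (j - i).gcd l.length ≤ j - i := Nat.gcd_le_left _ (by omega)
  omega

/-- Prime cycles: nonempty cyclic words that are not proper powers. -/
def IsPrime (c : Cycle α) : Prop :=
  c ≠ Cycle.nil ∧ ∀ (d : List α) (f : ℕ), 1 < f → c ≠ (lpow d f : List α)

theorem isPrime_coe {l : List α} : IsPrime (l : Cycle α) ↔ IsPrimitive l := by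
  unfold IsPrime IsPrimitive
  rw [ne_eq, Cycle.coe_eq_nil]
  refine and_congr Iff.rfl ⟨fun h d f hf he => h d f hf (by rw [he]), fun h d f hf he => ?_⟩
  obtain ⟨k, hk⟩ := (Cycle.coe_eq_coe.1 he).symm
  rw [rotate_lpow] at hk
  exact h _ f hf hk.symm

variable (α) in
/-- The type of prime cycles. -/
abbrev PrimeCyc : Type _ := {c : Cycle α // IsPrime c}

/-- A weight on words which only depends on the cyclic word and is multiplicative on powers. -/
structure CyclicWeight (α : Type*) where
  toFun : List α → ℂ
  rotated : ∀ {l l' : List α}, l ~r l' → toFun l = toFun l'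
  pow : ∀ (l : List α) (m : ℕ), toFun (lpow l (m + 1)) = toFun l ^ (m + 1)

instance : CoeFun (CyclicWeight α) (fun _ => List α → ℂ) := ⟨CyclicWeight.toFun⟩

/-- The weight of a cyclic word. -/
def CyclicWeight.cyc (W : CyclicWeight α) (c : Cycle α) : ℂ :=
  Quotient.liftOn c W.toFun fun _ _ h => W.rotated h

@[simp] theorem CyclicWeight.cyc_coe (W : CyclicWeight α) (l : List α) : W.cyc (l : Cycle α) = W l :=
  rfl

theorem lists_finite (c : Cycle α) : Finite {l : List α // (l : Cycle α) = c} := by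
  induction c using Quotient.inductionOn with
  | _ l =>
    refine Finite.of_surjective (fun k : Fin (l.length + 1) => (⟨l.rotate k, ?_⟩ :
      {l' : List α // (l' : Cycle α) = Quotient.mk _ l})) ?_
    · exact Cycle.coe_eq_coe.2 (List.IsRotated.forall l k)
    · rintro ⟨l', hl'⟩
      obtain ⟨k, hk, rfl⟩ := List.isRotated_iff_mod.1 (Cycle.coe_eq_coe.1 hl').symm
      exact ⟨⟨k, by omega⟩, rfl⟩

/-- A prime cycle of length `n` is represented by exactly `n` words. -/
theorem card_lists {c : Cycle α} (hc : IsPrime c) :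
    Nat.card {l : List α // (l : Cycle α) = c} = c.length := by
  induction c using Quotient.inductionOn with
  | _ l =>
    have hl : IsPrimitive l := isPrime_coe.1 hc
    have hb : Function.Bijective (fun k : Fin l.length => (⟨l.rotate k,
        Cycle.coe_eq_coe.2 (List.IsRotated.forall l k)⟩ :
        {l' : List α // (l' : Cycle α) = Quotient.mk _ l})) := by
      constructor
      · intro i j h
        exact Fin.ext (hl.rotate_injOn i.2 j.2 (congrArg Subtype.val h))
      · rintro ⟨l', hl'⟩
        obtain ⟨k, rfl⟩ := (Cycle.coe_eq_coe.1 hl').symm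
        refine ⟨⟨k % l.length, Nat.mod_lt _ (List.length_pos_iff.2 hl.1)⟩, ?_⟩
        simp [List.rotate_mod]
    rw [← Nat.card_congr (Equiv.ofBijective _ hb), Nat.card_fin]
    rfl

/-- The parametrization of nonempty words by a prime cycle, a word representing it, and an
exponent. -/
def rootPow (x : Σ c : PrimeCyc α, {l : List α // (l : Cycle α) = c.1} × ℕ) : List α :=
  lpow x.2.1.1 (x.2.2 + 1)

theorem rootPow_injective : Function.Injective (rootPow (α := α)) := by
  rintro ⟨⟨c, hc⟩, ⟨l, hl⟩, m⟩ ⟨⟨c', hc'⟩, ⟨l', hl'⟩, m'⟩ h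
  simp only at hl hl'
  subst hl hl'
  obtain ⟨rfl, rfl⟩ := lpow_injective_of_primitive (isPrime_coe.1 hc) (isPrime_coe.1 hc') h
  rfl

theorem exists_rootPow (w : List α) (hw : w ≠ []) : ∃ x, rootPow x = w := by
  obtain ⟨l, m, hl, rfl⟩ := exists_primitive_root w hw
  exact ⟨⟨⟨l, isPrime_coe.2 hl⟩, ⟨l, rfl⟩, m⟩, rfl⟩

/-- The weights of the powers of a word are the powers of its weight, so they are summable only if
the weight is less than `1` in absolute value. -/
theorem CyclicWeight.norm_lt_one (W : CyclicWeight α) (hs : Summable fun l : List α => ‖W l‖)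
    (l : List α) (hl : l ≠ []) : ‖W l‖ < 1 := by
  have hinj : Function.Injective fun m : ℕ => lpow l (m + 1) := by
    intro m m' h
    have := congrArg List.length h
    simp only [length_lpow] at this
    have := Nat.eq_of_mul_eq_mul_right (List.length_pos_iff.2 hl) this
    omega
  have h1 := (hs.comp_injective hinj).tendsto_atTop_zero
  by_contra hge
  rw [not_lt] at hge
  have h2 : ∀ m : ℕ, 1 ≤ ((fun l : List α => ‖W l‖) ∘ fun m : ℕ => lpow l (m + 1)) m := by
    intro m
    simp only [Function.comp, W.pow, norm_pow]
    exact one_le_pow₀ hge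
  have := ge_of_tendsto' h1 h2
  norm_num at this

/-- The trace formula: the logarithm of the Euler product over the prime cycles is the sum of
`W(w) / |w|` over all words, because every nonempty word is uniquely a power of a primitive word,
and a prime cycle of length `n` is represented by `n` words. -/
theorem CyclicWeight.hasSum_log (W : CyclicWeight α) (hs : Summable fun l : List α => ‖W l‖) :
    HasSum (fun c : PrimeCyc α => -Complex.log (1 - W.cyc c.1)) (∑' l, W l / l.length) := by
  have hsum : Summable fun l : List α => W l / l.length := by
    refine Summable.of_norm_bounded hs fun l => ?_
    rw [norm_div, Complex.norm_natCast]
    rcases Nat.eq_zero_or_pos l.length with h | h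
    · rw [h]; simp
    · exact div_le_self (norm_nonneg _) (by exact_mod_cast h)
  have h1 : HasSum ((fun l : List α => W l / l.length) ∘ rootPow) (∑' l, W l / l.length) := by
    rw [rootPow_injective.hasSum_iff]
    · exact hsum.hasSum
    · intro l hl
      have : l = [] := by
        by_contra h
        exact hl (exists_rootPow l h)
      simp [this]
  refine h1.sigma fun c => ?_
  have hfin := lists_finite c.1
  have hcard := card_lists c.2
  obtain ⟨l₀, hl₀⟩ : ∃ l₀ : List α, (l₀ : Cycle α) = c.1 := Quotient.exists_rep c.1
  have hprim : IsPrimitive l₀ := isPrime_coe.1 (hl₀ ▸ c.2)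
  have hlt : ‖W.cyc c.1‖ < 1 := by
    rw [← hl₀]; exact W.norm_lt_one hs l₀ hprim.1
  have hn : (c.1.length : ℂ) ≠ 0 := by
    rw [← hl₀, Cycle.length_coe]
    exact_mod_cast (List.length_pos_iff.2 hprim.1).ne'
  have hterm : ∀ p : {l : List α // (l : Cycle α) = c.1} × ℕ,
      ((fun l : List α => W l / l.length) ∘ rootPow) ⟨c, p⟩ =
        W.cyc c.1 ^ (p.2 + 1) / (p.2 + 1) / c.1.length := by
    rintro ⟨⟨l, hl⟩, m⟩
    have hl' : l.length = c.1.length := by rw [← hl, Cycle.length_coe]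
    simp only [Function.comp, rootPow, W.pow, length_lpow, hl']
    rw [← hl, W.cyc_coe]
    push_cast
    rw [div_div]
  have hfib : ∀ l : {l : List α // (l : Cycle α) = c.1},
      HasSum (fun m : ℕ => ((fun l : List α => W l / l.length) ∘ rootPow) ⟨c, l, m⟩)
        (-Complex.log (1 - W.cyc c.1) / c.1.length) := by
    intro l
    simp only [hterm]
    refine HasSum.div_const ?_ _
    have := (hasSum_nat_add_iff' (f := fun n : ℕ => W.cyc c.1 ^ n / n) 1).2
      (Complex.hasSum_taylorSeries_neg_log hlt)
    simpa using this
  have hsig : Summable fun p : {l : List α // (l : Cycle α) = c.1} × ℕ =>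
      ((fun l : List α => W l / l.length) ∘ rootPow) ⟨c, p⟩ :=
    h1.summable.comp_injective sigma_mk_injective
  have hfw := hsig.hasSum.prod_fiberwise hfib
  have := Fintype.ofFinite {l : List α // (l : Cycle α) = c.1}
  have huniq := hfw.unique (hasSum_fintype _)
  rw [Finset.sum_const, Finset.card_univ, ← Nat.card_eq_fintype_card, hcard, nsmul_eq_mul,
    mul_div_cancel₀ _ hn] at huniq
  rw [← huniq]
  exact hsig.hasSum

end CyclicWords

section Weights

variable {α : Type*}

/-! ### Sums over words -/

section Words

variable {S : Type*}

/-- Words of length `n + 1` are pairs of a letter and a word of length `n`. -/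
def consEquiv (n : ℕ) : {l : List S // l.length = n + 1} ≃ S × {l : List S // l.length = n} where
  toFun l := (l.1.head (by rw [← List.length_pos_iff, l.2]; omega), ⟨l.1.tail, by simp [l.2]⟩)
  invFun p := ⟨p.1 :: p.2.1, by simp [p.2.2]⟩
  left_inv l := by simp
  right_inv p := by simp

theorem hasSum_words_length {x : S → ℂ} (hx : Summable fun s => ‖x s‖) (n : ℕ) :
    (Summable fun l : {l : List S // l.length = n} => ‖(l.1.map x).prod‖) ∧
    HasSum (fun l : {l : List S // l.length = n} => (l.1.map x).prod) ((∑' s, x s) ^ n) := by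
  induction n with
  | zero =>
    have : Unique {l : List S // l.length = 0} :=
      ⟨⟨⟨[], rfl⟩⟩, fun l => Subtype.ext (List.length_eq_zero_iff.1 l.2)⟩
    have h0 : (default : {l : List S // l.length = 0}).1 = [] :=
      List.length_eq_zero_iff.1 (default : {l : List S // l.length = 0}).2
    refine ⟨(hasSum_unique _).summable, ?_⟩
    have := hasSum_unique (fun l : {l : List S // l.length = 0} => (l.1.map x).prod)
    simpa [h0] using this
  | succ n ih =>
    rw [← (consEquiv n).symm.summable_iff, ← (consEquiv n).symm.hasSum_iff]
    have h1 := summable_mul_of_summable_norm hx ih.1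
    have h2 := tsum_mul_tsum_of_summable_norm hx ih.1
    have h3 := hx.mul_of_nonneg ih.1 (fun _ => norm_nonneg _) (fun _ => norm_nonneg _)
    constructor
    · refine h3.congr fun p => ?_
      simp [consEquiv]
    · have h4 := h1.hasSum
      rw [← h2, ih.2.tsum_eq, ← pow_succ'] at h4
      refine h4.congr_fun fun p => ?_
      simp [consEquiv]

/-- The words of length `n` have the total weight `(∑ x) ^ n`. -/
theorem hasSum_words {x : S → ℂ} (hx : Summable fun s => ‖x s‖) (c : ℕ → ℂ)
    (hc : Summable fun n => (∑' s, ‖x s‖) ^ n * ‖c n‖) :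
    (Summable fun l : List S => ‖(l.map x).prod * c l.length‖) ∧
    HasSum (fun l : List S => (l.map x).prod * c l.length) (∑' n, (∑' s, x s) ^ n * c n) := by
  have hsum : Summable fun l : List S => ‖(l.map x).prod * c l.length‖ := by
    rw [← (Equiv.sigmaFiberEquiv (List.length : List S → ℕ)).summable_iff,
      summable_sigma_of_nonneg (f := (fun l : List S => ‖(l.map x).prod * c l.length‖) ∘
        Equiv.sigmaFiberEquiv (List.length : List S → ℕ)) (fun _ => norm_nonneg _)]
    have key : ∀ n : ℕ, HasSum (fun l : {l : List S // l.length = n} =>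
        ‖(l.1.map x).prod * c l.1.length‖) ((∑' s, ‖x s‖) ^ n * ‖c n‖) := by
      intro n
      have h := (hasSum_words_length (x := fun s => ((‖x s‖ : ℝ) : ℂ)) (by simpa using hx) n).2
      have h2 := (Complex.hasSum_re h).mul_right ‖c n‖
      rw [← Complex.ofReal_tsum, ← Complex.ofReal_pow, Complex.ofReal_re] at h2
      refine h2.congr_fun fun l => ?_
      have : ∀ l : List S, (l.map fun s => ((‖x s‖ : ℝ) : ℂ)).prod = ((‖(l.map x).prod‖ : ℝ) : ℂ) := by
        intro l
        induction l with
        | nil => simp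
        | cons a l ih => simp [ih]
      rw [this, Complex.ofReal_re, norm_mul, l.2]
    refine ⟨fun n => (key n).summable, ?_⟩
    exact hc.congr fun n => (key n).tsum_eq.symm
  refine ⟨hsum, ?_⟩
  have h1 := hsum.of_norm.hasSum
  have h2 := ((Equiv.sigmaFiberEquiv (List.length : List S → ℕ)).hasSum_iff.2 h1).sigma
    (g := fun n => (∑' s, x s) ^ n * c n) (fun n => by
      refine ((hasSum_words_length hx n).2.mul_right (c n)).congr_fun fun l => ?_
      simp only [Function.comp, Equiv.sigmaFiberEquiv_apply, l.2])
  rw [h2.tsum_eq]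
  exact h1

/-- Words are summed by the geometric series. -/
theorem hasSum_words_one {x : S → ℂ} (hx : Summable fun s => ‖x s‖) (h1 : ∑' s, ‖x s‖ < 1) :
    (Summable fun l : List S => ‖(l.map x).prod‖) ∧
    HasSum (fun l : List S => (l.map x).prod) (1 - ∑' s, x s)⁻¹ := by
  have h0 : 0 ≤ ∑' s, ‖x s‖ := tsum_nonneg fun _ => norm_nonneg _
  have hn : ‖∑' s, x s‖ < 1 := (norm_tsum_le_tsum_norm hx).trans_lt h1
  have := hasSum_words hx (fun _ => 1) (by simpa using summable_geometric_of_lt_one h0 h1)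
  simpa [tsum_geometric_of_norm_lt_one hn] using this

/-- Words weighted by the inverse of their length are summed by the logarithm. -/
theorem hasSum_words_log {x : S → ℂ} (hx : Summable fun s => ‖x s‖) (h1 : ∑' s, ‖x s‖ < 1) :
    HasSum (fun l : List S => (l.map x).prod / l.length) (-Complex.log (1 - ∑' s, x s)) := by
  have h0 : 0 ≤ ∑' s, ‖x s‖ := tsum_nonneg fun _ => norm_nonneg _
  have hn : ‖∑' s, x s‖ < 1 := (norm_tsum_le_tsum_norm hx).trans_lt h1
  have := (hasSum_words hx (fun n => (n : ℂ)⁻¹) (by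
    refine Summable.of_nonneg_of_le (fun n => by positivity) (fun n => ?_)
      (summable_geometric_of_lt_one h0 h1)
    rw [norm_inv, Complex.norm_natCast]
    exact mul_le_of_le_one_right (by positivity) (Nat.cast_inv_le_one n))).2
  rw [← (Complex.hasSum_taylorSeries_neg_log hn).tsum_eq]
  simpa [div_eq_mul_inv] using this

end Words

/-! ### Weights of cyclic words -/

/-- Multiplicative weights. -/
def prodWeight (x : α → ℂ) : CyclicWeight α where
  toFun l := (l.map x).prod
  rotated h := (h.perm.map x).prod_eq
  pow l m := by rw [map_lpow, lpow, List.prod_flatten]; simp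

/-- The Euler product of a multiplicative weight over the prime cycles of a full alphabet. -/
theorem hasSum_prodWeight {x : α → ℂ} (hx : Summable fun s => ‖x s‖) (h1 : ∑' s, ‖x s‖ < 1) :
    HasSum (fun c : PrimeCyc α => -Complex.log (1 - (prodWeight x).cyc c.1))
      (-Complex.log (1 - ∑' s, x s)) := by
  have := (prodWeight x).hasSum_log (hasSum_words_one hx h1).1
  rwa [← (hasSum_words_log hx h1).tsum_eq]

/-- The weight of the path that starts with the letter `a`, runs through the word `l`, and ends with
the factor `f` of its last letter. -/
def pathTo (ω : α → α → ℂ) (f : α → ℂ) : α → List α → ℂ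
  | a, [] => f a
  | a, b :: l => ω a b * pathTo ω f b l

theorem prod_zipWith_eq_pathTo (ω : α → α → ℂ) (a b : α) (l : List α) :
    (List.zipWith ω (a :: l) (l ++ [b])).prod = pathTo ω (fun s => ω s b) a l := by
  induction l generalizing a with
  | nil => simp [pathTo]
  | cons c l ih => simp only [List.cons_append, List.zipWith_cons_cons, List.prod_cons, pathTo, ih]

theorem zipWith_lpow (ω : α → α → ℂ) {l l' : List α} (h : l.length = l'.length) (m : ℕ) :
    List.zipWith ω (lpow l m) (lpow l' m) = (List.replicate m (List.zipWith ω l l')).flatten := by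
  induction m with
  | zero => rfl
  | succ m ih => rw [lpow_succ, lpow_succ, List.zipWith_append h, ih, List.replicate_succ,
      List.flatten_cons]

/-- The weight of a cyclic word that is the product of transition weights of consecutive letters. -/
def transWeight (ω : α → α → ℂ) : CyclicWeight α where
  toFun l := match l with
    | [] => 0
    | a :: l => (List.zipWith ω (a :: l) ((a :: l).rotate 1)).prod
  rotated {l l'} h := by
    obtain ⟨n, rfl⟩ := h
    cases l with
    | nil => simp
    | cons a l =>
      obtain ⟨b, l', hl'⟩ := List.exists_cons_of_ne_nil
        (show (a :: l).rotate n ≠ [] by simp)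
      rw [hl']
      simp only
      rw [← hl', List.rotate_rotate, Nat.add_comm n 1, ← List.rotate_rotate,
        ← List.zipWith_rotate_distrib ω (a :: l) ((a :: l).rotate 1) n (by simp)]
      exact (List.rotate_perm _ n).symm.prod_eq
  pow l m := by
    cases l with
    | nil => simp [lpow]
    | cons a l =>
      have h : lpow (a :: l) (m + 1) = a :: (l ++ lpow (a :: l) m) := by rw [lpow_succ]; rfl
      rw [h]
      simp only
      rw [← h, rotate_one_lpow, zipWith_lpow ω (by simp), List.prod_flatten]
      simp

theorem transWeight_cons (ω : α → α → ℂ) (a : α) (l : List α) :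
    transWeight ω (a :: l) = pathTo ω (fun s => ω s a) a l := by
  rw [← prod_zipWith_eq_pathTo]
  simp [transWeight]

theorem transWeight_map {β : Type*} (ω : α → α → ℂ) (j : β → α) (l : List β) :
    transWeight ω (l.map j) = transWeight (fun s t => ω (j s) (j t)) l := by
  cases l with
  | nil => rfl
  | cons a l =>
    rw [List.map_cons, transWeight_cons, transWeight_cons]
    suffices h : ∀ (f : α → ℂ) (a : β) (l : List β), pathTo ω f (j a) (l.map j) =
        pathTo (fun s t => ω (j s) (j t)) (fun s => f (j s)) a l from h _ a l
    intro f a l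
    induction l generalizing a with
    | nil => rfl
    | cons b l ih => simp only [List.map_cons, pathTo, ih]

theorem transWeight_cyc_map {β : Type*} (ω : α → α → ℂ) (j : β → α) (c : Cycle β) :
    (transWeight ω).cyc (c.map j) = (transWeight fun s t => ω (j s) (j t)).cyc c := by
  induction c using Quotient.inductionOn with
  | _ l => exact transWeight_map ω j l

/-- A cyclic word of nonzero weight has only nonzero transitions. -/
theorem chain_of_transWeight_ne_zero {ω : α → α → ℂ} {c : Cycle α} (h : (transWeight ω).cyc c ≠ 0) :
    c.Chain fun s t => ω s t ≠ 0 := by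
  induction c using Quotient.inductionOn with
  | _ l =>
    change transWeight ω l ≠ 0 at h
    change Cycle.Chain _ (l : Cycle α)
    cases l with
    | nil => trivial
    | cons a l =>
      rw [transWeight_cons] at h
      rw [Cycle.chain_coe_cons]
      suffices H : ∀ (e a : α) (l : List α), pathTo ω (fun s => ω s e) a l ≠ 0 →
          List.IsChain (fun s t => ω s t ≠ 0) (a :: (l ++ [e])) from H a a l h
      intro e a l
      induction l generalizing a with
      | nil => intro h; simpa [pathTo] using h
      | cons b l ih =>
        intro h
        rw [pathTo, mul_ne_zero_iff] at h
        rw [List.cons_append, List.isChain_cons_cons]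
        exact ⟨h.1, ih b h.2⟩

/-! ### Restriction to a subalphabet -/

theorem exists_map_eq {β : Type*} {j : β → α} {l : List α} (h : ∀ a ∈ l, a ∈ Set.range j) :
    ∃ l' : List β, l'.map j = l := by
  have : l ∈ Set.range (List.map j) := by rw [Set.range_list_map]; exact h
  exact this

theorem isPrimitive_map {β : Type*} {j : β → α} (hj : Function.Injective j) {l : List β} :
    IsPrimitive (l.map j) ↔ IsPrimitive l := by
  unfold IsPrimitive
  rw [ne_eq, List.map_eq_nil_iff]
  refine and_congr Iff.rfl ⟨fun h d f hf he => h (d.map j) f hf (by rw [he, map_lpow]),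
    fun h d f hf he => ?_⟩
  obtain ⟨d', rfl⟩ : ∃ d' : List β, d'.map j = d := by
    refine exists_map_eq fun a ha => ?_
    have : a ∈ l.map j := by
      rw [he, lpow, List.mem_flatten]
      exact ⟨d, by simp; omega, ha⟩
    obtain ⟨b, -, rfl⟩ := List.mem_map.1 this
    exact ⟨b, rfl⟩
  rw [← map_lpow] at he
  exact h d' f hf (List.map_injective_iff.2 hj he)

theorem cycle_map_injective {β : Type*} {j : β → α} (hj : Function.Injective j) :
    Function.Injective (Cycle.map j) := by
  intro c c' h
  induction c using Quotient.inductionOn with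
  | _ l =>
  induction c' using Quotient.inductionOn with
  | _ l' =>
    obtain ⟨k, hk⟩ := Cycle.coe_eq_coe.1 (show ((l.map j : List α) : Cycle α) = (l'.map j : List α) from h)
    rw [← List.map_rotate] at hk
    exact Cycle.coe_eq_coe.2 ⟨k, List.map_injective_iff.2 hj hk⟩

theorem isPrime_map {β : Type*} {j : β → α} (hj : Function.Injective j) {c : Cycle β} :
    IsPrime (c.map j) ↔ IsPrime c := by
  induction c using Quotient.inductionOn with
  | _ l => exact isPrime_coe.trans ((isPrimitive_map hj).trans isPrime_coe.symm)

/-- Prime cycles of a subalphabet as prime cycles. -/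
def PrimeCyc.map {β : Type*} {j : β → α} (hj : Function.Injective j) (c : PrimeCyc β) :
    PrimeCyc α := ⟨c.1.map j, (isPrime_map hj).2 c.2⟩

theorem PrimeCyc.map_injective {β : Type*} {j : β → α} (hj : Function.Injective j) :
    Function.Injective (PrimeCyc.map hj) := fun _ _ h =>
  Subtype.ext (cycle_map_injective hj (congrArg Subtype.val h))

theorem PrimeCyc.mem_range_map {β : Type*} {j : β → α} (hj : Function.Injective j)
    {c : PrimeCyc α} : c ∈ Set.range (PrimeCyc.map hj) ↔ ∀ a ∈ c.1, a ∈ Set.range j := by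
  constructor
  · rintro ⟨c, rfl⟩ a ha
    obtain ⟨b, -, rfl⟩ := Cycle.mem_map.1 ha
    exact ⟨b, rfl⟩
  · intro h
    obtain ⟨c, hc⟩ := c
    induction c using Quotient.inductionOn with
    | _ l =>
      obtain ⟨l', rfl⟩ := exists_map_eq (l := l) (j := j) fun a ha => h a (Cycle.mem_coe_iff.2 ha)
      exact ⟨⟨(l' : Cycle β), (isPrime_map hj).1 hc⟩, rfl⟩

theorem hasSum_primeCyc_restrict {β : Type*} {j : β → α} (hj : Function.Injective j)
    {g : Cycle α → ℂ} {s : ℂ} (h0 : ∀ c : Cycle α, (∃ a ∈ c, a ∉ Set.range j) → g c = 0)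
    (h : HasSum (fun c : PrimeCyc β => g (c.1.map j)) s) :
    HasSum (fun c : PrimeCyc α => g c.1) s := by
  refine ((PrimeCyc.map_injective hj).hasSum_iff fun c hc => h0 _ ?_).1 h
  rw [PrimeCyc.mem_range_map] at hc
  push Not at hc
  exact hc

theorem norm_primeCyc_restrict {β : Type*} {j : β → α} (hj : Function.Injective j)
    {g : Cycle α → ℂ} (h0 : ∀ c : Cycle α, (∃ a ∈ c, a ∉ Set.range j) → g c = 0)
    (h : ∀ c : PrimeCyc β, ‖g (c.1.map j)‖ < 1) (c : PrimeCyc α) : ‖g c.1‖ < 1 := by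
  by_cases hc : c ∈ Set.range (PrimeCyc.map hj)
  · obtain ⟨d, rfl⟩ := hc
    exact h d
  · rw [PrimeCyc.mem_range_map] at hc
    push Not at hc
    rw [h0 _ hc, norm_zero]
    exact one_pos

/-! ### Cutting cyclic words at marked letters -/

/-- A block: a marked letter followed by unmarked letters. -/
abbrev Block (p : α → Prop) : Type _ := {a // p a} × List {a // ¬ p a}

variable {p : α → Prop}

/-- The word spelled by a block. -/
def Block.toList (b : Block p) : List α := b.1.1 :: b.2.map Subtype.val

/-- The word spelled by a word of blocks. -/
def flat (l : List (Block p)) : List α := l.flatMap Block.toList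

@[simp] theorem flat_nil : flat ([] : List (Block p)) = [] := rfl

@[simp] theorem flat_cons (b : Block p) (l : List (Block p)) :
    flat (b :: l) = b.1.1 :: (b.2.map Subtype.val ++ flat l) := rfl

theorem flat_append (l l' : List (Block p)) : flat (l ++ l') = flat l ++ flat l' := by
  simp [flat]

theorem flat_lpow (l : List (Block p)) (m : ℕ) : flat (lpow l m) = lpow (flat l) m := by
  induction m with
  | zero => rfl
  | succ m ih => rw [lpow_succ, lpow_succ, flat_append, ih]

open Classical in
/-- The decomposition of a word into an unmarked prefix and blocks. -/
def splitBlocks (p : α → Prop) : List α → List {a // ¬ p a} × List (Block p)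
  | [] => ([], [])
  | a :: l => if h : p a then ([], (⟨a, h⟩, (splitBlocks p l).1) :: (splitBlocks p l).2)
      else (⟨a, h⟩ :: (splitBlocks p l).1, (splitBlocks p l).2)

theorem join_splitBlocks (l : List α) :
    (splitBlocks p l).1.map Subtype.val ++ flat (splitBlocks p l).2 = l := by
  induction l with
  | nil => rfl
  | cons a l ih =>
    unfold splitBlocks
    split_ifs with h
    · rw [List.map_nil, List.nil_append, flat_cons, ih]
    · rw [List.map_cons, List.cons_append, ih]

theorem splitBlocks_join (u : List {a // ¬ p a}) (bl : List (Block p)) :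
    splitBlocks p (u.map Subtype.val ++ flat bl) = (u, bl) := by
  induction bl generalizing u with
  | nil =>
    induction u with
    | nil => rfl
    | cons a u ih => simp only [List.map_cons, List.cons_append, splitBlocks, dif_neg a.2, ih]
  | cons b bl ihb =>
    induction u with
    | nil =>
      simp only [List.map_nil, List.nil_append, flat_cons, splitBlocks, dif_pos b.1.2, ihb]
    | cons a u ih => simp only [List.map_cons, List.cons_append, splitBlocks, dif_neg a.2, ih]

theorem flat_injective : Function.Injective (flat (p := p)) := by
  intro l l' h
  have h1 := splitBlocks_join [] l
  have h2 := splitBlocks_join [] l'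
  simp only [List.map_nil, List.nil_append] at h1 h2
  rw [h, h2] at h1
  exact (congrArg Prod.snd h1).symm

theorem exists_flat_eq {l : List α} (h : ∀ a ∈ l.head?, p a) : ∃ bl : List (Block p), flat bl = l := by
  cases l with
  | nil => exact ⟨[], rfl⟩
  | cons a l =>
    have ha : p a := h a rfl
    refine ⟨(splitBlocks p (a :: l)).2, ?_⟩
    conv_rhs => rw [← join_splitBlocks (p := p) (a :: l)]
    simp [splitBlocks, ha]

theorem head?_flat (bl : List (Block p)) : ∀ a ∈ (flat bl).head?, p a := by
  cases bl with
  | nil => simp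
  | cons b bl => simp [b.1.2]

/-- Two rotations of the same word that both begin with a marked letter differ by a rotation of
blocks. -/
theorem flat_isRotated {l l' : List (Block p)} : flat l ~r flat l' ↔ l ~r l' := by
  constructor
  · rintro ⟨k, hk⟩
    rw [← List.rotate_mod] at hk
    rcases Nat.eq_zero_or_pos (flat l).length with h0 | h0
    · have : flat l = [] := List.length_eq_zero_iff.1 h0
      rw [this, List.rotate_nil, ← this] at hk
      rw [flat_injective hk]
    have hlt := Nat.mod_lt k h0
    rw [List.rotate_eq_drop_append_take hlt.le] at hk
    set x := (flat l).take (k % (flat l).length)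
    set y := (flat l).drop (k % (flat l).length) with hy
    have hxy : x ++ y = flat l := List.take_append_drop _ _
    have hyne : y ≠ [] := by
      rw [← List.length_pos_iff, hy, List.length_drop]; omega
    obtain ⟨bx, hbx⟩ : ∃ bl : List (Block p), flat bl = x := by
      refine exists_flat_eq fun a ha => head?_flat l a ?_
      rw [← hxy]
      exact List.mem_head?_append_of_mem_head? ha
    obtain ⟨by', hby⟩ : ∃ bl : List (Block p), flat bl = y := by
      refine exists_flat_eq fun a ha => head?_flat l' a ?_
      rw [← hk]
      exact List.mem_head?_append_of_mem_head? ha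
    have h1 : l = bx ++ by' := flat_injective (by rw [flat_append, hbx, hby, hxy])
    have h2 : l' = by' ++ bx := flat_injective (by rw [flat_append, hbx, hby, hk])
    rw [h1, h2]
    exact List.isRotated_append
  · rintro ⟨k, rfl⟩
    induction k with
    | zero => rw [List.rotate_zero]
    | succ k ih =>
      refine ih.trans ?_
      rw [← List.rotate_rotate]
      generalize l.rotate k = l
      cases l with
      | nil => simp
      | cons b l =>
        rw [List.rotate_cons_succ, List.rotate_zero, flat_append,
          show b :: l = [b] ++ l from rfl, flat_append]
        exact List.isRotated_append

/-- The cyclic word spelled by a cyclic word of blocks. -/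
def flatCyc (c : Cycle (Block p)) : Cycle α :=
  Quotient.liftOn c (fun l => (flat l : Cycle α)) fun _ _ h =>
    Cycle.coe_eq_coe.2 (flat_isRotated.2 h)

theorem flatCyc_injective : Function.Injective (flatCyc (p := p)) := by
  intro c c' h
  induction c using Quotient.inductionOn with
  | _ l =>
  induction c' using Quotient.inductionOn with
  | _ l' => exact Cycle.coe_eq_coe.2 (flat_isRotated.1 (Cycle.coe_eq_coe.1 h))

theorem isPrimitive_flat {l : List (Block p)} : IsPrimitive (flat l) ↔ IsPrimitive l := by
  have hnil : flat l = [] ↔ l = [] := by cases l <;> simp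
  unfold IsPrimitive
  rw [ne_eq, hnil]
  refine and_congr_right fun hne => ⟨fun h d f hf he => h (flat d) f hf (by rw [he, flat_lpow]),
    fun h d f hf he => ?_⟩
  obtain ⟨d', rfl⟩ : ∃ bl : List (Block p), flat bl = d := by
    refine exists_flat_eq fun a ha => head?_flat l a ?_
    obtain ⟨k, rfl⟩ : ∃ k, f = k + 1 := ⟨f - 1, by omega⟩
    rw [he, lpow_succ]
    exact List.mem_head?_append_of_mem_head? ha
  rw [← flat_lpow] at he
  exact h d' f hf (flat_injective he)

/-- A prime cyclic word of blocks spells a prime cyclic word. -/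
def PrimeCyc.flat (c : PrimeCyc (Block p)) : PrimeCyc α :=
  ⟨flatCyc c.1, by
    obtain ⟨c, hc⟩ := c
    induction c using Quotient.inductionOn with
    | _ l => exact isPrime_coe.2 (isPrimitive_flat.2 (isPrime_coe.1 hc))⟩

theorem PrimeCyc.flat_injective : Function.Injective (PrimeCyc.flat (p := p)) := fun _ _ h =>
  Subtype.ext (flatCyc_injective (congrArg Subtype.val h))

theorem PrimeCyc.mem_range_flat {c : PrimeCyc α} :
    c ∈ Set.range (PrimeCyc.flat (p := p)) ↔ ∃ a ∈ c.1, p a := by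
  obtain ⟨c, hc⟩ := c
  induction c using Quotient.inductionOn with
  | _ l =>
  constructor
  · rintro ⟨⟨c', hc'⟩, he⟩
    induction c' using Quotient.inductionOn with
    | _ l' =>
      have hl' := (isPrime_coe.1 hc').1
      obtain ⟨b, l', rfl⟩ := List.exists_cons_of_ne_nil hl'
      rw [← he]
      exact ⟨b.1.1, Cycle.mem_coe_iff.2 (by simp), b.1.2⟩
  · rintro ⟨a, ha, hpa⟩
    obtain ⟨s, t, rfl⟩ := List.append_of_mem (Cycle.mem_coe_iff.1 ha)
    obtain ⟨bl, hbl⟩ : ∃ bl : List (Block p), Necklace.flat bl = (a :: t) ++ s :=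
      exists_flat_eq fun b hb => by
        simp only [List.cons_append, List.head?_cons, Option.mem_def, Option.some.injEq] at hb
        rwa [← hb]
    have he : ((Necklace.flat bl : List α) : Cycle α) = ((s ++ a :: t : List α) : Cycle α) := by
      rw [hbl]; exact Cycle.coe_eq_coe.2 List.isRotated_append
    have hp : IsPrime ((bl : List (Block p)) : Cycle (Block p)) :=
      isPrime_coe.2 (isPrimitive_flat.1 (isPrime_coe.1 (he ▸ hc)))
    exact ⟨⟨_, hp⟩, Subtype.ext he⟩

/-- A sum over prime cycles is the sum over the prime cycles with a marked letter, which are prime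
cyclic words of blocks, and the sum over the prime cycles without marked letters. -/
theorem hasSum_primeCyc_split (p : α → Prop) {g : Cycle α → ℂ} {s₁ s₂ : ℂ}
    (h₁ : HasSum (fun c : PrimeCyc (Block p) => g (flatCyc c.1)) s₁)
    (h₂ : HasSum (fun c : PrimeCyc {a // ¬ p a} => g (c.1.map Subtype.val)) s₂) :
    HasSum (fun c : PrimeCyc α => g c.1) (s₁ + s₂) := by
  have h₁' := (PrimeCyc.flat_injective (p := p)).hasSum_range_iff
    (f := fun c : PrimeCyc α => g c.1) |>.2 h₁
  have h₂' := (PrimeCyc.map_injective (Subtype.val_injective (p := fun a => ¬ p a))).hasSum_range_iff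
    (f := fun c : PrimeCyc α => g c.1) |>.2 h₂
  refine HasSum.add_isCompl ?_ h₁' h₂'
  have : Set.range (PrimeCyc.map (Subtype.val_injective (p := fun a => ¬ p a))) =
      (Set.range (PrimeCyc.flat (p := p)))ᶜ := by
    ext c
    rw [PrimeCyc.mem_range_map, Set.mem_compl_iff, PrimeCyc.mem_range_flat]
    simp
  rw [this]
  exact isCompl_compl

theorem norm_primeCyc_split (p : α → Prop) {g : Cycle α → ℂ}
    (h₁ : ∀ c : PrimeCyc (Block p), ‖g (flatCyc c.1)‖ < 1)
    (h₂ : ∀ c : PrimeCyc {a // ¬ p a}, ‖g (c.1.map Subtype.val)‖ < 1) (c : PrimeCyc α) :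
    ‖g c.1‖ < 1 := by
  by_cases hc : c ∈ Set.range (PrimeCyc.flat (p := p))
  · obtain ⟨d, rfl⟩ := hc
    exact h₁ d
  · have hc' : c ∈ Set.range (PrimeCyc.map (Subtype.val_injective (p := fun a => ¬ p a))) := by
      rw [PrimeCyc.mem_range_map]
      rw [PrimeCyc.mem_range_flat] at hc
      simpa using hc
    obtain ⟨d, rfl⟩ := hc'
    exact h₂ d

/-- The weight of a word of blocks is multiplicative if the transitions to the marked letters do not
depend on the marked letter. -/
theorem transWeight_flat {ω : α → α → ℂ} {f : α → ℂ} (hω : ∀ s t, p t → ω s t = f s)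
    (l : List (Block p)) (hl : l ≠ []) : transWeight ω (flat l) =
      (l.map fun b => pathTo ω f b.1.1 (b.2.map Subtype.val)).prod := by
  have h1 : ∀ (a b : α) (w r : List α) (f' : α → ℂ), p b →
      pathTo ω f' a (w ++ b :: r) = pathTo ω f a w * pathTo ω f' b r := by
    intro a b w r f' hb
    induction w generalizing a with
    | nil => simp [pathTo, hω _ _ hb]
    | cons c w ih => simp only [List.cons_append, pathTo, ih, mul_assoc]
  obtain ⟨b, l, rfl⟩ := List.exists_cons_of_ne_nil hl
  rw [flat_cons, transWeight_cons, show (fun s => ω s b.1.1) = f from funext fun s => hω s _ b.1.2]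
  clear hl
  induction l generalizing b with
  | nil => simp
  | cons b' l ih => rw [flat_cons, h1 _ _ _ _ _ b'.1.2, ih, List.map_cons (l := b' :: l), List.prod_cons]

/-- Elimination of the marked letters from an Euler product with transition weights: if the weight
of the transition to a marked letter depends only on the source of the transition, the prime cycles
with a marked letter contribute the factor of a full alphabet of blocks. -/
theorem hasSum_transWeight_split (p : α → Prop) {ω : α → α → ℂ} {f : α → ℂ}
    (hω : ∀ s t, p t → ω s t = f s) {s₂ : ℂ}
    (hy : Summable fun b : Block p => ‖pathTo ω f b.1.1 (b.2.map Subtype.val)‖)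
    (hy1 : ∑' b : Block p, ‖pathTo ω f b.1.1 (b.2.map Subtype.val)‖ < 1)
    (h₂ : HasSum (fun c : PrimeCyc {a // ¬ p a} =>
      -Complex.log (1 - (transWeight fun s t : {a // ¬ p a} => ω s t).cyc c.1)) s₂) :
    HasSum (fun c : PrimeCyc α => -Complex.log (1 - (transWeight ω).cyc c.1))
      (-Complex.log (1 - ∑' b : Block p, pathTo ω f b.1.1 (b.2.map Subtype.val)) + s₂) := by
  refine hasSum_primeCyc_split p (g := fun c => -Complex.log (1 - (transWeight ω).cyc c)) ?_ ?_
  · refine (hasSum_prodWeight hy hy1).congr_fun fun c => ?_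
    obtain ⟨c, hc⟩ := c
    induction c using Quotient.inductionOn with
    | _ l =>
      have := transWeight_flat hω l (isPrime_coe.1 hc).1
      change -Complex.log (1 - transWeight ω (flat l)) = _
      rw [this]
      rfl
  · simpa only [transWeight_cyc_map] using h₂

/-- The factors `1 - W(c)` of the Euler product are nonzero. -/
theorem norm_transWeight_split (p : α → Prop) {ω : α → α → ℂ} {f : α → ℂ}
    (hω : ∀ s t, p t → ω s t = f s)
    (hy : Summable fun b : Block p => ‖pathTo ω f b.1.1 (b.2.map Subtype.val)‖)
    (hy1 : ∑' b : Block p, ‖pathTo ω f b.1.1 (b.2.map Subtype.val)‖ < 1)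
    (h₂ : ∀ c : PrimeCyc {a // ¬ p a},
      ‖(transWeight fun s t : {a // ¬ p a} => ω s t).cyc c.1‖ < 1) (c : PrimeCyc α) :
    ‖(transWeight ω).cyc c.1‖ < 1 := by
  refine norm_primeCyc_split p (g := (transWeight ω).cyc) (fun c => ?_) ?_ c
  · obtain ⟨c, hc⟩ := c
    induction c using Quotient.inductionOn with
    | _ l =>
      have hl := (isPrime_coe.1 hc).1
      change ‖transWeight ω (flat l)‖ < 1
      rw [transWeight_flat hω l hl]
      exact (prodWeight _).norm_lt_one
        (hasSum_words_one hy (by simpa using hy1)).1 l hl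
  · simpa only [transWeight_cyc_map] using h₂

/-! ### The double cover -/

section DoubleCover

variable {S : Type*} (ε : S → Bool)

/-- The state after the letter `s`, read in the state `i`. -/
def nextState (i : Bool) (s : S) : Bool := if ε s then i else !i

/-- The path in the double cover of the alphabet `S` that starts in the state `i`. -/
def liftPath : Bool → List S → List (Bool × S)
  | _, [] => []
  | i, s :: w => (i, s) :: liftPath (nextState ε i s) w

/-- The state reached from `i` by reading a word. -/
def endState : Bool → List S → Bool
  | i, [] => i
  | i, s :: w => endState (nextState ε i s) w

theorem map_snd_liftPath (i : Bool) (w : List S) : (liftPath ε i w).map Prod.snd = w := by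
  induction w generalizing i with
  | nil => rfl
  | cons s w ih => rw [liftPath, List.map_cons, ih]

theorem length_liftPath (i : Bool) (w : List S) : (liftPath ε i w).length = w.length := by
  rw [← List.length_map (f := Prod.snd), map_snd_liftPath]

/-- The transition weights on the double cover. -/
def coverTrans (x : S → ℂ) (a b : Bool × S) : ℂ :=
  if b.1 = nextState ε a.1 a.2 then x a.2 else 0

theorem pathTo_liftPath (x : S → ℂ) (f : Bool × S → ℂ) (g : Bool → ℂ)
    (hf : ∀ a, f a = x a.2 * g (nextState ε a.1 a.2)) (i : Bool) (s : S) (w : List S) :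
    pathTo (coverTrans ε x) f (i, s) (liftPath ε (nextState ε i s) w) =
      ((s :: w).map x).prod * g (endState ε i (s :: w)) := by
  induction w generalizing i s with
  | nil => simp [liftPath, pathTo, hf, endState]
  | cons t w ih =>
    rw [liftPath, pathTo, ih, coverTrans, if_pos rfl]
    simp only [List.map_cons, List.prod_cons, endState]
    ring

theorem liftPath_of_pathTo_ne_zero {x : S → ℂ} {f : Bool × S → ℂ} {a : Bool × S}
    {l : List (Bool × S)} (h : pathTo (coverTrans ε x) f a l ≠ 0) :
    l = liftPath ε (nextState ε a.1 a.2) (l.map Prod.snd) := by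
  induction l generalizing a with
  | nil => rfl
  | cons b l ih =>
    rw [pathTo, mul_ne_zero_iff, coverTrans] at h
    have h1 : b.1 = nextState ε a.1 a.2 := by
      by_contra hne
      exact h.1 (if_neg hne)
    rw [List.map_cons, liftPath, ← h1, ← ih h.2]

theorem endState_not (i : Bool) (w : List S) : endState ε (!i) w = !endState ε i w := by
  induction w generalizing i with
  | nil => rfl
  | cons s w ih =>
    have : nextState ε (!i) s = !nextState ε i s := by unfold nextState; split_ifs <;> rfl
    rw [endState, this, ih, endState]

/-- The product of the signs of the letters tells whether a word changes the state. -/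
theorem prod_sign_eq (x : S → ℂ) (i : Bool) (w : List S) :
    (w.map fun s => if ε s then x s else -x s).prod =
      if endState ε i w = i then (w.map x).prod else -(w.map x).prod := by
  induction w generalizing i with
  | nil => simp [endState]
  | cons s w ih =>
    rw [List.map_cons, List.prod_cons, List.map_cons, List.prod_cons, endState, ih i]
    by_cases hs : ε s
    · simp only [nextState, hs, if_true]
      split_ifs <;> ring
    · simp only [nextState, hs, Bool.false_eq_true, if_false, endState_not]
      cases endState ε i w <;> cases i <;> simp

/-- A nonempty path in the double cover. -/
def liftCons (y : Bool × S × List S) : List (Bool × S) := liftPath ε y.1 (y.2.1 :: y.2.2)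

theorem liftCons_injective : Function.Injective (liftCons ε) := by
  rintro ⟨i, s, w⟩ ⟨i', s', w'⟩ h
  have h2 := congrArg (List.map Prod.snd) h
  simp only [liftCons, map_snd_liftPath, List.cons.injEq] at h2
  obtain ⟨rfl, rfl⟩ := h2
  simp only [liftCons, liftPath, List.cons.injEq, Prod.mk.injEq, and_true] at h
  rw [h.1]

theorem hasSum_cons_iff {f : List S → ℂ} (h0 : f [] = 0) {a : ℂ} :
    HasSum (fun y : S × List S => f (y.1 :: y.2)) a ↔ HasSum f a := by
  have hinj : Function.Injective fun y : S × List S => y.1 :: y.2 := by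
    rintro ⟨s, w⟩ ⟨s', w'⟩ h
    simpa using h
  refine hinj.hasSum_iff (f := f) fun l hl => ?_
  cases l with
  | nil => exact h0
  | cons s w => exact absurd ⟨(s, w), rfl⟩ hl

theorem transWeight_liftCons (x : S → ℂ) (y : Bool × S × List S) :
    transWeight (coverTrans ε x) (liftCons ε y) =
      if endState ε y.1 (y.2.1 :: y.2.2) = y.1 then ((y.2.1 :: y.2.2).map x).prod else 0 := by
  obtain ⟨i, s, w⟩ := y
  rw [liftCons, liftPath, transWeight_cons,
    pathTo_liftPath ε x _ (fun j => if j = i then 1 else 0) (fun a => ?_)]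
  · simp
  · simp only [coverTrans, mul_ite, mul_one, mul_zero]
    congr 1
    exact propext eq_comm

theorem transWeight_cover_eq_zero (x : S → ℂ) {l : List (Bool × S)} (hl : l ∉ Set.range (liftCons ε)) :
    transWeight (coverTrans ε x) l = 0 := by
  cases l with
  | nil => rfl
  | cons a l =>
    by_contra h
    rw [transWeight_cons] at h
    refine hl ⟨(a.1, a.2, l.map Prod.snd), ?_⟩
    rw [liftCons, liftPath, ← liftPath_of_pathTo_ne_zero ε h]

theorem summable_coverTrans {x : S → ℂ} (hx : Summable fun s => ‖x s‖) (h1 : ∑' s, ‖x s‖ < 1) :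
    Summable fun l : List (Bool × S) => ‖transWeight (coverTrans ε x) l‖ := by
  rw [← (liftCons_injective ε).summable_iff fun l hl => by
    rw [transWeight_cover_eq_zero ε x hl, norm_zero]]
  have hinj : Function.Injective fun y : S × List S => y.1 :: y.2 := by
    rintro ⟨s, w⟩ ⟨s', w'⟩ h
    simpa using h
  have h2 := (hasSum_words_one hx h1).1.comp_injective hinj
  have h3 : Summable fun y : Bool × S × List S => ‖((y.2.1 :: y.2.2).map x).prod‖ := by
    have : Summable fun i : Bool => (1 : ℝ) := (hasSum_fintype _).summable
    simpa using this.mul_of_nonneg h2 (fun _ => zero_le_one) (fun _ => norm_nonneg _)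
  refine Summable.of_nonneg_of_le (fun _ => norm_nonneg _) (fun y => ?_) h3
  simp only [Function.comp, transWeight_liftCons]
  split_ifs
  · exact le_rfl
  · rw [norm_zero]; exact norm_nonneg _

theorem norm_doubleCover {x : S → ℂ} (hx : Summable fun s => ‖x s‖) (h1 : ∑' s, ‖x s‖ < 1)
    (c : PrimeCyc (Bool × S)) : ‖(transWeight (coverTrans ε x)).cyc c.1‖ < 1 := by
  obtain ⟨c, hc⟩ := c
  induction c using Quotient.inductionOn with
  | _ l => exact CyclicWeight.norm_lt_one _ (summable_coverTrans ε hx h1) l (isPrime_coe.1 hc).1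

/-- The Euler product of the double cover is the product of the Euler products of the two
characters. -/
theorem hasSum_doubleCover {x : S → ℂ} (hx : Summable fun s => ‖x s‖) (h1 : ∑' s, ‖x s‖ < 1) :
    HasSum (fun c : PrimeCyc (Bool × S) => -Complex.log (1 - (transWeight (coverTrans ε x)).cyc c.1))
      (-Complex.log (1 - ∑' s, x s) + -Complex.log (1 - ∑' s, if ε s then x s else -x s)) := by
  have hnorm : ∀ s, ‖(if ε s then x s else -x s)‖ = ‖x s‖ := fun s => by split_ifs <;> simp
  have hsum := summable_coverTrans ε hx h1
  have hlog := (transWeight (coverTrans ε x)).hasSum_log hsum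
  convert hlog using 1
  symm
  have hA := hasSum_words_log hx h1
  have hB := hasSum_words_log (x := fun s => if ε s then x s else -x s) (by simpa [hnorm] using hx)
    (by simpa [hnorm] using h1)
  have hAB := (hasSum_cons_iff (by simp)).2 (hA.add hB)
  have hsum' : Summable fun l : List (Bool × S) => transWeight (coverTrans ε x) l / l.length := by
    refine Summable.of_norm_bounded hsum fun l => ?_
    rw [norm_div, Complex.norm_natCast]
    rcases Nat.eq_zero_or_pos l.length with h | h
    · rw [h]; simp
    · exact div_le_self (norm_nonneg _) (by exact_mod_cast h)
  have h4 := ((liftCons_injective ε).hasSum_iff fun l hl => by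
    rw [transWeight_cover_eq_zero ε x hl, zero_div]).2 hsum'.hasSum
  have h5 := ((Equiv.prodComm _ _).hasSum_iff.2 h4).prod_fiberwise
    (g := fun y : S × List S => ((y.1 :: y.2).map x).prod / (y.1 :: y.2).length +
      ((y.1 :: y.2).map fun s => if ε s then x s else -x s).prod / (y.1 :: y.2).length) (fun y => by
      have hlen : ∀ i, (liftCons ε (i, y)).length = (y.1 :: y.2).length := fun i =>
        length_liftPath ε i _
      convert hasSum_fintype _ using 1
      rw [Fintype.sum_bool]
      simp only [Function.comp, Equiv.prodComm_apply, Prod.swap, transWeight_liftCons, hlen]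
      rw [← add_div, ← add_div]
      congr 1
      have e2 := endState_not ε true (y.1 :: y.2)
      rw [prod_sign_eq ε x true (y.1 :: y.2)]
      simp only [Bool.not_true] at e2
      rw [e2]
      cases endState ε true (y.1 :: y.2) <;> simp)
  exact h5.unique hAB

end DoubleCover

end Weights

/-! ### Normal forms and conjugacy classes -/

/-- Elements that are not proper powers. -/
def NotPower {Γ : Type*} [Group Γ] (γ : Γ) : Prop := ∀ (δ : Γ) (r : ℕ), 1 < r → γ ≠ δ ^ r

theorem NotPower.conj {Γ : Type*} [Group Γ] {γ γ' : Γ} (h : NotPower γ) (hc : IsConj γ γ') :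
    NotPower γ' := by
  intro δ r hr he
  obtain ⟨g, hg⟩ := isConj_iff.1 hc.symm
  refine h (g * δ * g⁻¹) r hr ?_
  rw [conj_pow, ← hg, he]

theorem NotPower.map_equiv {Γ Γ' : Type*} [Group Γ] [Group Γ'] (e : Γ ≃* Γ') {γ : Γ} :
    NotPower (e γ) ↔ NotPower γ := by
  refine ⟨fun h δ r hr he => h (e δ) r hr (by rw [he, map_pow]), fun h δ r hr he =>
    h (e.symm δ) r hr ?_⟩
  rw [← map_pow, ← he, e.symm_apply_apply]

/-- Elements of finite order are proper powers. -/
theorem NotPower.not_isOfFinOrder {Γ : Type*} [Group Γ] {γ : Γ} (h : NotPower γ) :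
    ¬ IsOfFinOrder γ := by
  intro hf
  refine h γ (orderOf γ + 1) (by have := hf.orderOf_pos; omega) ?_
  rw [pow_succ, pow_orderOf_eq_one, one_mul]

/-- A normal form of a group: every element is uniquely a product of letters, such that the target
of each letter is different from the source of the next one.  If the target of a letter is the
source of the next one, the two letters cancel or can be merged. The main cases are the alternating
words in a free product, where the source and the target of a letter both name its factor. -/
structure NormalForm (Γ Λ I : Type*) [Group Γ] where
  src : Λ → I
  tgt : Λ → I
  val : Λ → Γ
  inj : ∀ l l' : List Λ, l.IsChain (fun s t => tgt s ≠ src t) → l'.IsChain (fun s t => tgt s ≠ src t) →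
    (l.map val).prod = (l'.map val).prod → l = l'
  surj : ∀ γ : Γ, ∃ l : List Λ, l.IsChain (fun s t => tgt s ≠ src t) ∧ (l.map val).prod = γ
  merge : ∀ s t, tgt s = src t → val s * val t = 1 ∨
    ∃ r, src r = src s ∧ tgt r = tgt t ∧ val r = val s * val t

namespace NormalForm

variable {Γ Λ I : Type*} [Group Γ] (𝒩 : NormalForm Γ Λ I)

/-- The letter `t` may follow the letter `s`. -/
def Follow (s t : Λ) : Prop := 𝒩.tgt s ≠ 𝒩.src t

/-- Reduced words. -/
abbrev Red (l : List Λ) : Prop := l.IsChain 𝒩.Follow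

/-- The element of the group that a word represents. -/
def eval (l : List Λ) : Γ := (l.map 𝒩.val).prod

@[simp] theorem eval_nil : 𝒩.eval [] = 1 := rfl
@[simp] theorem eval_cons (s : Λ) (l : List Λ) : 𝒩.eval (s :: l) = 𝒩.val s * 𝒩.eval l := by
  simp [eval]
@[simp] theorem eval_append (l l' : List Λ) : 𝒩.eval (l ++ l') = 𝒩.eval l * 𝒩.eval l' := by
  simp [eval]
@[simp] theorem eval_lpow (l : List Λ) (n : ℕ) : 𝒩.eval (lpow l n) = 𝒩.eval l ^ n := by
  induction n with
  | zero => simp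
  | succ n ih => rw [lpow_succ, eval_append, ih, pow_succ']

/-- The reduced word of an element. -/
def nf (γ : Γ) : List Λ := (𝒩.surj γ).choose

theorem red_nf (γ : Γ) : 𝒩.Red (𝒩.nf γ) := (𝒩.surj γ).choose_spec.1
@[simp] theorem eval_nf (γ : Γ) : 𝒩.eval (𝒩.nf γ) = γ := (𝒩.surj γ).choose_spec.2

theorem eval_inj {l l' : List Λ} (h : 𝒩.Red l) (h' : 𝒩.Red l') (he : 𝒩.eval l = 𝒩.eval l') :
    l = l' := 𝒩.inj l l' h h' he

theorem nf_eval {l : List Λ} (h : 𝒩.Red l) : 𝒩.nf (𝒩.eval l) = l :=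
  𝒩.eval_inj (𝒩.red_nf _) h (𝒩.eval_nf _)

theorem nf_one : 𝒩.nf 1 = [] := 𝒩.nf_eval (l := []) List.IsChain.nil

/-- Multiplication by a letter from the left changes at most the first letter of a reduced word. -/
theorem mul_letter_left (s : Λ) {x : List Λ} (hx : 𝒩.Red x) : ∃ (q : List Λ) (j : ℕ),
    𝒩.Red (q ++ x.drop j) ∧ 𝒩.eval (q ++ x.drop j) = 𝒩.val s * 𝒩.eval x ∧ j ≤ 1 ∧ q.length ≤ 1 := by
  cases x with
  | nil => exact ⟨[s], 0, by simp, by simp, by simp, by simp⟩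
  | cons t x =>
    by_cases h : 𝒩.Follow s t
    · exact ⟨[s], 0, by simpa using ⟨h, hx⟩, by simp, by simp, by simp⟩
    · obtain h1 | ⟨r, hr1, hr2, hr3⟩ := 𝒩.merge s t (not_not.1 h)
      · refine ⟨[], 1, ?_, ?_, le_rfl, by simp⟩
        · simpa using hx.tail
        · simp [← mul_assoc, h1]
      · refine ⟨[r], 1, ?_, ?_, le_rfl, by simp⟩
        · simp only [List.drop_succ_cons, List.drop_zero, List.singleton_append]
          cases x with
          | nil => exact List.IsChain.singleton r
          | cons t' x =>
            rw [Red, List.isChain_cons_cons] at hx ⊢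
            exact ⟨by rw [Follow, hr2]; exact hx.1, hx.2⟩
        · simp [hr3, mul_assoc]

theorem mul_letter_right (s : Λ) {x : List Λ} (hx : 𝒩.Red x) : ∃ (q : List Λ) (k : ℕ),
    𝒩.Red (x.take k ++ q) ∧ 𝒩.eval (x.take k ++ q) = 𝒩.eval x * 𝒩.val s ∧ x.length ≤ k + 1 := by
  rcases List.eq_nil_or_concat x with rfl | ⟨x, t, rfl⟩
  · exact ⟨[s], 0, by simp, by simp, by simp⟩
  · rw [List.concat_eq_append] at hx ⊢
    by_cases h : 𝒩.Follow t s
    · refine ⟨[t, s], x.length, ?_, by simp [mul_assoc], by simp⟩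
      rw [List.take_left]
      rw [Red, List.isChain_append] at hx ⊢
      exact ⟨hx.1, by simpa using h, by simpa using hx.2.2⟩
    · obtain h1 | ⟨r, hr1, hr2, hr3⟩ := 𝒩.merge t s (not_not.1 h)
      · refine ⟨[], x.length, ?_, ?_, by simp⟩
        · rw [List.take_left, List.append_nil]
          exact (List.isChain_append.1 hx).1
        · simp [mul_assoc, h1]
      · refine ⟨[r], x.length, ?_, by simp [hr3, mul_assoc], by simp⟩
        rw [List.take_left]
        rw [Red, List.isChain_append] at hx ⊢
        refine ⟨hx.1, List.IsChain.singleton r, ?_⟩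
        simpa [Follow, hr1] using hx.2.2

/-- Multiplication by a word of length `n` from the left changes at most the first `n` letters of a
reduced word. -/
theorem absorb_left (l : List Λ) {x : List Λ} (hx : 𝒩.Red x) : ∃ (q : List Λ) (j : ℕ),
    𝒩.Red (q ++ x.drop j) ∧ 𝒩.eval (q ++ x.drop j) = 𝒩.eval l * 𝒩.eval x ∧ j ≤ l.length ∧
      q.length ≤ l.length := by
  induction l with
  | nil => exact ⟨[], 0, by simpa using hx, by simp, le_rfl, le_rfl⟩
  | cons s l ih =>
    obtain ⟨q, j, h1, h2, h3, h4⟩ := ih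
    obtain ⟨q', j', h1', h2', h3', h4'⟩ := 𝒩.mul_letter_left s h1
    rw [List.drop_append, List.drop_drop, ← List.append_assoc] at h1' h2'
    refine ⟨q' ++ q.drop j', j + (j' - q.length), h1', ?_, ?_, ?_⟩
    · rw [h2', h2, eval_cons, mul_assoc]
    · simp only [List.length_cons]; omega
    · simp only [List.length_cons, List.length_append, List.length_drop]; omega

theorem absorb_right (l : List Λ) {x : List Λ} (hx : 𝒩.Red x) : ∃ (q : List Λ) (k : ℕ),
    𝒩.Red (x.take k ++ q) ∧ 𝒩.eval (x.take k ++ q) = 𝒩.eval x * 𝒩.eval l ∧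
      x.length ≤ k + l.length := by
  induction l using List.reverseRecOn with
  | nil => exact ⟨[], x.length, by simpa using hx, by simp, by simp⟩
  | append_singleton l s ih =>
    obtain ⟨q, k, h1, h2, h3⟩ := ih
    obtain ⟨q', k', h1', h2', h3'⟩ := 𝒩.mul_letter_right s h1
    rw [List.take_append, List.take_take, List.append_assoc] at h1' h2'
    refine ⟨_, _, h1', ?_, ?_⟩
    · rw [h2', h2, eval_append, mul_assoc]; simp
    · simp only [List.length_append, List.length_take, List.length_singleton] at h3' ⊢
      omega

/-- Cyclically reduced words. -/
def CycRed (l : List Λ) : Prop := l ≠ [] ∧ Cycle.Chain 𝒩.Follow (l : Cycle Λ)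

theorem cycRed_iff {l : List Λ} : 𝒩.CycRed l ↔ l ≠ [] ∧ 𝒩.Red l ∧
    ∀ s ∈ l.getLast?, ∀ t ∈ l.head?, 𝒩.Follow s t := by
  refine and_congr_right fun h => ?_
  obtain ⟨a, l, rfl⟩ := List.exists_cons_of_ne_nil h
  rw [Cycle.chain_coe_cons, ← List.cons_append, List.isChain_append]
  simp

variable {𝒩} in
theorem CycRed.red {l : List Λ} (h : 𝒩.CycRed l) : 𝒩.Red l := (𝒩.cycRed_iff.1 h).2.1

theorem head?_lpow_succ {l : List Λ} (n : ℕ) : (lpow l (n + 1)).head? = l.head? := by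
  cases l with
  | nil => simp [lpow]
  | cons a l => simp [lpow_succ]

theorem getLast?_lpow_succ {l : List Λ} (n : ℕ) : (lpow l (n + 1)).getLast? = l.getLast? := by
  rcases List.eq_nil_or_concat l with rfl | ⟨l, a, rfl⟩
  · simp [lpow]
  · simp [lpow_succ']

theorem red_append_lpow {x u : List Λ} (hx : 𝒩.Red x) (hu : 𝒩.CycRed u)
    (hl : x.getLast? = u.getLast?) (k : ℕ) : 𝒩.Red (x ++ lpow u k) := by
  have hu' := 𝒩.cycRed_iff.1 hu
  induction k with
  | zero => simpa using hx
  | succ k ih =>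
    rw [lpow_succ', ← List.append_assoc, Red, List.isChain_append]
    refine ⟨ih, hu'.2.1, fun s hs t ht => hu'.2.2 s ?_ t ht⟩
    cases k with
    | zero => rw [lpow_zero, List.append_nil, hl] at hs; exact hs
    | succ k =>
      rw [List.getLast?_append, getLast?_lpow_succ] at hs
      obtain ⟨u, b, rfl⟩ := List.eq_nil_or_concat u |>.resolve_left hu.1
      simpa using hs

theorem CycRed.lpow {u : List Λ} (hu : 𝒩.CycRed u) (k : ℕ) : 𝒩.CycRed (lpow u (k + 1)) := by
  have hu' := 𝒩.cycRed_iff.1 hu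
  rw [cycRed_iff, head?_lpow_succ, getLast?_lpow_succ]
  refine ⟨?_, ?_, hu'.2.2⟩
  · rw [lpow_succ]; simp [hu.1]
  · rw [lpow_succ]; exact 𝒩.red_append_lpow hu'.2.1 hu rfl k

theorem CycRed.of_lpow {u : List Λ} {k : ℕ} (hu : 𝒩.CycRed (Necklace.lpow u (k + 1))) : 𝒩.CycRed u := by
  have hu' := 𝒩.cycRed_iff.1 hu
  rw [head?_lpow_succ, getLast?_lpow_succ] at hu'
  refine 𝒩.cycRed_iff.2 ⟨?_, ?_, hu'.2.2⟩
  · rintro rfl; exact hu.1 (by simp [Necklace.lpow])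
  · have := hu'.2.1
    rw [lpow_succ, Red, List.isChain_append] at this
    exact this.1

theorem isRotated_of_append_eq {v u : List Λ} : ∀ {y : List Λ}, v ++ y = y ++ u → v ~r u := by
  intro y
  induction hn : y.length using Nat.strong_induction_on generalizing y with
  | _ n ih =>
    intro h
    rcases le_total v.length y.length with hle | hle
    · obtain ⟨z, rfl⟩ : v <+: y :=
        List.prefix_of_prefix_length_le (List.prefix_append v y) (h ▸ List.prefix_append y u) hle
      rcases v.eq_nil_or_concat with rfl | ⟨v', b, hv⟩
      · have := congrArg List.length h
        simp only [List.nil_append, List.length_append] at this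
        have : u = [] := List.length_eq_zero_iff.1 (by omega)
        rw [this]
      · rw [List.append_assoc, List.append_cancel_left_eq] at h
        refine ih z.length ?_ rfl h
        rw [← hn, hv]
        simp only [List.length_append, List.length_concat]
        omega
    · obtain ⟨z, rfl⟩ : y <+: v :=
        List.prefix_of_prefix_length_le (h ▸ List.prefix_append y u) (List.prefix_append v y) hle
      rw [List.append_assoc, List.append_cancel_left_eq] at h
      rw [← h]
      exact List.isRotated_append

/-- Conjugate cyclically reduced words are rotations of each other: for a conjugating element `g`,
the reduced word of `vᵏ g uⁿ` begins like `v` and ends like `u` when `k` and `n` are large. -/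
theorem isRotated_of_isConj {u v : List Λ} (hu : 𝒩.CycRed u) (hv : 𝒩.CycRed v)
    (hc : IsConj (𝒩.eval u) (𝒩.eval v)) : u ~r v := by
  obtain ⟨g, hg⟩ := isConj_iff.1 hc
  have hg' : g * 𝒩.eval u = 𝒩.eval v * g := by rw [← hg]; group
  have hgn : ∀ n : ℕ, 𝒩.eval v ^ n * g = g * 𝒩.eval u ^ n := fun n => by
    rw [← hg, conj_pow]; group
  have hupos := List.length_pos_iff.2 hu.1
  have hvpos := List.length_pos_iff.2 hv.1
  set n := (𝒩.nf g).length + 1 with hn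
  obtain ⟨q, j, hX, heX, hj, -⟩ := 𝒩.absorb_left (𝒩.nf g) (CycRed.lpow 𝒩 hu (n - 1)).red
  rw [show n - 1 + 1 = n by omega] at hX heX
  set X := q ++ (lpow u n).drop j with hXdef
  have hXlast : X.getLast? = u.getLast? := by
    have hlen : j < (lpow u n).length := by rw [length_lpow]; nlinarith
    obtain ⟨b, hb⟩ : ∃ b, u.getLast? = some b := by
      obtain ⟨u, b, rfl⟩ := List.eq_nil_or_concat u |>.resolve_left hu.1
      exact ⟨b, by simp⟩
    rw [hXdef, List.getLast?_append, List.getLast?_drop, if_neg (by omega),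
      show n = (𝒩.nf g).length + 1 from hn, getLast?_lpow_succ, hb]
    rfl
  set k := X.length + 1 with hk
  set Y := X ++ lpow u k with hY
  have hYred : 𝒩.Red Y := 𝒩.red_append_lpow hX hu hXlast k
  rw [eval_nf, eval_lpow] at heX
  have hYlast : Y.getLast? = u.getLast? := by
    obtain ⟨b, hb⟩ : ∃ b, u.getLast? = some b := by
      obtain ⟨u, b, rfl⟩ := List.eq_nil_or_concat u |>.resolve_left hu.1
      exact ⟨b, by simp⟩
    rw [hY, List.getLast?_append, hk, getLast?_lpow_succ, hb]
    rfl
  have hYev : 𝒩.eval Y = g * 𝒩.eval u ^ (n + k) := by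
    rw [hY, eval_append, heX, eval_lpow, mul_assoc, ← pow_add]
  obtain ⟨q', m, h1, h2, h3⟩ := 𝒩.absorb_right X (CycRed.lpow 𝒩 hv X.length).red
  rw [← hk] at h1 h2 h3
  have hYeq : Y = (lpow v k).take m ++ q' := by
    refine 𝒩.eval_inj hYred h1 ?_
    rw [h2, hYev, eval_lpow, heX, ← mul_assoc, hgn, mul_assoc, ← pow_add, add_comm]
  have hYhead : Y.head? = v.head? := by
    rw [length_lpow] at h3
    have hm : 0 < m := by nlinarith
    obtain ⟨b, v', rfl⟩ := List.exists_cons_of_ne_nil hv.1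
    obtain ⟨m, rfl⟩ : ∃ i, m = i + 1 := ⟨m - 1, by omega⟩
    rw [hYeq, hk, lpow_succ]
    simp
  have hu' := 𝒩.cycRed_iff.1 hu
  have hv' := 𝒩.cycRed_iff.1 hv
  have hfin : v ++ Y = Y ++ u := by
    refine 𝒩.eval_inj ?_ ?_ ?_
    · rw [Red, List.isChain_append]
      exact ⟨hv'.2.1, hYred, fun s hs t ht => hv'.2.2 s hs t (hYhead ▸ ht)⟩
    · rw [Red, List.isChain_append]
      exact ⟨hYred, hu'.2.1, fun s hs t ht => hu'.2.2 s (hYlast ▸ hs) t ht⟩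
    · rw [𝒩.eval_append v Y, 𝒩.eval_append Y u, hYev, ← mul_assoc, ← hg', mul_assoc, mul_assoc, ← pow_succ,
        ← pow_succ']
  exact (isRotated_of_append_eq hfin).symm

/-- Elements conjugate to `1` or to a letter that is not cyclically reduced. -/
def IsElliptic (γ : Γ) : Prop :=
  IsConj 1 γ ∨ ∃ s, 𝒩.tgt s = 𝒩.src s ∧ IsConj (𝒩.val s) γ

theorem IsElliptic.conj {γ γ' : Γ} (h : 𝒩.IsElliptic γ) (hc : IsConj γ γ') : 𝒩.IsElliptic γ' := by
  rcases h with h | ⟨s, hs, h⟩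
  · exact Or.inl (h.trans hc)
  · exact Or.inr ⟨s, hs, h.trans hc⟩

/-- A reduced word that is not cyclically reduced can be shortened by a conjugation that merges its
last letter with its first one. -/
theorem isElliptic_or_cycRed (γ : Γ) : 𝒩.IsElliptic γ ∨ ∃ u, 𝒩.CycRed u ∧ IsConj (𝒩.eval u) γ := by
  induction hn : (𝒩.nf γ).length using Nat.strong_induction_on generalizing γ with
  | _ n ih =>
    have hγ := 𝒩.eval_nf γ
    have hred := 𝒩.red_nf γ
    by_cases hcr : 𝒩.CycRed (𝒩.nf γ)
    · exact Or.inr ⟨_, hcr, by rw [hγ]⟩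
    generalize 𝒩.nf γ = l at *
    -- conjugate by the last letter, which merges with the first one
    rcases List.eq_nil_or_concat l with rfl | ⟨l, t, rfl⟩
    · exact Or.inl (Or.inl (by rw [← hγ, eval_nil]))
    rw [List.concat_eq_append] at hγ hred hcr hn
    cases l with
    | nil =>
      refine Or.inl (Or.inr ⟨t, ?_, by rw [← hγ, List.nil_append, eval_cons, eval_nil, mul_one]⟩)
      by_contra h
      exact hcr (𝒩.cycRed_iff.2 ⟨by simp, hred, by simpa [Follow] using h⟩)
    | cons s l =>
      have hts : 𝒩.tgt t = 𝒩.src s := by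
        by_contra h
        refine hcr (𝒩.cycRed_iff.2 ⟨by simp, hred, ?_⟩)
        simp only [List.cons_append, List.head?_cons]
        rw [← List.cons_append, List.getLast?_append]
        simpa [Follow] using h
      have hconj : IsConj (𝒩.val t * 𝒩.val s * 𝒩.eval l) γ := by
        rw [← hγ]
        refine IsConj.symm (isConj_iff.2 ⟨𝒩.val t, ?_⟩)
        simp only [eval_append, eval_cons, eval_nil]
        group
      have hl : 𝒩.Red l := (List.isChain_append.1 hred).1.tail
      have key : (𝒩.nf (𝒩.val t * 𝒩.val s * 𝒩.eval l)).length < n := by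
        obtain h1 | ⟨r, hr1, hr2, hr3⟩ := 𝒩.merge t s hts
        · rw [h1, one_mul, 𝒩.nf_eval hl, ← hn]
          simp
        · rw [← hr3, ← eval_cons, nf_eval, ← hn]
          · simp
          · cases l with
            | nil => exact List.IsChain.singleton r
            | cons t' l =>
              have := (List.isChain_append.1 hred).1
              rw [Red, List.isChain_cons_cons] at *
              exact ⟨by rw [Follow, hr2]; exact this.1, this.2⟩
      rcases ih _ key _ rfl with h | ⟨u, hu, h⟩
      · exact Or.inl (IsElliptic.conj 𝒩 h hconj)
      · exact Or.inr ⟨u, hu, h.trans hconj⟩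

theorem pow_letter {s : Λ} (hs : 𝒩.tgt s = 𝒩.src s) (n : ℕ) : 𝒩.val s ^ n = 1 ∨
    ∃ r, 𝒩.tgt r = 𝒩.src r ∧ 𝒩.val r = 𝒩.val s ^ n ∧ 𝒩.src r = 𝒩.src s := by
  induction n with
  | zero => simp
  | succ n ih =>
    rw [pow_succ]
    rcases ih with h | ⟨r, hr, hv, hrs⟩
    · exact Or.inr ⟨s, hs, by rw [h, one_mul], rfl⟩
    · obtain h1 | ⟨r', h1, h2, h3⟩ := 𝒩.merge r s (by rw [hr, hrs])
      · left; rw [← hv, h1]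
      · refine Or.inr ⟨r', ?_, ?_, ?_⟩
        · rw [h2, h1, hs, hrs]
        · rw [h3, hv]
        · rw [h1, hrs]

theorem IsElliptic.pow {γ : Γ} (h : 𝒩.IsElliptic γ) (n : ℕ) : 𝒩.IsElliptic (γ ^ n) := by
  rcases h with h | ⟨s, hs, h⟩
  · exact Or.inl (by simpa using h.pow n)
  · rcases 𝒩.pow_letter hs n with h1 | ⟨r, hr, hv, -⟩
    · exact Or.inl (h1 ▸ h.pow n)
    · exact Or.inr ⟨r, hr, hv ▸ h.pow n⟩

theorem length_nf_mul_le (γ δ : Γ) :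
    (𝒩.nf (γ * δ)).length ≤ (𝒩.nf γ).length + (𝒩.nf δ).length := by
  obtain ⟨q, j, h1, h2, h3, h4⟩ := 𝒩.absorb_left (𝒩.nf γ) (𝒩.red_nf δ)
  rw [eval_nf, eval_nf] at h2
  rw [← h2, 𝒩.nf_eval h1, List.length_append, List.length_drop]
  omega

/-- The reduced words of the powers of a cyclically reduced word have unbounded length. -/
theorem CycRed.not_isElliptic {u : List Λ} (hu : 𝒩.CycRed u) : ¬ 𝒩.IsElliptic (𝒩.eval u) := by
  intro h
  -- the powers of an elliptic element have bounded length
  obtain ⟨B, hB⟩ : ∃ B : ℕ, ∀ n, (𝒩.nf (𝒩.eval u ^ n)).length ≤ B := by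
    have aux : ∀ x : Γ, (∀ n, (𝒩.nf (x ^ n)).length ≤ 1) → IsConj x (𝒩.eval u) →
        ∃ B : ℕ, ∀ n, (𝒩.nf (𝒩.eval u ^ n)).length ≤ B := by
      intro x hx hc
      obtain ⟨g, hg⟩ := isConj_iff.1 hc
      refine ⟨(𝒩.nf g).length + 1 + (𝒩.nf g⁻¹).length, fun n => ?_⟩
      rw [← hg, conj_pow]
      have h1 := 𝒩.length_nf_mul_le (g * x ^ n) g⁻¹
      have h2 := 𝒩.length_nf_mul_le g (x ^ n)
      have h3 := hx n
      omega
    rcases h with h | ⟨s, hs, h⟩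
    · exact aux 1 (fun n => by rw [one_pow, nf_one]; simp) h
    · refine aux _ (fun n => ?_) h
      rcases 𝒩.pow_letter hs n with h1 | ⟨r, hr, hv, -⟩
      · rw [h1, nf_one]; simp
      · have : 𝒩.val s ^ n = 𝒩.eval [r] := by simp [hv]
        rw [this, 𝒩.nf_eval (List.IsChain.singleton r)]
        simp
  have := hB (B + 1)
  rw [← eval_lpow, 𝒩.nf_eval (CycRed.lpow 𝒩 hu B).red, length_lpow] at this
  nlinarith [List.length_pos_iff.2 hu.1]

/-- If `u = δ ^ r`, then `δ` is conjugate to a cyclically reduced word, the `r`-th power of which is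
a rotation of `u`. -/
theorem CycRed.notPower_iff {u : List Λ} (hu : 𝒩.CycRed u) :
    NotPower (𝒩.eval u) ↔ IsPrimitive u := by
  constructor
  · intro h
    refine ⟨hu.1, fun d f hf he => h (𝒩.eval d) f hf (by rw [he, eval_lpow])⟩
  · intro h δ r hr he
    obtain ⟨k, rfl⟩ : ∃ k, r = k + 1 := ⟨r - 1, by omega⟩
    rcases 𝒩.isElliptic_or_cycRed δ with hδ | ⟨d, hd, hc⟩
    · exact hu.not_isElliptic 𝒩 (he ▸ IsElliptic.pow 𝒩 hδ (k + 1))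
    · have hc' := hc.pow (k + 1)
      rw [← eval_lpow, ← he] at hc'
      obtain ⟨i, hi⟩ := 𝒩.isRotated_of_isConj (CycRed.lpow 𝒩 hd k) hu hc'
      rw [rotate_lpow] at hi
      exact h.2 _ _ hr hi.symm

/-- The prime cyclically reduced cyclic words. -/
abbrev PrimeWord : Type _ := {c : PrimeCyc Λ // c.1.Chain 𝒩.Follow}

theorem exists_rep (c : 𝒩.PrimeWord) : ∃ u : List Λ, (u : Cycle Λ) = c.1.1 ∧ 𝒩.CycRed u ∧
    IsPrimitive u := by
  obtain ⟨⟨c, hp⟩, hc⟩ := c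
  induction c using Quotient.inductionOn with
  | _ u =>
    have hp' := isPrime_coe.1 hp
    exact ⟨u, rfl, ⟨hp'.1, hc⟩, hp'⟩

/-- A word representing a prime cyclically reduced cyclic word. -/
def rep (c : 𝒩.PrimeWord) : List Λ := (𝒩.exists_rep c).choose

theorem coe_rep (c : 𝒩.PrimeWord) : (𝒩.rep c : Cycle Λ) = c.1.1 := (𝒩.exists_rep c).choose_spec.1
theorem cycRed_rep (c : 𝒩.PrimeWord) : 𝒩.CycRed (𝒩.rep c) := (𝒩.exists_rep c).choose_spec.2.1
theorem isPrimitive_rep (c : 𝒩.PrimeWord) : IsPrimitive (𝒩.rep c) :=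
  (𝒩.exists_rep c).choose_spec.2.2

theorem rep_injective {c c' : 𝒩.PrimeWord} (h : IsConj (𝒩.eval (𝒩.rep c)) (𝒩.eval (𝒩.rep c'))) :
    c = c' := by
  have := 𝒩.isRotated_of_isConj (𝒩.cycRed_rep c) (𝒩.cycRed_rep c') h
  rw [← Cycle.coe_eq_coe, coe_rep, coe_rep] at this
  exact Subtype.ext (Subtype.ext this)

theorem exists_isConj_rep {u : List Λ} (hu : 𝒩.CycRed u) (hp : IsPrimitive u) :
    ∃ c : 𝒩.PrimeWord, IsConj (𝒩.eval (𝒩.rep c)) (𝒩.eval u) := by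
  refine ⟨⟨⟨u, isPrime_coe.2 hp⟩, hu.2⟩, ?_⟩
  obtain ⟨k, hk⟩ := Cycle.coe_eq_coe.1 (𝒩.coe_rep ⟨⟨u, isPrime_coe.2 hp⟩, hu.2⟩)
  generalize 𝒩.rep ⟨⟨u, isPrime_coe.2 hp⟩, hu.2⟩ = v at hk
  rw [← List.rotate_mod, List.rotate_eq_drop_append_take_mod, Nat.mod_mod] at hk
  set i := k % v.length
  refine isConj_iff.2 ⟨(𝒩.eval (v.take i))⁻¹, ?_⟩
  rw [← hk, eval_append]
  conv_lhs => rw [← List.take_append_drop i v, eval_append]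
  simp

/-- The non-elliptic elements that are not proper powers are the conjugates of the prime cyclically
reduced words. -/
theorem exists_isConj_of_notPower {γ : Γ} (h : NotPower γ) (he : ¬ 𝒩.IsElliptic γ) :
    ∃ c : 𝒩.PrimeWord, IsConj (𝒩.eval (𝒩.rep c)) γ := by
  rcases 𝒩.isElliptic_or_cycRed γ with h' | ⟨u, hu, hc⟩
  · exact absurd h' he
  · obtain ⟨c, hc'⟩ := 𝒩.exists_isConj_rep hu ((hu.notPower_iff 𝒩).1 (h.conj hc.symm))
    exact ⟨c, hc'.trans hc⟩

end NormalForm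

/-! ### Free products -/

/-- The words whose letters satisfy the merging rule represent all the elements generated by the
letters. -/
theorem exists_red_of_closure {Γ Λ I : Type*} [Group Γ] (src tgt : Λ → I) (val : Λ → Γ)
    (merge : ∀ s t, tgt s = src t → val s * val t = 1 ∨
      ∃ r, src r = src s ∧ tgt r = tgt t ∧ val r = val s * val t)
    (hgen : Submonoid.closure (Set.range val) = ⊤) (γ : Γ) :
    ∃ l : List Λ, l.IsChain (fun s t => tgt s ≠ src t) ∧ (l.map val).prod = γ := by
  have hγ : γ ∈ Submonoid.closure (Set.range val) := hgen ▸ Submonoid.mem_top γ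
  induction hγ using Submonoid.closure_induction_left with
  | one => exact ⟨[], List.IsChain.nil, rfl⟩
  | mul_left x hx y hy ih =>
    obtain ⟨s, rfl⟩ := hx
    obtain ⟨l, hl, rfl⟩ := ih
    cases l with
    | nil => exact ⟨[s], List.IsChain.singleton s, by simp⟩
    | cons t l =>
      by_cases h : tgt s = src t
      · obtain h1 | ⟨r, hr1, hr2, hr3⟩ := merge s t h
        · exact ⟨l, hl.tail, by simp [← mul_assoc, h1]⟩
        · refine ⟨r :: l, ?_, by simp [hr3, mul_assoc]⟩
          rw [List.isChain_cons] at hl ⊢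
          rw [hr2]
          exact hl
      · exact ⟨s :: t :: l, List.isChain_cons_cons.2 ⟨h, hl⟩, by simp⟩

section CoprodI

variable {ι : Type} (M : ι → Type) [∀ i, Group (M i)]

/-- The nontrivial elements of the factors of a free product. -/
abbrev FactorLetter : Type := {p : Σ i, M i // p.2 ≠ 1}

variable {M} in
theorem merge_factorLetter (s t : FactorLetter M) (h : s.1.1 = t.1.1) :
    Monoid.CoprodI.of s.1.2 * Monoid.CoprodI.of t.1.2 = 1 ∨ ∃ r : FactorLetter M, r.1.1 = s.1.1 ∧
      r.1.1 = t.1.1 ∧ Monoid.CoprodI.of r.1.2 =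
        Monoid.CoprodI.of s.1.2 * Monoid.CoprodI.of t.1.2 := by
  obtain ⟨⟨i, a⟩, ha⟩ := s
  obtain ⟨⟨j, b⟩, hb⟩ := t
  obtain rfl : i = j := h
  by_cases hab : a * b = 1
  · left; simp only [← map_mul, hab, map_one]
  · exact Or.inr ⟨⟨⟨i, a * b⟩, hab⟩, rfl, rfl, map_mul _ _ _⟩

/-- The normal form of a free product by alternating words. -/
def coprodNF [DecidableEq ι] : NormalForm (Monoid.CoprodI M) (FactorLetter M) ι where
  src s := s.1.1
  tgt s := s.1.1
  val s := Monoid.CoprodI.of s.1.2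
  merge := merge_factorLetter
  inj l l' h h' he := by
    have aux : ∀ (l : List (FactorLetter M)) (h : l.IsChain fun s t => s.1.1 ≠ t.1.1),
        ∃ w : Monoid.CoprodI.Word M, w.toList = l.map Subtype.val ∧
          w.prod = (l.map fun s => Monoid.CoprodI.of s.1.2).prod := by
      intro l h
      refine ⟨⟨l.map Subtype.val, ?_, ?_⟩, rfl, ?_⟩
      · intro x hx
        obtain ⟨y, -, rfl⟩ := List.mem_map.1 hx
        exact y.2
      · rwa [List.isChain_map]
      · rw [Monoid.CoprodI.Word.prod]
        change ((l.map Subtype.val).map _).prod = _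
        rw [List.map_map]
        rfl
    obtain ⟨w, hw, hwp⟩ := aux l h
    obtain ⟨w', hw', hwp'⟩ := aux l' h'
    have : w = w' := by
      classical
      exact Monoid.CoprodI.Word.equiv.symm.injective (by
        change w.prod = w'.prod
        rw [hwp, hwp', he])
    rw [this, hw'] at hw
    exact (List.map_injective_iff.2 Subtype.val_injective hw).symm
  surj γ := by
    refine exists_red_of_closure _ _ _ merge_factorLetter ?_ γ
    rw [eq_top_iff, ← Monoid.CoprodI.mclosure_iUnion_range_of, Submonoid.closure_le]
    intro x hx
    obtain ⟨i, a, rfl⟩ := Set.mem_iUnion.1 hx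
    by_cases ha : a = 1
    · rw [ha, map_one]; exact one_mem _
    · exact Submonoid.subset_closure ⟨⟨⟨i, a⟩, ha⟩, rfl⟩

end CoprodI

/-! ### The free product of a group and an infinite cyclic group -/

section Loop

variable (P : Type) [Group P]

/-- The letters of the free product of `P` and an infinite cyclic group `⟨t⟩`: in each of two
states, a nontrivial element of `P`, or any element of `P` together with a passage of the loop. -/
abbrev LoopLetter : Type := {s : P × Bool // s ≠ (1, false)}

/-- The free product of `P` and an infinite cyclic group. -/
abbrev LoopGroup : Type := Monoid.Coprod P (Multiplicative ℤ)

variable {P}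

/-- The base points of the two sides: `1` and `t`. -/
def sideElt (x : Bool) : LoopGroup P :=
  if x then Monoid.Coprod.inr (Multiplicative.ofAdd 1) else 1

/-- The element `τ_x⁻¹ h τ_y`. -/
def sideVal (x : Bool) (h : P) (y : Bool) : LoopGroup P :=
  (sideElt x)⁻¹ * Monoid.Coprod.inl h * sideElt y

theorem sideVal_mul (x y z : Bool) (h h' : P) :
    sideVal x h y * sideVal y h' z = sideVal x (h * h') z := by
  simp only [sideVal, map_mul]; group

@[simp] theorem sideVal_one (x : Bool) : sideVal x (1 : P) x = 1 := by simp [sideVal]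

namespace Loop

/-- The side on which a letter arrives. -/
def tgt (a : Bool × LoopLetter P) : Bool := xor a.1 a.2.1.2

/-- The value of a letter. -/
def val (a : Bool × LoopLetter P) : LoopGroup P := sideVal a.1 a.2.1.1 (tgt a)

variable (P) in
/-- The reduced words. -/
abbrev W : Type := {l : List (Bool × LoopLetter P) // l.IsChain fun s t => tgt s ≠ t.1}

variable (P) in
/-- A morphism that ends at the side `y`, followed by a reduced word that does not start at `y`. -/
abbrev Pair : Type := {p : P × Bool × W P // ∀ a ∈ p.2.2.1.head?, a.1 ≠ p.2.1}

open Classical in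
/-- Splitting off the first letter of a reduced word, which is taken to be trivial if the word does
not start at the side `x`. -/
def toPair (x : Bool) (w : W P) : Pair P :=
  match w with
  | ⟨[], _⟩ => ⟨(1, x, ⟨[], List.IsChain.nil⟩), by simp⟩
  | ⟨a :: l, h⟩ => if ha : a.1 = x then ⟨(a.2.1.1, tgt a, ⟨l, h.tail⟩), fun b hb =>
        ((List.isChain_cons.1 h).1 b hb).symm⟩
      else ⟨(1, x, ⟨a :: l, h⟩), by simpa using ha⟩

open Classical in
/-- Putting a morphism that starts at the side `x` in front of a word. -/
def ofPair (x : Bool) (p : Pair P) : W P :=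
  if h : (p.1.1, xor x p.1.2.1) = ((1 : P), false) then p.1.2.2
  else ⟨(x, ⟨(p.1.1, xor x p.1.2.1), h⟩) :: p.1.2.2.1, by
    rw [List.isChain_cons]
    refine ⟨fun b hb => ?_, p.1.2.2.2⟩
    have := p.2 b hb
    simpa [tgt] using this.symm⟩

theorem xor_tgt (a : Bool × LoopLetter P) : xor a.1 (tgt a) = a.2.1.2 := by
  simp only [tgt]; cases a.1 <;> simp

theorem tgt_mk (x y : Bool) (h : P) (hh : (h, xor x y) ≠ ((1 : P), false)) :
    tgt (x, ⟨(h, xor x y), hh⟩) = y := by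
  simp only [tgt]; cases x <;> simp

theorem eq_one_and_eq {x y : Bool} {h : P} (hh : (h, xor x y) = ((1 : P), false)) :
    h = 1 ∧ y = x := by
  rw [Prod.mk.injEq] at hh
  refine ⟨hh.1, ?_⟩
  have := hh.2
  cases x <;> cases y <;> simp_all

/-- Reduced words correspond to pairs, for each of the two sides. -/
def pairEquiv (x : Bool) : W P ≃ Pair P where
  toFun := toPair x
  invFun := ofPair x
  left_inv := by
    rintro ⟨l, h⟩
    cases l with
    | nil => simp [toPair, ofPair]
    | cons a l =>
      by_cases ha : a.1 = x
      · subst ha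
        have h1 : toPair a.1 ⟨a :: l, h⟩ = ⟨(a.2.1.1, tgt a, ⟨l, h.tail⟩), fun b hb =>
            ((List.isChain_cons.1 h).1 b hb).symm⟩ := dif_pos rfl
        have h2 : (a.2.1.1, xor a.1 (tgt a)) = a.2.1 := Prod.ext rfl (xor_tgt a)
        rw [h1, ofPair, dif_neg (by rw [h2]; exact a.2.2)]
        exact Subtype.ext (congrArg₂ _ (Prod.ext rfl (Subtype.ext h2)) rfl)
      · simp only [toPair, ofPair, dif_neg ha, Bool.xor_self, dite_true]
  right_inv := by
    rintro ⟨⟨h, y, ⟨l, hl⟩⟩, hp⟩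
    by_cases hh : (h, xor x y) = ((1 : P), false)
    · obtain ⟨rfl, rfl⟩ := eq_one_and_eq hh
      simp only [ofPair, Bool.xor_self, dite_true]
      cases l with
      | nil => rfl
      | cons a l =>
        have ha : a.1 ≠ y := hp a (by simp)
        simp only [toPair, dif_neg ha]
    · rw [ofPair, dif_neg hh]
      refine (dif_pos rfl).trans (Subtype.ext (Prod.ext rfl (Prod.ext ?_ rfl)))
      exact tgt_mk x y h hh

/-- Left multiplication of the morphism. -/
def pairMul (h : P) : Equiv.Perm (Pair P) where
  toFun p := ⟨(h * p.1.1, p.1.2), p.2⟩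
  invFun p := ⟨(h⁻¹ * p.1.1, p.1.2), p.2⟩
  left_inv p := by simp
  right_inv p := by simp

variable (P) in
/-- The action of the group on reduced words. -/
def act : LoopGroup P →* Equiv.Perm (W P) :=
  Monoid.Coprod.lift
    (MonoidHom.mk' (fun h => (pairEquiv false).trans ((pairMul h).trans (pairEquiv false).symm))
      fun h h' => by ext w : 1; simp [pairMul, mul_assoc])
    (zpowersHom (Equiv.Perm (W P)) ((pairEquiv true).trans (pairEquiv false).symm))

theorem act_sideElt (x : Bool) :
    act P (sideElt x) = (pairEquiv x).trans (pairEquiv false).symm := by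
  cases x
  · simp only [sideElt, Bool.false_eq_true, if_false, map_one, Equiv.self_trans_symm]; rfl
  · simp [sideElt, act]

theorem act_sideVal (x y : Bool) (h : P) (w : W P) :
    act P (sideVal x h y) w = (pairEquiv x).symm (pairMul h (pairEquiv y w)) := by
  rw [sideVal, map_mul, map_mul, map_inv, Equiv.Perm.mul_apply, Equiv.Perm.mul_apply, act_sideElt,
    act_sideElt, Equiv.Perm.inv_def]
  simp [act]

theorem act_eval (l : List (Bool × LoopLetter P)) (hl : l.IsChain fun s t => tgt s ≠ t.1) :
    act P (l.map val).prod ⟨[], List.IsChain.nil⟩ = ⟨l, hl⟩ := by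
  induction l with
  | nil => simp
  | cons a l ih =>
    rw [List.map_cons, List.prod_cons, map_mul, Equiv.Perm.mul_apply, ih hl.tail, val, act_sideVal,
      Equiv.symm_apply_eq]
    have h1 : pairEquiv (tgt a) ⟨l, hl.tail⟩ = ⟨(1, tgt a, ⟨l, hl.tail⟩), fun b hb =>
        ((List.isChain_cons.1 hl).1 b hb).symm⟩ := by
      cases l with
      | nil => rfl
      | cons b l =>
        have : b.1 ≠ tgt a := ((List.isChain_cons.1 hl).1 b (by simp)).symm
        simp only [pairEquiv, Equiv.coe_fn_mk, toPair, dif_neg this]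
    rw [h1]
    simp [pairMul, pairEquiv, toPair]

theorem merge (s t : Bool × LoopLetter P) (h : tgt s = t.1) : val s * val t = 1 ∨
    ∃ r : Bool × LoopLetter P, r.1 = s.1 ∧ tgt r = tgt t ∧ val r = val s * val t := by
  have hmul : val s * val t = sideVal s.1 (s.2.1.1 * t.2.1.1) (tgt t) := by
    rw [val, val, ← h, sideVal_mul]
  by_cases hh : (s.2.1.1 * t.2.1.1, xor s.1 (tgt t)) = ((1 : P), false)
  · left
    obtain ⟨h1, h2⟩ := eq_one_and_eq hh
    rw [hmul, h1, h2, sideVal_one]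
  · refine Or.inr ⟨(s.1, ⟨_, hh⟩), rfl, tgt_mk _ _ _ hh, ?_⟩
    rw [hmul, val, tgt_mk]

theorem sideVal_mem (x y : Bool) (h : P) :
    sideVal x h y ∈ Submonoid.closure (Set.range (val (P := P))) := by
  by_cases hh : (h, xor x y) = ((1 : P), false)
  · obtain ⟨rfl, rfl⟩ := eq_one_and_eq hh
    rw [sideVal_one]
    exact one_mem _
  · refine Submonoid.subset_closure ⟨(x, ⟨_, hh⟩), ?_⟩
    rw [val, tgt_mk]

theorem closure_val : Submonoid.closure (Set.range (val (P := P))) = ⊤ := by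
  rw [eq_top_iff]
  intro γ _
  induction γ using Monoid.Coprod.induction_on with
  | inl h => simpa [sideVal, sideElt] using sideVal_mem false false h
  | inr n =>
    have ht : ∀ k : ℕ, (Monoid.Coprod.inr (Multiplicative.ofAdd (1 : ℤ)) : LoopGroup P) ^ k ∈
        Submonoid.closure (Set.range (val (P := P))) := fun k =>
      pow_mem (by simpa [sideVal, sideElt] using sideVal_mem false true (1 : P)) k
    have ht' : ∀ k : ℕ, (Monoid.Coprod.inr (Multiplicative.ofAdd (1 : ℤ)) : LoopGroup P)⁻¹ ^ k ∈
        Submonoid.closure (Set.range (val (P := P))) := fun k =>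
      pow_mem (by simpa [sideVal, sideElt] using sideVal_mem true false (1 : P)) k
    have hn : n = Multiplicative.ofAdd (1 : ℤ) ^ n.toAdd := by
      rw [← ofAdd_zsmul]; simp
    rw [hn, map_zpow]
    rcases Int.eq_nat_or_neg n.toAdd with ⟨k, hk | hk⟩
    · rw [hk, zpow_natCast]; exact ht k
    · rw [hk, zpow_neg, zpow_natCast, ← inv_pow]; exact ht' k
  | mul x y hx hy => exact mul_mem (hx trivial) (hy trivial)

end Loop

variable (P) in
/-- The normal form of the free product of `P` and an infinite cyclic group `⟨t⟩` by the paths in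
the two-state automaton: the letters are `h`, `h t`, `t⁻¹ h`, `t⁻¹ h t` with `h` in `P`. -/
def loopNF : NormalForm (LoopGroup P) (Bool × LoopLetter P) Bool where
  src a := a.1
  tgt := Loop.tgt
  val := Loop.val
  merge := Loop.merge
  inj l l' h h' he := by
    have h1 := Loop.act_eval l h
    rw [he, Loop.act_eval l' h'] at h1
    exact (congrArg Subtype.val h1).symm
  surj := exists_red_of_closure _ _ _ Loop.merge Loop.closure_val

theorem loopNF_isOfFinOrder [Finite P] {γ : LoopGroup P} (h : (loopNF P).IsElliptic γ) :
    IsOfFinOrder γ := by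
  rcases h with h | ⟨⟨x, ⟨⟨h', e⟩, he⟩⟩, hs, h⟩
  · rw [isConj_one_right.1 h]; exact IsOfFinOrder.one
  · obtain ⟨g, rfl⟩ := isConj_iff.1 h
    have hs' : xor x e = x := hs
    have he' : e = false := by cases x <;> cases e <;> simp at hs' ⊢
    subst he'
    have h1 : (loopNF P).val (x, ⟨(h', false), he⟩) = (sideElt x)⁻¹ * Monoid.Coprod.inl h' * sideElt x := by
      simp [loopNF, Loop.val, Loop.tgt, sideVal]
    have h2 : IsOfFinOrder (Monoid.Coprod.inl h' : LoopGroup P) :=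
      (Monoid.Coprod.inl : P →* LoopGroup P).isOfFinOrder (isOfFinOrder_of_finite h')
    rw [h1, isOfFinOrder_iff_pow_eq_one] at *
    obtain ⟨n, hn, hn1⟩ := h2
    refine ⟨n, hn, ?_⟩
    have := conj_pow (i := n) (a := (sideElt x)⁻¹) (b := (Monoid.Coprod.inl h' : LoopGroup P))
    rw [inv_inv] at this
    rw [conj_pow, this, hn1]
    group

end Loop

/-! ### Conjugacy classes in `(C × F) * G` -/

section Classes

/-- `h` is not an `r`-th power for any divisor `r > 1` of `m`. -/
def PrimitiveFor {C : Type*} [Group C] (m : ℕ) (h : C) : Prop :=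
  ∀ r : ℕ, 1 < r → r ∣ m → ∀ y : C, h ≠ y ^ r

variable {C F : Type} [CommGroup C] [Group F] {Λ I : Type} (𝒩 : NormalForm F Λ I)

theorem IsConj.fst {C F : Type} [CommGroup C] [Group F] {a b : C × F} (h : IsConj a b) :
    a.1 = b.1 := by
  obtain ⟨c, rfl⟩ := isConj_iff.1 h
  simp [mul_comm]

theorem IsConj.snd {C F : Type} [CommGroup C] [Group F] {a b : C × F} (h : IsConj a b) :
    IsConj a.2 b.2 := (MonoidHom.snd C F).map_isConj h

/-- The powers of inequivalent primitive elements are not conjugate. -/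
theorem NormalForm.rep_pow_injective {c c' : 𝒩.PrimeWord} {m m' : ℕ}
    (h : IsConj (𝒩.eval (𝒩.rep c) ^ (m + 1)) (𝒩.eval (𝒩.rep c') ^ (m' + 1))) : c = c' ∧ m = m' := by
  rw [← eval_lpow, ← eval_lpow] at h
  obtain ⟨k, hk⟩ := 𝒩.isRotated_of_isConj (CycRed.lpow 𝒩 (𝒩.cycRed_rep c) m)
    (CycRed.lpow 𝒩 (𝒩.cycRed_rep c') m') h
  rw [rotate_lpow] at hk
  obtain ⟨h1, h2⟩ := lpow_injective_of_primitive ((𝒩.isPrimitive_rep c).rotate k)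
    (𝒩.isPrimitive_rep c') hk
  refine ⟨?_, h2⟩
  have : (𝒩.rep c : Cycle Λ) = (𝒩.rep c' : Cycle Λ) := Cycle.coe_eq_coe.2 ⟨k, h1⟩
  rw [coe_rep, coe_rep] at this
  exact Subtype.ext (Subtype.ext this)

theorem NormalForm.exists_isConj_rep_pow (hell : ∀ f : F, 𝒩.IsElliptic f → IsOfFinOrder f) {f : F}
    (hf : ¬ IsOfFinOrder f) : ∃ (c : 𝒩.PrimeWord) (m : ℕ), IsConj (𝒩.eval (𝒩.rep c) ^ (m + 1)) f := by
  rcases 𝒩.isElliptic_or_cycRed f with h | ⟨u, hu, hc⟩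
  · exact absurd (hell f h) hf
  · obtain ⟨l, m, hl, rfl⟩ := exists_primitive_root u hu.1
    obtain ⟨c, hc'⟩ := 𝒩.exists_isConj_rep (CycRed.of_lpow 𝒩 hu) hl
    refine ⟨c, m, (hc'.pow (m + 1)).trans ?_⟩
    rwa [← eval_lpow]

/-- In a product with an abelian group, the `r`-th roots of `(h, f ^ m)`, where `f` is primitive,
are the pairs `(y, f ^ k)` with `y ^ r = h` and `k * r = m`. -/
theorem notPower_prod_iff (hell : ∀ f : F, 𝒩.IsElliptic f → IsOfFinOrder f) (h : C)
    (c : 𝒩.PrimeWord) (m : ℕ) :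
    NotPower ((h, 𝒩.eval (𝒩.rep c) ^ (m + 1)) : C × F) ↔ PrimitiveFor (m + 1) h := by
  constructor
  · rintro hn r hr ⟨k, hk⟩ y rfl
    exact hn (y, 𝒩.eval (𝒩.rep c) ^ k) r hr (by rw [Prod.pow_mk, ← pow_mul, mul_comm k r, hk])
  · rintro hp ⟨y, g⟩ r hr he
    rw [Prod.pow_mk, Prod.mk.injEq] at he
    obtain ⟨k, rfl⟩ : ∃ k, r = k + 1 := ⟨r - 1, by omega⟩
    have hg : ¬ IsOfFinOrder g := by
      intro hg
      have h1 := (NormalForm.CycRed.lpow 𝒩 (𝒩.cycRed_rep c) m)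
      have h2 : IsOfFinOrder (𝒩.eval (lpow (𝒩.rep c) (m + 1))) := by
        rw [NormalForm.eval_lpow, he.2]; exact hg.pow
      obtain ⟨n, hn, hn1⟩ := isOfFinOrder_iff_pow_eq_one.1 h2
      obtain ⟨n, rfl⟩ : ∃ i, n = i + 1 := ⟨n - 1, by omega⟩
      refine (NormalForm.CycRed.lpow 𝒩 h1 n).not_isElliptic 𝒩 (Or.inl ?_)
      rw [NormalForm.eval_lpow _ (lpow _ _), hn1]
    obtain ⟨c', m', hc'⟩ := 𝒩.exists_isConj_rep_pow hell hg
    have h1 := hc'.pow (k + 1)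
    rw [← he.2, ← pow_mul, show (m' + 1) * (k + 1) = ((m' + 1) * (k + 1) - 1) + 1 from
      (Nat.sub_add_cancel (by nlinarith)).symm] at h1
    obtain ⟨-, h2⟩ := 𝒩.rep_pow_injective h1
    refine hp (k + 1) hr ⟨m' + 1, ?_⟩ y he.1
    rw [← h2, Nat.sub_add_cancel (by nlinarith), mul_comm]

theorem exists_isConj_prod [Finite C] (hell : ∀ f : F, 𝒩.IsElliptic f → IsOfFinOrder f) {x : C × F}
    (hx : NotPower x) : ∃ (c : 𝒩.PrimeWord) (m : ℕ), PrimitiveFor (m + 1) x.1 ∧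
      IsConj (x.1, 𝒩.eval (𝒩.rep c) ^ (m + 1)) x := by
  have hf : ¬ IsOfFinOrder x.2 := by
    intro hf
    refine hx.not_isOfFinOrder ?_
    obtain ⟨n, hn, hn1⟩ := isOfFinOrder_iff_pow_eq_one.1 hf
    obtain ⟨n', hn', hn1'⟩ := isOfFinOrder_iff_pow_eq_one.1 (isOfFinOrder_of_finite x.1)
    refine isOfFinOrder_iff_pow_eq_one.2 ⟨n * n', by positivity, ?_⟩
    ext
    · simp [mul_comm n n', pow_mul, hn1']
    · simp [pow_mul, hn1]
  obtain ⟨c, m, hc⟩ := 𝒩.exists_isConj_rep_pow hell hf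
  have hconj : IsConj (x.1, 𝒩.eval (𝒩.rep c) ^ (m + 1)) x := by
    obtain ⟨g, hg⟩ := isConj_iff.1 hc
    exact isConj_iff.2 ⟨(1, g), by ext <;> simp [hg]⟩
  exact ⟨c, m, (notPower_prod_iff 𝒩 hell _ c m).1 (hx.conj hconj.symm), hconj⟩

/-- The two factors of a free product, as a family. -/
abbrev twoFactors (K G : Type) : Bool → Type := fun b => if b then G else K

instance (K G : Type) [Group K] [Group G] (b : Bool) : Group (twoFactors K G b) :=
  match b with
  | false => inferInstanceAs (Group K)
  | true => inferInstanceAs (Group G)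

/-- The free product of two groups. -/
abbrev FreeProd (K G : Type) [Group K] [Group G] : Type := Monoid.CoprodI (twoFactors K G)

variable {K G : Type} [Group K] [Group G]

variable (K G) in
/-- The inclusion of the first factor. -/
def inK : K →* FreeProd K G := Monoid.CoprodI.of (M := twoFactors K G) (i := false)

variable (K G) in
/-- The inclusion of the second factor. -/
def inG : G →* FreeProd K G := Monoid.CoprodI.of (M := twoFactors K G) (i := true)

variable (K G) in
/-- The normal form of the free product of two groups. -/
abbrev freeProdNF : NormalForm (FreeProd K G) (FactorLetter (twoFactors K G)) Bool :=
  coprodNF (twoFactors K G)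

/-- The homomorphism from a free product given by homomorphisms from the factors. -/
def liftFP {H : Type*} [Monoid H] (f : K →* H) (g : G →* H) : FreeProd K G →* H :=
  Monoid.CoprodI.lift fun b => match b with
    | false => f
    | true => g

@[simp] theorem liftFP_inK {H : Type*} [Monoid H] (f : K →* H) (g : G →* H) (k : K) :
    liftFP f g (inK K G k) = f k := by
  simp only [liftFP, inK]
  exact Monoid.CoprodI.lift_of _ _

@[simp] theorem liftFP_inG {H : Type*} [Monoid H] (f : K →* H) (g : G →* H) (k : G) :
    liftFP f g (inG K G k) = g k := by
  simp only [liftFP, inG]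
  exact Monoid.CoprodI.lift_of _ _

theorem hom_ext_FP {H : Type*} [Monoid H] {f g : FreeProd K G →* H}
    (h1 : f.comp (inK K G) = g.comp (inK K G)) (h2 : f.comp (inG K G) = g.comp (inG K G)) : f = g :=
  Monoid.CoprodI.ext_hom _ _ fun b => match b with
    | false => h1
    | true => h2

theorem isConj_inK {k k' : K} (h : IsConj (inK K G k) (inK K G k')) : IsConj k k' := by
  simpa using (liftFP (MonoidHom.id K) (1 : G →* K)).map_isConj h

theorem notPower_inK {k : K} : NotPower (inK K G k) ↔ NotPower k := by
  constructor
  · intro h δ r hr he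
    exact h (inK K G δ) r hr (by rw [he, map_pow])
  · intro h δ r hr he
    refine h (liftFP (MonoidHom.id K) (1 : G →* K) δ) r hr ?_
    rw [← map_pow, ← he, liftFP_inK]
    rfl

theorem isElliptic_inK (k : K) : (freeProdNF K G).IsElliptic (inK K G k) := by
  by_cases hk : k = 1
  · left; rw [hk, map_one]; exact IsConj.refl 1
  · exact Or.inr ⟨⟨⟨false, k⟩, hk⟩, rfl, IsConj.refl _⟩

theorem isElliptic_FP_iff {γ : FreeProd K G} : (freeProdNF K G).IsElliptic γ ↔
    (∃ k, IsConj (inK K G k) γ) ∨ ∃ g, IsConj (inG K G g) γ := by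
  constructor
  · rintro (h | ⟨⟨⟨b, a⟩, ha⟩, -, h⟩)
    · exact Or.inl ⟨1, by rwa [map_one]⟩
    · cases b
      · exact Or.inl ⟨a, h⟩
      · exact Or.inr ⟨a, h⟩
  · rintro (⟨k, h⟩ | ⟨g, h⟩)
    · exact NormalForm.IsElliptic.conj _ (isElliptic_inK k) h
    · by_cases hg : g = 1
      · left; rwa [hg, map_one] at h
      · exact Or.inr ⟨⟨⟨true, g⟩, hg⟩, rfl, h⟩

/-- The index type of the conjugacy classes of elements of `(C × F) * G` that are not proper powers,
for torsion groups `C` and `G`. -/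
abbrev ClassIndex (C G : Type) [CommGroup C] [Group G] (𝒩 : NormalForm F Λ I) : Type :=
  {x : ℕ × C × 𝒩.PrimeWord // PrimitiveFor (x.1 + 1) x.2.1} ⊕ (freeProdNF (C × F) G).PrimeWord

/-- Representatives of the conjugacy classes of elements that are not proper powers. -/
def classRep (C G : Type) [CommGroup C] [Group G] (𝒩 : NormalForm F Λ I) :
    ClassIndex C G 𝒩 → FreeProd (C × F) G
  | .inl x => inK (C × F) G (x.1.2.1, 𝒩.eval (𝒩.rep x.1.2.2) ^ (x.1.1 + 1))
  | .inr c => (freeProdNF (C × F) G).eval ((freeProdNF (C × F) G).rep c)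

theorem notPower_classRep (hell : ∀ f : F, 𝒩.IsElliptic f → IsOfFinOrder f)
    (x : ClassIndex C G 𝒩) : NotPower (classRep C G 𝒩 x) := by
  rcases x with ⟨⟨m, h, c⟩, hx⟩ | c
  · exact notPower_inK.2 ((notPower_prod_iff 𝒩 hell h c m).2 hx)
  · exact (((freeProdNF (C × F) G).cycRed_rep c).notPower_iff _).2
      ((freeProdNF (C × F) G).isPrimitive_rep c)

theorem classRep_injective {x y : ClassIndex C G 𝒩}
    (h : IsConj (classRep C G 𝒩 x) (classRep C G 𝒩 y)) : x = y := by
  rcases x with ⟨⟨m, a, c⟩, hx⟩ | c <;> rcases y with ⟨⟨m', a', c'⟩, hy⟩ | c'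
  · have h1 := isConj_inK h
    have h2 : a = a' := IsConj.fst h1
    obtain ⟨h3, h4⟩ := 𝒩.rep_pow_injective (IsConj.snd h1)
    subst h2 h3 h4
    rfl
  · exact absurd (NormalForm.IsElliptic.conj _ (isElliptic_inK _) h)
      (((freeProdNF (C × F) G).cycRed_rep c').not_isElliptic _)
  · exact absurd (NormalForm.IsElliptic.conj _ (isElliptic_inK _) h.symm)
      (((freeProdNF (C × F) G).cycRed_rep c).not_isElliptic _)
  · exact congrArg Sum.inr ((freeProdNF (C × F) G).rep_injective h)

/-- An elliptic element is conjugate to an element of `C × F`, since the elements of `G` have finite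
order. -/
theorem exists_isConj_classRep [Finite C] (hell : ∀ f : F, 𝒩.IsElliptic f → IsOfFinOrder f)
    (hG : ∀ g : G, IsOfFinOrder g) {γ : FreeProd (C × F) G} (hγ : NotPower γ) :
    ∃ x, IsConj (classRep C G 𝒩 x) γ := by
  by_cases he : (freeProdNF (C × F) G).IsElliptic γ
  · rcases isElliptic_FP_iff.1 he with ⟨k, h⟩ | ⟨g, h⟩
    · have hk : NotPower k := notPower_inK.1 (hγ.conj h.symm)
      obtain ⟨c, m, hm, hc⟩ := exists_isConj_prod 𝒩 hell hk
      exact ⟨Sum.inl ⟨(m, k.1, c), hm⟩, ((inK (C × F) G).map_isConj hc).trans h⟩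
    · exact absurd ((inG (C × F) G).isOfFinOrder (hG g)) (hγ.conj h.symm).not_isOfFinOrder
  · obtain ⟨c, hc⟩ := (freeProdNF (C × F) G).exists_isConj_of_notPower hγ he
    exact ⟨Sum.inr c, hc⟩

end Classes

open GraphOfGroups

/-! ### The fundamental group of `X_N` -/

theorem edgeElt_rev {X : GraphOfGroups} {T : Set X.B} (e : X.Edge) :
    X.edgeElt T (rev e) = (X.edgeElt T e)⁻¹ := by
  have key := PresentedGroup.mk_eq_one_iff.2 (Subgroup.subset_normalClosure
    (show _ ∈ {r | X.Relator T r} from Relator.inverse e))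
  rw [map_mul] at key
  exact eq_inv_of_mul_eq_one_left key

section Pi1

variable (q N : ℕ)

/-- The union of the groups `G_k`. -/
def XGInf : Subgroup (XAmbient q) where
  carrier := {x | x.1 = 1 ∧ ∃ k, ∀ i, k ≤ i → x.2 i = 1}
  mul_mem' := by
    rintro x y ⟨hx, k, hk⟩ ⟨hy, l, hl⟩
    refine ⟨by simp [hx, hy], max k l, fun i hi => ?_⟩
    simp [hk i ((le_max_left _ _).trans hi), hl i ((le_max_right _ _).trans hi)]
  one_mem' := ⟨rfl, 0, fun _ _ => rfl⟩
  inv_mem' := by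
    rintro x ⟨hx, k, hk⟩
    exact ⟨by simp [hx], k, fun i hi => by simp [hk i hi]⟩

/-- The cyclic group `C_{q-1}`. -/
abbrev CycC : Type := Multiplicative (ZMod (q - 1))

/-- The group `(C_{q-1} × (C_q^N * ℤ)) * ⋃ C_q^k`, which is the fundamental group of `X_N`. -/
abbrev Gam : Type := FreeProd (CycC q × LoopGroup (XG q N)) (XGInf q)

/-- The fundamental group of `X_N`. -/
abbrev PiN : Type := (XGraph q N).Pi1 (XTree q N)

variable {q N}

theorem XG_le_XGInf (k : ℕ) : XG q k ≤ XGInf q := fun _ hx => ⟨hx.1, k, hx.2⟩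

theorem XG_le_XH (k : ℕ) : XG q k ≤ XH q k := fun _ hx => hx.2

/-- The projection of `H_N` to `G_N`. -/
def pPart : XH q N →* XG q N where
  toFun x := ⟨(1, x.1.2), rfl, x.2⟩
  map_one' := rfl
  map_mul' _ _ := Subtype.ext (Prod.ext (one_mul 1).symm rfl)

/-- The conjugate of `C_q^N` at one of the sides. -/
def sideHom {P : Type} [Group P] (s : Bool) : P →* LoopGroup P :=
  MonoidHom.mk' (fun h => sideVal s h s) fun h h' => (sideVal_mul s s s h h').symm

variable (q N) in
/-- The group `H_N` at one of the sides. -/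
def sHom (s : Bool) : XH q N →* Gam q N :=
  (inK _ _).comp (((MonoidHom.fst _ _).comp (XH q N).subtype).prod ((sideHom s).comp pPart))

theorem sHom_apply (s : Bool) (x : XH q N) :
    sHom q N s x = inK _ _ (x.1.1, sideVal s (pPart x) s) := rfl

theorem sHom_eq_of_mem {x : XH q N} (hx : x.1 ∈ XH q 0) (s s' : Bool) :
    sHom q N s x = sHom q N s' x := by
  have : pPart x = 1 := by
    refine Subtype.ext (Prod.ext rfl (funext fun i => ?_))
    exact hx i (Nat.zero_le i)
  rw [sHom_apply, sHom_apply, this, sideVal_one, sideVal_one]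

theorem group_a_le (k : Fin N) : (XVertex.a k).group q ≤ XH q N := XH_mono q k.2
theorem group_b_le (k : Fin N) : (XVertex.b k).group q ≤ XH q N := XH_mono q k.2
theorem group_c_zero_le : (XVertex.c (N := N) 0).group q ≤ XH q N := XH_mono q (Nat.zero_le N)
theorem group_c_succ_le (k : ℕ) : (XVertex.c (N := N) (k + 1)).group q ≤ XGInf q := XG_le_XGInf _

variable (q N) in
/-- The images of the vertex groups. -/
def vHom : ∀ v : XVertex N, v.group q →* Gam q N
  | .c 0 => (sHom q N false).comp (Subgroup.inclusion group_c_zero_le)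
  | .c (k + 1) => (inG _ _).comp (Subgroup.inclusion (group_c_succ_le k))
  | .a k => (sHom q N false).comp (Subgroup.inclusion (group_a_le k))
  | .b k => (sHom q N true).comp (Subgroup.inclusion (group_b_le k))

variable (q N) in
/-- The image of the letter of the edge from `a_N` to `b_N`. -/
def tElt : Gam q N := inK _ _ (1, sideElt true)

variable (q N) in
/-- The images of the letters of the edges. -/
def eElt (e : (XGraph q N).Edge) : Gam q N :=
  match e.1, e.2 with
  | .cross, true => tElt q N
  | .cross, false => (tElt q N)⁻¹
  | _, _ => 1

theorem vHom_aPos (k : Fin (N + 1)) (x : XAmbient q) (hx : x ∈ (XVertex.aPos k).group q)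
    (hx' : x ∈ XH q N) : vHom q N (XVertex.aPos k) ⟨x, hx⟩ = sHom q N false ⟨x, hx'⟩ := by
  revert hx
  refine Fin.cases (fun hx => rfl) (fun i hx => rfl) k

theorem vHom_bPos (k : Fin (N + 1)) (x : XAmbient q) (hx : x ∈ (XVertex.bPos k).group q)
    (hx' : x ∈ XH q N) : vHom q N (XVertex.bPos k) ⟨x, hx⟩ = sHom q N true ⟨x, hx'⟩ := by
  revert hx
  refine Fin.cases (fun hx => ?_) (fun i hx => rfl) k
  exact sHom_eq_of_mem (x := ⟨x, hx'⟩) hx false true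

/-- The letter of the edge from `a_N` to `b_N` conjugates the two copies of `H_N`. -/
theorem tElt_conj (x : XH q N) : tElt q N * sHom q N true x * (tElt q N)⁻¹ = sHom q N false x := by
  rw [tElt, sHom_apply, sHom_apply, ← map_mul, ← map_inv, ← map_mul]
  congr 1
  ext
  · simp
  · simp only [Prod.inv_mk, Prod.mk_mul_mk, inv_one, mul_one, one_mul]
    simp only [sideVal, sideElt, Bool.false_eq_true, if_true, if_false, inv_one, one_mul, mul_one]
    group

/-- The images of the generators. -/
def genImg : (XGraph q N).Gen → Gam q N := Sum.elim (fun p => vHom q N p.1 p.2) (eElt q N)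

theorem genImg_relator {r : FreeGroup (XGraph q N).Gen} (hr : (XGraph q N).Relator (XTree q N) r) :
    FreeGroup.lift (genImg (q := q) (N := N)) r = 1 := by
  induction hr with
  | vertex v g h =>
    simp only [map_mul, map_inv, FreeGroup.lift_apply_of, genImg, Sum.elim_inl]
    rw [mul_inv_eq_one]
    exact (map_mul (vHom q N v) g h).symm
  | edge b x h =>
    simp only [map_mul, map_inv, FreeGroup.lift_apply_of, genImg, Sum.elim_inl, Sum.elim_inr]
    rw [mul_inv_eq_one]
    obtain ⟨y, hy⟩ := h
    cases b with
    | aEdge k =>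
      have hy' : y ∈ XH q N := XH_mono q k.2.le hy
      have h1 := vHom_aPos (q := q) k.castSucc y (XEdge.group_le q (.aEdge k) false hy) hy'
      have h2 := vHom_aPos (q := q) k.succ y (XEdge.group_le q (.aEdge k) true hy) hy'
      have h3 : ∀ x, eElt q N (XEdge.aEdge k, x) = 1 := fun x => by cases x <;> rfl
      rw [h3, one_mul, inv_one, mul_one]
      cases x
      · exact h1.trans h2.symm
      · exact h2.trans h1.symm
    | bEdge k =>
      have hy' : y ∈ XH q N := XH_mono q k.2.le hy
      have h1 := vHom_bPos (q := q) k.castSucc y (XEdge.group_le q (.bEdge k) false hy) hy'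
      have h2 := vHom_bPos (q := q) k.succ y (XEdge.group_le q (.bEdge k) true hy) hy'
      have h3 : ∀ x, eElt q N (XEdge.bEdge k, x) = 1 := fun x => by cases x <;> rfl
      rw [h3, one_mul, inv_one, mul_one]
      cases x
      · exact h1.trans h2.symm
      · exact h2.trans h1.symm
    | cross =>
      have h1 := vHom_aPos (q := q) (Fin.last N) y (XEdge.group_le q .cross false hy) hy
      have h2 := vHom_bPos (q := q) (Fin.last N) y (XEdge.group_le q .cross true hy) hy
      have h3 := tElt_conj (⟨y, hy⟩ : XH q N)
      cases x
      · change (tElt q N)⁻¹ * vHom q N (XVertex.aPos (Fin.last N)) ⟨y, _⟩ * ((tElt q N)⁻¹)⁻¹ =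
          vHom q N (XVertex.bPos (Fin.last N)) ⟨y, _⟩
        rw [h1, h2, ← h3]
        group
      · change tElt q N * vHom q N (XVertex.bPos (Fin.last N)) ⟨y, _⟩ * (tElt q N)⁻¹ =
          vHom q N (XVertex.aPos (Fin.last N)) ⟨y, _⟩
        rw [h1, h2, h3]
    | cEdge k =>
      have h3 : ∀ x, eElt q N (XEdge.cEdge k, x) = 1 := fun x => by cases x <;> rfl
      rw [h3, one_mul, inv_one, mul_one]
      have h4 : vHom q N (XVertex.c k) ⟨y, XEdge.group_le q (.cEdge k) false hy⟩ =
          vHom q N (XVertex.c (k + 1)) ⟨y, XEdge.group_le q (.cEdge k) true hy⟩ := by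
        cases k with
        | zero =>
          have : y = 1 := Prod.ext hy.1 (funext fun i => hy.2 i (Nat.zero_le i))
          subst this
          exact (map_one (vHom q N _)).trans (map_one (vHom q N _)).symm
        | succ k => rfl
      cases x
      · exact h4
      · exact h4.symm
  | inverse e =>
    simp only [map_mul, FreeGroup.lift_apply_of, genImg, Sum.elim_inr]
    obtain ⟨b, x⟩ := e
    cases b <;> cases x <;> simp [eElt, rev]
  | tree e he =>
    simp only [FreeGroup.lift_apply_of, genImg, Sum.elim_inr]
    obtain ⟨b, x⟩ := e
    cases b <;> cases x <;> first | rfl | exact absurd rfl he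

variable (q N) in
/-- The homomorphism from the fundamental group of `X_N` to the free product. -/
def toGam : PiN q N →* Gam q N := PresentedGroup.toGroup fun _ hr => genImg_relator hr

theorem toGam_vertexHom (v : XVertex N) (x : v.group q) :
    toGam q N (vertexHom (XGraph q N) (XTree q N) v x) = vHom q N v x := PresentedGroup.toGroup.of _

theorem toGam_edgeElt (e : (XGraph q N).Edge) :
    toGam q N (edgeElt (XGraph q N) (XTree q N) e) = eElt q N e := PresentedGroup.toGroup.of _

variable (q N) in
/-- The element of the fundamental group given by an element of a vertex group. -/
def vElt (v : XVertex N) (x : XAmbient q) (hx : x ∈ v.group q) : PiN q N :=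
  vertexHom (XGraph q N) (XTree q N) v ⟨x, hx⟩

variable (q N) in
/-- The letter of the edge from `a_N` to `b_N`. -/
def crossElt : PiN q N := edgeElt (XGraph q N) (XTree q N) (XEdge.cross, true)

theorem edgeElt_tree {e : (XGraph q N).Edge} (he : e.1 ≠ XEdge.cross) :
    edgeElt (XGraph q N) (XTree q N) e = 1 :=
  PresentedGroup.mk_eq_one_iff.2 (Subgroup.subset_normalClosure (Relator.tree e he))

theorem vElt_edge (b : XEdge N) (x : Bool) (y : XAmbient q) (hy : y ∈ b.group q) :
    edgeElt (XGraph q N) (XTree q N) (b, x) * vElt q N (b.ends x) y (XEdge.group_le q b x hy) *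
      (edgeElt (XGraph q N) (XTree q N) (b, x))⁻¹ =
    vElt q N (b.ends (!x)) y (XEdge.group_le q b (!x) hy) := by
  have key := PresentedGroup.mk_eq_one_iff.2 (Subgroup.subset_normalClosure
    (show _ ∈ {r | (XGraph q N).Relator (XTree q N) r} from
      Relator.edge (X := XGraph q N) b x (⟨y, hy⟩ : b.group q)))
  rw [map_mul, map_inv, mul_inv_eq_one, map_mul, map_mul, map_inv] at key
  exact key

theorem vElt_mul {v : XVertex N} {x y : XAmbient q} (hx : x ∈ v.group q) (hy : y ∈ v.group q)
    (hxy : x * y ∈ v.group q) : vElt q N v (x * y) hxy = vElt q N v x hx * vElt q N v y hy :=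
  map_mul (vertexHom (XGraph q N) (XTree q N) v) (⟨x, hx⟩ : v.group q) (⟨y, hy⟩ : v.group q)

theorem vElt_congr {v v' : XVertex N} (h : v = v') {x : XAmbient q} (hx : x ∈ v.group q)
    (hx' : x ∈ v'.group q) : vElt q N v x hx = vElt q N v' x hx' := by
  subst h; rfl

theorem vElt_tree {b : XEdge N} (hb : b ≠ XEdge.cross) (y : XAmbient q) (hy : y ∈ b.group q)
    (x x' : Bool) : vElt q N (b.ends x) y (XEdge.group_le q b x hy) =
      vElt q N (b.ends x') y (XEdge.group_le q b x' hy) := by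
  have h := vElt_edge b x y hy
  rw [edgeElt_tree (show ((b, x) : (XGraph q N).Edge).1 ≠ _ from hb), one_mul, inv_one, mul_one] at h
  cases x <;> cases x' <;> first | rfl | exact h

variable (N) in
/-- The vertices `a_k` and `b_k`, `0 ≤ k ≤ N`. -/
def sPos (s : Bool) : Fin (N + 1) → XVertex N := if s then XVertex.bPos else XVertex.aPos

theorem group_sPos (s : Bool) (k : Fin (N + 1)) : (sPos N s k).group q = XH q k := by
  cases s
  · exact XVertex.group_aPos q k
  · exact XVertex.group_bPos q k

theorem vElt_sPos_succ (s : Bool) (k : Fin N) {x : XAmbient q} (hx : x ∈ XH q k) :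
    vElt q N (sPos N s k.castSucc) x (by rw [group_sPos]; exact hx) =
      vElt q N (sPos N s k.succ) x (by rw [group_sPos]; exact XH_mono q (Nat.le_succ _) hx) := by
  cases s
  · exact vElt_tree (b := .aEdge k) (by simp) x hx false true
  · exact vElt_tree (b := .bEdge k) (by simp) x hx false true

theorem vElt_sPos (s : Bool) (k : Fin (N + 1)) {x : XAmbient q} (hx : x ∈ XH q k) :
    vElt q N (sPos N s k) x (by rw [group_sPos]; exact hx) =
      vElt q N (sPos N s (Fin.last N)) x
        (by rw [group_sPos]; exact XH_mono q (Nat.le_of_lt_succ k.2) hx) := by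
  induction k using Fin.reverseInduction with
  | last => rfl
  | cast k ih =>
    rw [vElt_sPos_succ s k hx]
    exact ih (XH_mono q (Nat.le_succ _) hx)

theorem vElt_cross {x : XAmbient q} (hx : x ∈ XH q N) :
    crossElt q N * vElt q N (sPos N true (Fin.last N)) x (by rw [group_sPos]; exact hx) *
      (crossElt q N)⁻¹ = vElt q N (sPos N false (Fin.last N)) x (by rw [group_sPos]; exact hx) :=
  vElt_edge .cross true x hx

theorem vElt_c {k m : ℕ} (hkm : k ≤ m) {x : XAmbient q} (hx : x ∈ XG q (k + 1)) :
    vElt q N (.c (k + 1)) x hx = vElt q N (.c (m + 1)) x (XG_mono q (by omega) hx) := by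
  induction m, hkm using Nat.le_induction with
  | base => rfl
  | succ m hm ih =>
    rw [ih]
    exact vElt_tree (b := .cEdge (m + 1)) (by simp) x (XG_mono q (by omega) hx) false true

/-- The level of an element: the least `k` such that it lies in `G_k`. -/
def level (x : XGInf q) : ℕ := by
  classical exact Nat.find (p := fun k => x.1 ∈ XG q k) ⟨x.2.2.choose, x.2.1, x.2.2.choose_spec⟩

theorem level_le_iff {x : XGInf q} {k : ℕ} : level x ≤ k ↔ x.1 ∈ XG q k := by
  classical
  unfold level
  rw [Nat.find_le_iff]
  exact ⟨fun ⟨m, hm, h⟩ => XG_mono q hm h, fun h => ⟨k, le_rfl, h⟩⟩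

theorem mem_level (x : XGInf q) : x.1 ∈ XG q (level x) := level_le_iff.1 le_rfl

variable (q N) in
/-- The embedding of the union of the groups `G_k` into the fundamental group. -/
def gHom : XGInf q →* PiN q N :=
  MonoidHom.mk' (fun x => vElt q N (.c (level x + 1)) x.1 (XG_mono q (Nat.le_succ _) (mem_level x)))
    fun x y => by
      have hx := vElt_c (N := N) (le_max_left (level x) (max (level y) (level (x * y))))
        (XG_mono q (Nat.le_succ _) (mem_level x))
      have hy := vElt_c (N := N) (m := max (level x) (max (level y) (level (x * y))))
        ((le_max_left (level y) (level (x * y))).trans (le_max_right _ _))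
        (XG_mono q (Nat.le_succ _) (mem_level y))
      have hxy := vElt_c (N := N) (m := max (level x) (max (level y) (level (x * y))))
        ((le_max_right (level y) (level (x * y))).trans (le_max_right _ _))
        (XG_mono q (Nat.le_succ _) (mem_level (x * y)))
      rw [hx, hy, hxy]
      exact vElt_mul _ _ _

theorem gHom_apply {k : ℕ} {x : XGInf q} (hx : x.1 ∈ XG q (k + 1)) :
    gHom q N x = vElt q N (.c (k + 1)) x.1 hx := by
  have h1 := vElt_c (N := N) (le_max_left (level x) k) (XG_mono q (Nat.le_succ _) (mem_level x))
  have h2 := vElt_c (N := N) (le_max_right (level x) k) hx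
  exact h1.trans h2.symm

variable (q N) in
/-- The embedding of the group `H_N` at `a_N`. -/
def hHom : XH q N →* PiN q N :=
  MonoidHom.mk' (fun x => vElt q N (sPos N false (Fin.last N)) x.1 (by rw [group_sPos]; exact x.2))
    fun _ _ => vElt_mul _ _ _

theorem hHom_apply (x : XH q N) : hHom q N x =
    vElt q N (sPos N false (Fin.last N)) x.1 (by rw [group_sPos]; exact x.2) := rfl

/-- The embedding of `C_{q-1}` into `H_N`. -/
def cIncl : CycC q →* XH q N where
  toFun c := ⟨(c, 1), fun _ _ => rfl⟩
  map_one' := rfl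
  map_mul' _ _ := Subtype.ext (Prod.ext rfl (one_mul 1).symm)

theorem hHom_comm (x y : XH q N) : Commute (hHom q N x) (hHom q N y) := by
  have : x * y = y * x := Subtype.ext (mul_comm x.1 y.1)
  rw [Commute, SemiconjBy, ← map_mul, ← map_mul, this]

/-- The factor `C_{q-1}` commutes with the letter of the edge from `a_N` to `b_N`, because it is
contained in the groups of all the edges of the loop. -/
theorem crossElt_comm (c : CycC q) : Commute (hHom q N (cIncl c)) (crossElt q N) := by
  have h0 : (cIncl (N := N) c).1 ∈ XH q ((0 : Fin (N + 1)) : ℕ) := fun _ _ => rfl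
  have h1 := vElt_sPos (q := q) false (0 : Fin (N + 1)) h0
  have h2 := vElt_sPos (q := q) true (0 : Fin (N + 1)) h0
  have h3 := vElt_cross (cIncl (N := N) c).2
  have h4 : vElt q N (sPos N true (Fin.last N)) (cIncl (N := N) c).1
      (by rw [group_sPos]; exact (cIncl c).2) = hHom q N (cIncl c) := by
    rw [hHom_apply, ← h1, ← h2]
    exact vElt_congr rfl _ _
  rw [h4, ← hHom_apply, mul_inv_eq_iff_eq_mul] at h3
  exact h3.symm

/-- The homomorphism to the fundamental group from the free product of `C_q^N` and an infinite
cyclic group. -/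
def lHom : LoopGroup (XG q N) →* PiN q N :=
  Monoid.Coprod.lift ((hHom q N).comp (Subgroup.inclusion (XG_le_XH N)))
    (zpowersHom _ (crossElt q N))

theorem lHom_comm (c : CycC q) (f : LoopGroup (XG q N)) :
    Commute (hHom q N (cIncl c)) (lHom f) := by
  induction f using Monoid.Coprod.induction_on with
  | inl x => simpa [lHom] using hHom_comm _ _
  | inr n => simpa [lHom] using (crossElt_comm c).zpow_right _
  | mul x y hx hy => rw [map_mul]; exact hx.mul_right hy

variable (q N) in
/-- The homomorphism from the free product to the fundamental group of `X_N`. -/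
def ofGam : Gam q N →* PiN q N :=
  liftFP (MonoidHom.noncommCoprod ((hHom q N).comp cIncl) lHom lHom_comm) (gHom q N)

theorem ofGam_sHom (s : Bool) (x : XH q N) : ofGam q N (sHom q N s x) =
    vElt q N (sPos N s (Fin.last N)) x.1 (by rw [group_sPos]; exact x.2) := by
  have hx : x = cIncl x.1.1 * Subgroup.inclusion (XG_le_XH N) (pPart x) :=
    Subtype.ext (Prod.ext (mul_one _).symm (one_mul _).symm)
  have h1 : ofGam q N (sHom q N false x) = hHom q N x := by
    conv_rhs => rw [hx]
    simp [sHom_apply, ofGam, lHom, sideVal, sideElt, MonoidHom.noncommCoprod_apply]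
  cases s
  · exact h1
  · have h2 := tElt_conj x
    have h3 := vElt_cross x.2
    have h4 : ofGam q N (tElt q N) = crossElt q N := by
      simp [tElt, ofGam, lHom, sideElt, MonoidHom.noncommCoprod_apply]
    rw [← hHom_apply, ← h1, ← h2, map_mul, map_mul, map_inv, h4] at h3
    simpa using h3.symm

theorem ofGam_tElt : ofGam q N (tElt q N) = crossElt q N := by
  simp [tElt, ofGam, lHom, sideElt, MonoidHom.noncommCoprod_apply]

theorem ofGam_inG (x : XGInf q) : ofGam q N (inG _ _ x) = gHom q N x := by simp [ofGam]

theorem ofGam_vHom (v : XVertex N) (x : v.group q) :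
    ofGam q N (vHom q N v x) = vElt q N v x.1 x.2 := by
  cases v with
  | c k =>
    cases k with
    | zero =>
      refine (ofGam_sHom false _).trans ?_
      exact (vElt_sPos false (0 : Fin (N + 1)) (x := x.1) x.2).symm
    | succ k => exact (ofGam_inG _).trans (gHom_apply (x := ⟨x.1, XG_le_XGInf _ x.2⟩) x.2)
  | a k =>
    refine (ofGam_sHom false _).trans ?_
    exact (vElt_sPos false k.succ (x := x.1) x.2).symm
  | b k =>
    refine (ofGam_sHom true _).trans ?_
    exact (vElt_sPos true k.succ (x := x.1) x.2).symm

theorem ofGam_eElt (e : (XGraph q N).Edge) :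
    ofGam q N (eElt q N e) = edgeElt (XGraph q N) (XTree q N) e := by
  by_cases he : e.1 = XEdge.cross
  · obtain ⟨b, x⟩ := e
    obtain rfl : b = XEdge.cross := he
    cases x
    · change ofGam q N (tElt q N)⁻¹ = _
      rw [map_inv, ofGam_tElt]
      exact (edgeElt_rev (X := XGraph q N) (XEdge.cross, true)).symm
    · exact ofGam_tElt
  · rw [edgeElt_tree he]
    obtain ⟨b, x⟩ := e
    cases b <;> cases x <;> first | exact map_one _ | exact absurd rfl he

theorem ofGam_toGam (γ : PiN q N) : ofGam q N (toGam q N γ) = γ := by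
  have : (ofGam q N).comp (toGam q N) = MonoidHom.id _ := by
    refine PresentedGroup.ext fun x => ?_
    rcases x with ⟨v, x⟩ | e
    · exact (congrArg _ (toGam_vertexHom v x)).trans (ofGam_vHom v x)
    · exact (congrArg _ (toGam_edgeElt e)).trans (ofGam_eElt e)
  exact DFunLike.congr_fun this γ

theorem toGam_vElt_sPos_last (s : Bool) (x : XAmbient q)
    (hx : x ∈ (sPos N s (Fin.last N)).group q) (hx' : x ∈ XH q N) :
    toGam q N (vElt q N (sPos N s (Fin.last N)) x hx) = sHom q N s ⟨x, hx'⟩ := by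
  refine (toGam_vertexHom _ _).trans ?_
  cases s
  · exact vHom_aPos (q := q) (Fin.last N) x hx hx'
  · exact vHom_bPos (q := q) (Fin.last N) x hx hx'

/-- It suffices to compare the two homomorphisms on the factors of the free product. -/
theorem toGam_ofGam (γ : Gam q N) : toGam q N (ofGam q N γ) = γ := by
  have hsl : ∀ x : XH q N, toGam q N (hHom q N x) = sHom q N false x := fun x =>
    toGam_vElt_sPos_last false _ _ x.2
  have h1 : ∀ f, toGam q N (lHom f) = inK _ _ (1, f) := by
    intro f
    induction f using Monoid.Coprod.induction_on with
    | inl x =>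
      have : (pPart (Subgroup.inclusion (XG_le_XH N) x)) = x := Subtype.ext (Prod.ext x.2.1.symm rfl)
      simp only [lHom, Monoid.Coprod.lift_apply_inl, MonoidHom.comp_apply, hsl, sHom_apply, this]
      simp only [sideVal, sideElt, Bool.false_eq_true, if_false, inv_one, one_mul, mul_one]
      congr 2
      exact x.2.1
    | inr n =>
      simp only [lHom, Monoid.Coprod.lift_apply_inr, zpowersHom_apply, map_zpow]
      rw [show toGam q N (crossElt q N) = tElt q N from toGam_edgeElt _, tElt, ← map_zpow]
      simp only [sideElt, if_true, Prod.pow_mk, one_zpow, ← map_zpow]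
      congr 3
      rw [← ofAdd_zsmul]; simp
    | mul x y hx hy => rw [map_mul, map_mul, hx, hy, ← map_mul, Prod.mk_mul_mk, one_mul]
  have : (toGam q N).comp (ofGam q N) = MonoidHom.id _ := by
    refine hom_ext_FP (MonoidHom.ext fun x => ?_) (MonoidHom.ext fun x => ?_)
    · obtain ⟨c, f⟩ := x
      simp only [MonoidHom.comp_apply, ofGam, liftFP_inK, MonoidHom.noncommCoprod_apply, map_mul,
        h1, hsl, MonoidHom.id_apply, sHom_apply]
      rw [← map_mul]
      congr 1
      have : pPart (cIncl (N := N) c) = 1 := rfl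
      rw [this, sideVal_one, Prod.mk_mul_mk, mul_one, one_mul]
      rfl
    · simp only [MonoidHom.comp_apply, ofGam, liftFP_inG, MonoidHom.id_apply]
      exact toGam_vertexHom _ _
  exact DFunLike.congr_fun this γ

variable (q N) in
/-- The fundamental group of `X_N` is `(C_{q-1} × (C_q^N * ℤ)) * ⋃ C_q^k`. -/
def piEquiv : PiN q N ≃* Gam q N :=
  { toFun := toGam q N
    invFun := ofGam q N
    left_inv := ofGam_toGam
    right_inv := toGam_ofGam
    map_mul' := map_mul _ }

end Pi1

/-! ### Word lengths -/

namespace NormalForm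

variable {Γ Λ I : Type*} [Group Γ] (𝒩 : NormalForm Γ Λ I) (w : Λ → ℕ)

/-- The sum of the lengths `w` of the letters of the reduced word of an element. -/
def wlen (γ : Γ) : ℕ := ((𝒩.nf γ).map w).sum

theorem wlen_eval {l : List Λ} (h : 𝒩.Red l) : 𝒩.wlen w (𝒩.eval l) = (l.map w).sum := by
  rw [wlen, 𝒩.nf_eval h]

theorem wlen_one : 𝒩.wlen w 1 = 0 := by rw [wlen, 𝒩.nf_one]; rfl

theorem sum_map_lpow (l : List Λ) (n : ℕ) : ((lpow l n).map w).sum = n * (l.map w).sum := by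
  induction n with
  | zero => simp
  | succ n ih => rw [lpow_succ, List.map_append, List.sum_append, ih]; ring

theorem wlen_eval_pow {l : List Λ} (h : 𝒩.CycRed l) (n : ℕ) :
    𝒩.wlen w (𝒩.eval l ^ n) = n * (l.map w).sum := by
  cases n with
  | zero => rw [pow_zero, wlen_one, zero_mul]
  | succ n => rw [← eval_lpow, 𝒩.wlen_eval w (CycRed.lpow 𝒩 h n).red, sum_map_lpow]

end NormalForm

section FactorLength

variable {ι : Type} [DecidableEq ι] {M : ι → Type} [∀ i, Group (M i)] (ℓ : ∀ i, M i → ℕ)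

/-- The length of an element of a free product, for given length functions of the factors. -/
def coprodLen (γ : Monoid.CoprodI M) : ℕ := (coprodNF M).wlen (fun s => ℓ s.1.1 s.1.2) γ

variable {ℓ}

theorem coprodLen_append (h1 : ∀ i, ℓ i 1 = 0) {b : ι} {l : List (FactorLetter M)}
    (hl : (coprodNF M).Red l) (hb : ∀ s ∈ l.getLast?, s.1.1 ≠ b) (k : M b) :
    coprodLen ℓ ((coprodNF M).eval l * Monoid.CoprodI.of k) =
      coprodLen ℓ ((coprodNF M).eval l) + ℓ b k := by
  by_cases hk : k = 1
  · rw [hk, map_one, mul_one, h1, add_zero]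
  · have he : (coprodNF M).eval l * Monoid.CoprodI.of k = (coprodNF M).eval (l ++ [⟨⟨b, k⟩, hk⟩]) := by
      rw [NormalForm.eval_append, NormalForm.eval_cons, NormalForm.eval_nil, mul_one]; rfl
    have hr : (coprodNF M).Red (l ++ [⟨⟨b, k⟩, hk⟩]) := by
      rw [NormalForm.Red, List.isChain_append]
      refine ⟨hl, List.IsChain.singleton _, fun s hs t ht => ?_⟩
      simp only [List.head?_cons, Option.mem_def, Option.some.injEq] at ht
      subst ht
      exact hb s hs
    rw [he, coprodLen, coprodLen, NormalForm.wlen_eval _ _ hr, NormalForm.wlen_eval _ _ hl]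
    simp

/-- The last letter of the reduced word of `γ` is split off if it belongs to the factor `b`. -/
theorem exists_coprodLen_mul (h1 : ∀ i, ℓ i 1 = 0) (b : ι) (γ : Monoid.CoprodI M) :
    ∃ (γ' : Monoid.CoprodI M) (k : M b), γ = γ' * Monoid.CoprodI.of k ∧
      ∀ k' : M b, coprodLen ℓ (γ' * Monoid.CoprodI.of k') = coprodLen ℓ γ' + ℓ b k' := by
  have hγ := (coprodNF M).eval_nf γ
  have hr := (coprodNF M).red_nf γ
  generalize (coprodNF M).nf γ = l at hγ hr
  by_cases hb : ∀ s ∈ l.getLast?, s.1.1 ≠ b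
  · exact ⟨γ, 1, by simp, hγ ▸ coprodLen_append h1 hr hb⟩
  · rcases List.eq_nil_or_concat l with rfl | ⟨l, ⟨⟨i, a⟩, ha⟩, rfl⟩
    · simp at hb
    · simp only [List.concat_eq_append, List.getLast?_append, List.getLast?_singleton,
        Option.some_or, Option.mem_def, Option.some.injEq, forall_eq', ne_eq, not_not] at hb
      subst hb
      rw [List.concat_eq_append] at hγ hr
      rw [NormalForm.Red, List.isChain_append] at hr
      refine ⟨(coprodNF M).eval l, a, ?_, coprodLen_append h1 hr.1 fun s hs => ?_⟩
      · rw [← hγ, NormalForm.eval_append, NormalForm.eval_cons, NormalForm.eval_nil, mul_one]; rfl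
      · exact hr.2.2 s hs _ rfl

theorem coprodLen_of (h1 : ∀ i, ℓ i 1 = 0) {b : ι} (k : M b) :
    coprodLen ℓ (Monoid.CoprodI.of k) = ℓ b k := by
  have := coprodLen_append (M := M) h1 (l := []) List.IsChain.nil (by simp) k
  rw [NormalForm.eval_nil, one_mul] at this
  rw [this, coprodLen, NormalForm.wlen_one, zero_add]

end FactorLength

section LoopLength

variable {P : Type} [Group P] (ℓ : P → ℕ) (m : ℕ)

/-- The length of a letter: `ℓ h` if the loop is not passed, `m` if it is passed. -/
def loopWt (s : LoopLetter P) : ℕ := if s.1.2 then m else ℓ s.1.1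

/-- The length of `τ_x⁻¹ h τ_y`. -/
def sideLen (x : Bool) (h : P) (y : Bool) : ℕ := if xor x y then m else ℓ h

/-- The length of an element of the free product of `P` and an infinite cyclic group. -/
def loopLen (f : LoopGroup P) : ℕ := (loopNF P).wlen (fun s => loopWt ℓ m s.2) f

variable {ℓ m}

theorem loopLen_append (h1 : ℓ 1 = 0) {x : Bool} {l : List (Bool × LoopLetter P)}
    (hl : (loopNF P).Red l) (hb : ∀ s ∈ l.getLast?, Loop.tgt s ≠ x) (h : P) (y : Bool) :
    loopLen ℓ m ((loopNF P).eval l * sideVal x h y) =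
      loopLen ℓ m ((loopNF P).eval l) + sideLen ℓ m x h y := by
  by_cases hh : (h, xor x y) = ((1 : P), false)
  · obtain ⟨rfl, rfl⟩ := Loop.eq_one_and_eq hh
    rw [sideVal_one, mul_one]
    simp [sideLen, h1]
  · have he : (loopNF P).eval l * sideVal x h y = (loopNF P).eval (l ++ [(x, ⟨_, hh⟩)]) := by
      rw [NormalForm.eval_append, NormalForm.eval_cons, NormalForm.eval_nil, mul_one]
      congr 1
      change _ = Loop.val _
      rw [Loop.val, Loop.tgt_mk]
    have hr : (loopNF P).Red (l ++ [(x, ⟨_, hh⟩)]) := by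
      rw [NormalForm.Red, List.isChain_append]
      refine ⟨hl, List.IsChain.singleton _, fun s hs t ht => ?_⟩
      simp only [List.head?_cons, Option.mem_def, Option.some.injEq] at ht
      subst ht
      exact hb s hs
    rw [he, loopLen, loopLen, NormalForm.wlen_eval _ _ hr, NormalForm.wlen_eval _ _ hl]
    simp [loopWt, sideLen]

/-- The last letter of the reduced word of `f` is split off if it arrives on the side `x`. -/
theorem exists_loopLen_mul (h1 : ℓ 1 = 0) (x : Bool) (f : LoopGroup P) :
    ∃ (f' : LoopGroup P) (x' : Bool) (p : P), f = f' * sideVal x' p x ∧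
      ∀ (h : P) (y : Bool), loopLen ℓ m (f' * sideVal x' h y) = loopLen ℓ m f' + sideLen ℓ m x' h y := by
  have hγ := (loopNF P).eval_nf f
  have hr := (loopNF P).red_nf f
  generalize (loopNF P).nf f = l at hγ hr
  by_cases hb : ∀ s ∈ l.getLast?, Loop.tgt s ≠ x
  · exact ⟨f, x, 1, by simp, hγ ▸ loopLen_append h1 hr hb⟩
  · rcases List.eq_nil_or_concat l with rfl | ⟨l, a, rfl⟩
    · simp at hb
    · simp only [List.concat_eq_append, List.getLast?_append, List.getLast?_singleton,
        Option.some_or, Option.mem_def, Option.some.injEq, forall_eq', ne_eq, not_not] at hb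
      subst hb
      rw [List.concat_eq_append] at hγ hr
      rw [NormalForm.Red, List.isChain_append] at hr
      refine ⟨(loopNF P).eval l, a.1, a.2.1.1, ?_, loopLen_append h1 hr.1 fun s hs => ?_⟩
      · rw [← hγ, NormalForm.eval_append, NormalForm.eval_cons, NormalForm.eval_nil, mul_one]; rfl
      · exact hr.2.2 s hs _ rfl

end LoopLength

/-! ### Translation lengths on the universal covering tree -/

section Translation

variable {X : GraphOfGroups} {T : Set X.B}

theorem translationLength_le (γ : X.Pi1 T) (p : X.CoverVertex T) :
    translationLength γ ≤ (X.cover T).dist p (γ • p) := ciInf_le (OrderBot.bddBelow _) p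

theorem dist_pow_smul_le (hc : (X.cover T).Connected) (γ : X.Pi1 T) (p : X.CoverVertex T) (n : ℕ) :
    (X.cover T).dist p (γ ^ n • p) ≤ n * (X.cover T).dist p (γ • p) := by
  induction n with
  | zero => simp
  | succ n ih =>
    have h1 := hc.dist_triangle (u := p) (v := γ ^ n • p) (w := γ ^ (n + 1) • p)
    have h2 : (X.cover T).dist (γ ^ n • p) (γ ^ (n + 1) • p) = (X.cover T).dist p (γ • p) := by
      rw [pow_succ, mul_smul, cover_dist_smul]
    rw [h2] at h1
    rw [add_mul, one_mul]
    omega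

/-- The translation length is the growth rate of the displacement of any vertex, because
`dist p₀ (γⁿ p₀) ≤ 2 dist p₀ p + n dist p (γ p)` for every vertex `p`. -/
theorem translationLength_eq (hc : (X.cover T).Connected) (γ : X.Pi1 T) (p₀ : X.CoverVertex T) (L : ℕ)
    (h : ∀ n : ℕ, (X.cover T).dist p₀ (γ ^ n • p₀) = n * L) : translationLength γ = L := by
  refine le_antisymm ?_ ?_
  · have := h 1
    rw [pow_one, one_mul] at this
    exact (translationLength_le γ p₀).trans this.le
  · have : Nonempty (X.CoverVertex T) := ⟨p₀⟩
    refine le_ciInf fun p => ?_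
    by_contra hlt
    push Not at hlt
    set d := (X.cover T).dist p₀ p with hd
    have h1 := dist_pow_smul_le hc γ p (2 * d + 1)
    have h2 := h (2 * d + 1)
    have h3 := hc.dist_triangle (u := p₀) (v := p) (w := γ ^ (2 * d + 1) • p₀)
    have h4 := hc.dist_triangle (u := p) (v := γ ^ (2 * d + 1) • p) (w := γ ^ (2 * d + 1) • p₀)
    rw [cover_dist_smul, SimpleGraph.dist_comm (u := p) (v := p₀)] at h4
    nlinarith

theorem isHyperbolic_of_translationLength_pos {γ : X.Pi1 T} (h : 0 < translationLength γ) :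
    IsHyperbolic γ := by
  intro p hp
  have := translationLength_le γ p
  rw [hp, SimpleGraph.dist_self] at this
  omega

/-- The vertices `p` and `p'` are joined by a path of length at most `n`. -/
def Within (n : ℕ) (p p' : X.CoverVertex T) : Prop := ∃ w : (X.cover T).Walk p p', w.length ≤ n

theorem Within.refl (p : X.CoverVertex T) : Within 0 p p := ⟨.nil, le_rfl⟩

theorem Within.trans {n n' : ℕ} {p p' p'' : X.CoverVertex T} (h : Within n p p')
    (h' : Within n' p' p'') : Within (n + n') p p'' := by
  obtain ⟨w, hw⟩ := h
  obtain ⟨w', hw'⟩ := h'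
  exact ⟨w.append w', by rw [SimpleGraph.Walk.length_append]; omega⟩

theorem Within.symm {n : ℕ} {p p' : X.CoverVertex T} (h : Within n p p') : Within n p' p := by
  obtain ⟨w, hw⟩ := h
  exact ⟨w.reverse, by rwa [SimpleGraph.Walk.length_reverse]⟩

theorem Within.smul {n : ℕ} {p p' : X.CoverVertex T} (h : Within n p p') (γ : X.Pi1 T) :
    Within n (γ • p) (γ • p') := by
  obtain ⟨w, hw⟩ := h
  exact ⟨w.map (⟨fun a => γ • a, fun {a b} h => cover_adj_smul γ a b h⟩ : X.cover T →g X.cover T),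
    by rwa [SimpleGraph.Walk.length_map]⟩

theorem within_edge (g : X.Pi1 T) (e : X.Edge) : Within (T := T) 1
    ⟨src e, QuotientGroup.mk g⟩ ⟨tgt e, QuotientGroup.mk (g * X.edgeElt T e)⟩ := by
  by_cases h : (⟨src e, QuotientGroup.mk g⟩ : X.CoverVertex T) =
      ⟨tgt e, QuotientGroup.mk (g * X.edgeElt T e)⟩
  · rw [← h]; exact ⟨.nil, Nat.zero_le _⟩
  · have hadj : (X.cover T).Adj ⟨src e, QuotientGroup.mk g⟩
        ⟨tgt e, QuotientGroup.mk (g * X.edgeElt T e)⟩ :=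
      (SimpleGraph.fromRel_adj _ _ _).2 ⟨h, Or.inl ⟨g, e, rfl, rfl⟩⟩
    exact ⟨.cons hadj .nil, le_rfl⟩

theorem exists_of_adj {p p' : X.CoverVertex T} (h : (X.cover T).Adj p p') :
    ∃ (g : X.Pi1 T) (e : X.Edge), p = ⟨src e, QuotientGroup.mk g⟩ ∧
      p' = ⟨tgt e, QuotientGroup.mk (g * X.edgeElt T e)⟩ := by
  rcases ((SimpleGraph.fromRel_adj _ _ _).1 h).2 with h | ⟨g, e, h1, h2⟩
  · exact h
  · refine ⟨g * X.edgeElt T e, rev e, ?_, ?_⟩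
    · obtain ⟨b, x⟩ := e
      cases x <;> exact h2
    · rw [h1, edgeElt_rev, mul_inv_cancel_right]
      rfl

theorem vertexHom_smul (v : X.V) (x : X.Gv v) : X.vertexHom T v x •
    (⟨v, QuotientGroup.mk 1⟩ : X.CoverVertex T) = ⟨v, QuotientGroup.mk 1⟩ := by
  have : (QuotientGroup.mk (X.vertexHom T v x * 1) : X.Pi1 T ⧸ (X.vertexHom T v).range) =
      QuotientGroup.mk 1 := by
    rw [QuotientGroup.eq, mul_one, mul_one]
    exact inv_mem ⟨x, rfl⟩
  exact congrArg (Sigma.mk v) this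

end Translation

/-! ### Displacement of the vertex `c_1` -/

section Displacement

variable {q N : ℕ}

theorem level_one : level (1 : XGInf q) = 0 := Nat.le_zero.1 (level_le_iff.2 (one_mem _))

theorem level_pos {x : XGInf q} (hx : x ≠ 1) : 0 < level x := by
  rw [Nat.pos_iff_ne_zero]
  intro h
  have := level_le_iff.1 h.le
  exact hx (Subtype.ext (Prod.ext this.1 (funext fun i => this.2 i (Nat.zero_le i))))

theorem level_mul_le {x y : XGInf q} {k : ℕ} (hx : level x ≤ k) (hy : level y ≤ k) :
    level (x * y) ≤ k := level_le_iff.2 (mul_mem (level_le_iff.1 hx) (level_le_iff.1 hy))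

/-- Every coset of `G_k` contains an element of level at least `k`, and at least that of all
elements of the coset of `G_{k+1}`, up to one. -/
theorem exists_level_le (hq : 2 ≤ q) (p : XGInf q) (k : ℕ) :
    ∃ z : XGInf q, z.1 ∈ XG q k ∧ k ≤ level (p * z) ∧ ∀ x : XGInf q, x.1 ∈ XG q (k + 1) →
      level (p * x) ≤ level (p * z) + 1 := by
  rcases le_or_gt k (level p) with h | h
  · refine ⟨1, one_mem _, by rwa [mul_one], fun x hx => ?_⟩
    rw [mul_one]
    exact level_mul_le (Nat.le_succ _) ((level_le_iff.2 hx).trans (by omega))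
  · obtain ⟨j, rfl⟩ : ∃ j, k = j + 1 := ⟨k - 1, by omega⟩
    have : Fact (1 < q) := ⟨hq⟩
    -- an element of level `k`
    let e : XAmbient q := (1, Function.update 1 j (Multiplicative.ofAdd 1))
    have he : e ∈ XG q (j + 1) := by
      refine ⟨rfl, fun i hi => ?_⟩
      simp [e, Function.update_of_ne (show i ≠ j by omega)]
    have he' : ¬ e ∈ XG q j := by
      intro h
      have := h.2 j le_rfl
      simp only [e, Function.update_self] at this
      exact one_ne_zero (Multiplicative.ofAdd.injective this)
    let e' : XGInf q := ⟨e, XG_le_XGInf _ he⟩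
    have h1 : j < level e' := by
      rw [← not_le, level_le_iff]; exact he'
    refine ⟨p⁻¹ * e', mul_mem (inv_mem (level_le_iff.1 h.le)) he, by rwa [mul_inv_cancel_left],
      fun x hx => ?_⟩
    rw [mul_inv_cancel_left]
    have h2 := level_mul_le (h.le.trans (Nat.le_succ _)) (level_le_iff.2 hx)
    omega

variable (q N) in
/-- The level of an element of `G_N`. -/
def lev (x : XG q N) : ℕ := level ⟨x.1, XG_le_XGInf N x.2⟩

theorem lev_one : lev q N 1 = 0 := level_one

variable (q N) in
/-- The length functions of the two factors of the fundamental group. -/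
def gamLenFn : ∀ b : Bool, twoFactors (CycC q × LoopGroup (XG q N)) (XGInf q) b → ℕ
  | false, k => loopLen (fun h => 2 * lev q N h) (2 * N + 1) k.2
  | true, x => 2 * level x

theorem gamLenFn_one (b : Bool) : gamLenFn q N b 1 = 0 := by
  cases b
  · exact NormalForm.wlen_one _ _
  · change 2 * level (1 : XGInf q) = 0
    rw [level_one]

variable (q N) in
/-- The length of an element of the fundamental group. -/
def gamLen (γ : Gam q N) : ℕ := coprodLen (gamLenFn q N) γ

/-- Right multiplication by a letter that starts on the side `s` changes the last letter of a
reduced word or appends a letter. -/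
theorem gamLen_side (γ : Gam q N) (s : Bool) : ∃ (a : ℕ) (x' : Bool) (p : XG q N),
    ∀ (c : CycC q) (h : XG q N) (y : Bool), gamLen q N (γ * inK _ _ (c, sideVal s h y)) =
      a + sideLen (fun h => 2 * lev q N h) (2 * N + 1) x' (p * h) y := by
  obtain ⟨γ', k, rfl, hk⟩ := exists_coprodLen_mul (gamLenFn_one (q := q) (N := N)) false γ
  obtain ⟨f', x', p, hf, hf'⟩ := exists_loopLen_mul (ℓ := fun h => 2 * lev q N h) (m := 2 * N + 1)
    (by rw [lev_one]) s k.2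
  refine ⟨coprodLen (gamLenFn q N) γ' + loopLen (fun h => 2 * lev q N h) (2 * N + 1) f', x', p,
    fun c h y => ?_⟩
  have h1 : γ' * Monoid.CoprodI.of k * inK _ _ (c, sideVal s h y) =
      γ' * Monoid.CoprodI.of (M := twoFactors (CycC q × LoopGroup (XG q N)) (XGInf q)) (i := false)
        (k.1 * c, f' * sideVal x' (p * h) y) := by
    rw [inK, mul_assoc, ← map_mul]
    congr 2
    refine Prod.ext rfl ?_
    change k.2 * sideVal s h y = _
    rw [hf, mul_assoc, sideVal_mul]
  rw [gamLen, h1, hk]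
  change _ + loopLen _ _ (f' * sideVal x' (p * h) y) = _
  rw [hf', add_assoc]

theorem gamLen_mul_inG (γ : Gam q N) : ∃ (a : ℕ) (p : XGInf q), ∀ x : XGInf q,
    gamLen q N (γ * inG _ _ x) = a + 2 * level (p * x) := by
  obtain ⟨γ', k, rfl, hk⟩ := exists_coprodLen_mul (gamLenFn_one (q := q) (N := N)) true γ
  refine ⟨coprodLen (gamLenFn q N) γ', k, fun x => ?_⟩
  rw [gamLen, inG, mul_assoc, ← map_mul, hk]
  rfl

theorem gamLen_mul_inK_fst (γ : Gam q N) (c : CycC q) :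
    gamLen q N (γ * inK _ _ (c, 1)) = gamLen q N γ := by
  obtain ⟨a, x', p, h⟩ := gamLen_side γ false
  have h1 := h c 1 false
  have h2 := h 1 1 false
  rw [sideVal_one] at h1 h2
  rw [h1, ← h2, show ((1 : CycC q), (1 : LoopGroup (XG q N))) = 1 from rfl, map_one, mul_one]

theorem gamLen_inK (k : CycC q × LoopGroup (XG q N)) : gamLen q N (inK _ _ k) =
    loopLen (fun h => 2 * lev q N h) (2 * N + 1) k.2 := coprodLen_of gamLenFn_one _

theorem gamLen_one : gamLen q N 1 = 0 := NormalForm.wlen_one _ _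

theorem lev_mul_pPart (p : XG q N) {z : XGInf q} (hz : z.1 ∈ XH q N) (hz' : z.1.1 = 1) :
    lev q N (p * pPart ⟨z.1, hz⟩) = level ((⟨p.1, XG_le_XGInf N p.2⟩ : XGInf q) * z) := by
  unfold lev
  congr 1
  refine Subtype.ext (Prod.ext ?_ rfl)
  change p.1.1 * 1 = p.1.1 * z.1.1
  rw [hz']

/-- The distance of a vertex of the graph from `c_1` in the maximal subtree. -/
def ht : XVertex N → ℕ
  | .c k => k
  | .a k => k + 1
  | .b k => k + 1

theorem ht_sPos (s : Bool) (k : Fin (N + 1)) : ht (sPos N s k) = k := by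
  cases s <;> refine Fin.cases rfl (fun i => rfl) k

theorem vHom_sPos (s : Bool) (k : Fin (N + 1)) (x : XAmbient q) (hx : x ∈ (sPos N s k).group q)
    (hx' : x ∈ XH q N) : vHom q N (sPos N s k) ⟨x, hx⟩ = sHom q N s ⟨x, hx'⟩ := by
  cases s
  · exact vHom_aPos k x hx hx'
  · exact vHom_bPos k x hx hx'

variable (q N) in
/-- The elements of the coset `γ G_v` have length at most `n + ht v`. -/
def LenLe (n : ℕ) (γ : Gam q N) (v : XVertex N) : Prop :=
  ∀ h : v.group q, gamLen q N (γ * vHom q N v h) ≤ n + ht v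

theorem lenLe_sPos {n : ℕ} {γ : Gam q N} {s : Bool} {k : Fin (N + 1)} :
    LenLe q N n γ (sPos N s k) ↔ ∀ (x : XAmbient q) (hx : x ∈ XH q k),
      gamLen q N (γ * sHom q N s ⟨x, XH_mono q (Nat.le_of_lt_succ k.2) hx⟩) ≤ n + k := by
  constructor
  · intro h x hx
    have := h ⟨x, by rw [group_sPos]; exact hx⟩
    rwa [vHom_sPos, ht_sPos] at this
  · rintro h ⟨x, hx⟩
    have hx' : x ∈ XH q k := by rw [group_sPos] at hx; exact hx
    rw [vHom_sPos s k x hx (XH_mono q (Nat.le_of_lt_succ k.2) hx'), ht_sPos]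
    exact h x hx'

theorem lenLe_up (hq : 2 ≤ q) {n : ℕ} {γ : Gam q N} {s : Bool} {k : Fin N}
    (h : LenLe q N n γ (sPos N s k.castSucc)) : LenLe q N (n + 1) γ (sPos N s k.succ) := by
  rw [lenLe_sPos] at h ⊢
  intro x hx
  obtain ⟨a, x', p, hp⟩ := gamLen_side γ s
  rw [sHom_apply, hp]
  by_cases hs : xor x' s = true
  · have h1 := h 1 (one_mem _)
    rw [sHom_apply, hp] at h1
    simp only [sideLen, hs, if_true] at h1 ⊢
    simp only [Fin.val_castSucc, Fin.val_succ] at h1 ⊢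
    omega
  · obtain ⟨z, hz, -, hz'⟩ := exists_level_le hq ⟨p.1, XG_le_XGInf N p.2⟩ k
    have h1 := h z.1 (XG_le_XH k hz)
    rw [sHom_apply, hp] at h1
    have h2 := hz' ⟨(1, x.2), XG_le_XGInf (k + 1) ⟨rfl, hx⟩⟩ ⟨rfl, hx⟩
    have h3 : lev q N (p * pPart ⟨x, XH_mono q (Nat.le_of_lt_succ k.succ.2) hx⟩) =
      level ((⟨p.1, XG_le_XGInf N p.2⟩ : XGInf q) * ⟨(1, x.2), XG_le_XGInf (k + 1) ⟨rfl, hx⟩⟩) := rfl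
    have h4 := lev_mul_pPart p (XH_mono q (Nat.le_of_lt_succ k.castSucc.2) (XG_le_XH k hz)) hz.1
    simp only [sideLen, hs] at h1 ⊢
    rw [h4] at h1
    rw [h3]
    simp only [Fin.val_castSucc, Fin.val_succ, Bool.false_eq_true, if_false] at h1 ⊢
    omega

theorem lenLe_down {n : ℕ} {γ : Gam q N} {s : Bool} {k : Fin N}
    (h : LenLe q N n γ (sPos N s k.succ)) : LenLe q N (n + 1) γ (sPos N s k.castSucc) := by
  rw [lenLe_sPos] at h ⊢
  intro x hx
  have := h x (XH_mono q (Nat.le_succ _) hx)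
  simp only [Fin.val_castSucc, Fin.val_succ] at this ⊢
  omega

theorem eElt_cross (s : Bool) : eElt q N (XEdge.cross, !s) = inK _ _ (1, sideVal s 1 (!s)) := by
  cases s
  · simp [eElt, tElt, sideVal, sideElt]
  · simp [eElt, tElt, sideVal, sideElt, ← map_inv, Prod.inv_mk]

theorem lenLe_cross (hq : 2 ≤ q) {n : ℕ} {γ : Gam q N} {s : Bool} (h : LenLe q N n γ (sPos N s (Fin.last N))) :
    LenLe q N (n + 1) (γ * eElt q N (XEdge.cross, !s)) (sPos N (!s) (Fin.last N)) := by
  rw [lenLe_sPos] at h ⊢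
  intro x hx
  obtain ⟨a, x', p, hp⟩ := gamLen_side γ s
  rw [eElt_cross, sHom_apply, mul_assoc, ← map_mul, Prod.mk_mul_mk, one_mul, sideVal_mul, one_mul, hp]
  simp only [Fin.val_last] at h hx ⊢
  by_cases hs : x' = s
  · subst hs
    obtain ⟨z, hz, hz', -⟩ := exists_level_le hq ⟨p.1, XG_le_XGInf N p.2⟩ N
    have h1 := h z.1 (XG_le_XH N hz)
    rw [sHom_apply, hp, sideLen, lev_mul_pPart p (XG_le_XH N hz) hz.1] at h1
    simp only [sideLen, Bool.xor_self, Bool.xor_not, Bool.not_false, Bool.false_eq_true, if_false,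
      if_true] at h1 ⊢
    omega
  · have h1 := h 1 (one_mem _)
    rw [sHom_apply, hp] at h1
    have h2 : xor x' s = true := by cases x' <;> cases s <;> simp at hs ⊢
    have h3 : xor x' (!s) = false := by cases x' <;> cases s <;> simp at hs ⊢
    simp only [sideLen, h2, h3, if_true, Bool.false_eq_true, if_false] at h1 ⊢
    have h4 : lev q N (p * pPart ⟨x, hx⟩) ≤ N := level_le_iff.2 (p * pPart ⟨x, hx⟩).2
    omega

theorem vHom_c_zero (x : (XVertex.c (N := N) 0).group q) :
    vHom q N (XVertex.c 0) x = inK _ _ (x.1.1, 1) := by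
  change sHom q N false _ = _
  rw [sHom_apply]
  have : pPart (Subgroup.inclusion (group_c_zero_le (q := q) (N := N)) x) = 1 :=
    Subtype.ext (Prod.ext rfl (funext fun i => x.2 i (Nat.zero_le i)))
  rw [this, sideVal_one]
  rfl

theorem lenLe_c_up (hq : 2 ≤ q) {n k : ℕ} {γ : Gam q N} (h : LenLe q N n γ (XVertex.c k)) :
    LenLe q N (n + 1) γ (XVertex.c (k + 1)) := by
  rintro ⟨x, hx⟩
  obtain ⟨a, p, hp⟩ := gamLen_mul_inG γ
  obtain ⟨z, hz, -, hz'⟩ := exists_level_le hq p k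
  have h1 : a + 2 * level (p * z) ≤ n + k := by
    cases k with
    | zero =>
      have := h 1
      rw [map_one] at this
      have hz1 : z = 1 := Subtype.ext (Prod.ext hz.1 (funext fun i => hz.2 i (Nat.zero_le i)))
      rwa [← hp, hz1, map_one]
    | succ k =>
      have := h ⟨z.1, hz⟩
      rwa [← hp]
  have h2 := hz' ⟨x, XG_le_XGInf _ hx⟩ hx
  change gamLen q N (γ * inG _ _ ⟨x, XG_le_XGInf _ hx⟩) ≤ n + 1 + (k + 1)
  rw [hp]
  omega

theorem lenLe_c_down {n k : ℕ} {γ : Gam q N} (h : LenLe q N n γ (XVertex.c (k + 1))) :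
    LenLe q N (n + 1) γ (XVertex.c k) := by
  intro x
  cases k with
  | zero =>
    rw [vHom_c_zero, gamLen_mul_inK_fst]
    have := h 1
    rwa [map_one, mul_one] at this
  | succ k =>
    have := h ⟨x.1, XG_mono q (Nat.le_succ _) x.2⟩
    change _ ≤ n + (k + 1 + 1) at this
    change _ ≤ n + 1 + (k + 1)
    exact le_trans this (by omega)

/-- Passing to a neighbouring vertex of the covering tree increases the bound `n` by at most `1`.
This makes the length of an element a lower bound of the displacement of `c_1`. -/
theorem lenLe_edge (hq : 2 ≤ q) {n : ℕ} {γ : Gam q N} (e : (XGraph q N).Edge)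
    (h : LenLe q N n γ (src e)) : LenLe q N (n + 1) (γ * eElt q N e) (tgt e) := by
  obtain ⟨b, x⟩ := e
  cases b with
  | aEdge k =>
    have h3 : eElt q N (XEdge.aEdge k, x) = 1 := by cases x <;> rfl
    rw [h3, mul_one]
    cases x
    · exact lenLe_down (s := false) h
    · exact lenLe_up hq (s := false) h
  | bEdge k =>
    have h3 : eElt q N (XEdge.bEdge k, x) = 1 := by cases x <;> rfl
    rw [h3, mul_one]
    cases x
    · exact lenLe_down (s := true) h
    · exact lenLe_up hq (s := true) h
  | cross =>
    cases x
    · exact lenLe_cross hq (s := true) h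
    · exact lenLe_cross hq (s := false) h
  | cEdge k =>
    have h3 : eElt q N (XEdge.cEdge k, x) = 1 := by cases x <;> rfl
    rw [h3, mul_one]
    cases x
    · exact lenLe_c_down h
    · exact lenLe_c_up hq h

variable (q N) in
/-- The vertex `c_1` of the covering tree. -/
def basePt : (XGraph q N).CoverVertex (XTree q N) := ⟨XVertex.c 0, QuotientGroup.mk 1⟩

theorem lenLe_of_adj (hq : 2 ≤ q) {n : ℕ} {p p' : (XGraph q N).CoverVertex (XTree q N)}
    (hadj : ((XGraph q N).cover (XTree q N)).Adj p p')
    (h : ∀ (v : XVertex N) (g : PiN q N), p = ⟨v, QuotientGroup.mk g⟩ → LenLe q N n (toGam q N g) v)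
    (v : XVertex N) (g : PiN q N) (hp : p' = ⟨v, QuotientGroup.mk g⟩) :
    LenLe q N (n + 1) (toGam q N g) v := by
  obtain ⟨g₀, e, h1, h2⟩ := exists_of_adj hadj
  have h3 := lenLe_edge hq e (h _ g₀ h1)
  rw [hp] at h2
  obtain ⟨rfl, h4⟩ := Sigma.mk.inj_iff.1 h2
  obtain ⟨k, hk⟩ : ∃ k : XVertex.group q (tgt e), vertexHom (XGraph q N) (XTree q N) (tgt e) k =
      (g₀ * edgeElt (XGraph q N) (XTree q N) e)⁻¹ * g := QuotientGroup.eq.1 (eq_of_heq h4).symm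
  have h6 : g = g₀ * edgeElt (XGraph q N) (XTree q N) e * vertexHom _ (XTree q N) (tgt e) k := by
    rw [hk, mul_inv_cancel_left]
  intro x
  have h7 : toGam q N g * vHom q N (tgt e) x = toGam q N g₀ * eElt q N e * vHom q N (tgt e) (k * x) := by
    have h8 : toGam q N (vertexHom (XGraph q N) (XTree q N) (tgt e) k) = vHom q N (tgt e) k :=
      toGam_vertexHom _ k
    rw [h6, map_mul, map_mul, toGam_edgeElt, h8, mul_assoc, map_mul]
  rw [h7]
  exact h3 _

theorem lenLe_of_walk (hq : 2 ≤ q) {n : ℕ} {p p' : (XGraph q N).CoverVertex (XTree q N)}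
    (w : ((XGraph q N).cover (XTree q N)).Walk p p')
    (h : ∀ (v : XVertex N) (g : PiN q N), p = ⟨v, QuotientGroup.mk g⟩ → LenLe q N n (toGam q N g) v)
    (v : XVertex N) (g : PiN q N) (hp : p' = ⟨v, QuotientGroup.mk g⟩) :
    LenLe q N (n + w.length) (toGam q N g) v := by
  induction w generalizing n with
  | nil => exact h v g hp
  | cons hadj w ih =>
    have := ih (lenLe_of_adj hq hadj h) hp
    rw [SimpleGraph.Walk.length_cons]
    rwa [add_assoc, add_comm 1] at this

theorem lenLe_basePt (v : XVertex N) (g : PiN q N) (h : basePt q N = ⟨v, QuotientGroup.mk g⟩) :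
    LenLe q N 0 (toGam q N g) v := by
  obtain ⟨rfl, h4⟩ := Sigma.mk.inj_iff.1 h
  obtain ⟨k, hk⟩ : ∃ k : XVertex.group q (XVertex.c 0),
      vertexHom (XGraph q N) (XTree q N) (XVertex.c 0) k = 1⁻¹ * g :=
    QuotientGroup.eq.1 (eq_of_heq h4)
  rw [inv_one, one_mul] at hk
  intro x
  rw [← hk]
  have h1 := toGam_vertexHom (N := N) (XVertex.c 0) k
  rw [h1, ← map_mul, vHom_c_zero]
  rw [← one_mul (inK _ _ _), gamLen_mul_inK_fst, gamLen_one]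
  exact Nat.zero_le _

theorem gamLen_le_of_within (hq : 2 ≤ q) {n : ℕ} {γ : PiN q N}
    (h : Within n (basePt q N) (γ • basePt q N)) : gamLen q N (toGam q N γ) ≤ n := by
  obtain ⟨w, hw⟩ := h
  have h1 := lenLe_of_walk hq w lenLe_basePt (XVertex.c 0) (γ * 1) rfl 1
  rw [map_one, mul_one, mul_one] at h1
  refine h1.trans ?_
  change 0 + w.length + 0 ≤ n
  omega

theorem within_sPos (s : Bool) (k : Fin (N + 1)) :
    Within (k : ℕ) (basePt q N) ⟨sPos N s k, QuotientGroup.mk 1⟩ := by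
  induction k using Fin.induction with
  | zero => cases s <;> exact Within.refl _
  | succ k ih =>
    refine ih.trans (n' := 1) ?_
    cases s
    · have := within_edge (T := XTree q N) 1 ((XEdge.aEdge k, true) : (XGraph q N).Edge)
      rwa [edgeElt_tree (show (XEdge.aEdge k : XEdge N) ≠ _ by simp), mul_one] at this
    · have := within_edge (T := XTree q N) 1 ((XEdge.bEdge k, true) : (XGraph q N).Edge)
      rwa [edgeElt_tree (show (XEdge.bEdge k : XEdge N) ≠ _ by simp), mul_one] at this

theorem within_c (k : ℕ) : Within k (basePt q N) ⟨XVertex.c k, QuotientGroup.mk 1⟩ := by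
  induction k with
  | zero => exact Within.refl _
  | succ k ih =>
    refine ih.trans (n' := 1) ?_
    have := within_edge (T := XTree q N) 1 ((XEdge.cEdge k, true) : (XGraph q N).Edge)
    rwa [edgeElt_tree (show (XEdge.cEdge k : XEdge N) ≠ _ by simp), mul_one] at this

/-- An element of the group of a vertex at distance `n` from `c_1` moves `c_1` by at most `2 n`. -/
theorem within_vElt {n : ℕ} {v : XVertex N}
    (h : Within n (basePt q N) ⟨v, QuotientGroup.mk 1⟩) (x : XAmbient q) (hx : x ∈ v.group q) :
    Within (n + n) (basePt q N) (vElt q N v x hx • basePt q N) := by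
  refine h.trans ?_
  have := h.symm.smul (vElt q N v x hx)
  have h1 := vertexHom_smul (X := XGraph q N) (T := XTree q N) v (⟨x, hx⟩ : v.group q)
  rw [vElt] at this
  rwa [h1] at this

variable (q N) in
/-- An element of the fundamental group moves `c_1` by at most `n`. -/
def Moves (n : ℕ) (γ : Gam q N) : Prop := Within n (basePt q N) (ofGam q N γ • basePt q N)

theorem Moves.mul {n n' : ℕ} {γ γ' : Gam q N} (h : Moves q N n γ) (h' : Moves q N n' γ') :
    Moves q N (n + n') (γ * γ') := by
  have := h.trans (Within.smul h' (ofGam q N γ))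
  rwa [← mul_smul, ← map_mul] at this

theorem Moves.one : Moves q N 0 1 := by
  rw [Moves, map_one, one_smul]; exact Within.refl _

theorem moves_sHom (s : Bool) (k : Fin (N + 1)) (x : XAmbient q) (hx : x ∈ XH q k) :
    Moves q N (k + k) (sHom q N s ⟨x, XH_mono q (Nat.le_of_lt_succ k.2) hx⟩) := by
  rw [Moves, ofGam_sHom, ← vElt_sPos s k hx]
  exact within_vElt (within_sPos s k) x _

/-- On either side, an element of `G_N` of level `k` fixes a vertex at distance `k` from `c_1`, and
a passage of the loop has `2 * N + 1` edges. -/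
theorem moves_letter (s : Bool) (h : XG q N) (y : Bool) :
    Moves q N (sideLen (fun h => 2 * lev q N h) (2 * N + 1) s h y) (inK _ _ (1, sideVal s h y)) := by
  have hs : ∀ h : XG q N, pPart (⟨h.1, XG_le_XH N h.2⟩ : XH q N) = h := fun h =>
    Subtype.ext (Prod.ext h.2.1.symm rfl)
  have hsh : ∀ (s : Bool) (h : XG q N), inK _ _ ((1 : CycC q), sideVal s h s) =
      sHom q N s ⟨h.1, XG_le_XH N h.2⟩ := by
    intro s h
    rw [sHom_apply, hs]
    congr 2
    exact h.2.1.symm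
  by_cases hy : y = s
  · subst hy
    have hl : lev q N h ≤ N := level_le_iff.2 h.2
    have := moves_sHom (N := N) y ⟨lev q N h, by omega⟩ h.1 (XG_le_XH _ (mem_level _))
    rw [hsh]
    simpa [sideLen, two_mul] using this
  · obtain rfl : y = !s := by cases y <;> cases s <;> simp at hy ⊢
    have h1 : sideVal s h (!s) = sideVal s h s * sideVal s 1 (!s) := by rw [sideVal_mul, mul_one]
    have h2 : inK _ _ ((1 : CycC q), sideVal s h (!s)) =
        sHom q N s ⟨h.1, XG_le_XH N h.2⟩ * eElt q N (XEdge.cross, !s) := by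
      rw [h1, ← hsh, eElt_cross, ← map_mul, Prod.mk_mul_mk, one_mul]
    rw [h2]
    have h3 := within_sPos (q := q) s (Fin.last N)
    have h4 : Within 1 (T := XTree q N) ⟨sPos N s (Fin.last N), QuotientGroup.mk 1⟩
        (ofGam q N (eElt q N (XEdge.cross, !s)) •
          ⟨sPos N (!s) (Fin.last N), QuotientGroup.mk 1⟩) := by
      rw [ofGam_eElt]
      have := within_edge (T := XTree q N) 1 ((XEdge.cross, !s) : (XGraph q N).Edge)
      rw [one_mul] at this
      change Within 1 _ ⟨_, QuotientGroup.mk (_ * 1)⟩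
      rw [mul_one]
      cases s <;> exact this
    have h5 := (within_sPos (q := q) (!s) (Fin.last N)).symm.smul
      (ofGam q N (eElt q N (XEdge.cross, !s)))
    have h6 := (h4.trans h5).smul (ofGam q N (sHom q N s ⟨h.1, XG_le_XH N h.2⟩))
    have h7 : ofGam q N (sHom q N s ⟨h.1, XG_le_XH N h.2⟩) •
        (⟨sPos N s (Fin.last N), QuotientGroup.mk 1⟩ : (XGraph q N).CoverVertex (XTree q N)) =
        ⟨sPos N s (Fin.last N), QuotientGroup.mk 1⟩ := by
      rw [ofGam_sHom]
      exact vertexHom_smul _ _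
    rw [h7, ← mul_smul, ← map_mul] at h6
    have h8 := h3.trans h6
    rw [Moves]
    convert h8 using 1
    simp only [sideLen, Bool.xor_not, Bool.xor_self, Bool.not_false, if_true, Fin.val_last]
    ring

/-- The factor `C_{q-1}` fixes `c_1`, and the displacements by the letters of a word add up. -/
theorem moves_inK (k : CycC q × LoopGroup (XG q N)) : Moves q N (gamLen q N (inK _ _ k))
    (inK _ _ k) := by
  have h1 : ∀ l : List (Bool × LoopLetter (XG q N)), Moves q N
      ((l.map fun s => loopWt (fun h => 2 * lev q N h) (2 * N + 1) s.2).sum)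
      (inK _ _ (1, (loopNF (XG q N)).eval l)) := by
    intro l
    induction l with
    | nil =>
      have := Moves.one (q := q) (N := N)
      rwa [← map_one (inK _ _)] at this
    | cons a l ih =>
      have h2 := (moves_letter a.1 a.2.1.1 (Loop.tgt a)).mul ih
      rw [← map_mul, Prod.mk_mul_mk, one_mul] at h2
      rw [sideLen, Loop.xor_tgt] at h2
      exact h2
  have h2 := h1 ((loopNF (XG q N)).nf k.2)
  rw [NormalForm.eval_nf] at h2
  have h3 := moves_sHom (q := q) (N := N) false 0 (k.1, 1) (fun _ _ => rfl)
  have h4 := h3.mul h2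
  rw [gamLen_inK]
  convert h4 using 1
  · simp [loopLen, NormalForm.wlen]
  · rw [sHom_apply]
    have : pPart (⟨(k.1, 1), XH_mono q (Nat.zero_le N) (fun _ _ => rfl)⟩ : XH q N) = 1 := rfl
    change _ = inK _ _ (k.1, sideVal false (pPart _) false) * _
    rw [this, sideVal_one, ← map_mul, Prod.mk_mul_mk, mul_one, one_mul]

/-- An element of level `k` fixes `c_{k+1}`. -/
theorem moves_inG (x : XGInf q) : Moves q N (2 * level x) (inG _ _ x) := by
  rw [Moves, ofGam_inG]
  rcases hk : level x with _ | k
  · have hx := level_le_iff.1 hk.le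
    have : x = 1 := Subtype.ext (Prod.ext hx.1 (funext fun i => hx.2 i (Nat.zero_le i)))
    rw [this, map_one, one_smul]
    exact Within.refl _
  · have hx := level_le_iff.1 hk.le
    rw [gHom_apply hx, two_mul]
    exact within_vElt (within_c (k + 1)) _ _

theorem moves_gamLen (γ : Gam q N) : Moves q N (gamLen q N γ) γ := by
  have h1 : ∀ l : List (FactorLetter (twoFactors (CycC q × LoopGroup (XG q N)) (XGInf q))),
      Moves q N ((l.map fun s => gamLenFn q N s.1.1 s.1.2).sum) ((coprodNF _).eval l) := by
    intro l
    induction l with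
    | nil => exact Moves.one
    | cons a l ih =>
      refine Moves.mul ?_ ih
      obtain ⟨⟨b, k⟩, hk⟩ := a
      cases b
      · have := moves_inK (q := q) (N := N) k
        rwa [gamLen_inK] at this
      · exact moves_inG k
  have := h1 ((coprodNF _).nf γ)
  rwa [NormalForm.eval_nf] at this

theorem cover_connected : ((XGraph q N).cover (XTree q N)).Connected := by
  have h1 : ∀ p, ((XGraph q N).cover (XTree q N)).Reachable (basePt q N) p := by
    rintro ⟨v, g⟩
    induction g using QuotientGroup.induction_on with
    | _ g =>
      have hv : ∃ n, Within (T := XTree q N) n (basePt q N) ⟨v, QuotientGroup.mk 1⟩ := by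
        cases v with
        | c k => exact ⟨k, within_c k⟩
        | a k => exact ⟨_, within_sPos false k.succ⟩
        | b k => exact ⟨_, within_sPos true k.succ⟩
      obtain ⟨n, hn⟩ := hv
      have h2 := hn.smul g
      have h3 := moves_gamLen (toGam q N g)
      rw [Moves, ofGam_toGam] at h3
      obtain ⟨w, -⟩ := h3.trans h2
      have h4 : (g • (⟨v, QuotientGroup.mk 1⟩ : (XGraph q N).CoverVertex (XTree q N))) =
          ⟨v, QuotientGroup.mk g⟩ := by
        change (⟨v, QuotientGroup.mk (g * 1)⟩ : (XGraph q N).CoverVertex (XTree q N)) = _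
        rw [mul_one]
      rw [h4] at w
      exact ⟨w⟩
  have : Nonempty ((XGraph q N).CoverVertex (XTree q N)) := ⟨basePt q N⟩
  exact ⟨fun p p' => (h1 p).symm.trans (h1 p')⟩

/-- The length of an element is the displacement of `c_1`. -/
theorem dist_basePt (hq : 2 ≤ q) (γ : PiN q N) :
    ((XGraph q N).cover (XTree q N)).dist (basePt q N) (γ • basePt q N) = gamLen q N (toGam q N γ) := by
  refine le_antisymm ?_ ?_
  · have h3 := moves_gamLen (toGam q N γ)
    rw [Moves, ofGam_toGam] at h3
    obtain ⟨w, hw⟩ := h3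
    exact (SimpleGraph.dist_le w).trans hw
  · obtain ⟨w, hw⟩ := cover_connected.exists_walk_length_eq_dist (basePt q N) (γ • basePt q N)
    exact gamLen_le_of_within hq ⟨w, hw.le⟩

theorem translationLength_eq_of_gamLen (hq : 2 ≤ q) {γ : Gam q N} {L : ℕ}
    (h : ∀ n : ℕ, gamLen q N (γ ^ n) = n * L) : translationLength (ofGam q N γ) = L := by
  refine translationLength_eq cover_connected _ (basePt q N) L fun n => ?_
  rw [dist_basePt hq, map_pow, toGam_ofGam, h]

end Displacement

/-! ### The generating functions of the excursions -/

section Excursions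

variable {𝕜 : Type*} [Field 𝕜]

/-- The generating function of the excursions from `c_1` to one of the sides which return on the
same side. -/
def excA (q N : ℕ) (u : 𝕜) : 𝕜 := ((q : 𝕜) - 1) * ∑ k ∈ Finset.range N, (q : 𝕜) ^ k * u ^ (2 * (k + 1))

/-- The generating function of the excursions from `c_1` which pass the loop. -/
def excL (q N : ℕ) (u : 𝕜) : 𝕜 := (q : 𝕜) ^ N * u ^ (2 * N + 1)

/-- The generating function of the excursions from `c_1` into the ray. -/
def excC (q : ℕ) (u : 𝕜) : 𝕜 := ((q : 𝕜) - 1) * u ^ 2 / (1 - (q : 𝕜) * u ^ 2)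

/-- The generating function of the excursions from `c_1` to one of the sides. -/
def excS (q N : ℕ) (u : 𝕜) : 𝕜 := excA q N u + excL q N u

/-- The total weight of the paths from the ray to the ray through any number of excursions to the
sides. -/
def kap (q N : ℕ) (u : 𝕜) : 𝕜 :=
  ((q : 𝕜) - 2) + ((q : 𝕜) - 1) * (2 * (excS q N u / (1 - excS q N u)))

end Excursions

section Bounds

variable {q N : ℕ}

theorem ofReal_excA (r : ℝ) : ((excA q N r : ℝ) : ℂ) = excA q N (r : ℂ) := by simp [excA]
theorem ofReal_excL (r : ℝ) : ((excL q N r : ℝ) : ℂ) = excL q N (r : ℂ) := by simp [excL]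
theorem ofReal_excC (r : ℝ) : ((excC q r : ℝ) : ℂ) = excC q (r : ℂ) := by simp [excC]
theorem ofReal_excS (r : ℝ) : ((excS q N r : ℝ) : ℂ) = excS q N (r : ℂ) := by
  simp [excS, ofReal_excA, ofReal_excL]
theorem ofReal_kap (r : ℝ) : ((kap q N r : ℝ) : ℂ) = kap q N (r : ℂ) := by
  simp [kap, ← ofReal_excS]

theorem excS_inv (hq : 2 ≤ q) : excS q N ((q : ℝ)⁻¹) = (q : ℝ)⁻¹ := by
  have hq0 : (q : ℝ) ≠ 0 := by positivity
  unfold excS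
  induction N with
  | zero => simp [excA, excL]
  | succ N ih =>
    have h1 : excA q (N + 1) (q : ℝ)⁻¹ = excA q N (q : ℝ)⁻¹ +
        ((q : ℝ) - 1) * ((q : ℝ) ^ N * (q : ℝ)⁻¹ ^ (2 * (N + 1))) := by
      rw [excA, Finset.sum_range_succ, mul_add]; rfl
    refine Eq.trans ?_ ih
    rw [h1]
    simp only [excL]
    have hv : (q : ℝ) * (q : ℝ)⁻¹ = 1 := mul_inv_cancel₀ hq0
    generalize excA q N (q : ℝ)⁻¹ = a at *
    generalize (q : ℝ)⁻¹ = v at *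
    linear_combination (q : ℝ) ^ N * v ^ (2 * N + 1) * (1 + v) * hv

theorem sub_one_nonneg (hq : 2 ≤ q) : 0 ≤ (q : ℝ) - 1 := by
  have : (2 : ℝ) ≤ q := by exact_mod_cast hq
  linarith

theorem excA_nonneg (hq : 2 ≤ q) {r : ℝ} (hr : 0 ≤ r) : 0 ≤ excA q N r :=
  mul_nonneg (sub_one_nonneg hq) (Finset.sum_nonneg fun k _ => by positivity)

theorem excL_nonneg {r : ℝ} (hr : 0 ≤ r) : 0 ≤ excL q N r := by unfold excL; positivity

theorem excS_nonneg (hq : 2 ≤ q) {r : ℝ} (hr : 0 ≤ r) : 0 ≤ excS q N r :=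
  add_nonneg (excA_nonneg hq hr) (excL_nonneg hr)

theorem excS_mono (hq : 2 ≤ q) {r r' : ℝ} (hr : 0 ≤ r) (h : r ≤ r') : excS q N r ≤ excS q N r' := by
  have h1 := sub_one_nonneg hq
  unfold excS excA excL
  gcongr

theorem excS_le (hq : 2 ≤ q) {r : ℝ} (hr : 0 ≤ r) (h : r ≤ (q : ℝ)⁻¹) : excS q N r ≤ (q : ℝ)⁻¹ :=
  (excS_mono hq hr h).trans (excS_inv hq).le

theorem inv_le_half (hq : 2 ≤ q) : (q : ℝ)⁻¹ ≤ 1 / 2 := by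
  rw [one_div]
  exact inv_anti₀ two_pos (by exact_mod_cast hq)

theorem excS_lt_one (hq : 2 ≤ q) {r : ℝ} (hr : 0 ≤ r) (h : r ≤ (q : ℝ)⁻¹) : excS q N r < 1 := by
  linarith [excS_le (N := N) hq hr h, inv_le_half hq]

theorem mul_sq_lt_one (hq : 2 ≤ q) {r : ℝ} (hr : 0 ≤ r) (h : r ≤ (q : ℝ)⁻¹) :
    (q : ℝ) * r ^ 2 < 1 := by
  have hq0 : (0 : ℝ) < q := by positivity
  have h1 : (q : ℝ) * r ≤ 1 := by
    calc (q : ℝ) * r ≤ q * (q : ℝ)⁻¹ := by gcongr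
      _ = 1 := mul_inv_cancel₀ hq0.ne'
  have := inv_le_half hq
  nlinarith

theorem excC_nonneg (hq : 2 ≤ q) {r : ℝ} (hr : 0 ≤ r) (h : r ≤ (q : ℝ)⁻¹) : 0 ≤ excC q r :=
  div_nonneg (mul_nonneg (sub_one_nonneg hq) (sq_nonneg r)) (by linarith [mul_sq_lt_one hq hr h])

theorem excC_lt (hq : 2 ≤ q) {r : ℝ} (hr : 0 ≤ r) (h : r < (q : ℝ)⁻¹) : excC q r < (q : ℝ)⁻¹ := by
  have hq0 : (0 : ℝ) < q := by positivity
  have hq2 : (2 : ℝ) ≤ q := by exact_mod_cast hq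
  have h1 : (q : ℝ) * r < 1 := by
    calc (q : ℝ) * r < q * (q : ℝ)⁻¹ := by gcongr
      _ = 1 := mul_inv_cancel₀ hq0.ne'
  rw [excC, div_lt_iff₀ (by linarith [mul_sq_lt_one hq hr h.le]), ← sub_pos]
  have h2 : (q : ℝ)⁻¹ * (1 - q * r ^ 2) - (q - 1) * r ^ 2 = (q : ℝ)⁻¹ * ((1 - q * r) * (1 + q * r)) := by
    field_simp
    ring
  rw [h2]
  have : 0 < 1 - (q : ℝ) * r := by linarith
  positivity

theorem kap_le (hq : 2 ≤ q) {r : ℝ} (hr : 0 ≤ r) (h : r ≤ (q : ℝ)⁻¹) : kap q N r ≤ q := by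
  have hq2 : (2 : ℝ) ≤ q := by exact_mod_cast hq
  have hq0 : (q : ℝ) ≠ 0 := by positivity
  have h1 := excS_nonneg (N := N) hq hr
  have h2 := excS_le (N := N) hq hr h
  have h3 := inv_le_half hq
  have h4 : excS q N r / (1 - excS q N r) ≤ (q : ℝ)⁻¹ / (1 - (q : ℝ)⁻¹) := by
    gcongr
    linarith
  have h5 : ((q : ℝ) - 1) * ((q : ℝ)⁻¹ / (1 - (q : ℝ)⁻¹)) = 1 := by
    have : (q : ℝ) - 1 ≠ 0 := by linarith
    field_simp
  have h6 := mul_le_mul_of_nonneg_left h4 (sub_one_nonneg hq)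
  rw [kap]
  linarith

theorem kap_mul_excC_lt (hq : 2 ≤ q) {r : ℝ} (hr : 0 ≤ r) (h : r < (q : ℝ)⁻¹) :
    excC q r * kap q N r < 1 := by
  have hq0 : (0 : ℝ) < q := by positivity
  calc excC q r * kap q N r ≤ excC q r * q :=
        mul_le_mul_of_nonneg_left (kap_le hq hr h.le) (excC_nonneg hq hr h.le)
    _ < (q : ℝ)⁻¹ * q := by gcongr; exact excC_lt hq hr h
    _ = 1 := inv_mul_cancel₀ hq0.ne'

end Bounds

/-! ### Counting elements by levels -/

section Levels

variable {q N : ℕ}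

/-- The elements of `G_k` are given by `k` coordinates. -/
def equivXG (q k : ℕ) : XG q k ≃ (Fin k → ZMod q) where
  toFun x i := (x.1.2 i).toAdd
  invFun f := ⟨(1, fun i => if h : i < k then Multiplicative.ofAdd (f ⟨i, h⟩) else 1),
    rfl, fun i hi => dif_neg (by omega)⟩
  left_inv x := by
    refine Subtype.ext (Prod.ext x.2.1.symm (funext fun i => ?_))
    by_cases h : i < k
    · simp [h]
    · simp [h, x.2.2 i (by omega)]
  right_inv f := by
    funext i
    simp

/-- `H_k` is the product of `C_{q-1}` and `G_k`. -/
def equivXH (q k : ℕ) : XH q k ≃ CycC q × XG q k where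
  toFun x := (x.1.1, ⟨(1, x.1.2), rfl, x.2⟩)
  invFun x := ⟨(x.1, x.2.1.2), x.2.2.2⟩
  left_inv _ := rfl
  right_inv x := Prod.ext rfl (Subtype.ext (Prod.ext x.2.2.1.symm rfl))

theorem card_XG (k : ℕ) : Nat.card (XG q k) = q ^ k := by
  rw [Nat.card_congr (equivXG q k), Nat.card_fun]
  simp

theorem card_XH (k : ℕ) : Nat.card (XH q k) = (q - 1) * q ^ k := by
  rw [Nat.card_congr (equivXH q k), Nat.card_prod, card_XG]
  congr 1
  exact (Nat.card_congr Multiplicative.toAdd).trans (Nat.card_zmod _)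

theorem finite_XG (hq : 2 ≤ q) (k : ℕ) : Finite (XG q k) := by
  have : NeZero q := ⟨by omega⟩
  exact Finite.of_equiv _ (equivXG q k).symm

theorem finite_CycC (hq : 2 ≤ q) : Finite (CycC q) := by
  have : NeZero (q - 1) := ⟨by omega⟩
  exact Finite.of_equiv (ZMod (q - 1)) Multiplicative.ofAdd

theorem finite_XH (hq : 2 ≤ q) (k : ℕ) : Finite (XH q k) := by
  have := finite_XG hq k
  have := finite_CycC hq
  exact Finite.of_equiv _ (equivXH q k).symm

/-- The elements of level at most `k`. -/
def equivLevelLe (q k : ℕ) : {x : XGInf q // level x ≤ k} ≃ XG q k where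
  toFun x := ⟨x.1.1, level_le_iff.1 x.2⟩
  invFun x := ⟨⟨x.1, XG_le_XGInf k x.2⟩, level_le_iff.2 x.2⟩
  left_inv _ := rfl
  right_inv _ := rfl

/-- The complement of `G_k` in `G_{k+1}` has `q ^ (k + 1) - q ^ k` elements. -/
theorem card_level (hq : 2 ≤ q) (k : ℕ) :
    Nat.card {x : XGInf q // level x = k + 1} = (q - 1) * q ^ k := by
  have hfin : ∀ k, Finite {x : XGInf q // level x ≤ k} := fun k => by
    have := finite_XG hq k
    exact Finite.of_equiv _ (equivLevelLe q k).symm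
  have e : {x : XGInf q // level x ≤ k + 1} ≃
      {x : XGInf q // level x ≤ k} ⊕ {x : XGInf q // level x = k + 1} := by
    classical
    refine (Equiv.subtypeEquivRight fun x => ?_).trans (subtypeOrEquiv (fun x : XGInf q => level x ≤ k)
      (fun x => level x = k + 1) ?_)
    · omega
    · rw [Pi.disjoint_iff]
      intro x
      simp only [Prop.disjoint_iff]
      omega
  have hfin' : Finite {x : XGInf q // level x = k + 1} := by
    have := hfin (k + 1)
    exact Finite.of_injective (fun x : {x : XGInf q // level x = k + 1} =>
      (⟨x.1, x.2.le⟩ : {x : XGInf q // level x ≤ k + 1})) fun x y h =>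
        Subtype.ext (congrArg (fun z => z.1) h)
  have h1 := Nat.card_congr e
  have := hfin k
  rw [Nat.card_sum, Nat.card_congr (equivLevelLe q k), Nat.card_congr (equivLevelLe q (k + 1)), card_XG,
    card_XG, pow_succ] at h1
  obtain ⟨p, rfl⟩ : ∃ p, q = p + 1 := ⟨q - 1, by omega⟩
  simp only [Nat.add_sub_cancel]
  nlinarith

/-- Sums over the nontrivial elements of the union of the groups `G_k`, arranged by levels. -/
theorem hasSum_level (hq : 2 ≤ q) {g : ℕ → ℂ} {s : ℂ}
    (hs : Summable fun k => ((q : ℝ) - 1) * (q : ℝ) ^ k * ‖g (k + 1)‖)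
    (h : HasSum (fun k => ((q : ℂ) - 1) * (q : ℂ) ^ k * g (k + 1)) s) :
    HasSum (fun x : {x : XGInf q // x ≠ 1} => g (level x.1)) s := by
  have hcast : (((q - 1 : ℕ) : ℕ) : ℝ) = (q : ℝ) - 1 := by rw [Nat.cast_sub (by omega)]; simp
  have hcastC : (((q - 1 : ℕ) : ℕ) : ℂ) = (q : ℂ) - 1 := by rw [Nat.cast_sub (by omega)]; simp
  let e : (Σ k : ℕ, {x : XGInf q // level x = k + 1}) ≃ {x : XGInf q // x ≠ 1} :=
    { toFun := fun y => ⟨y.2.1, fun h => by have := y.2.2; rw [h, level_one] at this; omega⟩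
      invFun := fun x => ⟨level x.1 - 1, x.1, by have := level_pos x.2; omega⟩
      left_inv := by
        rintro ⟨k, x, hx⟩
        have : level x - 1 = k := by omega
        subst this
        rfl
      right_inv := fun x => rfl }
  rw [← e.hasSum_iff]
  have hfin : ∀ k, Finite {x : XGInf q // level x = k + 1} := fun k =>
    Nat.finite_of_card_ne_zero (by
      rw [card_level hq]
      have : 0 < q - 1 := by omega
      positivity)
  have hsum : Summable (fun y : Σ k : ℕ, {x : XGInf q // level x = k + 1} => ‖g (level y.2.1)‖) := by
    rw [summable_sigma_of_nonneg fun _ => norm_nonneg _]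
    refine ⟨fun k => ?_, ?_⟩
    · have := Fintype.ofFinite {x : XGInf q // level x = k + 1}
      exact (hasSum_fintype _).summable
    · convert hs using 2 with k
      have := Fintype.ofFinite {x : XGInf q // level x = k + 1}
      rw [tsum_fintype, Finset.sum_congr rfl fun x _ => by rw [x.2], Finset.sum_const,
        Finset.card_univ, ← Nat.card_eq_fintype_card, card_level hq, nsmul_eq_mul]
      push_cast
      rw [hcast]
  refine HasSum.sigma_of_hasSum h (fun k => ?_) hsum.of_norm
  have := Fintype.ofFinite {x : XGInf q // level x = k + 1}
  convert hasSum_fintype _ using 1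
  simp only [Function.comp]
  rw [Finset.sum_congr rfl fun x _ => (by change g (level x.1) = g (k + 1); rw [x.2]),
    Finset.sum_const, Finset.card_univ, ← Nat.card_eq_fintype_card, card_level hq, nsmul_eq_mul]
  push_cast
  rw [hcastC]

theorem norm_mul_sq_lt (hq : 2 ≤ q) {u : ℂ} (hu : ‖u‖ < (q : ℝ)⁻¹) : ‖(q : ℂ) * u ^ 2‖ < 1 := by
  rw [norm_mul, norm_pow, Complex.norm_natCast]
  exact mul_sq_lt_one hq (norm_nonneg u) hu.le

theorem hasSum_ray (hq : 2 ≤ q) {u : ℂ} (hu : ‖u‖ < (q : ℝ)⁻¹) :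
    HasSum (fun x : {x : XGInf q // x ≠ 1} => u ^ (2 * level x.1)) (excC q u) := by
  have h1 := norm_mul_sq_lt hq hu
  refine hasSum_level hq (g := fun k => u ^ (2 * k)) ?_ ?_
  · have := (summable_geometric_of_lt_one (norm_nonneg _) h1).mul_left (((q : ℝ) - 1) * ‖u‖ ^ 2)
    refine this.congr fun k => ?_
    simp only [norm_mul, norm_pow, Complex.norm_natCast]
    ring
  · have := (hasSum_geometric_of_norm_lt_one h1).mul_left (((q : ℂ) - 1) * u ^ 2)
    rw [← div_eq_mul_inv] at this
    refine this.congr_fun fun k => ?_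
    ring

theorem sum_lev (hq : 2 ≤ q) (u : ℂ) [Fintype {h : XG q N // h ≠ 1}] :
    ∑ h : {h : XG q N // h ≠ 1}, u ^ (2 * lev q N h.1) = excA q N u := by
  have h1 : HasSum (fun x : {x : XGInf q // x ≠ 1} =>
      if level x.1 ≤ N then u ^ (2 * level x.1) else 0) (excA q N u) := by
    have hf : ∀ k ∉ Finset.range N, ¬ k + 1 ≤ N := fun k hk => by simpa using hk
    refine hasSum_level hq (g := fun k => if k ≤ N then u ^ (2 * k) else 0) ?_ ?_
    · refine summable_of_ne_finset_zero (s := Finset.range N) fun k hk => ?_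
      rw [if_neg (hf k hk)]; simp
    · rw [excA, Finset.mul_sum]
      have h0 : ∀ k ∉ Finset.range N, ((q : ℂ) - 1) * (q : ℂ) ^ k *
          (if k + 1 ≤ N then u ^ (2 * (k + 1)) else 0) = 0 := fun k hk => by
        rw [if_neg (hf k hk), mul_zero]
      have h5 : HasSum _ _ := hasSum_sum_of_ne_finset_zero h0
      convert h5 using 1
      refine Finset.sum_congr rfl fun k hk => ?_
      rw [if_pos (by simpa using hk)]
      ring
  let j : {h : XG q N // h ≠ 1} → {x : XGInf q // x ≠ 1} := fun h =>
    ⟨⟨h.1.1, XG_le_XGInf N h.1.2⟩, fun he => h.2 (Subtype.ext (congrArg (fun z : XGInf q => z.1) he))⟩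
  have hj : Function.Injective j := fun h h' he => by
    have := congrArg (fun z => z.1.1) he
    exact Subtype.ext (Subtype.ext this)
  have h2 := (hj.hasSum_iff fun x hx => if_neg fun hl => hx
    ⟨⟨⟨x.1.1, level_le_iff.1 hl⟩, fun he => x.2 (Subtype.ext (congrArg (fun z : XG q N => z.1) he))⟩,
      rfl⟩).2 h1
  have h3 := h2.unique (hasSum_fintype _)
  rw [h3]
  refine Finset.sum_congr rfl fun h _ => ?_
  exact (if_pos (level_le_iff.2 h.1.2)).symm

end Levels

/-! ### Growth series of the free factors -/

theorem HasSum.mul_prod {ι κ : Type*} {f : ι → ℂ} {g : κ → ℂ} {a b : ℂ} (hf : HasSum f a)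
    (hg : HasSum g b) : HasSum (fun p : ι × κ => f p.1 * g p.2) (a * b) :=
  hf.mul hg (summable_mul_of_summable_norm hf.summable.norm hg.summable.norm)

theorem hasSum_norm_of_ofReal {ι : Type*} {n : ι → ℕ} {u : ℂ} {s : ℝ}
    (h : HasSum (fun i => ((‖u‖ : ℝ) : ℂ) ^ n i) (s : ℂ)) : HasSum (fun i => ‖u ^ n i‖) s := by
  refine Complex.hasSum_ofReal.1 (h.congr_fun fun i => ?_)
  simp

/-- The weight of a cyclic word with multiplicative weights and forbidden transitions. -/
theorem transWeight_ite {α : Type*} {R : α → α → Prop} [DecidableRel R] (y : α → ℂ) {l : List α}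
    (hl : l ≠ []) (hR : Cycle.Chain R (l : Cycle α)) :
    transWeight (fun s t => if R s t then y s else 0) l = (l.map y).prod := by
  obtain ⟨a, l, rfl⟩ := List.exists_cons_of_ne_nil hl
  rw [Cycle.chain_coe_cons] at hR
  rw [transWeight_cons]
  have key : ∀ (b : α) (l : List α), List.IsChain R (b :: (l ++ [a])) →
      pathTo (fun s t => if R s t then y s else 0) (fun s => if R s a then y s else 0) b l =
        ((b :: l).map y).prod := by
    intro b l
    induction l generalizing b with
    | nil => intro h; simp [pathTo, (List.isChain_cons_cons.1 h).1]
    | cons c l ih =>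
      intro h
      obtain ⟨h1, h2⟩ := List.isChain_cons_cons.1 h
      rw [pathTo, ih c h2, if_pos h1]
      simp
  exact key a l hR

theorem transWeight_ite_cyc_eq_zero {α : Type*} {R : α → α → Prop} [DecidableRel R] (y : α → ℂ)
    {c : Cycle α} (hR : ¬ c.Chain R) :
    (transWeight fun s t => if R s t then y s else 0).cyc c = 0 := by
  by_contra h
  refine hR ((chain_of_transWeight_ne_zero h).imp fun s t hst => ?_)
  by_contra hn
  exact hst (if_neg hn)

theorem transWeight_eq_zero {α : Type*} {ω : α → α → ℂ} (h : ∀ s t, ω s t = 0) (c : PrimeCyc α) :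
    (transWeight ω).cyc c.1 = 0 := by
  obtain ⟨c, hc⟩ := c
  induction c using Quotient.inductionOn with
  | _ l =>
    change transWeight ω l = 0
    obtain ⟨a, l, rfl⟩ := List.exists_cons_of_ne_nil (isPrime_coe.1 hc).1
    rw [transWeight_cons]
    cases l <;> simp [pathTo, h]

open Classical in
/-- The Euler product over the prime cyclically reduced words of a normal form. -/
theorem NormalForm.hasSum_primeWord {Γ Λ I : Type*} [Group Γ] (𝒩 : NormalForm Γ Λ I) (y : Λ → ℂ)
    {s : ℂ} (h : HasSum (fun c : PrimeCyc Λ => -Complex.log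
      (1 - (transWeight fun a b => if 𝒩.Follow a b then y a else 0).cyc c.1)) s) :
    HasSum (fun c : 𝒩.PrimeWord => -Complex.log (1 - ((𝒩.rep c).map y).prod)) s := by
  refine ((Subtype.val_injective (p := fun c : PrimeCyc Λ => c.1.Chain 𝒩.Follow)).hasSum_iff
    fun c hc => ?_).2 h |>.congr_fun fun c => ?_
  · rw [transWeight_ite_cyc_eq_zero y (fun h' => hc ⟨⟨c, h'⟩, rfl⟩)]
    simp
  · have h1 := 𝒩.cycRed_rep c
    simp only [Function.comp]
    rw [← 𝒩.coe_rep c, CyclicWeight.cyc_coe, transWeight_ite y h1.1 h1.2]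

theorem prod_map_pow {Λ : Type*} (w : Λ → ℕ) (u : ℂ) (l : List Λ) :
    (l.map fun s => u ^ w s).prod = u ^ (l.map w).sum := by
  induction l with
  | nil => simp
  | cons a l ih => simp [ih, pow_add]

section DoubleCover

variable {S : Type*} (ε : S → Bool)

theorem isChain_liftPath (i : Bool) (w : List S) :
    (liftPath ε i w).IsChain (fun a b => b.1 = nextState ε a.1 a.2) := by
  induction w generalizing i with
  | nil => exact List.IsChain.nil
  | cons s w ih =>
    rw [liftPath, List.isChain_cons]
    refine ⟨fun b hb => ?_, ih _⟩
    cases w with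
    | nil => simp [liftPath] at hb
    | cons t w =>
      simp only [liftPath, List.head?_cons, Option.mem_def, Option.some.injEq] at hb
      rw [← hb]

theorem eq_liftPath_of_isChain {a : Bool × S} {l : List (Bool × S)}
    (h : (a :: l).IsChain (fun a b => b.1 = nextState ε a.1 a.2)) :
    l = liftPath ε (nextState ε a.1 a.2) (l.map Prod.snd) := by
  induction l generalizing a with
  | nil => rfl
  | cons b l ih =>
    obtain ⟨h1, h2⟩ := List.isChain_cons_cons.1 h
    rw [List.map_cons, liftPath, ← h1, ← ih h2]

theorem mem_range_liftCons {l : List (Bool × S)} (hl : l ≠ [])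
    (h : l.IsChain (fun a b => b.1 = nextState ε a.1 a.2)) : l ∈ Set.range (liftCons ε) := by
  obtain ⟨a, l, rfl⟩ := List.exists_cons_of_ne_nil hl
  refine ⟨(a.1, a.2, l.map Prod.snd), ?_⟩
  rw [liftCons, liftPath, ← eq_liftPath_of_isChain ε h]

theorem map_snd_liftCons (y : Bool × S × List S) : (liftCons ε y).map Prod.snd = y.2.1 :: y.2.2 :=
  map_snd_liftPath ε _ _

/-- The generating function of the paths in the double cover, for both initial states. -/
theorem hasSum_liftCons {x : S → ℂ} (hx : Summable fun s => ‖x s‖) (h1 : ∑' s, ‖x s‖ < 1) :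
    HasSum (fun y : Bool × S × List S => ((liftCons ε y).map fun a => x a.2).prod)
      (2 * ((∑' s, x s) / (1 - ∑' s, x s))) := by
  have h2 := HasSum.mul_prod hx.of_norm.hasSum (hasSum_words_one hx h1).2
  have h3 := HasSum.mul_prod (hasSum_fintype fun _ : Bool => (1 : ℂ)) h2
  rw [Fintype.sum_bool, one_add_one_eq_two, ← div_eq_mul_inv] at h3
  refine h3.congr_fun fun y => ?_
  rw [show (fun a : Bool × S => x a.2) = x ∘ Prod.snd from rfl, ← List.map_map, map_snd_liftCons]
  simp

end DoubleCover

section Loop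

variable {q N : ℕ}

variable (q N) in
/-- The length of a letter of the free product of `G_N` and an infinite cyclic group. -/
def letterLen (s : LoopLetter (XG q N)) : ℕ := loopWt (fun h => 2 * lev q N h) (2 * N + 1) s

/-- The letters which do not pass the loop, and those which do. -/
def loopLetterEquiv (P : Type) [Group P] : {h : P // h ≠ 1} ⊕ P ≃ LoopLetter P where
  toFun := Sum.elim (fun h => ⟨(h.1, false), fun e => h.2 (congrArg Prod.fst e)⟩)
    fun h => ⟨(h, true), fun e => Bool.noConfusion (congrArg Prod.snd e)⟩
  invFun s := if hs : s.1.2 = false then Sum.inl ⟨s.1.1, fun h => s.2 (Prod.ext h hs)⟩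
    else Sum.inr s.1.1
  left_inv x := by rcases x with x | x <;> simp
  right_inv s := by
    obtain ⟨⟨h, e⟩, hs⟩ := s
    cases e <;> simp

theorem hasSum_loopLetter (hq : 2 ≤ q) (u : ℂ) (c : Bool → ℂ) :
    HasSum (fun s : LoopLetter (XG q N) => c s.1.2 * u ^ letterLen q N s)
      (c false * excA q N u + c true * excL q N u) := by
  have := finite_XG hq N
  have := Fintype.ofFinite (XG q N)
  have := Fintype.ofFinite {h : XG q N // h ≠ 1}
  rw [← (loopLetterEquiv (XG q N)).hasSum_iff]
  convert hasSum_fintype _ using 1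
  rw [Fintype.sum_sum_type, ← sum_lev hq u, Finset.mul_sum]
  congr 1
  have : ∀ h : XG q N, ((fun s : LoopLetter (XG q N) => c s.1.2 * u ^ letterLen q N s) ∘
      loopLetterEquiv (XG q N)) (Sum.inr h) = c true * u ^ (2 * N + 1) := fun h => rfl
  rw [Finset.sum_congr rfl fun h _ => this h, Finset.sum_const, Finset.card_univ,
    ← Nat.card_eq_fintype_card, card_XG, nsmul_eq_mul, excL]
  push_cast
  ring

theorem hasSum_loopLetter_pow (hq : 2 ≤ q) (u : ℂ) :
    HasSum (fun s : LoopLetter (XG q N) => u ^ letterLen q N s) (excS q N u) := by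
  simpa [excS] using hasSum_loopLetter hq u fun _ => 1

/-- A letter that does not pass the loop is followed by a letter that starts on the other side, so
the nontrivial character of the double cover is `-1` on it. -/
theorem hasSum_loopLetter_sign (hq : 2 ≤ q) (u : ℂ) :
    HasSum (fun s : LoopLetter (XG q N) => if s.1.2 then u ^ letterLen q N s else -u ^ letterLen q N s)
      (excL q N u - excA q N u) := by
  have := hasSum_loopLetter (N := N) hq u fun b => if b then 1 else -1
  simp only [if_true, Bool.false_eq_true, if_false, one_mul, neg_mul] at this
  rw [neg_add_eq_sub] at this
  refine this.congr_fun fun s => ?_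
  split_ifs <;> simp

theorem hasSum_norm_loopLetter (hq : 2 ≤ q) (u : ℂ) :
    HasSum (fun s : LoopLetter (XG q N) => ‖u ^ letterLen q N s‖) (excS q N ‖u‖) := by
  have := hasSum_loopLetter_pow (N := N) hq (‖u‖ : ℂ)
  rw [← ofReal_excS] at this
  exact hasSum_norm_of_ofReal this

theorem excS_norm_lt (hq : 2 ≤ q) {u : ℂ} (hu : ‖u‖ < (q : ℝ)⁻¹) :
    ∑' s : LoopLetter (XG q N), ‖u ^ letterLen q N s‖ < 1 := by
  rw [(hasSum_norm_loopLetter hq u).tsum_eq]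
  exact excS_lt_one hq (norm_nonneg u) hu.le

/-- The reduced words of the loop group are the paths of a double cover: a letter arrives on the
side `tgt`, and the next one starts on the other side. -/
theorem follow_loopNF {P : Type} [Group P] (a b : Bool × LoopLetter P) :
    (loopNF P).Follow a b ↔ b.1 = nextState (fun s => s.1.2) a.1 a.2 := by
  obtain ⟨i, ⟨⟨h, e⟩, hs⟩⟩ := a
  obtain ⟨j, t⟩ := b
  change xor i e ≠ j ↔ j = if e then i else !i
  cases i <;> cases e <;> cases j <;> simp

open Classical in
/-- The Euler product of the free product of `G_N` and an infinite cyclic group. -/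
theorem hasSum_loop_primeWord (hq : 2 ≤ q) {u : ℂ} (hu : ‖u‖ < (q : ℝ)⁻¹) :
    HasSum (fun c : (loopNF (XG q N)).PrimeWord => -Complex.log
        (1 - u ^ (((loopNF (XG q N)).rep c).map fun a => letterLen q N a.2).sum))
      (-Complex.log (1 - excS q N u) + -Complex.log (1 + excA q N u - excL q N u)) := by
  have h1 := hasSum_doubleCover (fun s : LoopLetter (XG q N) => s.1.2)
    (hasSum_norm_loopLetter hq u).summable (excS_norm_lt hq hu)
  rw [(hasSum_loopLetter_pow hq u).tsum_eq, (hasSum_loopLetter_sign hq u).tsum_eq,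
    ← sub_add, add_comm (1 - _), ← add_sub_assoc, add_comm (excA q N u)] at h1
  refine ((loopNF (XG q N)).hasSum_primeWord (fun a => u ^ letterLen q N a.2) ?_).congr_fun
    fun c => by rw [prod_map_pow]
  have h3 : (fun a b => if (loopNF (XG q N)).Follow a b then u ^ letterLen q N a.2 else 0) =
      coverTrans (fun s : LoopLetter (XG q N) => s.1.2) (fun s => u ^ letterLen q N s) := by
    funext a b
    rw [coverTrans]
    exact if_congr (follow_loopNF a b) rfl rfl
  rwa [h3]

theorem summable_loop_primeWord (hq : 2 ≤ q) {u : ℂ} (hu : ‖u‖ < (q : ℝ)⁻¹) :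
    Summable fun c : (loopNF (XG q N)).PrimeWord =>
      ‖u‖ ^ (((loopNF (XG q N)).rep c).map fun a => letterLen q N a.2).sum := by
  classical
  have h1 := summable_coverTrans (fun s : LoopLetter (XG q N) => s.1.2)
    (hasSum_norm_loopLetter hq u).summable (excS_norm_lt hq hu)
  have hinj : Function.Injective (loopNF (XG q N)).rep := fun c c' h => by
    have := congrArg (fun l : List _ => (l : Cycle (Bool × LoopLetter (XG q N)))) h
    simp only [NormalForm.coe_rep] at this
    exact Subtype.ext (Subtype.ext this)
  refine (h1.comp_injective hinj).congr fun c => ?_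
  have h2 := (loopNF (XG q N)).cycRed_rep c
  have h3 : coverTrans (fun s : LoopLetter (XG q N) => s.1.2) (fun s => u ^ letterLen q N s) =
      fun a b => if (loopNF (XG q N)).Follow a b then u ^ letterLen q N a.2 else 0 := by
    funext a b
    rw [coverTrans]
    exact (if_congr (follow_loopNF a b) rfl rfl).symm
  simp only [Function.comp]
  rw [h3, transWeight_ite (fun a : Bool × LoopLetter (XG q N) => u ^ letterLen q N a.2) h2.1 h2.2,
    prod_map_pow, norm_pow]

variable (q N) in
/-- The length of an element of the free product of `G_N` and an infinite cyclic group. -/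
def fLen (f : LoopGroup (XG q N)) : ℕ := loopLen (fun h => 2 * lev q N h) (2 * N + 1) f

theorem red_liftCons (y : Bool × LoopLetter (XG q N) × List (LoopLetter (XG q N))) :
    (loopNF (XG q N)).Red (liftCons (fun s => s.1.2) y) :=
  (isChain_liftPath (fun s : LoopLetter (XG q N) => s.1.2) y.1 (y.2.1 :: y.2.2)).imp
    fun a b h => (follow_loopNF a b).2 h

/-- The growth series of the free product of `G_N` and an infinite cyclic group. -/
theorem hasSum_fLen (hq : 2 ≤ q) {u : ℂ} (hu : ‖u‖ < (q : ℝ)⁻¹) :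
    HasSum (fun f : LoopGroup (XG q N) => u ^ fLen q N f)
      (1 + 2 * (excS q N u / (1 - excS q N u))) := by
  classical
  have h1 := hasSum_liftCons (fun s : LoopLetter (XG q N) => s.1.2)
    (hasSum_norm_loopLetter hq u).summable (excS_norm_lt hq hu)
  rw [(hasSum_loopLetter_pow hq u).tsum_eq] at h1
  let j : Bool × LoopLetter (XG q N) × List (LoopLetter (XG q N)) → LoopGroup (XG q N) := fun y =>
    (loopNF (XG q N)).eval (liftCons (fun s => s.1.2) y)
  have hj : Function.Injective j := fun y y' h =>
    liftCons_injective _ ((loopNF (XG q N)).eval_inj (red_liftCons y) (red_liftCons y') h)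
  have hj1 : ∀ y, j y ≠ 1 := fun y h => by
    have := (loopNF (XG q N)).eval_inj (red_liftCons y) (l' := []) List.IsChain.nil h
    simp [liftCons, liftPath] at this
  have h2 : HasSum (fun f : LoopGroup (XG q N) => if f = 1 then 0 else u ^ fLen q N f)
      (2 * (excS q N u / (1 - excS q N u))) := by
    refine (hj.hasSum_iff fun f hf => ?_).1 (h1.congr_fun fun y => ?_)
    · refine if_pos (by_contra fun hf1 => hf ?_)
      have hred := (loopNF (XG q N)).red_nf f
      obtain ⟨y, hy⟩ := mem_range_liftCons (fun s : LoopLetter (XG q N) => s.1.2)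
        (l := (loopNF (XG q N)).nf f) (fun h => hf1 (by
          rw [← (loopNF (XG q N)).eval_nf f, h, NormalForm.eval_nil]))
        (hred.imp fun a b h => (follow_loopNF a b).1 h)
      exact ⟨y, by simp only [j]; rw [hy, NormalForm.eval_nf]⟩
    · simp only [Function.comp]
      rw [if_neg (hj1 y), fLen, loopLen, NormalForm.wlen_eval _ _ (red_liftCons y)]
      exact (prod_map_pow (fun a : Bool × LoopLetter (XG q N) => letterLen q N a.2) u _).symm
  have h3 := (hasSum_ite_eq (1 : LoopGroup (XG q N)) (1 : ℂ)).add h2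
  refine h3.congr_fun fun f => ?_
  by_cases hf : f = 1
  · subst hf
    simp [fLen, loopLen, NormalForm.wlen_one]
  · simp [hf]

/-- The growth series of the factor `C_{q-1} × (C_q^N * ℤ)`, without the trivial element. -/
theorem hasSum_kLen (hq : 2 ≤ q) {u : ℂ} (hu : ‖u‖ < (q : ℝ)⁻¹) :
    HasSum (fun k : {k : CycC q × LoopGroup (XG q N) // k ≠ 1} => u ^ fLen q N k.1.2)
      (kap q N u) := by
  classical
  have := finite_CycC hq
  have := Fintype.ofFinite (CycC q)
  have h1 := HasSum.mul_prod (hasSum_fintype fun _ : CycC q => (1 : ℂ)) (hasSum_fLen (N := N) hq hu)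
  have hc : ∑ _ : CycC q, (1 : ℂ) = (q : ℂ) - 1 := by
    rw [Finset.sum_const, Finset.card_univ, ← Nat.card_eq_fintype_card,
      (Nat.card_congr Multiplicative.toAdd).trans (Nat.card_zmod _), nsmul_eq_mul, mul_one,
      Nat.cast_sub (by omega), Nat.cast_one]
  rw [hc] at h1
  have h2 := h1.sub (hasSum_ite_eq (1 : CycC q × LoopGroup (XG q N)) (1 : ℂ))
  have h3 : HasSum (fun k : CycC q × LoopGroup (XG q N) => if k = 1 then 0 else u ^ fLen q N k.2)
      (kap q N u) := by
    have he : kap q N u = ((q : ℂ) - 1) * (1 + 2 * (excS q N u / (1 - excS q N u))) - 1 := by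
      rw [kap]; ring
    rw [he]
    refine h2.congr_fun fun k => ?_
    by_cases hk : k = 1
    · subst hk
      simp [fLen, loopLen, NormalForm.wlen_one]
    · simp [hk]
  refine ((Subtype.val_injective (p := fun k : CycC q × LoopGroup (XG q N) => k ≠ 1)).hasSum_iff
    fun k hk => if_pos (by simpa using hk)).2 h3 |>.congr_fun fun k => ?_
  simp [k.2]

theorem hasSum_norm_kLen (hq : 2 ≤ q) {u : ℂ} (hu : ‖u‖ < (q : ℝ)⁻¹) :
    HasSum (fun k : {k : CycC q × LoopGroup (XG q N) // k ≠ 1} => ‖u ^ fLen q N k.1.2‖)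
      (kap q N ‖u‖) := by
  have := hasSum_kLen (N := N) hq (u := (‖u‖ : ℂ)) (by simpa using hu)
  rw [← ofReal_kap] at this
  exact hasSum_norm_of_ofReal this

theorem hasSum_norm_ray (hq : 2 ≤ q) {u : ℂ} (hu : ‖u‖ < (q : ℝ)⁻¹) :
    HasSum (fun x : {x : XGInf q // x ≠ 1} => ‖u ^ (2 * level x.1)‖) (excC q ‖u‖) := by
  have := hasSum_ray hq (u := (‖u‖ : ℂ)) (by simpa using hu)
  rw [← ofReal_excC] at this
  exact hasSum_norm_of_ofReal this

end Loop

/-! ### Conjugacy classes of primitive hyperbolic elements -/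

section Classes

variable {q N : ℕ}

theorem isOfFinOrder_XGInf (hq : 2 ≤ q) (x : XGInf q) : IsOfFinOrder x := by
  refine isOfFinOrder_iff_pow_eq_one.2 ⟨q, by omega, Subtype.ext (Prod.ext ?_ (funext fun i => ?_))⟩
  · change x.1.1 ^ q = 1
    rw [x.2.1, one_pow]
  · change x.1.2 i ^ q = 1
    apply Multiplicative.toAdd.injective
    rw [toAdd_pow, nsmul_eq_mul, CharP.cast_eq_zero, zero_mul, toAdd_one]

theorem isOfFinOrder_of_isElliptic (hq : 2 ≤ q) (f : LoopGroup (XG q N))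
    (h : (loopNF (XG q N)).IsElliptic f) : IsOfFinOrder f := by
  have := finite_XG hq N
  exact loopNF_isOfFinOrder h

variable (q N) in
/-- The index type of the conjugacy classes of primitive hyperbolic elements. -/
abbrev Index : Type := ClassIndex (CycC q) (XGInf q) (loopNF (XG q N))

variable (q N) in
/-- The normal form of the fundamental group. -/
abbrev gamNF : NormalForm (Gam q N) (FactorLetter (twoFactors (CycC q × LoopGroup (XG q N)) (XGInf q)))
    Bool := freeProdNF (CycC q × LoopGroup (XG q N)) (XGInf q)

/-- The length of a primitive cyclic word of the free product of `G_N` and an infinite cyclic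
group. -/
def loopWordLen (c : (loopNF (XG q N)).PrimeWord) : ℕ :=
  (((loopNF (XG q N)).rep c).map fun a => letterLen q N a.2).sum

/-- The translation lengths of the conjugacy classes. -/
def idxLen : Index q N → ℕ
  | .inl x => (x.1.1 + 1) * loopWordLen x.1.2.2
  | .inr c => (((gamNF q N).rep c).map fun s => gamLenFn q N s.1.1 s.1.2).sum

/-- The representatives are cyclically reduced, so their lengths are multiplicative on powers. -/
theorem gamLen_classRep_pow (x : Index q N) (n : ℕ) :
    gamLen q N (classRep _ _ _ x ^ n) = n * idxLen x := by
  rcases x with ⟨⟨m, h, c⟩, hx⟩ | c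
  · simp only [classRep, idxLen]
    rw [← map_pow, gamLen_inK, Prod.pow_mk, ← pow_mul, loopLen,
      NormalForm.wlen_eval_pow _ _ ((loopNF (XG q N)).cycRed_rep c)]
    change (m + 1) * n * loopWordLen c = _
    ring
  · exact NormalForm.wlen_eval_pow _ _ ((gamNF q N).cycRed_rep c) n

theorem letterLen_pos (s : LoopLetter (XG q N)) : 0 < letterLen q N s := by
  obtain ⟨⟨h, e⟩, hs⟩ := s
  cases e
  · have hh : h ≠ 1 := fun he => hs (by rw [he])
    have : 0 < lev q N h := level_pos fun he =>
      hh (Subtype.ext (congrArg (fun z : XGInf q => z.1) he))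
    change 0 < 2 * lev q N h
    omega
  · change 0 < 2 * N + 1
    omega

theorem sum_map_pos {α : Type*} {w : α → ℕ} {l : List α} (h : ∃ a ∈ l, 0 < w a) :
    0 < (l.map w).sum := by
  obtain ⟨a, ha, hw⟩ := h
  exact lt_of_lt_of_le hw (List.single_le_sum (by simp) _ (List.mem_map_of_mem ha))

theorem loopWordLen_pos (c : (loopNF (XG q N)).PrimeWord) : 0 < loopWordLen c := by
  obtain ⟨a, l, h⟩ := List.exists_cons_of_ne_nil ((loopNF (XG q N)).cycRed_rep c).1
  exact sum_map_pos ⟨a, by rw [h]; simp, letterLen_pos _⟩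

theorem idxLen_pos (x : Index q N) : 0 < idxLen x := by
  rcases x with ⟨⟨m, h, c⟩, hx⟩ | c
  · exact Nat.mul_pos (Nat.succ_pos m) (loopWordLen_pos c)
  · -- a cyclically reduced word contains a letter of the second factor
    have key : ∀ s : FactorLetter (twoFactors (CycC q × LoopGroup (XG q N)) (XGInf q)),
        s.1.1 = true → 0 < gamLenFn q N s.1.1 s.1.2 := by
      rintro ⟨⟨b, x⟩, hx⟩ hb
      cases b
      · exact absurd hb (by simp)
      · exact Nat.mul_pos two_pos (level_pos (q := q) hx)
    refine sum_map_pos ?_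
    have h := (gamNF q N).cycRed_rep c
    rw [NormalForm.cycRed_iff] at h
    obtain ⟨a, l, hl⟩ := List.exists_cons_of_ne_nil h.1
    rw [hl] at h ⊢
    by_cases ha : a.1.1 = true
    · exact ⟨a, by simp, key a ha⟩
    · cases l with
      | nil => exact absurd rfl (h.2.2 a (by simp) a (by simp))
      | cons b l =>
        have hab : a.1.1 ≠ b.1.1 := (List.isChain_cons_cons.1 h.2.1).1
        refine ⟨b, by simp, key b ?_⟩
        revert ha hab
        cases a.1.1 <;> cases b.1.1 <;> simp

theorem translationLength_classRep (hq : 2 ≤ q) (x : Index q N) :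
    translationLength (ofGam q N (classRep _ _ _ x)) = idxLen x :=
  translationLength_eq_of_gamLen hq (gamLen_classRep_pow x)

theorem isPrimitiveHyperbolic_classRep (hq : 2 ≤ q) (x : Index q N) :
    IsPrimitiveHyperbolic (ofGam q N (classRep _ _ _ x)) := by
  refine ⟨isHyperbolic_of_translationLength_pos ?_, ?_⟩
  · rw [translationLength_classRep hq]; exact idxLen_pos x
  · exact (NotPower.map_equiv (piEquiv q N).symm).2
      (notPower_classRep _ (isOfFinOrder_of_isElliptic hq) x)

/-- The conjugacy class with a given index. -/
def classOf (hq : 2 ≤ q) (x : Index q N) : (XGraph q N).PrimitiveClass (XTree q N) :=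
  ⟨ConjClasses.mk (ofGam q N (classRep _ _ _ x)), _, isPrimitiveHyperbolic_classRep hq x, rfl⟩

/-- Elements that are not proper powers are conjugate to exactly one of the representatives, and the
representatives are hyperbolic because their lengths are positive. -/
theorem classOf_bijective (hq : 2 ≤ q) : Function.Bijective (classOf (N := N) hq) := by
  constructor
  · intro x y h
    have h1 : IsConj (ofGam q N (classRep _ _ _ x)) (ofGam q N (classRep _ _ _ y)) :=
      ConjClasses.mk_eq_mk_iff_isConj.1 (congrArg Subtype.val h)
    have h2 := (toGam q N).map_isConj h1
    rw [toGam_ofGam, toGam_ofGam] at h2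
    exact classRep_injective _ h2
  · rintro ⟨_, γ, hγ, rfl⟩
    have := finite_CycC hq
    have h1 : NotPower (toGam q N γ) := (NotPower.map_equiv (piEquiv q N)).2 hγ.2
    obtain ⟨x, hx⟩ := exists_isConj_classRep _ (isOfFinOrder_of_isElliptic hq)
      (isOfFinOrder_XGInf hq) h1
    have h2 := (ofGam q N).map_isConj hx
    rw [ofGam_toGam] at h2
    exact ⟨x, Subtype.ext (ConjClasses.mk_eq_mk_iff_isConj.2 h2)⟩

theorem classLength_classOf (hq : 2 ≤ q) (x : Index q N) : classLength (classOf hq x).1 = idxLen x :=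
  translationLength_classRep hq x

end Classes

/-! ### The Selberg zeta function as an Euler product -/

section Selberg

variable {q N : ℕ}

/-- The Euler product over the alternating words in the two free factors. -/
theorem hasSum_gam_primeWord (hq : 2 ≤ q) {u : ℂ} (hu : ‖u‖ < (q : ℝ)⁻¹) :
    HasSum (fun c : (gamNF q N).PrimeWord => -Complex.log
        (1 - u ^ (((gamNF q N).rep c).map fun s => gamLenFn q N s.1.1 s.1.2).sum))
      (-Complex.log (1 - excC q u * kap q N u)) := by
  classical
  let Λ := FactorLetter (twoFactors (CycC q × LoopGroup (XG q N)) (XGInf q))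
  let y : Λ → ℂ := fun s => u ^ gamLenFn q N s.1.1 s.1.2
  let p : Λ → Prop := fun s => s.1.1 = true
  let ω : Λ → Λ → ℂ := fun a b => if (gamNF q N).Follow a b then y a else 0
  let f : Λ → ℂ := fun a => if a.1.1 ≠ true then y a else 0
  have hω : ∀ s t, p t → ω s t = f s := by
    intro s t ht
    have : (gamNF q N).Follow s t ↔ s.1.1 ≠ true := by
      change s.1.1 ≠ t.1.1 ↔ _
      rw [show t.1.1 = true from ht]
    simp only [ω, f, this]
  -- the blocks that contribute consist of one letter from each factor
  let j : {x : XGInf q // x ≠ 1} × {k : CycC q × LoopGroup (XG q N) // k ≠ 1} → Block p := fun z =>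
    (⟨⟨⟨true, z.1.1⟩, z.1.2⟩, rfl⟩, [⟨⟨⟨false, z.2.1⟩, z.2.2⟩, Bool.false_ne_true⟩])
  have hj : Function.Injective j := by
    rintro ⟨⟨x, hx⟩, ⟨k, hk⟩⟩ ⟨⟨x', hx'⟩, ⟨k', hk'⟩⟩ h
    simp only [j, Prod.mk.injEq, Subtype.mk.injEq, List.cons.injEq, and_true] at h
    have h1 : x = x' := eq_of_heq (Sigma.mk.inj_iff.1 (congrArg Subtype.val h.1)).2
    have h2 : k = k' := eq_of_heq (Sigma.mk.inj_iff.1 (congrArg Subtype.val h.2)).2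
    subst h1 h2
    rfl
  have hval : ∀ z, pathTo ω f (j z).1.1 ((j z).2.map Subtype.val) =
      u ^ (2 * level z.1.1) * u ^ fLen q N z.2.1.2 := by
    intro z
    have h1 : (gamNF q N).Follow ⟨⟨true, z.1.1⟩, z.1.2⟩ ⟨⟨false, z.2.1⟩, z.2.2⟩ :=
      Bool.false_ne_true.symm
    simp only [j, List.map_cons, List.map_nil, pathTo, ω, f, if_pos h1]
    rfl
  have hoff : ∀ b ∉ Set.range j, pathTo ω f b.1.1 (b.2.map Subtype.val) = 0 := by
    rintro ⟨⟨⟨⟨b, x⟩, hx⟩, hb⟩, l⟩ hr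
    obtain rfl : b = true := hb
    rcases l with _ | ⟨⟨⟨⟨b, k⟩, hk⟩, hb'⟩, l⟩
    · simp [pathTo, f]
    · cases b
      · rcases l with _ | ⟨⟨⟨⟨b, k'⟩, hk'⟩, hb''⟩, l⟩
        · exact absurd ⟨(⟨x, hx⟩, ⟨k, hk⟩), rfl⟩ hr
        · cases b
          · have : ¬ (gamNF q N).Follow ⟨⟨false, k⟩, hk⟩ ⟨⟨false, k'⟩, hk'⟩ := fun h => h rfl
            simp [pathTo, ω, this]
          · exact absurd rfl hb''
      · exact absurd rfl hb'
  have hsum : HasSum (fun b : Block p => pathTo ω f b.1.1 (b.2.map Subtype.val))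
      (excC q u * kap q N u) := by
    refine (hj.hasSum_iff hoff).1 ((HasSum.mul_prod (hasSum_ray hq hu)
      (hasSum_kLen (N := N) hq hu)).congr_fun fun z => ?_)
    exact hval z
  have hnorm : HasSum (fun b : Block p => ‖pathTo ω f b.1.1 (b.2.map Subtype.val)‖)
      (excC q ‖u‖ * kap q N ‖u‖) := by
    have h1 := hasSum_norm_ray hq hu
    have h2 := hasSum_norm_kLen (N := N) hq hu
    refine (hj.hasSum_iff fun b hb => by rw [hoff b hb, norm_zero]).1 ((h1.mul h2
      (h1.summable.mul_of_nonneg h2.summable (fun _ => norm_nonneg _)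
        fun _ => norm_nonneg _)).congr_fun fun z => ?_)
    simp only [Function.comp, hval, norm_mul]
  have h1 := hasSum_transWeight_split p hω (s₂ := 0) hnorm.summable
    (by rw [hnorm.tsum_eq]; exact kap_mul_excC_lt hq (norm_nonneg u) hu) (by
      refine hasSum_zero.congr_fun fun c => ?_
      rw [transWeight_eq_zero _ c]
      · simp
      · rintro ⟨⟨⟨b, k⟩, hk⟩, hb⟩ ⟨⟨⟨b', k'⟩, hk'⟩, hb'⟩
        cases b
        · cases b'
          · exact if_neg fun h => h rfl
          · exact absurd rfl hb'
        · exact absurd rfl hb)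
  rw [hsum.tsum_eq, add_zero] at h1
  refine ((gamNF q N).hasSum_primeWord y ?_).congr_fun fun c => by rw [← prod_map_pow]
  convert h1

/-- The logarithm of `1 / Λ`. -/
def loopLog (q N : ℕ) (u : ℂ) : ℂ :=
  -Complex.log (1 - excS q N u) + -Complex.log (1 + excA q N u - excL q N u)

theorem norm_excS_lt (hq : 2 ≤ q) {u : ℂ} (hu : ‖u‖ < (q : ℝ)⁻¹) : ‖excS q N u‖ < 1 := by
  rw [← (hasSum_loopLetter_pow hq u).tsum_eq]
  exact (norm_tsum_le_tsum_norm (hasSum_norm_loopLetter hq u).summable).trans_lt (excS_norm_lt hq hu)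

theorem norm_excL_sub_lt (hq : 2 ≤ q) {u : ℂ} (hu : ‖u‖ < (q : ℝ)⁻¹) :
    ‖excL q N u - excA q N u‖ < 1 := by
  have hn : ∀ s : LoopLetter (XG q N), ‖(if s.1.2 then u ^ letterLen q N s else -u ^ letterLen q N s)‖ =
      ‖u ^ letterLen q N s‖ := fun s => by split_ifs <;> simp
  rw [← (hasSum_loopLetter_sign hq u).tsum_eq]
  refine (norm_tsum_le_tsum_norm ?_).trans_lt ?_
  · simpa only [hn] using (hasSum_norm_loopLetter hq u).summable
  · simpa only [hn] using excS_norm_lt (N := N) hq hu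

theorem one_sub_ne_zero_of_norm {z : ℂ} (hz : ‖z‖ < 1) : 1 - z ≠ 0 := fun h => by
  rw [← sub_eq_zero.1 h, norm_one] at hz
  exact lt_irrefl _ hz

theorem exp_neg_log {z : ℂ} (hz : z ≠ 0) : Complex.exp (-Complex.log z) = z⁻¹ := by
  rw [Complex.exp_neg, Complex.exp_log hz]

/-- The two factors of `Λ` belong to the two characters of the double cover. -/
theorem loopFactor_eq (u : ℂ) :
    loopFactor q N u = (1 - excS q N u) * (1 + excA q N u - excL q N u) := by
  rw [loopFactor, excS, excA, excL]
  ring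

theorem loopFactor_ne_zero (hq : 2 ≤ q) {u : ℂ} (hu : ‖u‖ < (q : ℝ)⁻¹) : loopFactor q N u ≠ 0 := by
  rw [loopFactor_eq]
  refine mul_ne_zero (one_sub_ne_zero_of_norm (norm_excS_lt hq hu)) ?_
  have := one_sub_ne_zero_of_norm (norm_excL_sub_lt (N := N) hq hu)
  rwa [← sub_add, sub_add_eq_add_sub] at this

theorem exp_loopLog (hq : 2 ≤ q) {u : ℂ} (hu : ‖u‖ < (q : ℝ)⁻¹) :
    Complex.exp (loopLog q N u) = (loopFactor q N u)⁻¹ := by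
  have h := loopFactor_ne_zero (N := N) hq hu
  rw [loopFactor_eq] at h ⊢
  rw [loopLog, Complex.exp_add, exp_neg_log (left_ne_zero_of_mul h), exp_neg_log (right_ne_zero_of_mul h),
    mul_inv]

theorem norm_pow_succ_lt (hq : 2 ≤ q) {u : ℂ} (hu : ‖u‖ < (q : ℝ)⁻¹) (m : ℕ) :
    ‖u ^ (m + 1)‖ < (q : ℝ)⁻¹ := by
  rw [norm_pow]
  refine lt_of_le_of_lt (pow_le_of_le_one (norm_nonneg u) ?_ (Nat.succ_ne_zero m)) hu
  linarith [inv_le_half hq]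

theorem card_primitiveFor (m : ℕ) :
    Nat.card {h : CycC q // PrimitiveFor m h} = primitiveCount (q - 1) m :=
  Nat.card_congr (Equiv.subtypeEquiv Multiplicative.toAdd fun _ => Iff.rfl)

theorem primitiveCount_one (n : ℕ) : primitiveCount n 1 = n := by
  rw [primitiveCount]
  have : ∀ h : ZMod n, ∀ r : ℕ, 1 < r → r ∣ 1 → ∀ y : ZMod n, h ≠ r • y := fun h r hr hr1 => by
    have := Nat.dvd_one.1 hr1
    omega
  exact (Nat.card_congr (Equiv.subtypeUnivEquiv this)).trans (Nat.card_zmod n)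

theorem norm_log_one_sub_le {z : ℂ} (hz : ‖z‖ ≤ 1 / 2) : ‖-Complex.log (1 - z)‖ ≤ 3 / 2 * ‖z‖ := by
  have := Complex.norm_log_one_add_half_le_self (z := -z) (by rwa [norm_neg])
  rwa [norm_neg, ← sub_eq_add_neg, ← norm_neg] at this

/-- The classes of elements of the factor `C_{q-1} × (C_q^N * ℤ)`. The element `(h, f^m)` with a
primitive element `f` is not a proper power if and only if `h` is not an `r`-th power for any
divisor `r > 1` of `m`. -/
theorem hasSum_elliptic_classes (hq : 2 ≤ q) {u : ℂ} (hu : ‖u‖ < (q : ℝ)⁻¹) : ∃ T : ℂ,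
    HasSum (fun m : ℕ => (primitiveCount (q - 1) (m + 1) : ℂ) * loopLog q N (u ^ (m + 1))) T ∧
    HasSum (fun x : {x : ℕ × CycC q × (loopNF (XG q N)).PrimeWord // PrimitiveFor (x.1 + 1) x.2.1} =>
      -Complex.log (1 - u ^ ((x.1.1 + 1) * loopWordLen x.1.2.2))) T := by
  classical
  have := finite_CycC hq
  have := Fintype.ofFinite (CycC q)
  let e : (Σ m : ℕ, {h : CycC q // PrimitiveFor (m + 1) h} × (loopNF (XG q N)).PrimeWord) ≃
      {x : ℕ × CycC q × (loopNF (XG q N)).PrimeWord // PrimitiveFor (x.1 + 1) x.2.1} :=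
    { toFun := fun y => ⟨(y.1, y.2.1.1, y.2.2), y.2.1.2⟩
      invFun := fun x => ⟨x.1.1, ⟨x.1.2.1, x.2⟩, x.1.2.2⟩
      left_inv := fun _ => rfl
      right_inv := fun _ => rfl }
  have hu2 : ‖u‖ ≤ 1 / 2 := hu.le.trans (inv_le_half hq)
  have hsum : Summable (fun x : ℕ × CycC q × (loopNF (XG q N)).PrimeWord =>
      -Complex.log (1 - u ^ ((x.1 + 1) * loopWordLen x.2.2))) := by
    have h1 := summable_geometric_of_lt_one (norm_nonneg u) (by linarith)
    have h2 : Summable fun _ : CycC q => (1 : ℝ) := (hasSum_fintype _).summable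
    have h3 := h2.mul_of_nonneg (summable_loop_primeWord (N := N) hq hu) (fun _ => zero_le_one)
      (fun _ => by positivity)
    have h4 := (h1.mul_of_nonneg h3 (fun _ => by positivity) (fun _ => by positivity)).mul_left (3 / 2)
    refine Summable.of_norm_bounded h4 ?_
    rintro ⟨m, h, c⟩
    have hpos := loopWordLen_pos c
    have hle : ‖u ^ ((m + 1) * loopWordLen c)‖ ≤ ‖u‖ ^ m * ‖u‖ ^ loopWordLen c := by
      rw [norm_pow, ← pow_add]
      exact pow_le_pow_of_le_one (norm_nonneg u) (by linarith) (by nlinarith)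
    have hle' : ‖u ^ ((m + 1) * loopWordLen c)‖ ≤ 1 / 2 := by
      rw [norm_pow]
      exact (pow_le_of_le_one (norm_nonneg u) (by linarith) (by positivity)).trans hu2
    refine (norm_log_one_sub_le hle').trans ?_
    simp only [one_mul]
    exact mul_le_mul_of_nonneg_left hle (by norm_num)
  have hsum' := (e.summable_iff.2 (hsum.comp_injective Subtype.val_injective)).hasSum
  refine ⟨_, hsum'.sigma fun m => ?_, e.hasSum_iff.1 hsum'⟩
  have h1 := HasSum.mul_prod (hasSum_fintype fun _ : {h : CycC q // PrimitiveFor (m + 1) h} => (1 : ℂ))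
    (hasSum_loop_primeWord (N := N) hq (norm_pow_succ_lt hq hu m))
  rw [Finset.sum_const, Finset.card_univ, ← Nat.card_eq_fintype_card, card_primitiveFor, nsmul_eq_mul,
    mul_one] at h1
  refine h1.congr_fun fun z => ?_
  rw [one_mul, ← pow_mul]
  rfl

/-- The Selberg zeta function in terms of the generating functions of the excursions. -/
theorem hasProd_selberg (hq : 2 ≤ q) {u : ℂ} (hu : ‖u‖ < (q : ℝ)⁻¹) :
    Multipliable (fun m : ℕ =>
      ((loopFactor q N (u ^ (m + 2)))⁻¹) ^ primitiveCount (q - 1) (m + 2)) ∧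
    HasProd (fun c : (XGraph q N).PrimitiveClass (XTree q N) => selbergFactor u c)
      ((1 - excC q u * kap q N u)⁻¹ * ((loopFactor q N u)⁻¹) ^ (q - 1) *
        ∏' m : ℕ, ((loopFactor q N (u ^ (m + 2)))⁻¹) ^ primitiveCount (q - 1) (m + 2)) := by
  obtain ⟨T, hT, hT'⟩ := hasSum_elliptic_classes (N := N) hq hu
  have hexp : ∀ m : ℕ, Complex.exp ((primitiveCount (q - 1) (m + 1) : ℂ) * loopLog q N (u ^ (m + 1))) =
      ((loopFactor q N (u ^ (m + 1)))⁻¹) ^ primitiveCount (q - 1) (m + 1) := fun m => by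
    rw [Complex.exp_nat_mul, exp_loopLog hq (norm_pow_succ_lt hq hu m)]
  have hT2 := (hasSum_nat_add_iff' 1).2 hT
  have hP := hT2.cexp
  simp only [Function.comp_def, add_assoc, one_add_one_eq_two] at hP
  have hexp' : ∀ m : ℕ, Complex.exp ((primitiveCount (q - 1) (m + 2) : ℂ) * loopLog q N (u ^ (m + 2))) =
      ((loopFactor q N (u ^ (m + 2)))⁻¹) ^ primitiveCount (q - 1) (m + 2) := fun m => hexp (m + 1)
  simp only [hexp'] at hP
  refine ⟨hP.multipliable, ?_⟩
  have hK := norm_pow_succ_lt hq hu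
  have hnorm : ‖excC q u * kap q N u‖ < 1 := by
    have h1 := norm_tsum_le_tsum_norm (hasSum_norm_ray hq hu).summable
    have h2 := norm_tsum_le_tsum_norm (hasSum_norm_kLen (N := N) hq hu).summable
    rw [(hasSum_norm_ray hq hu).tsum_eq, (hasSum_ray hq hu).tsum_eq] at h1
    rw [(hasSum_norm_kLen hq hu).tsum_eq, (hasSum_kLen hq hu).tsum_eq] at h2
    rw [norm_mul]
    exact (mul_le_mul h1 h2 (norm_nonneg _) (excC_nonneg hq (norm_nonneg u) hu.le)).trans_lt
      (kap_mul_excC_lt hq (norm_nonneg u) hu)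
  have h3 : HasSum (fun x : Index q N => -Complex.log (1 - u ^ idxLen x))
      (T + -Complex.log (1 - excC q u * kap q N u)) :=
    HasSum.sum hT' (hasSum_gam_primeWord hq hu)
  have h4 : HasProd (fun x : Index q N => (1 - u ^ idxLen x)⁻¹) (Complex.exp T *
      (1 - excC q u * kap q N u)⁻¹) := by
    have h5 := h3.cexp
    rw [Complex.exp_add, exp_neg_log (one_sub_ne_zero_of_norm hnorm)] at h5
    convert h5 using 1
    funext x
    refine (exp_neg_log (one_sub_ne_zero_of_norm ?_)).symm
    obtain ⟨k, hk⟩ : ∃ k, idxLen x = k + 1 := ⟨idxLen x - 1, by have := idxLen_pos x; omega⟩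
    rw [hk]
    linarith [hK k, inv_le_half hq]
  have h5 : HasProd (fun c : (XGraph q N).PrimitiveClass (XTree q N) => selbergFactor u c)
      (Complex.exp T * (1 - excC q u * kap q N u)⁻¹) := by
    rw [← (Equiv.ofBijective _ (classOf_bijective (N := N) hq)).hasProd_iff]
    convert h4 using 1
    funext x
    change (1 - u ^ classLength (classOf hq x).1)⁻¹ = _
    rw [classLength_classOf]
  convert h5 using 1
  rw [hP.tprod_eq, Complex.exp_sub, Finset.sum_range_one, hexp 0, zero_add, primitiveCount_one, pow_one,
    mul_assoc, mul_div_cancel₀ _ (pow_ne_zero _ (inv_ne_zero (loopFactor_ne_zero hq hu))), mul_comm]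

end Selberg

/-! ### The edges of `X_N` and their weights -/

section Edges

variable {q N : ℕ}

/-- The oriented edges of `X_N`. -/
abbrev OEdge (N : ℕ) : Type := XEdge N × Bool

variable (N) in
/-- The edges of the three lines that start at `c_1`: the ray (`none`) and the two sides
(`some false`, `some true`). The sides have the edges with index less than `N`. -/
def lineEdge : Option Bool → ℕ → XEdge N
  | none, k => .cEdge k
  | some s, k => if h : k < N then (if s then .bEdge ⟨k, h⟩ else .aEdge ⟨k, h⟩) else .cross

variable (N) in
/-- The vertices of the three lines. -/
def linePos : Option Bool → ℕ → XVertex N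
  | none, k => .c k
  | some _, 0 => .c 0
  | some s, k + 1 => if h : k < N then (if s then .b ⟨k, h⟩ else .a ⟨k, h⟩) else .c 0

variable (N) in
/-- The index `k` is that of an edge of the line. -/
def Valid : Option Bool → ℕ → Prop
  | none, _ => True
  | some _, k => k < N

theorem Valid.of_succ {t : Option Bool} {k : ℕ} (h : Valid N t (k + 1)) : Valid N t k := by
  cases t
  · trivial
  · exact Nat.lt_of_succ_lt h

variable (N) in
/-- The edge leading away from `c_1`. -/
abbrev upE (t : Option Bool) (k : ℕ) : OEdge N := (lineEdge N t k, true)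

variable (N) in
/-- The edge leading towards `c_1`. -/
abbrev downE (t : Option Bool) (k : ℕ) : OEdge N := (lineEdge N t k, false)

variable (N) in
/-- The edge from the end of the side `s` to the end of the other side. -/
abbrev crossE (s : Bool) : OEdge N := (.cross, !s)

variable (N) in
/-- The source of an edge of `X_N`. -/
abbrev xsrc (e : OEdge N) : XVertex N := e.1.ends (!e.2)

variable (N) in
/-- The target of an edge of `X_N`. -/
abbrev xtgt (e : OEdge N) : XVertex N := e.1.ends e.2

theorem linePos_zero (t : Option Bool) : linePos N t 0 = .c 0 := by cases t <;> rfl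

theorem linePos_some {s : Bool} {k : ℕ} (h : k < N + 1) : linePos N (some s) k = sPos N s ⟨k, h⟩ := by
  cases k with
  | zero => cases s <;> rfl
  | succ k =>
    simp only [linePos, dif_pos (Nat.lt_of_succ_lt_succ h)]
    cases s <;> rfl

theorem ends_lineEdge {t : Option Bool} {k : ℕ} (h : Valid N t k) :
    (lineEdge N t k).ends false = linePos N t k ∧ (lineEdge N t k).ends true = linePos N t (k + 1) := by
  cases t with
  | none => exact ⟨rfl, rfl⟩
  | some s =>
    have h' : k < N := h
    rw [linePos_some (by omega), linePos_some (by omega), lineEdge, dif_pos h']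
    cases s <;> exact ⟨rfl, rfl⟩

theorem ends_cross (x : Bool) : (XEdge.cross : XEdge N).ends x = linePos N (some x) N := by
  rw [linePos_some (Nat.lt_succ_self N)]
  cases x <;> rfl

theorem linePos_succ_inj {t t' : Option Bool} {k k' : ℕ} (h : Valid N t k) (h' : Valid N t' k')
    (he : linePos N t (k + 1) = linePos N t' (k' + 1)) : t = t' ∧ k = k' := by
  rcases t with _ | _ | _ <;> rcases t' with _ | _ | _ <;> simp_all [linePos, Valid]

theorem linePos_succ_ne {t : Option Bool} {k : ℕ} (h : Valid N t k) : linePos N t (k + 1) ≠ .c 0 := by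
  rcases t with _ | _ | _ <;> simp_all [linePos, Valid]

theorem lineEdge_inj {t t' : Option Bool} {k k' : ℕ} (h : Valid N t k) (h' : Valid N t' k')
    (he : lineEdge N t k = lineEdge N t' k') : t = t' ∧ k = k' := by
  rcases t with _ | _ | _ <;> rcases t' with _ | _ | _ <;> simp_all [lineEdge, Valid]

theorem lineEdge_ne_cross {t : Option Bool} {k : ℕ} (h : Valid N t k) : lineEdge N t k ≠ .cross := by
  rcases t with _ | _ | _ <;> simp_all [lineEdge, Valid]

theorem edge_cases (e : OEdge N) : (∃ t k, Valid N t k ∧ e = upE N t k) ∨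
    (∃ t k, Valid N t k ∧ e = downE N t k) ∨ ∃ s, e = crossE N s := by
  have key : ∀ b : XEdge N, (∃ t k, Valid N t k ∧ b = lineEdge N t k) ∨ b = .cross := by
    intro b
    cases b with
    | aEdge k => exact Or.inl ⟨some false, k, k.2, by simp [lineEdge]⟩
    | bEdge k => exact Or.inl ⟨some true, k, k.2, by simp [lineEdge]⟩
    | cross => exact Or.inr rfl
    | cEdge k => exact Or.inl ⟨none, k, trivial, rfl⟩
  obtain ⟨b, x⟩ := e
  rcases key b with ⟨t, k, h, rfl⟩ | rfl
  · cases x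
    · exact Or.inr (Or.inl ⟨t, k, h, rfl⟩)
    · exact Or.inl ⟨t, k, h, rfl⟩
  · exact Or.inr (Or.inr ⟨!x, by simp [crossE]⟩)

theorem xsrc_upE {t : Option Bool} {k : ℕ} (h : Valid N t k) : xsrc N (upE N t k) = linePos N t k :=
  (ends_lineEdge h).1
theorem xtgt_upE {t : Option Bool} {k : ℕ} (h : Valid N t k) : xtgt N (upE N t k) = linePos N t (k + 1) :=
  (ends_lineEdge h).2
theorem xsrc_downE {t : Option Bool} {k : ℕ} (h : Valid N t k) :
    xsrc N (downE N t k) = linePos N t (k + 1) := (ends_lineEdge h).2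
theorem xtgt_downE {t : Option Bool} {k : ℕ} (h : Valid N t k) : xtgt N (downE N t k) = linePos N t k :=
  (ends_lineEdge h).1
theorem xsrc_crossE (s : Bool) : xsrc N (crossE N s) = linePos N (some s) N := by
  rw [xsrc, ends_cross, Bool.not_not]
theorem xtgt_crossE (s : Bool) : xtgt N (crossE N s) = linePos N (some !s) N := ends_cross _

/-- The edges that start at a vertex other than `c_1`. -/
theorem xsrc_eq_linePos_succ (hN : 1 ≤ N) {t : Option Bool} {k : ℕ} (h : Valid N t k) (e : OEdge N) :
    xsrc N e = linePos N t (k + 1) ↔ e = downE N t k ∨ (Valid N t (k + 1) ∧ e = upE N t (k + 1)) ∨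
      ∃ s, t = some s ∧ k + 1 = N ∧ e = crossE N s := by
  constructor
  · intro he
    rcases edge_cases e with ⟨t', k', h', rfl⟩ | ⟨t', k', h', rfl⟩ | ⟨s, rfl⟩
    · rw [xsrc_upE h'] at he
      rcases k' with _ | k'
      · rw [linePos_zero] at he
        exact absurd he.symm (linePos_succ_ne h)
      · obtain ⟨rfl, rfl⟩ := linePos_succ_inj h'.of_succ h he
        exact Or.inr (Or.inl ⟨h', rfl⟩)
    · rw [xsrc_downE h'] at he
      obtain ⟨rfl, rfl⟩ := linePos_succ_inj h' h he
      exact Or.inl rfl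
    · rw [xsrc_crossE] at he
      obtain ⟨M, rfl⟩ : ∃ M, N = M + 1 := ⟨N - 1, by omega⟩
      obtain ⟨rfl, rfl⟩ := linePos_succ_inj (show Valid (M + 1) (some s) M from Nat.lt_succ_self M) h he
      exact Or.inr (Or.inr ⟨s, rfl, rfl, rfl⟩)
  · rintro (rfl | ⟨h', rfl⟩ | ⟨s, rfl, rfl, rfl⟩)
    · exact xsrc_downE h
    · exact xsrc_upE h'
    · exact xsrc_crossE s

/-- The edges that start at `c_1`. -/
theorem xsrc_eq_c_zero (hN : 1 ≤ N) (e : OEdge N) : xsrc N e = .c 0 ↔ ∃ t, e = upE N t 0 := by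
  have hv : ∀ t, Valid N t 0 := fun t => by
    cases t
    · trivial
    · exact hN
  constructor
  · intro he
    rcases edge_cases e with ⟨t', k', h', rfl⟩ | ⟨t', k', h', rfl⟩ | ⟨s, rfl⟩
    · rw [xsrc_upE h'] at he
      rcases k' with _ | k'
      · exact ⟨t', rfl⟩
      · exact absurd he (linePos_succ_ne h'.of_succ)
    · rw [xsrc_downE h'] at he
      exact absurd he (linePos_succ_ne h')
    · rw [xsrc_crossE] at he
      obtain ⟨M, rfl⟩ : ∃ M, N = M + 1 := ⟨N - 1, by omega⟩
      exact absurd he (linePos_succ_ne (show Valid (M + 1) (some s) M from Nat.lt_succ_self M))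
  · rintro ⟨t, rfl⟩
    rw [xsrc_upE (hv t), linePos_zero]

variable (q N) in
/-- The weight of an edge of `X_N`. -/
def xweight (e : OEdge N) : ℚ := (Nat.card ((xsrc N e).group q) : ℚ) / Nat.card (e.1.group q)

theorem cast_sub_one (hq : 2 ≤ q) : (((q - 1 : ℕ) : ℕ) : ℚ) = (q : ℚ) - 1 := by
  rw [Nat.cast_sub (by omega), Nat.cast_one]

theorem card_linePos_none (k : ℕ) : Nat.card ((linePos N none (k + 1)).group q) = q ^ (k + 1) :=
  card_XG (k + 1)

theorem card_linePos_some (hq : 2 ≤ q) {s : Bool} {k : ℕ} (h : k < N + 1) :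
    (Nat.card ((linePos N (some s) k).group q) : ℚ) = ((q : ℚ) - 1) * q ^ k := by
  rw [linePos_some h, group_sPos, card_XH]
  push_cast [cast_sub_one hq]
  rfl

theorem card_c_zero (hq : 2 ≤ q) : (Nat.card ((XVertex.c (N := N) 0).group q) : ℚ) = (q : ℚ) - 1 := by
  change (Nat.card (XH q 0) : ℚ) = _
  rw [card_XH, pow_zero, mul_one, cast_sub_one hq]

theorem card_lineEdge_none (k : ℕ) : Nat.card ((lineEdge N none k).group q) = q ^ k := card_XG k

theorem card_lineEdge_some (hq : 2 ≤ q) {s : Bool} {k : ℕ} (h : k < N) :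
    (Nat.card ((lineEdge N (some s) k).group q) : ℚ) = ((q : ℚ) - 1) * q ^ k := by
  have : (lineEdge N (some s) k).group q = XH q k := by
    rw [lineEdge, dif_pos h]
    cases s <;> rfl
  rw [this, card_XH]
  push_cast [cast_sub_one hq]
  rfl

theorem weight_upE_zero (hq : 2 ≤ q) (hN : 1 ≤ N) (t : Option Bool) :
    xweight q N (upE N t 0) = if t = none then (q : ℚ) - 1 else 1 := by
  have hq1 : (q : ℚ) - 1 ≠ 0 := by
    have : (2 : ℚ) ≤ q := by exact_mod_cast hq
    linarith
  rw [xweight]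
  cases t with
  | none =>
    rw [xsrc_upE (show Valid N none 0 from trivial), linePos_zero, card_c_zero hq, card_lineEdge_none]
    simp
  | some s =>
    rw [xsrc_upE (show Valid N (some s) 0 from hN), linePos_zero, card_c_zero hq,
      card_lineEdge_some hq hN]
    simp [hq1]

theorem weight_upE_succ (hq : 2 ≤ q) {t : Option Bool} {k : ℕ} (h : Valid N t (k + 1)) :
    xweight q N (upE N t (k + 1)) = 1 := by
  have hq0 : (q : ℚ) ≠ 0 := by positivity
  have hq1 : (q : ℚ) - 1 ≠ 0 := by
    have : (2 : ℚ) ≤ q := by exact_mod_cast hq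
    linarith
  rw [xweight, xsrc_upE h]
  cases t with
  | none =>
    rw [card_linePos_none, card_lineEdge_none]
    exact div_self (by positivity)
  | some s =>
    rw [card_linePos_some hq (Nat.lt_succ_of_lt h), card_lineEdge_some hq h]
    exact div_self (mul_ne_zero hq1 (pow_ne_zero _ hq0))

theorem weight_downE (hq : 2 ≤ q) {t : Option Bool} {k : ℕ} (h : Valid N t k) :
    xweight q N (downE N t k) = q := by
  have hq0 : (q : ℚ) ≠ 0 := by positivity
  have hq1 : (q : ℚ) - 1 ≠ 0 := by
    have : (2 : ℚ) ≤ q := by exact_mod_cast hq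
    linarith
  rw [xweight, xsrc_downE h]
  cases t with
  | none =>
    rw [card_linePos_none, card_lineEdge_none]
    push_cast
    field_simp
    ring
  | some s =>
    rw [card_linePos_some hq (Nat.succ_lt_succ h), card_lineEdge_some hq h]
    field_simp
    rw [Nat.succ_eq_add_one]
    ring

theorem weight_crossE (hq : 2 ≤ q) (s : Bool) : xweight q N (crossE N s) = 1 := by
  have hq0 : (q : ℚ) ≠ 0 := by positivity
  have hq1 : (q : ℚ) - 1 ≠ 0 := by
    have : (2 : ℚ) ≤ q := by exact_mod_cast hq
    linarith
  rw [xweight, xsrc_crossE, card_linePos_some hq (Nat.lt_succ_self N)]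
  have : (Nat.card ((XEdge.cross : XEdge N).group q) : ℚ) = ((q : ℚ) - 1) * q ^ N := by
    change (Nat.card (XH q N) : ℚ) = _
    rw [card_XH]
    push_cast [cast_sub_one hq]
    rfl
  rw [this]
  exact div_self (mul_ne_zero hq1 (pow_ne_zero _ hq0))

theorem exists_linePos (v : XVertex N) : v = .c 0 ∨ ∃ t k, Valid N t k ∧ v = linePos N t (k + 1) := by
  cases v with
  | c k =>
    cases k with
    | zero => exact Or.inl rfl
    | succ k => exact Or.inr ⟨none, k, trivial, rfl⟩
  | a k => exact Or.inr ⟨some false, k, k.2, by simp [linePos]⟩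
  | b k => exact Or.inr ⟨some true, k, k.2, by simp [linePos]⟩

/-- The edges that start at a vertex have the weights `q`, `1`; at `c_1` they have the weights `q -
1`, `1`, `1`. -/
theorem isRegular_XGraph (hq : 2 ≤ q) (hN : 1 ≤ N) : (XGraph q N).IsRegular (q + 1) := by
  refine ⟨fun v => ?_, fun v => ?_⟩
  · change Finite (XVertex.group q (N := N) v)
    have h1 := finite_XH hq
    have h2 := finite_XG hq
    cases v with
    | c k =>
      cases k with
      | zero => exact h1 0
      | succ k => exact h2 (k + 1)
    | a k => exact h1 (k + 1)
    | b k => exact h1 (k + 1)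
  · have hpair : ∀ e e' : OEdge N, e ≠ e' → {e : OEdge N | xsrc N e = v} = {e, e'} →
        xweight q N e = q → xweight q N e' = 1 →
        {e : OEdge N | xsrc N e = v}.Finite ∧
          ∑ᶠ e ∈ {e : OEdge N | xsrc N e = v}, xweight q N e = ((q + 1 : ℕ) : ℚ) := by
      intro e e' hne hset h1 h2
      rw [hset]
      refine ⟨Set.toFinite _, ?_⟩
      rw [finsum_mem_pair hne, h1, h2]
      push_cast
      rfl
    change {e : OEdge N | xsrc N e = v}.Finite ∧
      ∑ᶠ e ∈ {e : OEdge N | xsrc N e = v}, xweight q N e = ((q + 1 : ℕ) : ℚ)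
    rcases exists_linePos v with rfl | ⟨t, k, h, rfl⟩
    · have hset : {e : OEdge N | xsrc N e = XVertex.c 0} = Set.range fun t => upE N t 0 := by
        ext e
        exact (xsrc_eq_c_zero hN e).trans ⟨fun ⟨t, h⟩ => ⟨t, h.symm⟩, fun ⟨t, h⟩ => ⟨t, h.symm⟩⟩
      have hinj : Function.Injective fun t => upE N t 0 := fun t t' h => by
        have hv : ∀ t, Valid N t 0 := fun t => by
          cases t
          · trivial
          · exact hN
        exact (lineEdge_inj (hv t) (hv t') (congrArg Prod.fst h)).1
      rw [hset]
      refine ⟨Set.finite_range _, ?_⟩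
      rw [finsum_mem_range hinj, finsum_eq_sum_of_fintype, Fintype.sum_option, Fintype.sum_bool]
      simp only [weight_upE_zero hq hN]
      simp
    · by_cases h1 : Valid N t (k + 1)
      · refine hpair (downE N t k) (upE N t (k + 1)) (fun h => ?_) ?_ (weight_downE hq h)
          (weight_upE_succ hq h1)
        · exact Bool.false_ne_true (congrArg Prod.snd h)
        · ext e
          rw [Set.mem_ofPred_eq, xsrc_eq_linePos_succ hN h]
          refine or_congr Iff.rfl ⟨fun h2 => ?_, fun h2 => Or.inl ⟨h1, h2⟩⟩
          rcases h2 with h2 | ⟨s, rfl, h2, -⟩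
          · exact h2.2
          · exact absurd h1 (by simp only [Valid]; omega)
      · obtain ⟨s, rfl⟩ : ∃ s, t = some s := by
          cases t
          · exact absurd trivial h1
          · exact ⟨_, rfl⟩
        have hk : k + 1 = N := by
          have h2 : k < N := h
          have h3 : ¬ k + 1 < N := h1
          omega
        refine hpair (downE N (some s) k) (crossE N s) (fun h' => ?_) ?_ (weight_downE hq h)
          (weight_crossE hq s)
        · exact lineEdge_ne_cross h (congrArg Prod.fst h')
        · ext e
          rw [Set.mem_ofPred_eq, xsrc_eq_linePos_succ hN h]
          refine or_congr Iff.rfl ⟨fun h2 => ?_, fun h2 => Or.inr ⟨s, rfl, hk, h2⟩⟩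
          rcases h2 with h2 | ⟨s', hs', -, h2⟩
          · exact absurd h2.1 h1
          · exact h2.trans (by rw [Option.some.inj hs'])

end Edges

/-! ### The transition weights of the Bass–Ihara zeta function -/

section Flat

variable {α : Type*} {p : α → Prop}

theorem pathTo_append_cons (ω : α → α → ℂ) (f : α → ℂ) (a b : α) (w r : List α) :
    pathTo ω f a (w ++ b :: r) = pathTo ω (fun s => ω s b) a w * pathTo ω f b r := by
  induction w generalizing a with
  | nil => rfl
  | cons c w ih => simp only [List.cons_append, pathTo, ih, mul_assoc]

/-- Transition weights on words of blocks: the weight of the first block, continued to the head of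
the second one. -/
def blockTrans (ω : α → α → ℂ) (b b' : Block p) : ℂ :=
  pathTo ω (fun s => ω s b'.1.1) b.1.1 (b.2.map Subtype.val)

theorem transWeight_flat_eq (ω : α → α → ℂ) (l : List (Block p)) :
    transWeight ω (flat l) = transWeight (blockTrans ω) l := by
  cases l with
  | nil => rfl
  | cons b l =>
    rw [flat_cons, transWeight_cons]
    rw [transWeight_cons]
    suffices H : ∀ (e : Block p) (b : Block p) (l : List (Block p)),
        pathTo ω (fun s => ω s e.1.1) b.1.1 (b.2.map Subtype.val ++ flat l) =
          pathTo (blockTrans ω) (fun s => blockTrans ω s e) b l from H b b l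
    intro e b l
    induction l generalizing b with
    | nil => rw [flat_nil, List.append_nil]; rfl
    | cons b' l ih =>
      rw [flat_cons]
      rw [pathTo_append_cons, ih]
      rfl

end Flat

section Trans

variable (q N : ℕ)

open Classical in
/-- The transition weights of `X_N`. -/
def xweight₂ (e e' : OEdge N) : ℚ :=
  if e' = (e.1, !e.2) then xweight q N e' - 1 else xweight q N e'

open Classical in
/-- The transition weights of `X_N`, with a factor `u` for every step and `0` for pairs of edges
that do not follow each other. -/
def edgeTrans (u : ℂ) (e e' : OEdge N) : ℂ :=
  if xtgt N e = xsrc N e' then (xweight₂ q N e e' : ℂ) * u else 0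

variable {q N}
variable {u : ℂ}

theorem edgeTrans_ne_zero {e e' : OEdge N} (h : edgeTrans q N u e e' ≠ 0) :
    xsrc N e' = xtgt N e := by
  by_contra hne
  exact h (if_neg fun h' => hne h'.symm)

theorem edgeTrans_of_ne {e e' : OEdge N} (h : xtgt N e = xsrc N e') (hne : e' ≠ (e.1, !e.2)) :
    edgeTrans q N u e e' = (xweight q N e' : ℂ) * u := by
  rw [edgeTrans, if_pos h, xweight₂, if_neg hne]

theorem edgeTrans_rev {e e' : OEdge N} (he : e' = (e.1, !e.2)) :
    edgeTrans q N u e e' = ((xweight q N e' : ℂ) - 1) * u := by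
  have h : xtgt N e = xsrc N e' := by rw [he, xsrc, xtgt, Bool.not_not]
  rw [edgeTrans, if_pos h, xweight₂, if_pos he]
  push_cast
  rfl

theorem edgeTrans_up_rev (b : XEdge N) :
    edgeTrans q N u (b, true) (b, false) = ((xweight q N (b, false) : ℂ) - 1) * u := edgeTrans_rev rfl

theorem edgeTrans_down_rev (b : XEdge N) :
    edgeTrans q N u (b, false) (b, true) = ((xweight q N (b, true) : ℂ) - 1) * u := edgeTrans_rev rfl

theorem edgeTrans_up_up (hq : 2 ≤ q) {t : Option Bool} {k : ℕ} (h : Valid N t (k + 1)) :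
    edgeTrans q N u (upE N t k) (upE N t (k + 1)) = u := by
  rw [edgeTrans_of_ne, weight_upE_succ hq h]
  · simp
  · rw [xtgt_upE h.of_succ, xsrc_upE h]
  · exact fun h => Bool.false_ne_true (congrArg Prod.snd h).symm

theorem edgeTrans_up_down (hq : 2 ≤ q) {t : Option Bool} {k : ℕ} (h : Valid N t k) :
    edgeTrans q N u (upE N t k) (downE N t k) = ((q : ℂ) - 1) * u := by
  rw [edgeTrans_up_rev, weight_downE hq h]
  simp

theorem edgeTrans_down_down (hq : 2 ≤ q) {t : Option Bool} {k : ℕ} (h : Valid N t (k + 1)) :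
    edgeTrans q N u (downE N t (k + 1)) (downE N t k) = q * u := by
  rw [edgeTrans_of_ne, weight_downE hq h.of_succ]
  · simp
  · rw [xtgt_downE h, xsrc_downE h.of_succ]
  · exact fun h => Bool.false_ne_true (congrArg Prod.snd h)

theorem edgeTrans_down_up (hq : 2 ≤ q) {t : Option Bool} {k : ℕ} (h : Valid N t (k + 1)) :
    edgeTrans q N u (downE N t (k + 1)) (upE N t (k + 1)) = 0 := by
  rw [edgeTrans_down_rev, weight_upE_succ hq h]
  simp

theorem edgeTrans_up_cross (hq : 2 ≤ q) {s : Bool} {k : ℕ} (h : k + 1 = N) :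
    edgeTrans q N u (upE N (some s) k) (crossE N s) = u := by
  have hv : Valid N (some s) k := show k < N by omega
  rw [edgeTrans_of_ne, weight_crossE hq]
  · simp
  · rw [xtgt_upE hv, xsrc_crossE, h]
  · exact fun h => lineEdge_ne_cross hv (congrArg Prod.fst h).symm

theorem edgeTrans_cross_cross (hq : 2 ≤ q) (s : Bool) :
    edgeTrans q N u (crossE N s) (crossE N !s) = 0 := by
  rw [edgeTrans_rev rfl, weight_crossE hq]
  simp

theorem edgeTrans_cross_down (hq : 2 ≤ q) {s : Bool} {k : ℕ} (h : k + 1 = N) :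
    edgeTrans q N u (crossE N s) (downE N (some !s) k) = q * u := by
  have hv : Valid N (some !s) k := show k < N by omega
  rw [edgeTrans_of_ne, weight_downE hq hv]
  · simp
  · rw [xsrc_downE hv, xtgt_crossE, h]
  · exact fun h => lineEdge_ne_cross hv (congrArg Prod.fst h)

theorem valid_zero (hN : 1 ≤ N) (t : Option Bool) : Valid N t 0 := by
  cases t
  · trivial
  · exact hN

variable (q) in
/-- The transition weights at `c_1` for a path which arrives from the line `t` and continues in the
line `t'`. -/
def turnWeight (t t' : Option Bool) : ℂ :=
  (if t' = none then (q : ℂ) - 1 else 1) - if t = t' then 1 else 0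

theorem edgeTrans_turn (hq : 2 ≤ q) (hN : 1 ≤ N) (t t' : Option Bool) :
    edgeTrans q N u (downE N t 0) (upE N t' 0) = turnWeight q t t' * u := by
  by_cases h : t = t'
  · subst h
    rw [edgeTrans_down_rev, weight_upE_zero hq hN, turnWeight, if_pos rfl]
    split_ifs <;> simp
  · rw [edgeTrans_of_ne, weight_upE_zero hq hN, turnWeight, if_neg h]
    · split_ifs <;> simp
    · rw [xtgt_downE (valid_zero hN t), xsrc_upE (valid_zero hN t'), linePos_zero, linePos_zero]
    · exact fun h' => h (lineEdge_inj (valid_zero hN t') (valid_zero hN t)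
        (congrArg Prod.fst h')).1.symm

end Trans

/-! ### Excursions from `c_1` -/

section Excursions

variable (q N : ℕ)

/-- The edge starts at `c_1`. -/
def AtBase (e : OEdge N) : Prop := xsrc N e = .c 0

/-- Upward edges of a line, with the indices `a, …, a + n - 1`. -/
def upList (t : Option Bool) : ℕ → ℕ → List (OEdge N)
  | _, 0 => []
  | a, n + 1 => upE N t a :: upList t (a + 1) n

/-- Downward edges of a line, with the indices `n - 1, …, 0`. -/
def downList (t : Option Bool) : ℕ → List (OEdge N)
  | 0 => []
  | n + 1 => downE N t n :: downList t n

/-- Excursions from `c_1`: to the vertex with index `k + 1` of the ray; to the vertex with index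
`k + 1` of the side `s`; or along the side `s` through the edge joining the ends of the two sides
and back along the other side. -/
abbrev Exc : Type := ℕ ⊕ Bool × (Fin N ⊕ Unit)

variable {N}

/-- The line in which an excursion starts. -/
def Exc.start : Exc N → Option Bool
  | .inl _ => none
  | .inr (s, _) => some s

/-- The line in which an excursion ends. -/
def Exc.last : Exc N → Option Bool
  | .inl _ => none
  | .inr (s, σ) => some !(nextState Sum.isRight s σ)

/-- The edges of an excursion after the first one. -/
def Exc.tail : Exc N → List (OEdge N)
  | .inl k => upList N none 1 k ++ downList N none (k + 1)
  | .inr (s, .inl k) => upList N (some s) 1 k ++ downList N (some s) (k + 1)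
  | .inr (s, .inr _) => upList N (some s) 1 (N - 1) ++ crossE N s :: downList N (some !s) N

variable {q}
variable {u : ℂ}

/-- The edges leading towards `c_1` have the weight `q`. -/
theorem pathTo_downList (hq : 2 ≤ q) (f : OEdge N → ℂ) {t : Option Bool} {k : ℕ} (h : Valid N t k) :
    pathTo (edgeTrans q N u) f (downE N t k) (downList N t k) = (q * u) ^ k * f (downE N t 0) := by
  induction k with
  | zero => simp [downList, pathTo]
  | succ k ih =>
    rw [downList, pathTo, edgeTrans_down_down hq h, ih h.of_succ]
    ring

/-- The edges leading away from `c_1` have the weight `1`, apart from the first edge of the ray. -/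
theorem pathTo_upList (hq : 2 ≤ q) (f : OEdge N → ℂ) {t : Option Bool} {k n : ℕ}
    (h : Valid N t (k + n)) (l : List (OEdge N)) :
    pathTo (edgeTrans q N u) f (upE N t k) (upList N t (k + 1) n ++ l) =
      u ^ n * pathTo (edgeTrans q N u) f (upE N t (k + n)) l := by
  induction n generalizing k with
  | zero => simp [upList]
  | succ n ih =>
    have hv : Valid N t (k + 1) := by
      cases t
      · trivial
      · have : k + (n + 1) < N := h
        show k + 1 < N
        omega
    have h' : Valid N t (k + 1 + n) := by rwa [Nat.add_right_comm]
    rw [upList, List.cons_append, pathTo, edgeTrans_up_up hq hv, ih h', Nat.add_right_comm k 1 n]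
    rw [Nat.add_assoc, pow_succ]
    ring

variable (q N) in
/-- The weight of an excursion into the ray. -/
def rayWeight (u : ℂ) (k : ℕ) : ℂ := ((q : ℂ) - 1) * ((q : ℂ) ^ k * u ^ (2 * (k + 1)))

variable (q N) in
/-- The weight of an excursion to one of the sides. -/
def sideWeight (u : ℂ) : Fin N ⊕ Unit → ℂ
  | .inl k => rayWeight q u k
  | .inr _ => excL q N u

variable (q N) in
/-- The weight of an excursion. -/
def Exc.weight (u : ℂ) : Exc N → ℂ
  | .inl k => rayWeight q u k
  | .inr (_, σ) => sideWeight q N u σ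

/-- The weight of a closed path factors into the weights of its excursions and the weights of the
turns at `c_1`. -/
theorem pathTo_exc (hq : 2 ≤ q) (hN : 1 ≤ N) (f : OEdge N → ℂ) (g : Option Bool → ℂ)
    (hf : ∀ t, f (downE N t 0) = g t * u) (i : Exc N) :
    pathTo (edgeTrans q N u) f (upE N i.start 0) i.tail = i.weight q N u * g i.last := by
  have key : ∀ t k, Valid N t k → pathTo (edgeTrans q N u) f (upE N t 0)
      (upList N t 1 k ++ downList N t (k + 1)) = rayWeight q u k * g t := by
    intro t k h
    rw [pathTo_upList (k := 0) hq f (by rwa [Nat.zero_add]), Nat.zero_add, downList, pathTo,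
      edgeTrans_up_down hq h, pathTo_downList hq f h, hf, rayWeight]
    ring
  match i with
  | .inl k => exact key none k trivial
  | .inr (s, .inl k) =>
    refine (key (some s) k k.2).trans ?_
    simp [Exc.weight, sideWeight, Exc.last, nextState]
  | .inr (s, .inr _) =>
    obtain ⟨M, rfl⟩ : ∃ M, N = M + 1 := ⟨N - 1, by omega⟩
    have hv : ∀ s : Bool, Valid (M + 1) (some s) M := fun s => Nat.lt_succ_self M
    simp only [Exc.start, Exc.tail, Nat.add_sub_cancel]
    rw [pathTo_upList (k := 0) hq f (by rw [Nat.zero_add]; exact hv s), Nat.zero_add, pathTo, downList,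
      pathTo, edgeTrans_up_cross hq rfl, edgeTrans_cross_down hq rfl, pathTo_downList hq f (hv _), hf]
    simp only [Exc.weight, sideWeight, Exc.last, nextState, excL, Sum.isRight_inr, if_true]
    ring

/-- A path that moves towards `c_1` cannot turn before it reaches `c_1`: reversing costs the factor
`w - 1 = 0`. -/
theorem downList_of_pathTo_ne_zero (hq : 2 ≤ q) (hN : 1 ≤ N) {f : OEdge N → ℂ}
    (hf : ∀ e, f e ≠ 0 → xtgt N e = .c 0) {t : Option Bool} {k : ℕ} (h : Valid N t k)
    {l : List (OEdge N)} (hl : ∀ e ∈ l, ¬ AtBase N e)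
    (h0 : pathTo (edgeTrans q N u) f (downE N t k) l ≠ 0) : l = downList N t k := by
  induction l generalizing k with
  | nil =>
    have h1 := hf _ h0
    rw [xtgt_downE h] at h1
    cases k with
    | zero => rfl
    | succ k => exact absurd h1 (linePos_succ_ne h.of_succ)
  | cons b l ih =>
    rw [pathTo, mul_ne_zero_iff] at h0
    have h1 := edgeTrans_ne_zero h0.1
    rw [xtgt_downE h] at h1
    cases k with
    | zero =>
      rw [linePos_zero] at h1
      exact absurd h1 (hl b (List.mem_cons_self ..))
    | succ k =>
      rcases (xsrc_eq_linePos_succ hN h.of_succ b).1 h1 with rfl | ⟨-, rfl⟩ | ⟨s, rfl, h2, -⟩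
      · rw [downList, ← ih h.of_succ (fun e he => hl e (List.mem_cons_of_mem _ he)) h0.2]
      · exact absurd (edgeTrans_down_up hq h) h0.1
      · have : k + 1 < N := h
        omega

/-- A path that has passed the edge joining the ends of the sides cannot turn before it reaches
`c_1`. -/
theorem crossList_of_pathTo_ne_zero (hq : 2 ≤ q) (hN : 1 ≤ N) {f : OEdge N → ℂ}
    (hf : ∀ e, f e ≠ 0 → xtgt N e = .c 0) {s : Bool}
    {l : List (OEdge N)} (hl : ∀ e ∈ l, ¬ AtBase N e)
    (h0 : pathTo (edgeTrans q N u) f (crossE N s) l ≠ 0) : l = downList N (some !s) N := by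
  obtain ⟨M, rfl⟩ : ∃ M, N = M + 1 := ⟨N - 1, by omega⟩
  have hv : Valid (M + 1) (some !s) M := Nat.lt_succ_self M
  cases l with
  | nil =>
    have h1 := hf _ h0
    rw [xtgt_crossE] at h1
    exact absurd h1 (linePos_succ_ne hv)
  | cons b l =>
    rw [pathTo, mul_ne_zero_iff] at h0
    have h1 := edgeTrans_ne_zero h0.1
    rw [xtgt_crossE] at h1
    rcases (xsrc_eq_linePos_succ hN hv b).1 h1 with rfl | ⟨h2, rfl⟩ | ⟨s', hs', -, rfl⟩
    · rw [downList, downList_of_pathTo_ne_zero hq hN hf hv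
        (fun e he => hl e (List.mem_cons_of_mem _ he)) h0.2]
    · exact absurd h2 (lt_irrefl _)
    · rw [← Option.some.inj hs'] at h0
      exact absurd (edgeTrans_cross_cross hq s) h0.1

/-- A path that moves away from `c_1` turns at some vertex of the line, or passes the edge joining
the ends of the sides. -/
theorem upList_of_pathTo_ne_zero (hq : 2 ≤ q) (hN : 1 ≤ N) {f : OEdge N → ℂ}
    (hf : ∀ e, f e ≠ 0 → xtgt N e = .c 0) {t : Option Bool} {k : ℕ} (h : Valid N t k)
    {l : List (OEdge N)} (hl : ∀ e ∈ l, ¬ AtBase N e)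
    (h0 : pathTo (edgeTrans q N u) f (upE N t k) l ≠ 0) :
    (∃ n, Valid N t (k + n) ∧ l = upList N t (k + 1) n ++ downList N t (k + n + 1)) ∨
      ∃ s n, t = some s ∧ k + n + 1 = N ∧
        l = upList N t (k + 1) n ++ crossE N s :: downList N (some !s) N := by
  induction l generalizing k with
  | nil =>
    have h1 := hf _ h0
    rw [xtgt_upE h] at h1
    exact absurd h1 (linePos_succ_ne h)
  | cons b l ih =>
    have hl' : ∀ e ∈ l, ¬ AtBase N e := fun e he => hl e (List.mem_cons_of_mem _ he)
    rw [pathTo, mul_ne_zero_iff] at h0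
    have h1 := edgeTrans_ne_zero h0.1
    rw [xtgt_upE h] at h1
    rcases (xsrc_eq_linePos_succ hN h b).1 h1 with rfl | ⟨h2, rfl⟩ | ⟨s, rfl, h2, rfl⟩
    · exact Or.inl ⟨0, h, by rw [downList_of_pathTo_ne_zero hq hN hf h hl' h0.2]; rfl⟩
    · rcases ih h2 hl' h0.2 with ⟨n, h3, rfl⟩ | ⟨s, n, rfl, h3, rfl⟩
      · refine Or.inl ⟨n + 1, ?_, ?_⟩
        · rwa [← Nat.add_assoc, Nat.add_right_comm]
        · rw [Nat.add_right_comm k 1 n]; rfl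
      · exact Or.inr ⟨s, n + 1, rfl, by omega, rfl⟩
    · exact Or.inr ⟨s, 0, rfl, h2, by rw [crossList_of_pathTo_ne_zero hq hN hf hl' h0.2]; rfl⟩

/-- A block of nonzero weight is an excursion. -/
theorem exists_exc_of_pathTo_ne_zero (hq : 2 ≤ q) (hN : 1 ≤ N) {f : OEdge N → ℂ}
    (hf : ∀ e, f e ≠ 0 → xtgt N e = .c 0) {a : OEdge N} (ha : AtBase N a)
    {l : List (OEdge N)} (hl : ∀ e ∈ l, ¬ AtBase N e)
    (h0 : pathTo (edgeTrans q N u) f a l ≠ 0) : ∃ i : Exc N, a = upE N i.start 0 ∧ l = i.tail := by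
  obtain ⟨t, rfl⟩ := (xsrc_eq_c_zero hN a).1 ha
  rcases upList_of_pathTo_ne_zero hq hN hf (valid_zero hN t) hl h0 with
    ⟨n, h1, rfl⟩ | ⟨s, n, rfl, h1, rfl⟩
  · rw [Nat.zero_add] at h1 ⊢
    rcases t with _ | s
    · exact ⟨.inl n, rfl, by rw [Nat.zero_add]; rfl⟩
    · exact ⟨.inr (s, .inl ⟨n, h1⟩), rfl, by rw [Nat.zero_add]; rfl⟩
  · obtain rfl : n = N - 1 := by omega
    exact ⟨.inr (s, .inr ()), rfl, rfl⟩

theorem not_atBase_of_mem_upList {t : Option Bool} {a n : ℕ} (h : Valid N t (a + n)) {e : OEdge N}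
    (he : e ∈ upList N t (a + 1) n) : ¬ AtBase N e := by
  induction n generalizing a with
  | zero => simp [upList] at he
  | succ n ih =>
    have hv : Valid N t (a + 1) := by
      cases t
      · trivial
      · have : a + (n + 1) < N := h
        show a + 1 < N
        omega
    rcases List.mem_cons.1 he with rfl | he
    · rw [AtBase, xsrc_upE hv]
      exact linePos_succ_ne hv.of_succ
    · exact ih (by rwa [Nat.add_right_comm]) he

theorem not_atBase_of_mem_downList {t : Option Bool} {n : ℕ} (h : Valid N t n) {e : OEdge N}
    (he : e ∈ downList N t (n + 1)) : ¬ AtBase N e := by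
  induction n with
  | zero =>
    simp only [downList, List.mem_singleton] at he
    rw [he, AtBase, xsrc_downE h]
    exact linePos_succ_ne h
  | succ n ih =>
    rcases List.mem_cons.1 he with rfl | he
    · rw [AtBase, xsrc_downE h]
      exact linePos_succ_ne h
    · exact ih h.of_succ he

theorem Exc.not_atBase (hN : 1 ≤ N) (i : Exc N) : ∀ e ∈ i.tail, ¬ AtBase N e := by
  have key : ∀ t k, Valid N t k → ∀ e ∈ upList N t 1 k ++ downList N t (k + 1), ¬ AtBase N e := by
    intro t k h e he
    rcases List.mem_append.1 he with he | he
    · exact not_atBase_of_mem_upList (a := 0) (by rwa [Nat.zero_add]) he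
    · exact not_atBase_of_mem_downList h he
  match i with
  | .inl k => exact key none k trivial
  | .inr (s, .inl k) => exact key (some s) k k.2
  | .inr (s, .inr _) =>
    obtain ⟨M, rfl⟩ : ∃ M, N = M + 1 := ⟨N - 1, by omega⟩
    have hv : ∀ s : Bool, Valid (M + 1) (some s) M := fun s => Nat.lt_succ_self M
    intro e he
    simp only [Exc.tail, Nat.add_sub_cancel] at he
    rcases List.mem_append.1 he with he | he
    · exact not_atBase_of_mem_upList (a := 0) (by rw [Nat.zero_add]; exact hv s) he
    · rcases List.mem_cons.1 he with rfl | he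
      · rw [AtBase, xsrc_crossE]
        exact linePos_succ_ne (hv s)
      · exact not_atBase_of_mem_downList (hv _) he

/-- An excursion as a block. -/
def Exc.block (hN : 1 ≤ N) (i : Exc N) : Block (AtBase N) :=
  (⟨upE N i.start 0, (xsrc_eq_c_zero hN _).2 ⟨_, rfl⟩⟩, i.tail.attachWith _ (i.not_atBase hN))

theorem Exc.block_snd (hN : 1 ≤ N) (i : Exc N) : (i.block hN).2.map Subtype.val = i.tail :=
  List.attachWith_map_subtype_val _

theorem length_upList (t : Option Bool) (a n : ℕ) : (upList N t a n).length = n := by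
  induction n generalizing a with
  | zero => rfl
  | succ n ih => rw [upList, List.length_cons, ih]

theorem length_downList (t : Option Bool) (n : ℕ) : (downList N t n).length = n := by
  induction n with
  | zero => rfl
  | succ n ih => rw [downList, List.length_cons, ih]

theorem Exc.block_injective (hN : 1 ≤ N) : Function.Injective (Exc.block hN) := by
  intro i j h
  have h1 : i.start = j.start := (lineEdge_inj (valid_zero hN _) (valid_zero hN _)
    (congrArg Prod.fst (congrArg (fun b : Block (AtBase N) => b.1.1) h))).1
  have h2 : i.tail = j.tail := by rw [← i.block_snd hN, ← j.block_snd hN, h]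
  have h3 := congrArg List.length h2
  rcases i with i | ⟨s, i | i⟩ <;> rcases j with j | ⟨s', j | j⟩ <;>
    simp only [Exc.start, Exc.tail, List.length_append, List.length_cons, length_upList,
      length_downList, Option.some.injEq, reduceCtorEq] at h1 h3
  · exact congrArg Sum.inl (by omega)
  · rw [h1, Fin.ext (show (i : ℕ) = j by omega)]
  · omega
  · omega
  · rw [h1]

end Excursions

/-! ### Prime cyclic words of excursions -/

section ExcursionWords

variable {q N : ℕ}

variable (q) in
/-- The transition weights of excursions. -/
def excTrans (u : ℂ) (i j : Exc N) : ℂ := i.weight q N u * turnWeight q i.last j.start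

variable (q) in
/-- The weight of the transition from an excursion to an excursion into the ray. -/
def excTo (u : ℂ) (i : Exc N) : ℂ := i.weight q N u * turnWeight q i.last none

/-- The turns between the two sides have the weight `1`, and turning back into the same side has the
weight `0`, so the excursions to the sides form the paths of a double cover. -/
theorem excTrans_inr_inr (u : ℂ) (a b : Bool × (Fin N ⊕ Unit)) :
    excTrans q u (.inr a) (.inr b) = coverTrans Sum.isRight (sideWeight q N u) a b := by
  obtain ⟨s, σ⟩ := a
  obtain ⟨s', σ'⟩ := b
  simp only [excTrans, coverTrans, Exc.weight, Exc.last, Exc.start, turnWeight, Option.some.injEq,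
    reduceCtorEq, if_false]
  cases nextState Sum.isRight s σ <;> cases s' <;> simp

theorem excTrans_inl_inr (u : ℂ) (k : ℕ) (b : Bool × (Fin N ⊕ Unit)) :
    excTrans q u (.inl k) (.inr b) = rayWeight q u k := by
  simp [excTrans, Exc.weight, Exc.last, Exc.start, turnWeight]

theorem excTo_inl (u : ℂ) (k : ℕ) :
    excTo (N := N) q u (.inl k) = rayWeight q u k * ((q : ℂ) - 2) := by
  simp only [excTo, Exc.weight, Exc.last, turnWeight, if_true]
  ring

theorem excTo_inr (u : ℂ) (a : Bool × (Fin N ⊕ Unit)) :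
    excTo q u (.inr a) = sideWeight q N u a.2 * ((q : ℂ) - 1) := by
  simp [excTo, Exc.weight, Exc.last, turnWeight]

/-- The total weight of the ways to pass from an excursion into the ray to the next one through
given excursions to the sides. -/
def betweenRays (q : ℕ) (u : ℂ) : List (Bool × (Fin N ⊕ Unit)) → ℂ
  | [] => (q : ℂ) - 2
  | a :: w => pathTo (coverTrans Sum.isRight (sideWeight q N u))
      (fun a => sideWeight q N u a.2 * ((q : ℂ) - 1)) a w

theorem pathTo_excTrans (u : ℂ) (k : ℕ) (w : List (Bool × (Fin N ⊕ Unit))) :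
    pathTo (excTrans q u) (excTo q u) (.inl k : Exc N) (w.map Sum.inr) =
      rayWeight q u k * betweenRays q u w := by
  have key : ∀ a, pathTo (excTrans q u) (excTo q u) (.inr a : Exc N) (w.tail.map Sum.inr) =
      pathTo (coverTrans Sum.isRight (sideWeight q N u))
        (fun a => sideWeight q N u a.2 * ((q : ℂ) - 1)) a w.tail := by
    induction w.tail with
    | nil => exact fun a => excTo_inr u a
    | cons b w ih => exact fun a => by rw [List.map_cons, pathTo, pathTo, ih, excTrans_inr_inr]
  cases w with
  | nil => exact excTo_inl u k
  | cons a w =>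
    rw [List.map_cons, pathTo, excTrans_inl_inr, betweenRays]
    exact congrArg _ (key a)

theorem hasSum_rayWeight (hq : 2 ≤ q) {u : ℂ} (hu : ‖u‖ < (q : ℝ)⁻¹) :
    HasSum (rayWeight q u) (excC q u) := by
  have h := (hasSum_geometric_of_norm_lt_one (norm_mul_sq_lt hq hu)).mul_left (((q : ℂ) - 1) * u ^ 2)
  refine (h.congr_fun fun k => ?_)
  rw [rayWeight, mul_pow, ← pow_mul]
  ring

theorem sum_sideWeight (u : ℂ) : ∑' σ, sideWeight q N u σ = excS q N u := by
  rw [tsum_fintype, Fintype.sum_sum_type, excS, excA, Finset.mul_sum, Finset.sum_range]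
  simp [sideWeight, rayWeight]

theorem sum_sideWeight_sign (u : ℂ) :
    ∑' σ, (if σ.isRight then sideWeight q N u σ else -sideWeight q N u σ) =
      excL q N u - excA q N u := by
  rw [tsum_fintype, Fintype.sum_sum_type, excA, Finset.mul_sum, Finset.sum_range]
  simp only [sideWeight, rayWeight, Sum.isRight_inl, Sum.isRight_inr, Bool.false_eq_true, if_false,
    if_true, Finset.sum_neg_distrib]
  simp
  ring

theorem norm_sub_natCast (hq : 2 ≤ q) {m : ℕ} (hm : m ≤ 2) : ((‖(q : ℂ) - m‖ : ℝ) : ℂ) = (q : ℂ) - m := by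
  rw [← Nat.cast_sub (hm.trans hq), Complex.norm_natCast]
  simp

theorem ofReal_norm_rayWeight (hq : 2 ≤ q) (u : ℂ) (k : ℕ) :
    ((‖rayWeight q u k‖ : ℝ) : ℂ) = rayWeight q (‖u‖ : ℂ) k := by
  have h1 := norm_sub_natCast hq (m := 1) (by norm_num)
  rw [Nat.cast_one] at h1
  rw [rayWeight, rayWeight, norm_mul, Complex.ofReal_mul, h1]
  simp

theorem ofReal_norm_sideWeight (hq : 2 ≤ q) (u : ℂ) (σ : Fin N ⊕ Unit) :
    ((‖sideWeight q N u σ‖ : ℝ) : ℂ) = sideWeight q N (‖u‖ : ℂ) σ := by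
  cases σ with
  | inl k => exact ofReal_norm_rayWeight hq u k
  | inr _ => simp [sideWeight, excL]

theorem ofReal_norm_pathTo {α : Type*} {ω ω' : α → α → ℂ} {f f' : α → ℂ}
    (hω : ∀ s t, ((‖ω s t‖ : ℝ) : ℂ) = ω' s t) (hf : ∀ s, ((‖f s‖ : ℝ) : ℂ) = f' s) (a : α)
    (l : List α) : ((‖pathTo ω f a l‖ : ℝ) : ℂ) = pathTo ω' f' a l := by
  induction l generalizing a with
  | nil => exact hf a
  | cons b l ih => rw [pathTo, pathTo, norm_mul, Complex.ofReal_mul, hω, ih]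

theorem ofReal_norm_betweenRays (hq : 2 ≤ q) (u : ℂ) (w : List (Bool × (Fin N ⊕ Unit))) :
    ((‖betweenRays q u w‖ : ℝ) : ℂ) = betweenRays q (‖u‖ : ℂ) w := by
  have h1 := norm_sub_natCast hq (m := 1) (by norm_num)
  rw [Nat.cast_one] at h1
  cases w with
  | nil =>
    have h2 := norm_sub_natCast hq (m := 2) le_rfl
    rwa [Nat.cast_ofNat] at h2
  | cons a w =>
    refine ofReal_norm_pathTo (fun s t => ?_) (fun s => ?_) a w
    · rw [coverTrans, coverTrans]
      split_ifs
      · exact ofReal_norm_sideWeight hq u _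
      · simp
    · rw [norm_mul, Complex.ofReal_mul, h1, ofReal_norm_sideWeight hq]

theorem summable_norm_sideWeight (u : ℂ) : Summable fun σ => ‖sideWeight q N u σ‖ :=
  (hasSum_fintype _).summable

theorem tsum_norm_sideWeight (hq : 2 ≤ q) (u : ℂ) :
    ∑' σ, ‖sideWeight q N u σ‖ = excS q N ‖u‖ := by
  apply Complex.ofReal_injective
  rw [Complex.ofReal_tsum, ofReal_excS, ← sum_sideWeight]
  exact tsum_congr fun σ => ofReal_norm_sideWeight hq u σ

theorem tsum_norm_sideWeight_lt (hq : 2 ≤ q) {u : ℂ} (hu : ‖u‖ < (q : ℝ)⁻¹) :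
    ∑' σ, ‖sideWeight q N u σ‖ < 1 := by
  rw [tsum_norm_sideWeight hq]
  exact excS_lt_one hq (norm_nonneg u) hu.le

theorem betweenRays_liftCons (u : ℂ) (y : Bool × (Fin N ⊕ Unit) × List (Fin N ⊕ Unit)) :
    betweenRays q u (liftCons Sum.isRight y) =
      ((q : ℂ) - 1) * ((liftCons Sum.isRight y).map fun a => sideWeight q N u a.2).prod := by
  obtain ⟨i, s, w⟩ := y
  have h2 : (liftCons Sum.isRight (i, s, w)).map (fun a => sideWeight q N u a.2) =
      (s :: w).map (sideWeight q N u) := by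
    conv_rhs => rw [← map_snd_liftPath Sum.isRight i (s :: w), List.map_map]
    rfl
  rw [h2, liftCons, liftPath, betweenRays,
    pathTo_liftPath Sum.isRight _ _ (fun _ => (q : ℂ) - 1) (fun _ => rfl), mul_comm]

/-- The value `kap` is also the growth series of the first free factor without the trivial element.
-/
theorem hasSum_betweenRays (hq : 2 ≤ q) {u : ℂ} (hu : ‖u‖ < (q : ℝ)⁻¹) :
    HasSum (betweenRays (N := N) q u) (kap q N u) := by
  have h1 := (hasSum_liftCons Sum.isRight (summable_norm_sideWeight (N := N) u)
    (tsum_norm_sideWeight_lt hq hu)).mul_left ((q : ℂ) - 1)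
  rw [sum_sideWeight] at h1
  have h2 : HasSum (fun w => if w = [] then 0 else betweenRays (N := N) q u w)
      (((q : ℂ) - 1) * (2 * (excS q N u / (1 - excS q N u)))) := by
    refine ((liftCons_injective (Sum.isRight : Fin N ⊕ Unit → Bool)).hasSum_iff fun w hw => ?_).1
      (h1.congr_fun fun y => ?_)
    · cases w with
      | nil => rfl
      | cons a w =>
        by_contra h
        rw [if_neg (List.cons_ne_nil a w), betweenRays] at h
        refine hw ⟨(a.1, a.2, w.map Prod.snd), ?_⟩
        rw [liftCons, liftPath, ← liftPath_of_pathTo_ne_zero Sum.isRight h]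
    · have h3 : liftCons Sum.isRight y ≠ [] := by simp [liftCons, liftPath]
      simp only [Function.comp, if_neg h3]
      exact betweenRays_liftCons u y
  have h3 := (hasSum_ite_eq ([] : List (Bool × (Fin N ⊕ Unit))) ((q : ℂ) - 2)).add h2
  refine h3.congr_fun fun w => ?_
  by_cases h : w = []
  · subst h; simp [betweenRays]
  · simp [h]

/-- The excursions into the ray are marked. -/
def IsRay (i : Exc N) : Prop := i.isLeft = true

/-- Excursions to the sides. -/
def sideEquiv : Bool × (Fin N ⊕ Unit) ≃ {i : Exc N // ¬ IsRay i} where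
  toFun a := ⟨.inr a, by simp [IsRay]⟩
  invFun i := match i with
    | ⟨.inr a, _⟩ => a
    | ⟨.inl _, h⟩ => absurd rfl h
  left_inv _ := rfl
  right_inv i := match i with
    | ⟨.inr _, _⟩ => rfl
    | ⟨.inl _, h⟩ => absurd rfl h

/-- Excursions into the ray. -/
def rayEquiv : ℕ ≃ {i : Exc N // IsRay i} where
  toFun k := ⟨.inl k, rfl⟩
  invFun i := match i with
    | ⟨.inl k, _⟩ => k
    | ⟨.inr _, h⟩ => absurd h (by simp [IsRay])
  left_inv _ := rfl
  right_inv i := match i with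
    | ⟨.inl _, _⟩ => rfl
    | ⟨.inr _, h⟩ => absurd h (by simp [IsRay])

/-- Blocks of excursions which start with an excursion into the ray. -/
def rayBlockEquiv : ℕ × List (Bool × (Fin N ⊕ Unit)) ≃ Block (IsRay (N := N)) :=
  rayEquiv.prodCongr (Equiv.listEquivOfEquiv sideEquiv)

theorem pathTo_rayBlock (u : ℂ) (y : ℕ × List (Bool × (Fin N ⊕ Unit))) :
    pathTo (excTrans q u) (excTo q u) (rayBlockEquiv y).1.1 ((rayBlockEquiv y).2.map Subtype.val) =
      rayWeight q u y.1 * betweenRays q u y.2 := by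
  rw [← pathTo_excTrans]
  have : (rayBlockEquiv y).2.map Subtype.val = y.2.map Sum.inr := by
    change (y.2.map sideEquiv).map Subtype.val = _
    rw [List.map_map]
    rfl
  rw [this]
  rfl

theorem hasSum_rayBlock (hq : 2 ≤ q) {u : ℂ} (hu : ‖u‖ < (q : ℝ)⁻¹) :
    HasSum (fun b : Block (IsRay (N := N)) =>
      pathTo (excTrans q u) (excTo q u) b.1.1 (b.2.map Subtype.val)) (excC q u * kap q N u) := by
  rw [← rayBlockEquiv.hasSum_iff]
  exact (HasSum.mul_prod (hasSum_rayWeight hq hu) (hasSum_betweenRays hq hu)).congr_fun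
    fun y => pathTo_rayBlock u y

theorem hasSum_norm_rayBlock (hq : 2 ≤ q) {u : ℂ} (hu : ‖u‖ < (q : ℝ)⁻¹) :
    HasSum (fun b : Block (IsRay (N := N)) =>
      ‖pathTo (excTrans q u) (excTo q u) b.1.1 (b.2.map Subtype.val)‖)
      (excC q ‖u‖ * kap q N ‖u‖) := by
  have h := hasSum_rayBlock (N := N) hq (u := (‖u‖ : ℂ)) (by simpa using hu)
  rw [← ofReal_excC, ← ofReal_kap, ← Complex.ofReal_mul] at h
  refine Complex.hasSum_ofReal.1 (h.congr_fun fun b => ?_)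
  obtain ⟨y, rfl⟩ := rayBlockEquiv.surjective b
  rw [pathTo_rayBlock, pathTo_rayBlock, norm_mul, Complex.ofReal_mul, ofReal_norm_rayWeight hq,
    ofReal_norm_betweenRays hq]

theorem excTrans_of_isRay (u : ℂ) (i j : Exc N) (h : IsRay j) : excTrans q u i j = excTo q u i := by
  rcases j with k | a
  · rfl
  · simp [IsRay] at h

theorem mem_range_sideEquiv (i : {i : Exc N // ¬ IsRay i}) : i ∈ Set.range sideEquiv :=
  sideEquiv.surjective i

variable (q) in
/-- The transition weights of the excursions to the sides. -/
def sideTrans (u : ℂ) (s t : {i : Exc N // ¬ IsRay i}) : ℂ := excTrans q u s.1 t.1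

theorem cyc_sideEquiv (u : ℂ) (c : Cycle (Bool × (Fin N ⊕ Unit))) :
    (transWeight (sideTrans q u)).cyc (c.map sideEquiv) =
      (transWeight (coverTrans Sum.isRight (sideWeight q N u))).cyc c := by
  rw [transWeight_cyc_map]
  have : (fun s t : Bool × (Fin N ⊕ Unit) => sideTrans q u (sideEquiv s) (sideEquiv t)) =
      coverTrans Sum.isRight (sideWeight q N u) := by
    funext s t
    exact excTrans_inr_inr u s t
  rw [this]

/-- The Euler product over the prime cyclic words of excursions: the excursions into the ray are
eliminated, and the words without such excursions are those of a double cover of the alphabet of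
excursions to a side. -/
theorem hasSum_excursions (hq : 2 ≤ q) {u : ℂ} (hu : ‖u‖ < (q : ℝ)⁻¹) :
    HasSum (fun c : PrimeCyc (Exc N) => -Complex.log (1 - (transWeight (excTrans q u)).cyc c.1))
      (-Complex.log (1 - excC q u * kap q N u) + (-Complex.log (1 - excS q N u) +
        -Complex.log (1 - (excL q N u - excA q N u)))) := by
  have h := hasSum_doubleCover Sum.isRight (summable_norm_sideWeight (N := N) u)
    (tsum_norm_sideWeight_lt hq hu)
  rw [sum_sideWeight, sum_sideWeight_sign] at h
  rw [← (hasSum_rayBlock hq hu).tsum_eq]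
  refine hasSum_transWeight_split IsRay (excTrans_of_isRay u) (hasSum_norm_rayBlock hq hu).summable ?_ ?_
  · rw [(hasSum_norm_rayBlock hq hu).tsum_eq]
    exact kap_mul_excC_lt hq (norm_nonneg u) hu
  · refine hasSum_primeCyc_restrict sideEquiv.injective (g := fun c => -Complex.log
      (1 - (transWeight (sideTrans (N := N) q u)).cyc c)) ?_ ?_
    · rintro c ⟨i, -, hi⟩
      exact absurd (mem_range_sideEquiv i) hi
    · simp only [cyc_sideEquiv]
      exact h

theorem norm_excursions (hq : 2 ≤ q) {u : ℂ} (hu : ‖u‖ < (q : ℝ)⁻¹) (c : PrimeCyc (Exc N)) :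
    ‖(transWeight (excTrans q u)).cyc c.1‖ < 1 := by
  refine norm_transWeight_split IsRay (excTrans_of_isRay u) (hasSum_norm_rayBlock hq hu).summable ?_ ?_ c
  · rw [(hasSum_norm_rayBlock hq hu).tsum_eq]
    exact kap_mul_excC_lt hq (norm_nonneg u) hu
  · refine norm_primeCyc_restrict sideEquiv.injective (g := (transWeight
      (sideTrans (N := N) q u)).cyc) ?_ ?_
    · rintro c ⟨i, -, hi⟩
      exact absurd (mem_range_sideEquiv i) hi
    · intro c
      rw [cyc_sideEquiv]
      exact norm_doubleCover Sum.isRight (summable_norm_sideWeight u) (tsum_norm_sideWeight_lt hq hu) c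

end ExcursionWords

/-! ### The Bass–Ihara zeta function as an Euler product -/

section BassIhara

variable {q N : ℕ}

/-- The position of an edge in its line, and `none` for the edge joining the ends of the sides. -/
def lineIndex : XEdge N → Option ℕ
  | .aEdge k => some k
  | .bEdge k => some k
  | .cross => none
  | .cEdge k => some k

theorem lineIndex_lineEdge {t : Option Bool} {k : ℕ} (h : Valid N t k) :
    lineIndex (lineEdge N t k) = some k := by
  rcases t with _ | _ | _
  · rfl
  · simp only [lineEdge, dif_pos (show k < N from h)]
    rfl
  · simp only [lineEdge, dif_pos (show k < N from h)]
    rfl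

/-- A path which does not pass `c_1` first goes up, then through the edge joining the ends of the
sides, and then down; this rank increases along it. -/
def edgeRank (e : OEdge N) : ℕ ×ₗ ℤ :=
  match lineIndex e.1 with
  | none => toLex (1, 0)
  | some k => if e.2 then toLex (0, k) else toLex (2, -k)

theorem edgeRank_upE {t : Option Bool} {k : ℕ} (h : Valid N t k) :
    edgeRank (upE N t k) = toLex (0, (k : ℤ)) := by
  simp [edgeRank, lineIndex_lineEdge h]

theorem edgeRank_downE {t : Option Bool} {k : ℕ} (h : Valid N t k) :
    edgeRank (downE N t k) = toLex (2, -(k : ℤ)) := by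
  simp [edgeRank, lineIndex_lineEdge h]

theorem edgeRank_crossE (s : Bool) : edgeRank (crossE N s) = toLex (1, 0) := rfl

/-- A path of nonzero weight that avoids `c_1` cannot be closed. -/
theorem edgeRank_lt (hq : 2 ≤ q) (hN : 1 ≤ N) {u : ℂ} {e e' : OEdge N}
    (h : edgeTrans q N u e e' ≠ 0) (he' : ¬ AtBase N e') : edgeRank e < edgeRank e' := by
  have h1 := edgeTrans_ne_zero h
  rcases edge_cases e with ⟨t, k, hv, rfl⟩ | ⟨t, k, hv, rfl⟩ | ⟨s, rfl⟩
  · rw [xtgt_upE hv] at h1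
    rw [edgeRank_upE hv]
    rcases (xsrc_eq_linePos_succ hN hv e').1 h1 with rfl | ⟨h2, rfl⟩ | ⟨s, rfl, h2, rfl⟩
    · rw [edgeRank_downE hv, Prod.Lex.toLex_lt_toLex]
      exact Or.inl two_pos
    · rw [edgeRank_upE h2, Prod.Lex.toLex_lt_toLex]
      exact Or.inr ⟨rfl, by simp⟩
    · rw [edgeRank_crossE, Prod.Lex.toLex_lt_toLex]
      exact Or.inl one_pos
  · rw [xtgt_downE hv] at h1
    rw [edgeRank_downE hv]
    cases k with
    | zero =>
      rw [linePos_zero] at h1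
      exact absurd h1 he'
    | succ k =>
      rcases (xsrc_eq_linePos_succ hN hv.of_succ e').1 h1 with rfl | ⟨-, rfl⟩ | ⟨s, rfl, h2, rfl⟩
      · rw [edgeRank_downE hv.of_succ, Prod.Lex.toLex_lt_toLex]
        exact Or.inr ⟨rfl, by simp⟩
      · exact absurd (edgeTrans_down_up hq hv) h
      · have : k + 1 < N := hv
        omega
  · obtain ⟨M, rfl⟩ : ∃ M, N = M + 1 := ⟨N - 1, by omega⟩
    have hv : Valid (M + 1) (some !s) M := Nat.lt_succ_self M
    rw [xtgt_crossE] at h1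
    rw [edgeRank_crossE]
    rcases (xsrc_eq_linePos_succ hN hv e').1 h1 with rfl | ⟨h2, rfl⟩ | ⟨s', hs', -, rfl⟩
    · rw [edgeRank_downE hv, Prod.Lex.toLex_lt_toLex]
      exact Or.inl one_lt_two
    · exact absurd h2 (lt_irrefl _)
    · rw [← Option.some.inj hs'] at h
      exact absurd (edgeTrans_cross_cross hq s) h

/-- Every closed path of nonzero weight passes `c_1`. -/
theorem cyc_not_atBase (hq : 2 ≤ q) (hN : 1 ≤ N) (u : ℂ) (c : PrimeCyc {e : OEdge N // ¬ AtBase N e}) :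
    (transWeight fun s t : {e : OEdge N // ¬ AtBase N e} => edgeTrans q N u s.1 t.1).cyc c.1 = 0 := by
  by_contra h
  have h1 := (chain_of_transWeight_ne_zero h).imp (r₂ := fun
    s t : {e : OEdge N // ¬ AtBase N e} => edgeRank s.1 < edgeRank t.1) fun s t hst => edgeRank_lt hq hN hst t.2
  obtain ⟨c, hc⟩ := c
  induction c using Quotient.inductionOn with
  | _ l =>
    obtain ⟨a, l, rfl⟩ := List.exists_cons_of_ne_nil (isPrime_coe.1 hc).1
    have : IsTrans {e : OEdge N // ¬ AtBase N e} fun s t => edgeRank s.1 < edgeRank t.1 :=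
      ⟨fun _ _ _ => lt_trans⟩
    have ha : a ∈ ((a :: l : List _) : Cycle {e : OEdge N // ¬ AtBase N e}) :=
      Cycle.mem_coe_iff.2 (List.mem_cons_self ..)
    exact lt_irrefl _ (Cycle.chain_iff_pairwise.1 h1 a ha a ha)

theorem exists_of_mem_chain {α : Type*} {r : α → α → Prop} {c : Cycle α} (h : c.Chain r) {a : α}
    (ha : a ∈ c) : ∃ b, r a b := by
  induction c using Quotient.inductionOn with
  | _ l =>
    obtain ⟨s, t, rfl⟩ := List.append_of_mem (Cycle.mem_coe_iff.1 ha)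
    have h2 : ((s ++ a :: t : List α) : Cycle α) = (a :: (t ++ s) : List α) :=
      Cycle.coe_eq_coe.2 List.isRotated_append
    change Cycle.Chain r ((s ++ a :: t : List α) : Cycle α) at h
    rw [h2, Cycle.chain_coe_cons] at h
    obtain ⟨b, l, hl⟩ := List.exists_cons_of_ne_nil (show t ++ s ++ [a] ≠ [] by simp)
    rw [hl, List.isChain_cons_cons] at h
    exact ⟨b, h.1⟩

theorem blockTrans_exc (hq : 2 ≤ q) (hN : 1 ≤ N) (u : ℂ) (i j : Exc N) :
    blockTrans (edgeTrans q N u) (i.block hN) (j.block hN) = excTrans q u i j := by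
  rw [blockTrans, Exc.block_snd]
  exact pathTo_exc hq hN _ (fun t => turnWeight q t j.start) (fun t => edgeTrans_turn hq hN t _) i

theorem cyc_flat_block (hq : 2 ≤ q) (hN : 1 ≤ N) (u : ℂ) (c : Cycle (Exc N)) :
    (transWeight (edgeTrans q N u)).cyc (flatCyc (c.map (Exc.block hN))) =
      (transWeight (excTrans q u)).cyc c := by
  induction c using Quotient.inductionOn with
  | _ l =>
    change transWeight _ (flat (l.map _)) = transWeight _ l
    rw [transWeight_flat_eq, transWeight_map]
    have : (fun s t => blockTrans (edgeTrans q N u) (Exc.block hN s) (Exc.block hN t)) =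
        excTrans q u := funext fun i => funext fun j => blockTrans_exc hq hN u i j
    rw [this]

/-- A cyclic word of blocks that are not all excursions has the weight `0`. -/
theorem cyc_flat_of_not_mem (hq : 2 ≤ q) (hN : 1 ≤ N) (u : ℂ) (c : Cycle (Block (AtBase N)))
    (h : ∃ a ∈ c, a ∉ Set.range (Exc.block hN)) :
    (transWeight (edgeTrans q N u)).cyc (flatCyc c) = 0 := by
  have h1 : (transWeight (edgeTrans q N u)).cyc (flatCyc c) =
      (transWeight (blockTrans (edgeTrans q N u))).cyc c := by
    induction c using Quotient.inductionOn with
    | _ l => exact transWeight_flat_eq _ l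
  rw [h1]
  by_contra h0
  obtain ⟨a, ha, hna⟩ := h
  obtain ⟨b, hb⟩ := exists_of_mem_chain (chain_of_transWeight_ne_zero h0) ha
  obtain ⟨i, hi1, hi2⟩ := exists_exc_of_pathTo_ne_zero hq hN
    (fun e he => (edgeTrans_ne_zero he).symm.trans b.1.2) a.1.2
    (fun e he => by
      obtain ⟨e, -, rfl⟩ := List.mem_map.1 he
      exact e.2) hb
  refine hna ⟨i, Prod.ext (Subtype.ext hi1.symm) ?_⟩
  exact List.map_injective_iff.2 Subtype.val_injective ((i.block_snd hN).trans hi2.symm)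

/-- The closed paths of nonzero weight are the cyclic words of excursions. -/
theorem hasSum_edges (hq : 2 ≤ q) (hN : 1 ≤ N) {u : ℂ} (hu : ‖u‖ < (q : ℝ)⁻¹) :
    HasSum (fun c : PrimeCyc (OEdge N) => -Complex.log (1 - (transWeight (edgeTrans q N u)).cyc c.1))
      (-Complex.log (1 - excC q u * kap q N u) + (-Complex.log (1 - excS q N u) +
        -Complex.log (1 - (excL q N u - excA q N u)))) := by
  have h := hasSum_primeCyc_split (AtBase N)
    (g := fun c => -Complex.log (1 - (transWeight (edgeTrans q N u)).cyc c))
    (s₁ := -Complex.log (1 - excC q u * kap q N u) + (-Complex.log (1 - excS q N u) +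
        -Complex.log (1 - (excL q N u - excA q N u)))) (s₂ := 0) ?_ ?_
  · rwa [add_zero] at h
  · refine hasSum_primeCyc_restrict (Exc.block_injective hN) (g := fun c => -Complex.log
      (1 - (transWeight (edgeTrans q N u)).cyc (flatCyc c))) (fun c hc => ?_) ?_
    · rw [cyc_flat_of_not_mem hq hN u c hc]
      simp
    · simp only [cyc_flat_block hq hN]
      exact hasSum_excursions hq hu
  · refine hasSum_zero.congr_fun fun c => ?_
    rw [transWeight_cyc_map, cyc_not_atBase hq hN u c]
    simp

theorem norm_edges (hq : 2 ≤ q) (hN : 1 ≤ N) {u : ℂ} (hu : ‖u‖ < (q : ℝ)⁻¹) (c : PrimeCyc (OEdge N)) :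
    ‖(transWeight (edgeTrans q N u)).cyc c.1‖ < 1 := by
  refine norm_primeCyc_split (AtBase N) (g := (transWeight (edgeTrans q N u)).cyc) ?_ (fun c => ?_) c
  · refine norm_primeCyc_restrict (Exc.block_injective hN) (g := fun c =>
      (transWeight (edgeTrans q N u)).cyc (flatCyc c)) (fun c hc => ?_) (fun c => ?_)
    · exact cyc_flat_of_not_mem hq hN u c hc
    · rw [cyc_flat_block hq hN]
      exact norm_excursions hq hu c
  · rw [transWeight_cyc_map, cyc_not_atBase hq hN u c, norm_zero]
    exact one_pos

theorem cyc_eq_zero_of_not_chain (u : ℂ) {c : Cycle (OEdge N)}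
    (h : ¬ c.Chain fun e e' => xtgt N e = xsrc N e') : (transWeight (edgeTrans q N u)).cyc c = 0 := by
  by_contra h0
  exact h ((chain_of_transWeight_ne_zero h0).imp fun e e' h' => (edgeTrans_ne_zero h').symm)

theorem transWeight_eq_pathWeight (u : ℂ) {l : List (OEdge N)} (hl : l ≠ [])
    (h : Cycle.Chain (fun e e' => xtgt N e = xsrc N e') (l : Cycle (OEdge N))) :
    transWeight (edgeTrans q N u) l =
      ((List.zipWith (xweight₂ q N) l (l.rotate 1)).prod : ℂ) * u ^ l.length := by
  obtain ⟨a, l, rfl⟩ := List.exists_cons_of_ne_nil hl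
  rw [Cycle.chain_coe_cons] at h
  rw [transWeight_cons, List.rotate_cons_succ, List.rotate_zero]
  have key : ∀ (b : OEdge N) (l : List (OEdge N)),
      List.IsChain (fun e e' => xtgt N e = xsrc N e') (b :: (l ++ [a])) →
      pathTo (edgeTrans q N u) (fun s => edgeTrans q N u s a) b l =
        ((List.zipWith (xweight₂ q N) (b :: l) (l ++ [a])).prod : ℂ) * u ^ (b :: l).length := by
    intro b l
    induction l generalizing b with
    | nil =>
      intro h
      simp [pathTo, edgeTrans, (List.isChain_cons_cons.1 h).1]
    | cons c l ih =>
      intro h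
      rw [List.cons_append, List.isChain_cons_cons] at h
      rw [pathTo, ih c h.2, edgeTrans, if_pos h.1, List.cons_append, List.zipWith_cons_cons,
        List.prod_cons, List.length_cons (as := c :: l), pow_succ]
      push_cast
      ring
  exact key a l h

/-- A prime cycle as a prime cyclic word in the oriented edges. -/
def primeCycleWord (c : (XGraph q N).PrimeCycle) : PrimeCyc (OEdge N) := ⟨c.1, c.2.1, c.2.2.2⟩

theorem primeCycleWord_injective : Function.Injective (primeCycleWord (q := q) (N := N)) :=
  fun _ _ h => Subtype.ext (congrArg (fun c : PrimeCyc (OEdge N) => c.1) h)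

theorem cyc_primeCycleWord (u : ℂ) (c : (XGraph q N).PrimeCycle) :
    (transWeight (edgeTrans q N u)).cyc (primeCycleWord c).1 =
      (cycleWeight c.1 : ℂ) * u ^ c.1.length := by
  obtain ⟨c, h1, h2, h3⟩ := c
  induction c using Quotient.inductionOn with
  | _ l =>
    have hl : l ≠ [] := fun h => h1 (by rw [h]; rfl)
    exact transWeight_eq_pathWeight u hl h2

theorem one_sub_excC_mul_kap_ne_zero (hq : 2 ≤ q) {u : ℂ} (hu : ‖u‖ < (q : ℝ)⁻¹) :
    1 - excC q u * kap q N u ≠ 0 := by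
  refine one_sub_ne_zero_of_norm ?_
  rw [← (hasSum_rayBlock (N := N) hq hu).tsum_eq]
  refine (norm_tsum_le_tsum_norm (hasSum_norm_rayBlock hq hu).summable).trans_lt ?_
  rw [(hasSum_norm_rayBlock hq hu).tsum_eq]
  exact kap_mul_excC_lt hq (norm_nonneg u) hu

theorem hasProd_bassIhara_euler (hq : 2 ≤ q) (hN : 1 ≤ N) {u : ℂ} (hu : ‖u‖ < (q : ℝ)⁻¹) :
    HasProd (fun c : (XGraph q N).PrimeCycle => bassIharaFactor u c)
      ((1 - excC q u * kap q N u)⁻¹ * (loopFactor q N u)⁻¹) := by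
  have h := (primeCycleWord_injective (q := q) (N := N)).hasSum_iff (fun c hc => by
    rw [cyc_eq_zero_of_not_chain u fun h => hc ⟨⟨c.1, c.2.1, h, c.2.2⟩, rfl⟩]
    simp) |>.2 (hasSum_edges hq hN hu)
  have h2 := h.cexp
  have h3 := one_sub_excC_mul_kap_ne_zero (N := N) hq hu
  have h4 := loopFactor_ne_zero (N := N) hq hu
  rw [loopFactor_eq] at h4 ⊢
  have h5 : 1 - (excL q N u - excA q N u) = 1 + excA q N u - excL q N u := by ring
  rw [h5, Complex.exp_add, Complex.exp_add, exp_neg_log h3, exp_neg_log (left_ne_zero_of_mul h4),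
    exp_neg_log (right_ne_zero_of_mul h4), ← mul_inv] at h2
  refine h2.congr_fun fun c => ?_
  simp only [Function.comp]
  rw [exp_neg_log (one_sub_ne_zero_of_norm (norm_edges hq hN hu _)), cyc_primeCycleWord]
  rfl

end BassIhara

/-! ### The explicit zeta functions -/

section Explicit

variable {q N : ℕ}

/-- The factor of the Bass–Ihara zeta function that comes from the loop. -/
def oddFactor (q N : ℕ) (u : ℂ) : ℂ :=
  (1 + u) * ∑ k ∈ Finset.range N, (q : ℂ) ^ k * u ^ (2 * k) + (q : ℂ) ^ N * u ^ (2 * N)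

theorem geom_identity (q N : ℕ) (u : ℂ) :
    ((q : ℂ) * u ^ 2 - 1) * ∑ k ∈ Finset.range N, (q : ℂ) ^ k * u ^ (2 * k) =
      (q : ℂ) ^ N * u ^ (2 * N) - 1 := by
  have h := geom_sum_mul ((q : ℂ) * u ^ 2) N
  simp only [mul_pow, ← pow_mul] at h
  rw [mul_comm, h]

theorem excA_eq (q N : ℕ) (u : ℂ) :
    excA q N u = ((q : ℂ) - 1) * u ^ 2 * ∑ k ∈ Finset.range N, (q : ℂ) ^ k * u ^ (2 * k) := by
  rw [excA, mul_assoc, Finset.mul_sum (a := u ^ 2)]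
  congr 1
  exact Finset.sum_congr rfl fun k _ => by ring

theorem poleFactor_eq (q N : ℕ) (u : ℂ) : poleFactor q N u =
    1 + ((q : ℂ) - 1) * u * ∑ k ∈ Finset.range N, (q : ℂ) ^ k * u ^ (2 * k) +
      ((q : ℂ) - 2) * u * ((q : ℂ) ^ N * u ^ (2 * N)) := by
  rw [poleFactor, mul_assoc ((q : ℂ) - 1) u, Finset.mul_sum (a := u)]
  congr 1
  · congr 2
    exact Finset.sum_congr rfl fun k _ => by ring
  · ring

/-- The factor of the nontrivial character of the double cover appears in the denominator of the
Bass–Ihara zeta function. -/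
theorem one_add_excA_sub_excL (q N : ℕ) (u : ℂ) :
    1 + excA q N u - excL q N u = (1 - u) * oddFactor q N u := by
  rw [excA_eq, excL, oddFactor, pow_succ]
  linear_combination geom_identity q N u

/-- The left hand side is `1 - excC q u * kap q N u`, multiplied by the denominators of `excC` and
`kap`. -/
theorem kap_identity (q N : ℕ) (u : ℂ) :
    (1 - (q : ℂ) * u ^ 2) * (1 - excS q N u) - ((q : ℂ) - 1) * u ^ 2 *
      (((q : ℂ) - 2) * (1 - excS q N u) + ((q : ℂ) - 1) * (2 * excS q N u)) =
      (1 + u) * (1 - (q : ℂ) * u) * poleFactor q N u := by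
  have h := geom_identity q N u
  rw [excS, excA_eq, excL, poleFactor_eq, pow_succ u (2 * N), ← mul_assoc _ _ u]
  generalize (∑ k ∈ Finset.range N, (q : ℂ) ^ k * u ^ (2 * k)) = σ at *
  generalize (q : ℂ) ^ N * u ^ (2 * N) = g at *
  linear_combination (u * ((q : ℂ) - 1) * (1 - ((q : ℂ) - 2) * u)) * h

theorem one_sub_excC_mul_kap (hq : 2 ≤ q) {u : ℂ} (hu : ‖u‖ < (q : ℝ)⁻¹) :
    (1 - (q : ℂ) * u ^ 2) * (1 - excS q N u) * (1 - excC q u * kap q N u) =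
      (1 + u) * (1 - (q : ℂ) * u) * poleFactor q N u := by
  have h1 := one_sub_ne_zero_of_norm (norm_mul_sq_lt hq hu)
  have h2 := one_sub_ne_zero_of_norm (norm_excS_lt (N := N) hq hu)
  rw [← kap_identity, excC, kap]
  field_simp

/-- The denominator of the Bass–Ihara zeta function. -/
def denom (q N : ℕ) (u : ℂ) : ℂ :=
  (1 - u ^ 2) * (1 - (q : ℂ) * u) * oddFactor q N u * poleFactor q N u

theorem explicitBassIhara_eq (q N : ℕ) (u : ℂ) :
    explicitBassIhara q N u = (1 - (q : ℂ) * u ^ 2) / denom q N u := rfl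

theorem denom_eq (hq : 2 ≤ q) {u : ℂ} (hu : ‖u‖ < (q : ℝ)⁻¹) :
    denom q N u = (1 - (q : ℂ) * u ^ 2) * ((1 - excC q u * kap q N u) * loopFactor q N u) := by
  rw [denom, loopFactor_eq, one_add_excA_sub_excL]
  linear_combination (-(1 - u) * oddFactor q N u) * one_sub_excC_mul_kap (N := N) hq hu

theorem denom_ne_zero (hq : 2 ≤ q) {u : ℂ} (hu : ‖u‖ < (q : ℝ)⁻¹) : denom q N u ≠ 0 := by
  rw [denom_eq hq hu]
  exact mul_ne_zero (one_sub_ne_zero_of_norm (norm_mul_sq_lt hq hu))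
    (mul_ne_zero (one_sub_excC_mul_kap_ne_zero hq hu) (loopFactor_ne_zero hq hu))

theorem explicitBassIhara_eq_inv (hq : 2 ≤ q) {u : ℂ} (hu : ‖u‖ < (q : ℝ)⁻¹) :
    explicitBassIhara q N u = (1 - excC q u * kap q N u)⁻¹ * (loopFactor q N u)⁻¹ := by
  rw [explicitBassIhara_eq, denom_eq hq hu, ← mul_inv, ← div_div,
    div_self (one_sub_ne_zero_of_norm (norm_mul_sq_lt hq hu)), one_div]

theorem hasProd_bassIhara (hq : 2 ≤ q) (hN : 1 ≤ N) {u : ℂ} (hu : ‖u‖ < (q : ℝ)⁻¹) :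
    HasProd (fun c : (XGraph q N).PrimeCycle => bassIharaFactor u c) (explicitBassIhara q N u) := by
  rw [explicitBassIhara_eq_inv hq hu]
  exact hasProd_bassIhara_euler hq hN hu

theorem hasProd_explicitSelberg (hq : 2 ≤ q) {u : ℂ} (hu : ‖u‖ < (q : ℝ)⁻¹) :
    HasProd (fun c : (XGraph q N).PrimitiveClass (XTree q N) => selbergFactor u c)
      (explicitSelberg q N u) := by
  have h := (hasProd_selberg (N := N) hq hu).2
  have h2 : q - 1 = q - 2 + 1 := by omega
  rw [explicitSelberg, explicitBassIhara_eq_inv hq hu, mul_assoc ((1 - excC q u * kap q N u)⁻¹),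
    ← pow_succ', ← h2]
  exact h

end Explicit

/-! ### Poles of quotients of holomorphic functions -/

section Quotients

open Metric

/-- The function `f` is the quotient `n / d` on the disc `|u| < R`, where `n` and `d` are
holomorphic on the larger disc `|u| < ρ` and `d` has no zeros with `|u| < R`. -/
structure IsQuotient (f n d : ℂ → ℂ) (R ρ : ℝ) : Prop where
  pos : 0 < R
  lt : R < ρ
  diff_num : DifferentiableOn ℂ n (ball 0 ρ)
  diff_den : DifferentiableOn ℂ d (ball 0 ρ)
  eq : ∀ u ∈ ball (0 : ℂ) R, f u = n u / d u
  ne : ∀ u ∈ ball (0 : ℂ) R, d u ≠ 0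

variable {f n d : ℂ → ℂ} {R ρ : ℝ}

namespace IsQuotient

theorem analyticAt_num (h : IsQuotient f n d R ρ) {x : ℂ} (hx : x ∈ ball (0 : ℂ) ρ) :
    AnalyticAt ℂ n x := h.diff_num.analyticAt (isOpen_ball.mem_nhds hx)

theorem analyticAt_den (h : IsQuotient f n d R ρ) {x : ℂ} (hx : x ∈ ball (0 : ℂ) ρ) :
    AnalyticAt ℂ d x := h.diff_den.analyticAt (isOpen_ball.mem_nhds hx)

theorem eventuallyEq (h : IsQuotient f n d R ρ) : (fun u => n u / d u) =ᶠ[𝓝 0] f := by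
  filter_upwards [isOpen_ball.mem_nhds (mem_ball_self h.pos)] with u hu
  exact (h.eq u hu).symm

theorem meromorphicOn (h : IsQuotient f n d R ρ) {r : ℝ} (hr : r < ρ) :
    MeromorphicOn (fun u => n u / d u) (closedBall 0 r) := fun _ hx =>
  (h.analyticAt_num (closedBall_subset_ball hr hx)).meromorphicAt.div
    (h.analyticAt_den (closedBall_subset_ball hr hx)).meromorphicAt

theorem isMeromorphicContinuation (h : IsQuotient f n d R ρ) {r : ℝ} (hr : r < ρ) :
    IsMeromorphicContinuation f (fun u => n u / d u) r := ⟨h.meromorphicOn hr, h.eventuallyEq⟩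

/-- The power series of `f` at the origin converges on the disc `|u| < R`. -/
theorem exists_hasFPowerSeries (h : IsQuotient f n d R ρ) : ∃ p : FormalMultilinearSeries ℂ ℂ ℂ,
    ∀ r : NNReal, 0 < r → (r : ℝ) < R → HasFPowerSeriesOnBall f p 0 r := by
  have hd : DifferentiableOn ℂ f (ball 0 R) := by
    have hsub : ball (0 : ℂ) R ⊆ ball 0 ρ := ball_subset_ball h.lt.le
    exact ((h.diff_num.mono hsub).div (h.diff_den.mono hsub) h.ne).congr h.eq
  have hser : ∀ r : NNReal, 0 < r → (r : ℝ) < R →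
      HasFPowerSeriesOnBall f (cauchyPowerSeries f 0 r) 0 r := fun r hr hrR =>
    (hd.mono (closedBall_subset_ball hrR)).hasFPowerSeriesOnBall hr
  obtain ⟨r₀, hr₀⟩ : ∃ r₀ : NNReal, (r₀ : ℝ) = R / 2 := ⟨⟨R / 2, by linarith [h.pos]⟩, rfl⟩
  have h0 : 0 < r₀ := by
    rw [← NNReal.coe_pos, hr₀]
    linarith [h.pos]
  refine ⟨cauchyPowerSeries f 0 r₀, fun r hr hrR => ?_⟩
  have h1 := hser r₀ h0 (by rw [hr₀]; linarith [h.pos])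
  rw [h1.hasFPowerSeriesAt.eq_formalMultilinearSeries (hser r hr hrR).hasFPowerSeriesAt]
  exact hser r hr hrR

/-- If the denominator vanishes at the point `R` and the numerator does not, the radius of
convergence is exactly `R`. -/
theorem hasConvergenceRadius (h : IsQuotient f n d R ρ) (hd : d R = 0) (hn : n R ≠ 0) :
    HasConvergenceRadius f R := by
  obtain ⟨p, hp⟩ := h.exists_hasFPowerSeries
  obtain ⟨r₀, hr₀⟩ : ∃ r₀ : NNReal, (r₀ : ℝ) = R / 2 := ⟨⟨R / 2, by linarith [h.pos]⟩, rfl⟩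
  have h0 : 0 < r₀ := by
    rw [← NNReal.coe_pos, hr₀]
    linarith [h.pos]
  refine ⟨p, (hp r₀ h0 (by rw [hr₀]; linarith [h.pos])).hasFPowerSeriesAt, le_antisymm ?_ ?_⟩
  · by_contra hlt
    rw [not_le] at hlt
    have hR : (R : ℂ) ∈ eball (0 : ℂ) p.radius := by
      rw [mem_eball, edist_eq_enorm_sub, sub_zero, ← ofReal_norm, Complex.norm_real,
        Real.norm_of_nonneg h.pos.le]
      exact hlt
    have hRρ : (R : ℂ) ∈ ball (0 : ℂ) ρ := by
      rw [mem_ball_zero_iff, Complex.norm_real, Real.norm_of_nonneg h.pos.le]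
      exact h.lt
    have hc : ContinuousAt (fun u => p.sum u * d u) R :=
      (p.analyticOnNhd _ hR).continuousAt.mul (h.analyticAt_den hRρ).continuousAt
    have hcn : ContinuousAt n R := (h.analyticAt_num hRρ).continuousAt
    have hcl : (R : ℂ) ∈ closure (ball (0 : ℂ) R) := by
      rw [closure_ball _ h.pos.ne', mem_closedBall_zero_iff, Complex.norm_real,
        Real.norm_of_nonneg h.pos.le]
    have := mem_closure_iff_nhdsWithin_neBot.1 hcl
    have heq : n =ᶠ[𝓝[ball (0 : ℂ) R] (R : ℂ)] fun u => p.sum u * d u := by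
      filter_upwards [self_mem_nhdsWithin] with u hu
      obtain ⟨r, hr1, hr2⟩ := exists_between (mem_ball_zero_iff.1 hu)
      have hr : 0 < r := (norm_nonneg u).trans_lt hr1
      have h1 := (hp ⟨r, hr.le⟩ hr hr2).sum (y := u) (by
        rw [mem_eball, edist_eq_enorm_sub, sub_zero, ← ofReal_norm]
        exact (ENNReal.ofReal_lt_ofReal_iff hr).2 hr1 |>.trans_eq (ENNReal.ofReal_eq_coe_nnreal hr.le))
      rw [zero_add] at h1
      rw [← h1, h.eq u hu, div_mul_cancel₀ _ (h.ne u hu)]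
    have h2 := tendsto_nhds_unique ((hcn.tendsto.mono_left nhdsWithin_le_nhds).congr' heq)
      (hc.tendsto.mono_left nhdsWithin_le_nhds)
    rw [hd, mul_zero] at h2
    exact hn h2
  · refine ENNReal.le_of_forall_nnreal_lt fun r hr => ?_
    rcases eq_or_ne r 0 with rfl | hr0
    · exact zero_le
    · refine (hp r (pos_iff_ne_zero.2 hr0) ?_).r_le
      rwa [← ENNReal.ofReal_coe_nnreal, ENNReal.ofReal_lt_ofReal_iff h.pos] at hr

/-- A zero of the denominator which is not a zero of the numerator is a pole. -/
theorem order_neg (h : IsQuotient f n d R ρ) {x : ℂ} (hx : ‖x‖ < ρ) (hd : d x = 0) (hn : n x ≠ 0) :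
    meromorphicOrderAt (fun u => n u / d u) x < 0 := by
  have hx' : x ∈ ball (0 : ℂ) ρ := mem_ball_zero_iff.2 hx
  have hm : MeromorphicAt (fun u => n u / d u) x :=
    (h.analyticAt_num hx').meromorphicAt.div (h.analyticAt_den hx').meromorphicAt
  have hne : ∀ᶠ u in 𝓝[≠] x, d u ≠ 0 := by
    refine (h.analyticAt_den hx').eventually_eq_zero_or_eventually_ne_zero.resolve_left fun h0 => ?_
    have h1 : AnalyticOnNhd ℂ d (ball 0 ρ) := h.diff_den.analyticOnNhd isOpen_ball
    have h2 := h1.eqOn_of_preconnected_of_eventuallyEq (analyticOnNhd_const (v := (0 : ℂ)))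
      (convex_ball (0 : ℂ) ρ).isPreconnected hx' h0
    exact h.ne 0 (mem_ball_self h.pos) (h2 (mem_ball_self (h.pos.trans h.lt)))
  by_contra hge
  rw [not_lt] at hge
  obtain ⟨c, hc⟩ := tendsto_nhds_of_meromorphicOrderAt_nonneg hm hge
  have h3 := hc.mul ((h.analyticAt_den hx').continuousAt.tendsto.mono_left nhdsWithin_le_nhds)
  have h4 := (h.analyticAt_num hx').continuousAt.tendsto.mono_left (nhdsWithin_le_nhds (s := {x}ᶜ))
  have h5 := tendsto_nhds_unique h4 (h3.congr' (by
    filter_upwards [hne] with u hu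
    rw [div_mul_cancel₀ _ hu]))
  rw [hd, mul_zero] at h5
  exact hn h5

theorem isPoleOfContinuation (h : IsQuotient f n d R ρ) {x : ℂ} (hx : ‖x‖ < ρ) (hd : d x = 0)
    (hn : n x ≠ 0) : IsPoleOfContinuation f x :=
  ⟨_, h.isMeromorphicContinuation hx, h.order_neg hx hd hn⟩

/-- The poles are isolated, hence the poles outside the circle `|u| = R` keep away from it. -/
theorem exists_isPoleFreeRadius (h : IsQuotient f n d R ρ) (hd : d R = 0) (hn : n R ≠ 0) :
    ∃ r, IsPoleFreeRadius f r := by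
  let g : ℂ → ℂ := fun u => n u / d u
  have hloc : ∀ x ∈ sphere (0 : ℂ) R, ∃ U : Set ℂ, IsOpen U ∧ x ∈ U ∧
      ∀ u ∈ U, u ≠ x → 0 ≤ meromorphicOrderAt g u := by
    intro x hx
    have hx' : x ∈ closedBall (0 : ℂ) R := sphere_subset_closedBall hx
    have h1 := (h.meromorphicOn h.lt x hx').eventually_analyticAt
    rw [eventually_nhdsWithin_iff] at h1
    obtain ⟨U, hU, hUo, hxU⟩ := _root_.eventually_nhds_iff.1 h1
    exact ⟨U, hUo, hxU, fun u hu hne => (hU u hu hne).meromorphicOrderAt_nonneg⟩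
  choose! U hUo hxU hU using hloc
  obtain ⟨δ, hδ, hsub⟩ := (isCompact_sphere (0 : ℂ) R).exists_cthickening_subset_open
    (isOpen_biUnion hUo) fun x hx => Set.mem_biUnion hx (hxU x hx)
  obtain ⟨r, hr1, hr2⟩ := exists_between (lt_min (lt_add_of_pos_right R hδ) h.lt)
  refine ⟨r, R, h.hasConvergenceRadius hd hn, hr1, g,
    h.isMeromorphicContinuation (hr2.trans_le (min_le_right _ _)), fun u hu1 hu2 hneg => ?_⟩
  by_contra hne
  have hu0 : u ≠ 0 := norm_pos_iff.1 (h.pos.trans_le hu1)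
  -- the radial projection of `u` to the circle
  let v : ℂ := ((R / ‖u‖ : ℝ) : ℂ) * u
  have hv : ‖v‖ = R := by
    rw [norm_mul, Complex.norm_real, Real.norm_of_nonneg (div_nonneg h.pos.le (norm_nonneg _)),
      div_mul_cancel₀ _ (norm_ne_zero_iff.2 hu0)]
  have hdist : dist u v ≤ δ := by
    have h2 : u - v = ((1 - R / ‖u‖ : ℝ) : ℂ) * u := by
      simp only [v]
      push_cast
      ring
    have h3 : R / ‖u‖ ≤ 1 := (div_le_one (norm_pos_iff.2 hu0)).2 hu1
    rw [dist_eq_norm, h2, norm_mul, Complex.norm_real, Real.norm_of_nonneg (by linarith), sub_mul,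
      one_mul, div_mul_cancel₀ _ (norm_ne_zero_iff.2 hu0)]
    linarith [hr2.trans_le (min_le_left _ _)]
  have hmem := hsub (mem_cthickening_of_dist_le u v δ _ (mem_sphere_zero_iff_norm.2 hv) hdist)
  simp only [Set.mem_iUnion] at hmem
  obtain ⟨x, hx, hux⟩ := hmem
  refine absurd hneg (not_lt.2 (hU x hx u hux ?_))
  rintro rfl
  exact hne (mem_sphere_zero_iff_norm.1 hx)

/-- A pole outside the circle of convergence bounds the pole-free regions. -/
theorem lt_of_isPoleFreeRadius (h : IsQuotient f n d R ρ) (hd : d R = 0) (hn : n R ≠ 0) {x : ℂ}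
    (hRx : R < ‖x‖) (hx : ‖x‖ < ρ) (hdx : d x = 0) (hnx : n x ≠ 0) {r : ℝ}
    (hr : IsPoleFreeRadius f r) : r < ‖x‖ := by
  obtain ⟨R', ⟨p', hp', hrad'⟩, hRr, g, ⟨hg, hgf⟩, hfree⟩ := hr
  obtain ⟨p, hp, hrad⟩ := h.hasConvergenceRadius hd hn
  have hRR : R' = R := by
    rw [hp'.eq_formalMultilinearSeries hp, hrad] at hrad'
    have h1 : 0 < ENNReal.ofReal R' := hrad' ▸ ENNReal.ofReal_pos.2 h.pos
    exact ((ENNReal.ofReal_eq_ofReal_iff h.pos.le (ENNReal.ofReal_pos.1 h1).le).1 hrad').symm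
  subst hRR
  by_contra hxr
  rw [not_lt] at hxr
  have hball : closedBall (0 : ℂ) ‖x‖ ⊆ closedBall 0 r := closedBall_subset_closedBall hxr
  have hdiff : MeromorphicOn (fun u => g u - n u / d u) (closedBall 0 ‖x‖) :=
    (hg.mono_set hball).sub (h.meromorphicOn hx)
  have h0 : meromorphicOrderAt (fun u => g u - n u / d u) 0 = ⊤ := by
    rw [meromorphicOrderAt_eq_top_iff]
    refine Filter.Eventually.filter_mono nhdsWithin_le_nhds ?_
    filter_upwards [hgf, h.eventuallyEq] with u h1 h2
    rw [h1, h2, sub_self]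
  have hxm : x ∈ closedBall (0 : ℂ) ‖x‖ := mem_closedBall_zero_iff.2 le_rfl
  have htop : meromorphicOrderAt (fun u => g u - n u / d u) x = ⊤ := by
    by_contra hne
    exact hdiff.meromorphicOrderAt_ne_top_of_isPreconnected (convex_closedBall (0 : ℂ) _).isPreconnected
      hxm (mem_closedBall_self (norm_nonneg x)) hne h0
  rw [meromorphicOrderAt_eq_top_iff] at htop
  have heq : g =ᶠ[𝓝[≠] x] fun u => n u / d u := htop.mono fun u hu => sub_eq_zero.1 hu
  have hneg := h.order_neg hx hdx hnx
  rw [← meromorphicOrderAt_congr heq] at hneg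
  exact hRx.ne' (hfree x hRx.le hxr hneg)

end IsQuotient

end Quotients

/-! ### The negative zeros of the pole factor -/

section Root

variable {q N : ℕ}

/-- The value of `poleFactor` at `-y`. -/
def realFactor (q N : ℕ) (y : ℝ) : ℝ :=
  1 - ((q : ℝ) - 1) * ∑ k ∈ Finset.range N, (q : ℝ) ^ k * y ^ (2 * k + 1) -
    (q : ℝ) ^ N * ((q : ℝ) - 2) * y ^ (2 * N + 1)

theorem poleFactor_neg (q N : ℕ) (y : ℝ) :
    poleFactor q N ((-y : ℝ) : ℂ) = (realFactor q N y : ℂ) := by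
  have h : ∀ k : ℕ, (-(y : ℂ)) ^ (2 * k + 1) = -(y : ℂ) ^ (2 * k + 1) := fun k =>
    Odd.neg_pow ⟨k, rfl⟩ _
  rw [poleFactor, realFactor]
  push_cast
  simp only [h, mul_neg, Finset.sum_neg_distrib]
  ring

/-- The pole factor has the positive value `2 / q ^ (N + 1)` at `-1 / q`. -/
theorem realFactor_inv (hq : 2 ≤ q) (N : ℕ) : realFactor q N (1 / q) = 2 * (1 / (q : ℝ)) ^ (N + 1) := by
  have hq0 : (q : ℝ) ≠ 0 := by positivity
  have ha : (q : ℝ) * (1 / q) = 1 := mul_one_div_cancel hq0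
  generalize 1 / (q : ℝ) = a at ha ⊢
  have hpow : ∀ k : ℕ, (q : ℝ) ^ k * a ^ (2 * k + 1) = a ^ (k + 1) := fun k => by
    rw [show 2 * k + 1 = k + (k + 1) by ring, pow_add, ← mul_assoc, ← mul_pow, ha, one_pow, one_mul]
  induction N with
  | zero =>
    simp only [realFactor, Finset.range_zero, Finset.sum_empty]
    linear_combination -ha
  | succ N ih =>
    have h1 : realFactor q (N + 1) a = realFactor q N a -
        ((q : ℝ) - 1) * ((q : ℝ) ^ N * a ^ (2 * N + 1)) +
        ((q : ℝ) - 2) * ((q : ℝ) ^ N * a ^ (2 * N + 1)) -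
        ((q : ℝ) - 2) * ((q : ℝ) ^ (N + 1) * a ^ (2 * (N + 1) + 1)) := by
      simp only [realFactor, Finset.sum_range_succ]
      ring
    rw [h1, ih, hpow, hpow]
    linear_combination -a ^ (N + 1) * ha

/-- On the negative axis beyond `-1 / q` the pole factor decreases at least with the slope `q - 1`,
by the term of degree `1` of the sum. -/
theorem realFactor_le (hq : 2 ≤ q) (hN : 1 ≤ N) {y : ℝ} (hy : 1 / (q : ℝ) ≤ y) :
    realFactor q N y ≤ realFactor q N (1 / q) - ((q : ℝ) - 1) * (y - 1 / q) := by
  have hq2 : (2 : ℝ) ≤ q := by exact_mod_cast hq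
  have ha : 0 ≤ 1 / (q : ℝ) := by positivity
  have hpow : ∀ k : ℕ, 0 ≤ y ^ (2 * k + 1) - (1 / (q : ℝ)) ^ (2 * k + 1) := fun k =>
    sub_nonneg.2 (pow_le_pow_left₀ ha hy _)
  have h1 : y - 1 / q ≤ ∑ k ∈ Finset.range N,
      (q : ℝ) ^ k * (y ^ (2 * k + 1) - (1 / (q : ℝ)) ^ (2 * k + 1)) := by
    have := Finset.single_le_sum (f := fun k : ℕ =>
      (q : ℝ) ^ k * (y ^ (2 * k + 1) - (1 / (q : ℝ)) ^ (2 * k + 1)))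
      (fun k _ => mul_nonneg (by positivity) (hpow k)) (Finset.mem_range.2 hN)
    simpa using this
  have h2 : 0 ≤ (q : ℝ) ^ N * ((q : ℝ) - 2) * (y ^ (2 * N + 1) - (1 / (q : ℝ)) ^ (2 * N + 1)) :=
    mul_nonneg (mul_nonneg (by positivity) (by linarith)) (hpow N)
  have h3 := mul_le_mul_of_nonneg_left h1 (show 0 ≤ (q : ℝ) - 1 by linarith)
  simp only [mul_sub, Finset.sum_sub_distrib] at h2 h3
  simp only [realFactor]
  linarith

/-- The zeros of the pole factor on the negative axis are not cancelled by the numerator `1 - q u²`.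
-/
theorem mul_sq_ne_one_of_root (hq : 2 ≤ q) (hN : 1 ≤ N) {y : ℝ} (h : realFactor q N y = 0) :
    (q : ℝ) * y ^ 2 ≠ 1 := by
  intro h1
  have hpow : ∀ k : ℕ, (q : ℝ) ^ k * y ^ (2 * k + 1) = y := fun k => by
    rw [pow_succ, pow_mul, ← mul_assoc, ← mul_pow, h1, one_pow, one_mul]
  have h2 : (q : ℝ) ^ N * ((q : ℝ) - 2) * y ^ (2 * N + 1) = ((q : ℝ) - 2) * y := by
    rw [mul_right_comm, hpow, mul_comm]
  rw [realFactor, h2, Finset.sum_congr rfl fun k _ => hpow k, Finset.sum_const, Finset.card_range,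
    nsmul_eq_mul] at h
  -- then `q` is the square of `(q - 1) * N + (q - 2)`, which is at least `q` if `q > 2`, and equal to
  -- `N` if `q = 2`
  have h3 : (((q - 1) * N + (q - 2) : ℕ) : ℝ) = ((q : ℝ) - 1) * N + ((q : ℝ) - 2) := by
    push_cast [Nat.cast_sub (show 1 ≤ q by omega), Nat.cast_sub hq]
    rfl
  have h4 : (((q - 1) * N + (q - 2) : ℕ) : ℝ) * y = 1 := by rw [h3]; linarith
  have h5 : ((((q - 1) * N + (q - 2)) ^ 2 : ℕ) : ℝ) = q := by
    push_cast only [Nat.cast_pow]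
    calc ((((q - 1) * N + (q - 2) : ℕ) : ℝ)) ^ 2
        = (((q - 1) * N + (q - 2) : ℕ) : ℝ) ^ 2 * (q * y ^ 2) := by rw [h1, mul_one]
      _ = q * ((((q - 1) * N + (q - 2) : ℕ) : ℝ) * y) ^ 2 := by ring
      _ = q := by rw [h4, one_pow, mul_one]
  have h6 : ((q - 1) * N + (q - 2)) ^ 2 = q := by exact_mod_cast h5
  obtain ⟨m, rfl⟩ : ∃ m, q = m + 2 := ⟨q - 2, by omega⟩
  obtain ⟨M, rfl⟩ : ∃ M, N = M + 1 := ⟨N - 1, by omega⟩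
  simp only [Nat.add_sub_cancel, show m + 2 - 1 = m + 1 by omega] at h6
  rcases Nat.eq_zero_or_pos m with rfl | hm
  · rcases Nat.eq_zero_or_pos M with rfl | hM
    · omega
    · nlinarith
  · nlinarith [Nat.zero_le (m * M), Nat.zero_le M]

/-- The pole factor has a zero slightly to the left of `-1/q`. -/
theorem exists_root (hq : 2 ≤ q) (hN : 1 ≤ N) : ∃ y : ℝ, 1 / (q : ℝ) < y ∧
    y ≤ 1 / (q : ℝ) + 2 * (1 / (q : ℝ)) ^ (N + 1) ∧ realFactor q N y = 0 := by
  have hq2 : (2 : ℝ) ≤ q := by exact_mod_cast hq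
  have ha : 0 < 2 * (1 / (q : ℝ)) ^ (N + 1) := by positivity
  have hcont : Continuous (realFactor q N) := by
    unfold realFactor
    fun_prop
  have hle : 1 / (q : ℝ) ≤ 1 / (q : ℝ) + 2 * (1 / (q : ℝ)) ^ (N + 1) := by linarith
  have h1 := realFactor_le hq hN hle
  rw [realFactor_inv hq, add_sub_cancel_left] at h1
  have h2 : realFactor q N (1 / (q : ℝ) + 2 * (1 / (q : ℝ)) ^ (N + 1)) ≤ 0 := by nlinarith
  have h3 : 0 ≤ realFactor q N (1 / (q : ℝ)) := by rw [realFactor_inv hq]; exact ha.le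
  obtain ⟨y, hy, h0⟩ := intermediate_value_Icc' hle hcont.continuousOn ⟨h2, h3⟩
  refine ⟨y, lt_of_le_of_ne hy.1 ?_, hy.2, h0⟩
  rintro rfl
  rw [realFactor_inv hq] at h0
  exact ha.ne' h0

end Root

/-! ### Holomorphic continuation of the tail of the product -/

section Tail

variable {q N : ℕ}

theorem differentiable_loopFactor (q N : ℕ) : Differentiable ℂ (loopFactor q N) := by
  unfold loopFactor
  fun_prop

theorem loopFactor_zero (q N : ℕ) : loopFactor q N 0 = 1 := by
  simp [loopFactor]

/-- Since `Λ(0) = 1`, the factor `Λ` is close to `1` near the origin. -/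
theorem exists_norm_one_sub_loopFactor_le (q N : ℕ) : ∃ C : ℝ, 0 ≤ C ∧
    ∀ v : ℂ, ‖v‖ ≤ 1 → ‖1 - loopFactor q N v‖ ≤ C * ‖v‖ := by
  have hd := differentiable_loopFactor q N
  have hc : Continuous (deriv (loopFactor q N)) :=
    (hd.contDiff (n := 1)).continuous_deriv le_rfl
  obtain ⟨C, hC⟩ := (isCompact_closedBall (0 : ℂ) 1).exists_bound_of_continuousOn hc.continuousOn
  refine ⟨C, (norm_nonneg _).trans (hC 0 (Metric.mem_closedBall_self zero_le_one)), fun v hv => ?_⟩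
  have h := (convex_closedBall (0 : ℂ) 1).norm_image_sub_le_of_norm_deriv_le
    (fun x _ => hd x) hC (Metric.mem_closedBall_self zero_le_one) (mem_closedBall_zero_iff.2 hv)
  rwa [loopFactor_zero, sub_zero, norm_sub_rev] at h

theorem primitiveCount_le {n : ℕ} (hn : n ≠ 0) (m : ℕ) : primitiveCount n m ≤ n := by
  have : NeZero n := ⟨hn⟩
  rw [primitiveCount]
  exact (Finite.card_subtype_le _).trans (Nat.card_zmod n).le

theorem primitiveCount_eq_zero {m : ℕ} (hm : 2 ≤ m) : primitiveCount 1 m = 0 := by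
  rw [primitiveCount]
  have : IsEmpty {h : ZMod 1 // ∀ r : ℕ, 1 < r → r ∣ m → ∀ y : ZMod 1, h ≠ r • y} :=
    ⟨fun h => h.2 m hm dvd_rfl 0 (Subsingleton.elim _ _)⟩
  exact Nat.card_of_isEmpty

/-- On a disc of radius less than `1`, the product over `m`, without finitely many factors, is the
exponential of a holomorphic function. -/
theorem exists_tail (hq : 2 ≤ q) {ρ : ℝ} (h0 : 0 < ρ) (h1 : ρ < 1) : ∃ (M : ℕ) (T : ℂ → ℂ),
    DifferentiableOn ℂ T (Metric.ball 0 ρ) ∧ (∀ u, T u ≠ 0) ∧ ∀ u ∈ Metric.ball (0 : ℂ) ρ,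
      HasProd (fun m : ℕ => ((loopFactor q N (u ^ (m + M + 2)))⁻¹) ^
        primitiveCount (q - 1) (m + M + 2)) (T u) := by
  obtain ⟨C, hC0, hC⟩ := exists_norm_one_sub_loopFactor_le q N
  obtain ⟨M, hM⟩ : ∃ M : ℕ, C * ρ ^ M < 1 / 2 := by
    have : Tendsto (fun M : ℕ => C * ρ ^ M) atTop (𝓝 (C * 0)) :=
      (tendsto_pow_atTop_nhds_zero_of_lt_one h0.le h1).const_mul C
    rw [mul_zero] at this
    exact (this.eventually_lt_const one_half_pos).exists
  have hbound : ∀ (m : ℕ), ∀ u ∈ Metric.ball (0 : ℂ) ρ,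
      ‖1 - loopFactor q N (u ^ (m + M + 2))‖ ≤ C * ρ ^ M * ρ ^ m := by
    intro m u hu
    have hu' : ‖u‖ ≤ ρ := (mem_ball_zero_iff.1 hu).le
    have h2 : ‖u ^ (m + M + 2)‖ ≤ ρ ^ (m + M) := by
      rw [norm_pow]
      exact (pow_le_pow_left₀ (norm_nonneg u) hu' _).trans
        (pow_le_pow_of_le_one h0.le h1.le (by omega))
    refine (hC _ (h2.trans (pow_le_one₀ h0.le h1.le))).trans ?_
    rw [mul_assoc, ← pow_add, Nat.add_comm M m]
    exact mul_le_mul_of_nonneg_left h2 hC0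
  have hhalf : ∀ (m : ℕ), ∀ u ∈ Metric.ball (0 : ℂ) ρ,
      ‖1 - loopFactor q N (u ^ (m + M + 2))‖ ≤ 1 / 2 := fun m u hu =>
    (hbound m u hu).trans ((mul_le_of_le_one_right (by positivity)
      (pow_le_one₀ h0.le h1.le)).trans hM.le)
  let F : ℕ → ℂ → ℂ := fun m u =>
    (primitiveCount (q - 1) (m + M + 2) : ℂ) * -Complex.log (loopFactor q N (u ^ (m + M + 2)))
  have hslit : ∀ (m : ℕ), ∀ u ∈ Metric.ball (0 : ℂ) ρ,
      loopFactor q N (u ^ (m + M + 2)) ∈ Complex.slitPlane := by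
    intro m u hu
    have h2 := Complex.mem_slitPlane_of_norm_lt_one
      (z := -(1 - loopFactor q N (u ^ (m + M + 2)))) (by
        rw [norm_neg]
        exact (hhalf m u hu).trans_lt one_half_lt_one)
    rwa [neg_sub, add_sub_cancel] at h2
  have hFd : ∀ m, DifferentiableOn ℂ (F m) (Metric.ball 0 ρ) := by
    intro m
    refine DifferentiableOn.const_mul (DifferentiableOn.neg (DifferentiableOn.clog ?_ (hslit m))) _
    exact ((differentiable_loopFactor q N).comp (differentiable_id.pow _)).differentiableOn
  have hFle : ∀ (m : ℕ) (u : ℂ), u ∈ Metric.ball (0 : ℂ) ρ →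
      ‖F m u‖ ≤ ((q - 1 : ℕ) : ℝ) * (3 / 2 * (C * ρ ^ M)) * ρ ^ m := by
    intro m u hu
    have h2 := norm_log_one_sub_le (hhalf m u hu)
    rw [sub_sub_cancel] at h2
    rw [norm_mul, Complex.norm_natCast, mul_assoc]
    refine mul_le_mul (by exact_mod_cast primitiveCount_le (by omega) _) (h2.trans ?_)
      (norm_nonneg _) (by positivity)
    rw [mul_assoc]
    exact mul_le_mul_of_nonneg_left (hbound m u hu) (by norm_num)
  have hsum : Summable fun m : ℕ => ((q - 1 : ℕ) : ℝ) * (3 / 2 * (C * ρ ^ M)) * ρ ^ m :=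
    (summable_geometric_of_lt_one h0.le h1).mul_left _
  refine ⟨M, fun u => Complex.exp (∑' m, F m u),
    (Complex.differentiableOn_tsum_of_summable_norm hsum hFd Metric.isOpen_ball hFle).cexp,
    fun u => Complex.exp_ne_zero _, fun u hu => ?_⟩
  have h2 : Summable fun m => F m u := Summable.of_norm_bounded hsum fun m => hFle m u hu
  refine h2.hasSum.cexp.congr_fun fun m => ?_
  simp only [Function.comp, F]
  rw [Complex.exp_nat_mul, exp_neg_log (Complex.slitPlane_ne_zero (hslit m u hu))]

end Tail

/-! ### The zeta functions as quotients of holomorphic functions -/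

section Zeta

variable {q N : ℕ}

theorem bassIharaZeta_eq (hq : 2 ≤ q) (hN : 1 ≤ N) {u : ℂ} (hu : ‖u‖ < (q : ℝ)⁻¹) :
    (XGraph q N).bassIharaZeta u = explicitBassIhara q N u := (hasProd_bassIhara hq hN hu).tprod_eq

theorem selbergZeta_eq (hq : 2 ≤ q) {u : ℂ} (hu : ‖u‖ < (q : ℝ)⁻¹) :
    (XGraph q N).selbergZeta (XTree q N) u = explicitSelberg q N u :=
  (hasProd_explicitSelberg hq hu).tprod_eq

variable (q N) in
/-- For every `ρ > 1/q`, which has to be less than `1` if `q > 2`, the function `f` is a quotient of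
holomorphic functions on the disc of radius `ρ`; its numerator has the zeros of `1 - q u^2`, and its
denominator vanishes at the zeros of `denom q N`. -/
def HasQuotients (f : ℂ → ℂ) : Prop :=
  ∀ ρ : ℝ, 1 / (q : ℝ) < ρ → (q = 2 ∨ ρ < 1) → ∃ n d : ℂ → ℂ, IsQuotient f n d (1 / q) ρ ∧
    (∀ u, n u = 0 → 1 - (q : ℂ) * u ^ 2 = 0) ∧ ∀ u, denom q N u = 0 → d u = 0

theorem differentiable_num (q : ℕ) : Differentiable ℂ fun u : ℂ => 1 - (q : ℂ) * u ^ 2 := by fun_prop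

theorem differentiable_denom (q N : ℕ) : Differentiable ℂ (denom q N) := by
  unfold denom oddFactor poleFactor
  fun_prop

theorem lt_inv_of_mem_ball {u : ℂ} (hu : u ∈ Metric.ball (0 : ℂ) (1 / (q : ℝ))) : ‖u‖ < (q : ℝ)⁻¹ := by
  rw [← one_div]
  exact mem_ball_zero_iff.1 hu

theorem hasQuotients_of_eq (hq : 2 ≤ q) {f : ℂ → ℂ}
    (hf : ∀ u : ℂ, ‖u‖ < (q : ℝ)⁻¹ → f u = explicitBassIhara q N u) : HasQuotients q N f :=
  fun ρ hρ _ => ⟨fun u => 1 - (q : ℂ) * u ^ 2, denom q N,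
    { pos := by positivity
      lt := hρ
      diff_num := (differentiable_num q).differentiableOn
      diff_den := (differentiable_denom q N).differentiableOn
      eq := fun u hu => hf u (lt_inv_of_mem_ball hu)
      ne := fun u hu => denom_ne_zero hq (lt_inv_of_mem_ball hu) }, fun _ h => h, fun _ h => h⟩

theorem hasQuotients_bassIhara (hq : 2 ≤ q) (hN : 1 ≤ N) :
    HasQuotients q N (XGraph q N).bassIharaZeta :=
  hasQuotients_of_eq hq fun _ hu => bassIharaZeta_eq hq hN hu

theorem explicitSelberg_two (N : ℕ) (u : ℂ) : explicitSelberg 2 N u = explicitBassIhara 2 N u := by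
  have h : ∀ m : ℕ, primitiveCount (2 - 1) (m + 2) = 0 := fun m => primitiveCount_eq_zero (by omega)
  simp [explicitSelberg, h]

/-- The Selberg zeta function is the Bass–Ihara zeta function times inverse powers of the entire
functions `Λ(u^m)`, times a holomorphic tail without zeros. The factors `Λ` only add zeros of the
denominator, so they cannot cancel the poles of the Bass–Ihara zeta function. -/
theorem hasQuotients_selberg (hq : 2 ≤ q) :
    HasQuotients q N ((XGraph q N).selbergZeta (XTree q N)) := by
  rcases eq_or_ne q 2 with rfl | hq2
  · exact hasQuotients_of_eq hq fun u hu => (selbergZeta_eq hq hu).trans (explicitSelberg_two N u)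
  intro ρ hρ h1
  obtain ⟨M, T, hTd, hT0, hT⟩ := exists_tail (N := N) hq ((by positivity : (0 : ℝ) < 1 / q).trans hρ)
    (h1.resolve_left hq2)
  refine ⟨fun u => (1 - (q : ℂ) * u ^ 2) * T u, fun u => denom q N u * (loopFactor q N u ^ (q - 2) *
    ∏ m ∈ Finset.range M, loopFactor q N (u ^ (m + 2)) ^ primitiveCount (q - 1) (m + 2)),
    { pos := by positivity
      lt := hρ
      diff_num := (differentiable_num q).differentiableOn.mul hTd
      diff_den := ?_
      eq := fun u hu => ?_
      ne := fun u hu => ?_ }, fun u h => (mul_eq_zero.1 h).resolve_right (hT0 u),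
    fun u h => mul_eq_zero_of_left h _⟩
  · have h2 := differentiable_denom q N
    have h3 := differentiable_loopFactor q N
    have h4 : ∀ m : ℕ, Differentiable ℂ fun u : ℂ =>
        loopFactor q N (u ^ (m + 2)) ^ primitiveCount (q - 1) (m + 2) := fun m =>
      (h3.comp (differentiable_id.pow _)).pow _
    exact (h2.mul ((h3.pow _).mul (Differentiable.fun_finsetProd fun m _ => h4 m))).differentiableOn
  · have hu' := lt_inv_of_mem_ball hu
    have h2 := (hT u (Metric.ball_subset_ball hρ.le hu))
    have h3 := Multipliable.prod_mul_tprod_nat_mul' (k := M) (f := fun m : ℕ =>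
      ((loopFactor q N (u ^ (m + 2)))⁻¹) ^ primitiveCount (q - 1) (m + 2)) h2.multipliable
    rw [h2.tprod_eq] at h3
    rw [selbergZeta_eq hq hu', explicitSelberg, ← h3, explicitBassIhara_eq]
    simp only [inv_pow, Finset.prod_inv_distrib, div_eq_mul_inv, mul_inv]
    ring
  · have hu' := lt_inv_of_mem_ball hu
    exact mul_ne_zero (denom_ne_zero hq hu') (mul_ne_zero (pow_ne_zero _ (loopFactor_ne_zero hq hu'))
      (Finset.prod_ne_zero_iff.2 fun m _ => pow_ne_zero _
        (loopFactor_ne_zero hq (norm_pow_succ_lt hq hu' (m + 1)))))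

theorem denom_inv (hq : 2 ≤ q) : denom q N ((1 / (q : ℝ) : ℝ) : ℂ) = 0 := by
  have hq0 : (q : ℂ) ≠ 0 := by
    have : q ≠ 0 := by omega
    exact_mod_cast this
  rw [denom]
  push_cast
  rw [mul_one_div_cancel hq0, sub_self]
  ring

theorem num_inv_ne_zero (hq : 2 ≤ q) : 1 - (q : ℂ) * ((1 / (q : ℝ) : ℝ) : ℂ) ^ 2 ≠ 0 := by
  have h1 : (q : ℝ) * (1 / (q : ℝ)) ^ 2 < 1 := by
    rw [one_div]
    exact mul_sq_lt_one hq (by positivity) le_rfl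
  have h2 : (1 : ℝ) - (q : ℝ) * (1 / (q : ℝ)) ^ 2 ≠ 0 := by linarith
  exact_mod_cast h2

theorem exists_radius {y : ℝ} (h1 : 1 / (q : ℝ) < y) (h2 : q = 2 ∨ y < 1) :
    ∃ ρ : ℝ, y < ρ ∧ 1 / (q : ℝ) < ρ ∧ (q = 2 ∨ ρ < 1) := by
  rcases h2 with h2 | h2
  · exact ⟨y + 1, by linarith, by linarith, Or.inl h2⟩
  · obtain ⟨ρ, h3, h4⟩ := exists_between h2
    exact ⟨ρ, h3, h1.trans h3, Or.inr h4⟩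

theorem exists_radius_gt (hq : 2 ≤ q) : ∃ ρ : ℝ, 1 / (q : ℝ) < ρ ∧ (q = 2 ∨ ρ < 1) := by
  have h : 1 / (q : ℝ) < 1 := by
    have := inv_le_half hq
    rw [one_div]
    linarith
  obtain ⟨ρ, h3, h4⟩ := exists_between h
  exact ⟨ρ, h3, Or.inr h4⟩

variable {f : ℂ → ℂ}

theorem HasQuotients.hasConvergenceRadius (hf : HasQuotients q N f) (hq : 2 ≤ q) :
    HasConvergenceRadius f (1 / (q : ℝ)) := by
  obtain ⟨ρ, h1, h2⟩ := exists_radius_gt hq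
  obtain ⟨n, d, h, hn, hd⟩ := hf ρ h1 h2
  exact h.hasConvergenceRadius (hd _ (denom_inv hq)) fun h0 => num_inv_ne_zero hq (hn _ h0)

theorem HasQuotients.exists_isPoleFreeRadius (hf : HasQuotients q N f) (hq : 2 ≤ q) :
    ∃ r, IsPoleFreeRadius f r := by
  obtain ⟨ρ, h1, h2⟩ := exists_radius_gt hq
  obtain ⟨n, d, h, hn, hd⟩ := hf ρ h1 h2
  exact h.exists_isPoleFreeRadius (hd _ (denom_inv hq)) fun h0 => num_inv_ne_zero hq (hn _ h0)

theorem denom_root {y : ℝ} (h : realFactor q N y = 0) : denom q N ((-y : ℝ) : ℂ) = 0 := by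
  rw [denom, poleFactor_neg, h, Complex.ofReal_zero, mul_zero]

theorem num_root_ne_zero (hq : 2 ≤ q) (hN : 1 ≤ N) {y : ℝ} (h : realFactor q N y = 0) :
    1 - (q : ℂ) * ((-y : ℝ) : ℂ) ^ 2 ≠ 0 := by
  have h1 : (1 : ℝ) - (q : ℝ) * (-y) ^ 2 ≠ 0 := fun h0 => mul_sq_ne_one_of_root hq hN h (by
    rw [neg_sq] at h0
    linarith)
  exact_mod_cast h1

theorem norm_neg_ofReal {y : ℝ} (hy : 0 ≤ y) : ‖((-y : ℝ) : ℂ)‖ = y := by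
  rw [Complex.norm_real, norm_neg, Real.norm_of_nonneg hy]

theorem HasQuotients.isPoleOfContinuation (hf : HasQuotients q N f) (hq : 2 ≤ q) (hN : 1 ≤ N) {y : ℝ}
    (h0 : realFactor q N y = 0) (h1 : 1 / (q : ℝ) < y) (h2 : q = 2 ∨ y < 1) :
    IsPoleOfContinuation f ((-y : ℝ) : ℂ) := by
  obtain ⟨ρ, h3, h4, h5⟩ := exists_radius h1 h2
  obtain ⟨n, d, h, hn, hd⟩ := hf ρ h4 h5
  have hy : 0 ≤ y := (by positivity : (0 : ℝ) ≤ 1 / q).trans h1.le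
  exact h.isPoleOfContinuation (by rwa [norm_neg_ofReal hy]) (hd _ (denom_root h0))
    fun h' => num_root_ne_zero hq hN h0 (hn _ h')

theorem HasQuotients.lt_of_isPoleFreeRadius (hf : HasQuotients q N f) (hq : 2 ≤ q) (hN : 1 ≤ N) {y : ℝ}
    (h0 : realFactor q N y = 0) (h1 : 1 / (q : ℝ) < y) (h2 : q = 2 ∨ y < 1) {r : ℝ}
    (hr : IsPoleFreeRadius f r) : r < y := by
  obtain ⟨ρ, h3, h4, h5⟩ := exists_radius h1 h2
  obtain ⟨n, d, h, hn, hd⟩ := hf ρ h4 h5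
  have hy : 0 ≤ y := (by positivity : (0 : ℝ) ≤ 1 / q).trans h1.le
  have := h.lt_of_isPoleFreeRadius (x := ((-y : ℝ) : ℂ)) (hd _ (denom_inv hq))
    (fun h0 => num_inv_ne_zero hq (hn _ h0)) (by rwa [norm_neg_ofReal hy])
    (by rwa [norm_neg_ofReal hy]) (hd _ (denom_root h0))
    (fun h' => num_root_ne_zero hq hN h0 (hn _ h')) hr
  rwa [norm_neg_ofReal hy] at this

/-- If `q > 2`, the zero lies in the unit disc, where the zeta functions are quotients of
holomorphic functions. -/
theorem root_lt_one (hq : 2 ≤ q) (hN : 1 ≤ N) {y : ℝ}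
    (h : y ≤ 1 / (q : ℝ) + 2 * (1 / (q : ℝ)) ^ (N + 1)) : q = 2 ∨ y < 1 := by
  rcases eq_or_ne q 2 with h2 | h2
  · exact Or.inl h2
  · right
    have h3 : (3 : ℝ) ≤ q := by
      have : 3 ≤ q := by omega
      exact_mod_cast this
    have h4 : 1 / (q : ℝ) ≤ 1 / 3 := one_div_le_one_div_of_le (by norm_num) h3
    have h5 : 0 ≤ 1 / (q : ℝ) := by positivity
    have h6 : (1 / (q : ℝ)) ^ (N + 1) ≤ (1 / (q : ℝ)) ^ 2 :=
      pow_le_pow_of_le_one h5 (by linarith) (by omega)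
    nlinarith

theorem tendsto_root_bound (hq : 2 ≤ q) :
    Tendsto (fun N : ℕ => 1 / (q : ℝ) + 2 * (1 / (q : ℝ)) ^ (N + 1)) atTop (𝓝 (1 / (q : ℝ))) := by
  have h1 : 1 / (q : ℝ) < 1 := by
    have := inv_le_half hq
    rw [one_div]
    linarith
  have h2 := (tendsto_add_atTop_iff_nat 1).2
    (tendsto_pow_atTop_nhds_zero_of_lt_one (by positivity : (0 : ℝ) ≤ 1 / q) h1)
  simpa using (h2.const_mul 2).const_add (1 / (q : ℝ))

end Zeta

end Necklace

end

theorem mainTheorem4 (q : ℕ) (hq : 2 ≤ q) :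
    -- the graphs of groups and their explicit zeta functions
    (∀ N : ℕ, 1 ≤ N →
      (XGraph q N).IsRegular (q + 1) ∧
      (∀ u : ℂ, ‖u‖ < 1 / (q : ℝ) →
        HasProd (fun c : (XGraph q N).PrimeCycle => GraphOfGroups.bassIharaFactor u c)
          (explicitBassIhara q N u)) ∧
      (∀ u : ℂ, ‖u‖ < 1 / (q : ℝ) →
        Multipliable (fun m : ℕ =>
          ((loopFactor q N (u ^ (m + 2)))⁻¹) ^ primitiveCount (q - 1) (m + 2)) ∧
        HasProd (fun c : (XGraph q N).PrimitiveClass (XTree q N) =>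
          GraphOfGroups.selbergFactor u c) (explicitSelberg q N u))) ∧
    -- the negative real poles
    (∃ x : ℕ → ℝ,
      (∀ N : ℕ, 1 ≤ N → x N < -(1 / (q : ℝ)) ∧ poleFactor q N (x N : ℂ) = 0 ∧
        IsPoleOfContinuation ((XGraph q N).bassIharaZeta) (x N : ℂ) ∧
        IsPoleOfContinuation ((XGraph q N).selbergZeta (XTree q N)) (x N : ℂ)) ∧
      Tendsto x atTop (𝓝 (-(1 / (q : ℝ))))) ∧
    -- the radius of convergence is `1 / q`, and pole-free regions exist
    (∀ N : ℕ, 1 ≤ N →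
      HasConvergenceRadius ((XGraph q N).bassIharaZeta) (1 / (q : ℝ)) ∧
      HasConvergenceRadius ((XGraph q N).selbergZeta (XTree q N)) (1 / (q : ℝ)) ∧
      (∃ r, IsPoleFreeRadius ((XGraph q N).bassIharaZeta) r) ∧
      (∃ r, IsPoleFreeRadius ((XGraph q N).selbergZeta (XTree q N)) r)) ∧
    -- the pole-free regions shrink to `|u| ≤ 1 / q`
    (∀ ε : ℝ, 0 < ε → ∃ N₀ : ℕ, ∀ N : ℕ, N₀ ≤ N → ∀ r : ℝ,
      (IsPoleFreeRadius ((XGraph q N).bassIharaZeta) r ∨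
        IsPoleFreeRadius ((XGraph q N).selbergZeta (XTree q N)) r) →
      r < 1 / (q : ℝ) + ε) := by
  have hroot : ∀ N : ℕ, ∃ y : ℝ, 1 ≤ N → 1 / (q : ℝ) < y ∧
      y ≤ 1 / (q : ℝ) + 2 * (1 / (q : ℝ)) ^ (N + 1) ∧ Necklace.realFactor q N y = 0 := fun N => by
    by_cases hN : 1 ≤ N
    · obtain ⟨y, hy⟩ := Necklace.exists_root hq hN
      exact ⟨y, fun _ => hy⟩
    · exact ⟨0, fun h => absurd h hN⟩
  choose y hy using hroot
  refine ⟨fun N hN => ⟨Necklace.isRegular_XGraph hq hN, fun u hu => ?_, fun u hu => ?_⟩,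
    ⟨fun N => -y N, fun N hN => ?_, ?_⟩, fun N hN => ?_, fun ε hε => ?_⟩
  · exact Necklace.hasProd_bassIhara hq hN (by rwa [← one_div])
  · rw [one_div] at hu
    exact ⟨(Necklace.hasProd_selberg hq hu).1, Necklace.hasProd_explicitSelberg hq hu⟩
  · obtain ⟨h1, h2, h3⟩ := hy N hN
    have h4 := Necklace.root_lt_one hq hN h2
    refine ⟨neg_lt_neg h1, ?_, (Necklace.hasQuotients_bassIhara hq hN).isPoleOfContinuation hq hN h3 h1 h4,
      (Necklace.hasQuotients_selberg hq).isPoleOfContinuation hq hN h3 h1 h4⟩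
    rw [Necklace.poleFactor_neg, h3, Complex.ofReal_zero]
  · refine Tendsto.neg (tendsto_of_tendsto_of_tendsto_of_le_of_le' tendsto_const_nhds
      (Necklace.tendsto_root_bound hq) ?_ ?_)
    · filter_upwards [eventually_ge_atTop 1] with N hN using (hy N hN).1.le
    · filter_upwards [eventually_ge_atTop 1] with N hN using (hy N hN).2.1
  · have h1 := Necklace.hasQuotients_bassIhara hq hN
    have h2 := Necklace.hasQuotients_selberg (N := N) hq
    exact ⟨h1.hasConvergenceRadius hq, h2.hasConvergenceRadius hq, h1.exists_isPoleFreeRadius hq,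
      h2.exists_isPoleFreeRadius hq⟩
  · obtain ⟨N₀, h0⟩ := eventually_atTop.1 (((Necklace.tendsto_root_bound hq).eventually_lt_const
      (lt_add_of_pos_right _ hε)).and (eventually_ge_atTop 1))
    refine ⟨N₀, fun N hNN r hr => ?_⟩
    obtain ⟨hlt, hN⟩ := h0 N hNN
    obtain ⟨h1, h2, h3⟩ := hy N hN
    have h4 := Necklace.root_lt_one hq hN h2
    refine lt_of_lt_of_le (b := y N) ?_ (h2.trans hlt.le)
    rcases hr with hr | hr
    · exact (Necklace.hasQuotients_bassIhara hq hN).lt_of_isPoleFreeRadius hq hN h3 h1 h4 hr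
    · exact (Necklace.hasQuotients_selberg hq).lt_of_isPoleFreeRadius hq hN h3 h1 h4 hr
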